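/- **Setting.** Let $k$ be a field and $S$ a finite-dimensional semisimple $k$-algebra such that $S\otimes_kS^{op}$ is also semisimple; $S$ is considered as a graded algebra concentrated in degree $0$. All (bi)modules are $\mathbb Z$-graded, $k$ acts centrally on bimodules, $M[1]_i=M_{i+1}$, and $\sigma=\sigma_M:M\to M[1]$ is the identity map of the underlying modules, which has degree $-1$. Tensor products of homogeneous maps are evaluated by the Koszul rule $(f\otimes g)(x\otimes y)=(-1)^{|g||x|}f(x)\otimes g(y)$. An $A_\infty$-algebra is a graded $S$-$S$-bimodule $A$ with homogeneous bimodule maps $m_n:A^{\otimes n}\to A$ $(n\ge1)$ of degree $2-n$ such that $\sum_{r+s+t=n}(-1)^{r+st}m_{r+1+t}(id^{\otimes r}\otimes m_s\otimes id^{\otimes t})=0$ for all $n\ge 1$ (tensor products over $S$; $r,t\ge0$, $s\geq 1$). Fix an $A_\infty$-algebra $A$. *The category $\mathrm{GMod}\text{-}A$.* Its objects are the graded right $S$-modules. A homogeneous morphism $f:M\to N$ of degree $d=|f|$ is a family $f=\{f_n\}_{n\ge1}$ of homogeneous maps of right $S$-modules $f_n:M\otimes_SA^{\otimes(n-1)}\to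 N$ of degree $d+1-n$. The composition is $(g\circ f)_n=\sum_{r+s=n,\,r\ge1,\,s\ge0}(-1)^{(|f|+r+1)s}g_{1+s}(f_r\otimes id^{\otimes s})$, and the identity of $M$ is $(id_M,0,0,\dots)$. A morphism $f$ is *strict* if $f_n=0$ for $n\ge2$. $\mathrm{GMod}^0\text{-}A$ is the subcategory of the morphisms of degree $0$. Write $\underline\sigma_M=(\sigma_M,0,0,\dots):M\to M[1]$, an isomorphism of degree $-1$. *The category $\mathrm{TGMod}\text{-}A$.* Its objects are the right $A_\infty$-modules $(M,m^M)$: $m^M=\{m^M_n\}_{n\ge1}$ is a morphism $M\to M$ of degree $1$ in $\mathrm{GMod}\text{-}A$ with, for all $n\ge1$, $$\sum_{r+s+t=n;\,r,s\ge1}(-1)^{r+st}m^M_{r+1+t}(id^{\otimes r}\otimes m_s\otimes id^{\otimes t})+\sum_{s+t=n;\,s\ge1}(-1)^{st}m^M_{1+t}(m^M_s\otimes id^{\otimes t})=0 .$$ Its homogeneous morphisms $(M,m^M)\to(N,m^N)$ of degree $d$ are the homogeneous morphisms $f:M\to N$ of degree $d$ of $\mathrm{GMod}\text{-}A$ with,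 for all $n\ge1$, $$\sum_{r+s+t=n;\,r,s\ge1}(-1)^{d+r+st}f_{r+1+t}(id^{\otimes r}\otimes m_s\otimes id^{\otimes t})+\sum_{s+t=n;\,s\ge1}(-1)^{d+st}f_{1+t}(m^M_s\otimes id^{\otimes t})=\sum_{r+s=n;\,r\ge1}(-1)^{(d+r+1)s}m^N_{1+s}(f_r\otimes id^{\otimes s}).$$ The composition is that of $\mathrm{GMod}\text{-}A$. $\mathrm{Mod}_\infty\text{-}A$ is the subcategory with the same objects and the morphisms of degree $0$. *Twisted $\mathcal B_A$-modules.* $\mathcal B_A=(C,\mu,\epsilon,\delta)$ is the bar construction: $C=T_S(A[1])$, $\mu$ is the deconcatenation comultiplication, $\epsilon:C\to S$ the projection, $\delta=\sum id^{\otimes r}\otimes b_s\otimes id^{\otimes t}$, where $b_s:A[1]^{\otimes s}\to A[1]$ is given by $b_s\,\sigma^{\otimes s}=\sigma m_s$. In $\mathrm{GMod}\text{-}\mathcal B_A$, a morphism $M\to N$ of degree $d$ between graded right $S$-modules is a homogeneous map $f:M\otimes_SC\to N$ of right $S$-modules of degree $d$, with $g*f=g(f\otimes id_C)(id_M\otimes\mu)$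 and $\widehat\delta(f)=(-1)^{|f|+1}f(id_M\otimes\delta)$; its first component is $f^0:M\to N$, $f^0(x)=f(x\otimes1)$. The objects of $\mathrm{TGMod}\text{-}\mathcal B_A$ are the pairs $(M,u)$ with $u:M\to M$ of degree $1$ and $\widehat\delta(u)+u*u=0$; its morphisms $(M,u)\to(N,v)$ of degree $d$ are the morphisms $f$ of degree $d$ with $\widehat\delta(f)+v*f-(-1)^{d}f*u=0$. $\mathrm{TGMod}^0\text{-}\mathcal B_A$ is the subcategory of the morphisms of degree $0$, and $\mathcal E$ is the class of the composable pairs $(f,g)$ in it with $g*f=0$ and $0\to M\xrightarrow{f^0}E\xrightarrow{g^0}N\to0$ exact. On $\mathrm{TGMod}\text{-}\mathcal B_A$ put $T(M,u)=(M[1],-u[1])$, $T(f)=f[1]$, where $f[1]=\sigma_N f(\sigma_M^{-1}\otimes id_C)$, and $J(M,u)=\bigl(M\oplus M[1],\begin{pmatrix}u&\sigma^{-1}\\0&-u[1]\end{pmatrix}\bigr)$, $J(f)=\begin{pmatrix}f&0\\0&(-1)^{|f|}f[1]\end{pmatrix}$, where $\sigma^{-1}$ stands for the morphism $x\otimes c\mapsto\sigma^{-1}(x)\epsilon(c)$.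 *The functor $\mathbb G$.* $\mathbb G(M,m^M)=(M[1],\widehat{m^M})$ and $\mathbb G(f)=\widehat f$, where $\widehat f:M[1]\otimes_ST_S(A[1])\to N[1]$ is determined by $\widehat f\,(\sigma_M\otimes\sigma^{\otimes n})=\sigma_Nf_{n+1}$, $n\ge0$. *Exact and Frobenius categories.* An exact structure on an additive category is a class of kernel-cokernel pairs (*conflations*, consisting of an *inflation* and a *deflation*) that is closed under isomorphism, such that identities are inflations and deflations, inflations and deflations are closed under composition, pushouts of inflations along arbitrary morphisms exist and are inflations, and pullbacks of deflations along arbitrary morphisms exist and are deflations. An additive category with split idempotents and an exact structure is a *Frobenius category* if it has enough projectives and enough injectives (relative to the exact structure), and these coincide. It is *special* if there are an automorphism $T$ of it as an exact category, an endofunctor $J$ with projective values, and natural transformations $\alpha:id\to J$, $\beta:J\to T$ such that $X\xrightarrow{\alpha_X}J(X)\xrightarrow{\beta_X}T(X)$ is a conflation for every object $X$. **Statement.** $\mathrm{Mod}_\infty\text{-}A$ is an additive category with split idempotents. Let $\mathcal E_\infty$ be the class of the composable pairs $(M,m^M)\xrightarrow{f}(E,m^E)\xrightarrow{g}(N,m^N)$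 in $\mathrm{Mod}_\infty\text{-}A$ such that $g\circ f=0$ and $0\to M\xrightarrow{f_1}E\xrightarrow{g_1}N\to0$ is an exact sequence of graded right $S$-modules. 1. $(\mathrm{Mod}_\infty\text{-}A,\mathcal E_\infty)$ is an exact category, and $\mathcal E_\infty$ is the class of the composable pairs with zero composition that become split exact pairs in $\mathrm{GMod}^0\text{-}A$ when the second components $m$ of the objects are forgotten. 2. A morphism $f$ of $\mathrm{Mod}_\infty\text{-}A$ is an $\mathcal E_\infty$-inflation if and only if $f_1$ is injective. 3. A morphism $g$ of $\mathrm{Mod}_\infty\text{-}A$ is an $\mathcal E_\infty$-deflation if and only if $g_1$ is surjective. 4. $\mathcal E$ is an exact structure on $\mathrm{TGMod}^0\text{-}\mathcal B_A$, and $\mathbb G:(\mathrm{Mod}_\infty\text{-}A,\mathcal E_\infty)\to(\mathrm{TGMod}^0\text{-}\mathcal B_A,\mathcal E)$ is an equivalence of exact categories (a pair is in $\mathcal E_\infty$ if and only if its image is in $\mathcal E$). Moreover, $\mathbb G$ is bijective on the homogeneous morphisms of every degree. 5. $T(M,m^M)=(M[1],m^{M[1]})$, with $m^{M[1]}=-\,\underline\sigma_M\circ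 m^M\circ\underline\sigma_M^{-1}$, i.e. $m^{M[1]}_n=(-1)^{n}\sigma_Mm^M_n(\sigma_M^{-1}\otimes id^{\otimes(n-1)})$, and $T(f)=f[1]=\underline\sigma_N\circ f\circ\underline\sigma_M^{-1}$, i.e. $f[1]_n=(-1)^{n-1}\sigma_Nf_n(\sigma_M^{-1}\otimes id^{\otimes(n-1)})$, define an endofunctor of $\mathrm{TGMod}\text{-}A$ (respecting degrees), which is bijective on the homogeneous morphisms of every degree. It restricts to an automorphism of the exact category $(\mathrm{Mod}_\infty\text{-}A,\mathcal E_\infty)$: the restriction has an inverse functor, and a pair is in $\mathcal E_\infty$ if and only if its image under $T$ is. 6. $J(M,m^M)=\left(M\oplus M[1],\begin{pmatrix}m^M&\underline\sigma_M^{-1}\\0&m^{M[1]}\end{pmatrix}\right)$ and $J(f)=\begin{pmatrix}f&0\\0&(-1)^{|f|}f[1]\end{pmatrix}$ define an endofunctor of $\mathrm{TGMod}\text{-}A$ (respecting degrees), and hence of $\mathrm{Mod}_\infty\text{-}A$, where $J(f)=\begin{pmatrix}f&0\\0&f[1]\end{pmatrix}$. 7. $\mathbb GT=T\mathbb G$ and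 $\mathbb GJ=J\mathbb G$. 8. There are natural transformations $\alpha:id\to J$ and $\beta:J\to T$ of endofunctors of $\mathrm{Mod}_\infty\text{-}A$ such that for each $X=(M,m^M)$ the morphisms $\alpha_X$ and $\beta_X$ are strict, with $(\alpha_X)_1=(id_M,0)^t:M\to M\oplus M[1]$ and $(\beta_X)_1=(0,id_{M[1]}):M\oplus M[1]\to M[1]$, and $X\xrightarrow{\alpha_X}J(X)\xrightarrow{\beta_X}T(X)$ is an $\mathcal E_\infty$-conflation. 9. $J(X)$ is $\mathcal E_\infty$-projective for each $X$; $\mathrm{Mod}_\infty\text{-}A$ has enough $\mathcal E_\infty$-projectives and enough $\mathcal E_\infty$-injectives, and an object is $\mathcal E_\infty$-projective if and only if it is $\mathcal E_\infty$-injective. Thus $(\mathrm{Mod}_\infty\text{-}A,\mathcal E_\infty)$, with $T$, $J$, $\alpha$, $\beta$, is a special Frobenius category. -/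

import Mathlib

open CategoryTheory MulOpposite
open scoped TensorProduct DirectSum

set_option linter.unusedSectionVars false

universe uk uS uA uC w w'

namespace AInfinity

/-- The sign `(-1)^n`. -/
def sgn (n : ℤ) : ℤ := (n.negOnePow : ℤ)

lemma sgn_add (a b : ℤ) : sgn (a + b) = sgn a * sgn b := by
  simp [sgn, Int.negOnePow_add]

lemma sgn_eq_of_even {a b : ℤ} (h : Even (a - b)) : sgn a = sgn b := by
  have : a.negOnePow = b.negOnePow := (Int.negOnePow_eq_iff a b).2 h
  simp [sgn, this]

lemma sgn_even {a : ℤ} (h : Even a) : sgn a = 1 := by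
  simp [sgn, Int.negOnePow_even a h]

@[simp] lemma sgn_zero : sgn 0 = 1 := by simp [sgn]

@[simp] lemma sgn_one : sgn 1 = -1 := by simp [sgn]

section Modules

variable (k : Type uk) (S : Type uS) [Field k] [Ring S] [Algebra k S]

/-- A graded right `S`-module `M = ⨁_j M_j` (with the induced action of `k`); a right `S`-action is
an action of `Sᵐᵒᵖ`, and `gr j` is the homogeneous component `M_j`. -/
structure GrMod where
  carrier : Type w
  [acg : AddCommGroup carrier]
  [modk : Module k carrier]
  [modR : Module Sᵐᵒᵖ carrier]
  [towerR : IsScalarTower k Sᵐᵒᵖ carrier]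
  gr : ℤ → Submodule k carrier
  rsmul_mem : ∀ (j : ℤ) (s : S) (x : carrier), x ∈ gr j → op s • x ∈ gr j
  internal : DirectSum.IsInternal gr

/-- A graded `S`-`S`-bimodule on which `k` acts centrally. -/
structure GrBimod extends GrMod.{uk, uS, w} k S where
  [modL : Module S carrier]
  [towerL : IsScalarTower k S carrier]
  [comm : SMulCommClass S Sᵐᵒᵖ carrier]
  lsmul_mem : ∀ (j : ℤ) (s : S) (x : carrier), x ∈ gr j → s • x ∈ gr j

end Modules

attribute [instance] GrMod.acg GrMod.modk GrMod.modR GrMod.towerR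
attribute [instance] GrBimod.modL GrBimod.towerL GrBimod.comm

variable {k : Type uk} {S : Type uS} [Field k] [Ring S] [Algebra k S]

instance : CoeSort (GrMod.{uk, uS, w} k S) (Type w) := ⟨GrMod.carrier⟩

section Shortcuts

variable (M : GrMod.{uk, uS, w} k S)

instance : AddCommMonoid M.carrier := inferInstance

instance : AddGroup M.carrier := inferInstance

instance : SubNegMonoid M.carrier := inferInstance

instance : AddMonoid M.carrier := inferInstance

instance : AddZeroClass M.carrier := inferInstance

instance : AddZero M.carrier := inferInstance

instance : Add M.carrier := inferInstance

instance : Zero M.carrier := inferInstance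

instance : AddCommSemigroup M.carrier := inferInstance

instance : AddSemigroup M.carrier := inferInstance

end Shortcuts

instance : CoeSort (GrBimod.{uk, uS, w} k S) (Type w) := ⟨fun V => V.carrier⟩

namespace GrMod

variable (M : GrMod.{uk, uS, w} k S)

/-- The decomposition of the elements of `M` into homogeneous components. -/
noncomputable def decomp : M ≃ₗ[k] (⨁ j, M.gr j) :=
  (LinearEquiv.ofBijective (DirectSum.coeLinearMap M.gr) M.internal).symm

lemma decomp_of_mem {j : ℤ} {x : M} (hx : x ∈ M.gr j) :
    M.decomp x = DirectSum.lof k ℤ (fun j => M.gr j) j ⟨x, hx⟩ := by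
  rw [decomp, LinearEquiv.symm_apply_eq]
  exact (DirectSum.coeLinearMap_lof M.gr j ⟨x, hx⟩).symm

/-- The Koszul sign operator: `x ↦ (-1)^{n|x|} x` for homogeneous `x`. -/
noncomputable def tw (n : ℤ) : M →ₗ[k] M :=
  (DirectSum.toModule k ℤ M (fun j => sgn (n * j) • (M.gr j).subtype)) ∘ₗ M.decomp.toLinearMap

lemma tw_of_mem (n : ℤ) {j : ℤ} {x : M} (hx : x ∈ M.gr j) : M.tw n x = sgn (n * j) • x := by
  simp [tw, M.decomp_of_mem hx]

lemma induction_homog {p : M → Prop} (hm : ∀ j x, x ∈ M.gr j → p x)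
    (ha : ∀ x y, p x → p y → p (x + y)) (x : M) : p x := by
  have h := ((DirectSum.isInternal_submodule_iff_iSupIndep_and_iSup_eq_top M.gr).1 M.internal).2
  have hx : x ∈ iSup M.gr := h ▸ Submodule.mem_top
  exact Submodule.iSup_induction M.gr (motive := p) hx hm (hm 0 0 (zero_mem _)) ha

lemma tw_rsmul (n : ℤ) (s : S) (x : M) : M.tw n (op s • x) = op s • M.tw n x := by
  induction x using M.induction_homog with
  | hm j x hx =>
    rw [M.tw_of_mem n hx, M.tw_of_mem n (M.rsmul_mem j s x hx), smul_comm]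
  | ha x y hx hy => simp [hx, hy]

lemma tw_mem (n : ℤ) {j : ℤ} {x : M} (hx : x ∈ M.gr j) : M.tw n x ∈ M.gr j := by
  rw [M.tw_of_mem n hx]; exact zsmul_mem hx _

lemma tw_tw (a b : ℤ) (x : M) : M.tw a (M.tw b x) = M.tw (a + b) x := by
  induction x using M.induction_homog with
  | hm j x hx =>
    rw [M.tw_of_mem b hx, map_zsmul, M.tw_of_mem a hx, M.tw_of_mem _ hx, smul_smul, ← sgn_add]
    congr 2; ring
  | ha x y hx hy => simp [hx, hy]

lemma tw_even {a : ℤ} (h : Even a) (x : M) : M.tw a x = x := by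
  induction x using M.induction_homog with
  | hm j x hx => rw [M.tw_of_mem a hx, sgn_even (h.mul_right j), one_smul]
  | ha x y hx hy => simp [hx, hy]

lemma tw_eq_of_even {a b : ℤ} (h : Even (a - b)) (x : M) : M.tw a x = M.tw b x := by
  have := M.tw_tw (a - b) b x
  rw [M.tw_even h] at this
  simpa using this.symm

@[simp] lemma tw_zero (x : M) : M.tw 0 x = x := M.tw_even (by simp) x

/-- A criterion for a family of submodules to be a grading. -/
lemma internal_of_proj {X : Type*} [AddCommGroup X] [Module k X] (gr : ℤ → Submodule k X)
    (p : ℤ → X →ₗ[k] X) (h1 : ∀ j x, x ∈ gr j → p j x = x)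
    (h2 : ∀ i j x, x ∈ gr j → i ≠ j → p i x = 0) (h3 : iSup gr = ⊤) :
    DirectSum.IsInternal gr := by
  refine (DirectSum.isInternal_submodule_iff_iSupIndep_and_iSup_eq_top gr).2 ⟨?_, h3⟩
  intro i
  rw [Submodule.disjoint_def]
  intro x hx hx'
  have hle : (⨆ j, ⨆ (_ : j ≠ i), gr j) ≤ LinearMap.ker (p i) :=
    iSup₂_le fun j hj y hy => h2 i j y hy (Ne.symm hj)
  have := hle hx'
  rw [LinearMap.mem_ker, h1 i x hx] at this
  exact this

lemma iSup_gr : iSup M.gr = ⊤ :=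
  ((DirectSum.isInternal_submodule_iff_iSupIndep_and_iSup_eq_top M.gr).1 M.internal).2

/-- The projection onto the homogeneous component of degree `j`. -/
noncomputable def proj (j : ℤ) : M →ₗ[k] M :=
  (M.gr j).subtype ∘ₗ DirectSum.component k ℤ (fun j => M.gr j) j ∘ₗ M.decomp.toLinearMap

lemma proj_of_mem {j : ℤ} {x : M} (hx : x ∈ M.gr j) : M.proj j x = x := by
  simp [proj, M.decomp_of_mem hx, DirectSum.component.lof_self]

lemma proj_of_mem_ne {i j : ℤ} {x : M} (hx : x ∈ M.gr j) (h : i ≠ j) : M.proj i x = 0 := by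
  simp [proj, M.decomp_of_mem hx, DirectSum.component.of, h.symm]

/-- The translate `M[1]`, with `M[1]_i = M_{i+1}`; the canonical map `σ_M : M → M[1]` of degree `-1`
is the identity of the underlying module. -/
abbrev shift : GrMod.{uk, uS, w} k S where
  carrier := M
  gr j := M.gr (j + 1)
  rsmul_mem j s x hx := M.rsmul_mem _ s x hx
  internal := by
    refine internal_of_proj _ (fun j => M.proj (j + 1)) (fun j x hx => M.proj_of_mem hx)
      (fun i j x hx hij => M.proj_of_mem_ne hx (by simpa using hij)) ?_
    rw [eq_top_iff, ← M.iSup_gr]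
    refine iSup_le fun j => ?_
    have := le_iSup (fun j => M.gr (j + 1)) (j - 1)
    simpa using this

/-- The direct sum `M ⊕ N` of graded modules. -/
abbrev prod (N : GrMod.{uk, uS, w} k S) : GrMod.{uk, uS, w} k S where
  carrier := M × N
  gr j := (M.gr j).prod (N.gr j)
  rsmul_mem j s x hx := ⟨M.rsmul_mem _ s _ hx.1, N.rsmul_mem _ s _ hx.2⟩
  internal := by
    refine internal_of_proj _ (fun j => (M.proj j).prodMap (N.proj j)) ?_ ?_ ?_
    · rintro j ⟨x, y⟩ ⟨hx, hy⟩
      simp [M.proj_of_mem hx, N.proj_of_mem hy]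
    · rintro i j ⟨x, y⟩ ⟨hx, hy⟩ hij
      simp [M.proj_of_mem_ne hx hij, N.proj_of_mem_ne hy hij]
    · rw [eq_top_iff]
      rintro ⟨x, y⟩ -
      have h1 : ∀ x : M, (x, (0 : N)) ∈ ⨆ j, (M.gr j).prod (N.gr j) := by
        intro x
        induction x using M.induction_homog with
        | hm _ x hx => exact Submodule.mem_iSup_of_mem _ ⟨hx, zero_mem _⟩
        | ha x y hx hy => simpa using add_mem hx hy
      have h2 : ∀ y : N, ((0 : M), y) ∈ ⨆ j, (M.gr j).prod (N.gr j) := by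
        intro x
        induction x using N.induction_homog with
        | hm _ x hx => exact Submodule.mem_iSup_of_mem _ ⟨zero_mem _, hx⟩
        | ha x y hx hy => simpa using add_mem hx hy
      simpa using add_mem (h1 x) (h2 y)

lemma shift_tw (n : ℤ) (x : M) : M.shift.tw n x = sgn n • M.tw n x := by
  induction x using M.induction_homog with
  | hm j x hx =>
    have hx' : x ∈ M.shift.gr (j - 1) := by
      change x ∈ M.gr (j - 1 + 1)
      rwa [sub_add_cancel]
    rw [M.tw_of_mem n hx, smul_smul, ← sgn_add]
    refine (M.shift.tw_of_mem n hx').trans ?_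
    have : sgn (n * (j - 1)) = sgn (n + n * j) := sgn_eq_of_even ⟨-n, by ring⟩
    rw [this]
  | ha x y hx hy =>
    rw [map_add, hx, hy, map_add, smul_add]

lemma prod_tw (N : GrMod.{uk, uS, w} k S) (n : ℤ) (x : M.prod N) :
    (M.prod N).tw n x = (M.tw n x.1, N.tw n x.2) := by
  induction x using (M.prod N).induction_homog with
  | hm j x hx =>
    rw [(M.prod N).tw_of_mem n hx, M.tw_of_mem n hx.1, N.tw_of_mem n hx.2]; rfl
  | ha x y hx hy =>
    rw [map_add, hx, hy]
    change _ = (M.tw n (x.1 + y.1), N.tw n (x.2 + y.2))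
    rw [map_add, map_add]; rfl

end GrMod

namespace GrBimod

lemma tw_lsmul (V : GrBimod.{uk, uS, w} k S) (n : ℤ) (s : S) (x : V) :
    V.tw n (s • x) = s • V.tw n x := by
  induction x using V.toGrMod.induction_homog with
  | hm j x hx =>
    rw [V.tw_of_mem n hx, V.tw_of_mem n (V.lsmul_mem j s x hx), smul_comm]
  | ha x y hx hy => simp [hx, hy]

lemma proj_lsmul (V : GrBimod.{uk, uS, w} k S) (n : ℤ) (s : S) (x : V) :
    V.proj n (s • x) = s • V.proj n x := by
  induction x using V.toGrMod.induction_homog with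
  | hm j x hx =>
    by_cases h : n = j
    · subst h; rw [V.proj_of_mem hx, V.proj_of_mem (V.lsmul_mem _ s x hx)]
    · rw [V.proj_of_mem_ne hx h, V.proj_of_mem_ne (V.lsmul_mem _ s x hx) h, smul_zero]
  | ha x y hx hy => simp [hx, hy]

/-- The translate `V[1]` of a graded bimodule. -/
abbrev shift (V : GrBimod.{uk, uS, w} k S) : GrBimod.{uk, uS, w} k S where
  toGrMod := V.toGrMod.shift
  modL := V.modL
  towerL := V.towerL
  comm := V.comm
  lsmul_mem _ s x hx := V.lsmul_mem _ s x hx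

end GrBimod

section Tensor

variable (k S)
variable (M N : Type*) [AddCommGroup M] [Module k M] [Module Sᵐᵒᵖ M]
  [AddCommGroup N] [Module k N] [Module S N]

/-- The relations `(m s) ⊗ n = m ⊗ (s n)`. -/
def balRel : Submodule k (M ⊗[k] N) :=
  Submodule.span k {x | ∃ (m : M) (s : S) (n : N), x = (op s • m) ⊗ₜ[k] n - m ⊗ₜ[k] (s • n)}

/-- The tensor product `M ⊗_S N` of a right and a left `S`-module. -/
def BTen := (M ⊗[k] N) ⧸ balRel k S M N

noncomputable instance : AddCommGroup (BTen k S M N) :=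
  inferInstanceAs (AddCommGroup ((M ⊗[k] N) ⧸ balRel k S M N))

noncomputable instance : Module k (BTen k S M N) :=
  inferInstanceAs (Module k ((M ⊗[k] N) ⧸ balRel k S M N))

noncomputable instance : AddCommMonoid (BTen k S M N) := inferInstance

noncomputable instance : AddGroup (BTen k S M N) := inferInstance

noncomputable instance : SubNegMonoid (BTen k S M N) := inferInstance

noncomputable instance : AddMonoid (BTen k S M N) := inferInstance

noncomputable instance : AddZeroClass (BTen k S M N) := inferInstance

noncomputable instance : AddZero (BTen k S M N) := inferInstance

noncomputable instance : Add (BTen k S M N) := inferInstance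

noncomputable instance : Zero (BTen k S M N) := inferInstance

noncomputable instance : AddCommSemigroup (BTen k S M N) := inferInstance

noncomputable instance : AddSemigroup (BTen k S M N) := inferInstance

namespace BTen

variable {M N}

/-- The pure tensors, as a bilinear map. -/
noncomputable def mk : M →ₗ[k] N →ₗ[k] BTen k S M N :=
  (TensorProduct.mk k M N).compr₂ (balRel k S M N).mkQ

/-- The pure tensor `m ⊗ n`. -/
noncomputable def tm (m : M) (n : N) : BTen k S M N := mk k S m n

lemma tm_add (m : M) (n n' : N) : tm k S m (n + n') = tm k S m n + tm k S m n' := map_add _ _ _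

lemma add_tm (m m' : M) (n : N) : tm k S (m + m') n = tm k S m n + tm k S m' n := by simp [tm]

lemma tm_smul (c : k) (m : M) (n : N) : tm k S m (c • n) = c • tm k S m n := map_smul _ _ _

lemma smul_tm (c : k) (m : M) (n : N) : tm k S (c • m) n = c • tm k S m n := by simp [tm]

lemma tm_zsmul (c : ℤ) (m : M) (n : N) : tm k S m (c • n) = c • tm k S m n := map_zsmul _ _ _

lemma zsmul_tm (c : ℤ) (m : M) (n : N) : tm k S (c • m) n = c • tm k S m n := by
  simp only [tm, map_zsmul]; rfl

@[simp] lemma tm_zero (m : M) : tm k S m (0 : N) = 0 := map_zero _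

@[simp] lemma zero_tm (n : N) : tm k S (0 : M) n = 0 := by simp [tm]

lemma tm_bal (m : M) (s : S) (n : N) : tm k S (op s • m) n = tm k S m (s • n) :=
  (Submodule.Quotient.eq _).2 (Submodule.subset_span ⟨m, s, n, rfl⟩)

lemma induction {p : BTen k S M N → Prop} (ht : ∀ m n, p (tm k S m n))
    (ha : ∀ x y, p x → p y → p (x + y)) (x : BTen k S M N) : p x := by
  obtain ⟨y, rfl⟩ := Submodule.Quotient.mk_surjective _ x
  induction y using TensorProduct.induction_on with
  | zero => have := ht 0 0; rw [tm_zero] at this; exact this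
  | tmul m n => exact ht m n
  | add x y hx hy => exact ha _ _ hx hy

variable {k S}
variable {P : Type*} [AddCommGroup P] [Module k P]

/-- The universal property of `M ⊗_S N`. -/
noncomputable def lift (φ : M →ₗ[k] N →ₗ[k] P)
    (h : ∀ (m : M) (s : S) (n : N), φ (op s • m) n = φ m (s • n)) : BTen k S M N →ₗ[k] P :=
  (balRel k S M N).liftQ (TensorProduct.lift φ) (by
    refine Submodule.span_le.2 ?_
    rintro _ ⟨m, s, n, rfl⟩
    simp [h])

@[simp] lemma lift_tm (φ : M →ₗ[k] N →ₗ[k] P) (h) (m : M) (n : N) :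
    lift (S := S) φ h (tm k S m n) = φ m n := rfl

lemma ext {f g : BTen k S M N →ₗ[k] P} (h : ∀ m n, f (tm k S m n) = g (tm k S m n)) : f = g := by
  refine LinearMap.ext fun x => ?_
  induction x using induction with
  | ht m n => exact h m n
  | ha x y hx hy => simp [hx, hy]

variable {M' N' : Type*} [AddCommGroup M'] [Module k M'] [Module Sᵐᵒᵖ M']
  [AddCommGroup N'] [Module k N'] [Module S N']

/-- The map `m ⊗ n ↦ f m ⊗ g n`, for `f` right `S`-linear and `g` left `S`-linear. -/
noncomputable def map (f : M →ₗ[k] M') (g : N →ₗ[k] N')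
    (hf : ∀ (s : S) (m : M), f (op s • m) = op s • f m)
    (hg : ∀ (s : S) (n : N), g (s • n) = s • g n) : BTen k S M N →ₗ[k] BTen k S M' N' :=
  lift ((mk k S).compl₁₂ f g) (fun m s n => by
    change tm k S (f (op s • m)) (g n) = tm k S (f m) (g (s • n))
    rw [hf, hg, tm_bal])

@[simp] lemma map_tm (f : M →ₗ[k] M') (g : N →ₗ[k] N') (hf hg) (m : M) (n : N) :
    map (S := S) f g hf hg (tm k S m n) = tm k S (f m) (g n) := rfl

section Right

variable [Module Sᵐᵒᵖ N] [IsScalarTower k Sᵐᵒᵖ N] [SMulCommClass S Sᵐᵒᵖ N]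

/-- The right action of `s` on `M ⊗_S N`, for a bimodule `N`. -/
noncomputable def rmul (a : Sᵐᵒᵖ) : BTen k S M N →ₗ[k] BTen k S M N :=
  map LinearMap.id
    { toFun := fun n => a • n
      map_add' := smul_add a
      map_smul' := fun c n => smul_comm a c n } (fun _ _ => rfl) (fun s n => (smul_comm s a n).symm)

noncomputable instance : Module Sᵐᵒᵖ (BTen k S M N) where
  smul a x := rmul a x
  one_smul x := by
    change rmul 1 x = x
    induction x using induction with
    | ht m n => simp [rmul]
    | ha x y hx hy => rw [map_add, hx, hy]
  mul_smul a b x := by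
    change rmul (a * b) x = rmul a (rmul b x)
    induction x using induction with
    | ht m n => simp [rmul, mul_smul]
    | ha x y hx hy => simp only [map_add, hx, hy]
  smul_zero a := map_zero (rmul a)
  smul_add a := map_add (rmul a)
  add_smul a b x := by
    change rmul (a + b) x = rmul a x + rmul b x
    induction x using induction with
    | ht m n => simp [rmul, add_smul, tm_add]
    | ha x y hx hy => simp only [map_add, hx, hy]; abel
  zero_smul x := by
    change rmul 0 x = 0
    induction x using induction with
    | ht m n => simp [rmul]
    | ha x y hx hy => simp [hx, hy]

lemma rsmul_tm (a : Sᵐᵒᵖ) (m : M) (n : N) : a • tm k S m n = tm k S m (a • n) := rfl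

instance : IsScalarTower k Sᵐᵒᵖ (BTen k S M N) where
  smul_assoc c a x := by
    induction x using induction with
    | ht m n => rw [rsmul_tm, rsmul_tm, smul_assoc, tm_smul]
    | ha x y hx hy => simp only [smul_add, hx, hy]

end Right

section Left

variable [Module S M] [IsScalarTower k S M] [SMulCommClass S Sᵐᵒᵖ M]

/-- The left action of `s` on `M ⊗_S N`, for a bimodule `M`. -/
noncomputable def lmul (a : S) : BTen k S M N →ₗ[k] BTen k S M N :=
  map
    { toFun := fun n => a • n
      map_add' := smul_add a
      map_smul' := fun c n => smul_comm a c n } LinearMap.id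
    (fun s m => smul_comm a (op s) m) (fun _ _ => rfl)

noncomputable instance : Module S (BTen k S M N) where
  smul a x := lmul a x
  one_smul x := by
    change lmul 1 x = x
    induction x using induction with
    | ht m n => simp [lmul]
    | ha x y hx hy => rw [map_add, hx, hy]
  mul_smul a b x := by
    change lmul (a * b) x = lmul a (lmul b x)
    induction x using induction with
    | ht m n => simp [lmul, mul_smul]
    | ha x y hx hy => simp only [map_add, hx, hy]
  smul_zero a := map_zero (lmul a)
  smul_add a := map_add (lmul a)
  add_smul a b x := by
    change lmul (a + b) x = lmul a x + lmul b x
    induction x using induction with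
    | ht m n => simp [lmul, add_smul, add_tm]
    | ha x y hx hy => simp only [map_add, hx, hy]; abel
  zero_smul x := by
    change lmul 0 x = 0
    induction x using induction with
    | ht m n => simp [lmul]
    | ha x y hx hy => simp [hx, hy]

lemma lsmul_tm (a : S) (m : M) (n : N) : a • tm k S m n = tm k S (a • m) n := rfl

instance : IsScalarTower k S (BTen k S M N) where
  smul_assoc c a x := by
    induction x using induction with
    | ht m n => rw [lsmul_tm, lsmul_tm, smul_assoc, smul_tm]
    | ha x y hx hy => simp only [smul_add, hx, hy]

end Left

instance [Module S M] [IsScalarTower k S M] [SMulCommClass S Sᵐᵒᵖ M]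
    [Module Sᵐᵒᵖ N] [IsScalarTower k Sᵐᵒᵖ N] [SMulCommClass S Sᵐᵒᵖ N] :
    SMulCommClass S Sᵐᵒᵖ (BTen k S M N) where
  smul_comm a b x := by
    induction x using induction with
    | ht m n => rfl
    | ha x y hx hy => simp only [smul_add, hx, hy]

section Assoc

variable {Q : Type*} [AddCommGroup Q] [Module k Q] [Module S Q]
variable [Module Sᵐᵒᵖ N] [IsScalarTower k Sᵐᵒᵖ N] [IsScalarTower k S N] [SMulCommClass S Sᵐᵒᵖ N]

variable (k S) in
/-- The canonical isomorphism `M ⊗ (N ⊗ Q) → (M ⊗ N) ⊗ Q`. -/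
noncomputable def assocInv :
    BTen k S M (BTen k S N Q) →ₗ[k] BTen k S (BTen k S M N) Q :=
  lift (S := S) (M := M) (N := BTen k S N Q)
    { toFun := fun m => lift (S := S) (M := N) (N := Q) ((mk k S).comp (mk k S m)) (fun n s p => by
        change tm k S (tm k S m (op s • n)) p = tm k S (tm k S m n) (s • p)
        rw [← tm_bal, rsmul_tm])
      map_add' := fun m m' => ext fun n p => by
        change tm k S (tm k S (m + m') n) p = tm k S (tm k S m n) p + tm k S (tm k S m' n) p
        rw [add_tm, add_tm]
      map_smul' := fun c m => ext fun n p => by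
        change tm k S (tm k S (c • m) n) p = c • tm k S (tm k S m n) p
        rw [smul_tm, smul_tm] }
    (fun m s x => by
      induction x using induction with
      | ht n p =>
        change tm k S (tm k S (op s • m) n) p = tm k S (tm k S m (s • n)) p
        rw [tm_bal]
      | ha x y hx hy => simp only [map_add, smul_add, hx, hy])

@[simp] lemma assocInv_tm (m : M) (n : N) (p : Q) :
    assocInv k S (tm k S m (tm k S n p)) = tm k S (tm k S m n) p := rfl

end Assoc

end BTen

end Tensor

namespace GrBimod

/-- The tensor product `V ⊗_S W` of graded bimodules, with
`(V ⊗ W)_j = ⨁_{s + t = j} V_s ⊗ W_t`. -/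
noncomputable def tgr (V : GrBimod.{uk, uS, w} k S) (W : GrBimod.{uk, uS, w'} k S) (j : ℤ) :
    Submodule k (BTen k S V W) :=
  Submodule.span k {x | ∃ (a b : ℤ) (v : V) (u : W), v ∈ V.gr a ∧ u ∈ W.gr b ∧ a + b = j ∧
    x = BTen.tm k S v u}

lemma tm_mem_tgr (V : GrBimod.{uk, uS, w} k S) (W : GrBimod.{uk, uS, w'} k S) {a b : ℤ} {v : V}
    {u : W} (hv : v ∈ V.gr a) (hu : u ∈ W.gr b) : BTen.tm k S v u ∈ tgr V W (a + b) :=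
  Submodule.subset_span ⟨a, b, v, u, hv, hu, rfl, rfl⟩

/-- Auxiliary bilinear map for the homogeneous components of a tensor product. -/
noncomputable def tprojAux (V : GrBimod.{uk, uS, w} k S) (W : GrBimod.{uk, uS, w'} k S) (d : ℤ) :
    V →ₗ[k] W →ₗ[k] BTen k S V W :=
  (DirectSum.toModule k ℤ (W →ₗ[k] BTen k S V W)
    (fun i => ((BTen.mk k S).compl₂ (W.proj (d - i))) ∘ₗ (V.gr i).subtype)) ∘ₗ
      V.decomp.toLinearMap

lemma tprojAux_of_mem (V : GrBimod.{uk, uS, w} k S) (W : GrBimod.{uk, uS, w'} k S) (d : ℤ) {i : ℤ}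
    {v : V} (hv : v ∈ V.gr i) (u : W) :
    tprojAux V W d v u = BTen.tm k S v (W.proj (d - i) u) := by
  simp [tprojAux, V.decomp_of_mem hv, BTen.tm]

/-- The homogeneous components of the elements of a tensor product. -/
noncomputable def tproj (V : GrBimod.{uk, uS, w} k S) (W : GrBimod.{uk, uS, w'} k S) (d : ℤ) :
    BTen k S V W →ₗ[k] BTen k S V W :=
  BTen.lift (tprojAux V W d) (fun v s u => by
    induction v using V.toGrMod.induction_homog with
    | hm i v hv =>
      rw [tprojAux_of_mem V W d hv, tprojAux_of_mem V W d (V.rsmul_mem i s v hv), BTen.tm_bal,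
        W.proj_lsmul]
    | ha x y hx hy => rw [smul_add, map_add, map_add, LinearMap.add_apply, hx, hy]; rfl)

lemma tproj_tm (V : GrBimod.{uk, uS, w} k S) (W : GrBimod.{uk, uS, w'} k S) (d : ℤ) {i : ℤ}
    {v : V} (hv : v ∈ V.gr i) (u : W) :
    tproj V W d (BTen.tm k S v u) = BTen.tm k S v (W.proj (d - i) u) :=
  tprojAux_of_mem V W d hv u

lemma iSup_tgr (V : GrBimod.{uk, uS, w} k S) (W : GrBimod.{uk, uS, w'} k S) :
    iSup (tgr V W) = ⊤ := by
  rw [eq_top_iff]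
  rintro x -
  induction x using BTen.induction with
  | ht v u =>
    induction v using V.toGrMod.induction_homog with
    | hm i v hv =>
      induction u using W.toGrMod.induction_homog with
      | hm j u hu => exact Submodule.mem_iSup_of_mem _ (tm_mem_tgr V W hv hu)
      | ha x y hx hy => rw [BTen.tm_add]; exact add_mem hx hy
    | ha x y hx hy => rw [BTen.add_tm]; exact add_mem hx hy
  | ha x y hx hy => exact add_mem hx hy

lemma internal_tgr (V : GrBimod.{uk, uS, w} k S) (W : GrBimod.{uk, uS, w'} k S) :
    DirectSum.IsInternal (tgr V W) := by
  refine GrMod.internal_of_proj _ (tproj V W) ?_ ?_ (iSup_tgr V W)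
  · intro j x hx
    induction hx using Submodule.span_induction with
    | mem x h =>
      obtain ⟨a, b, v, u, hv, hu, rfl, rfl⟩ := h
      rw [tproj_tm V W _ hv, add_sub_cancel_left, W.proj_of_mem hu]
    | zero => simp
    | add x y _ _ hx hy => rw [map_add, hx, hy]
    | smul c x _ hx => rw [map_smul, hx]
  · intro i j x hx hij
    induction hx using Submodule.span_induction with
    | mem x h =>
      obtain ⟨a, b, v, u, hv, hu, rfl, rfl⟩ := h
      rw [tproj_tm V W _ hv, W.proj_of_mem_ne hu (by intro h; apply hij; rw [← h]; ring),
        BTen.tm_zero]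
    | zero => simp
    | add x y _ _ hx hy => rw [map_add, hx, hy, add_zero]
    | smul c x _ hx => rw [map_smul, hx, smul_zero]

/-- The graded bimodule `V ⊗_S W`. -/
noncomputable abbrev tensor (V : GrBimod.{uk, uS, w} k S) (W : GrBimod.{uk, uS, w'} k S) :
    GrBimod.{uk, uS, max w w'} k S where
  carrier := BTen k S V W
  gr := tgr V W
  internal := internal_tgr V W
  rsmul_mem j s x hx := by
    induction hx using Submodule.span_induction with
    | mem x h =>
      obtain ⟨a, b, v, u, hv, hu, rfl, rfl⟩ := h
      rw [BTen.rsmul_tm]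
      exact tm_mem_tgr V W hv (W.rsmul_mem _ _ _ hu)
    | zero => rw [smul_zero]; exact zero_mem _
    | add x y _ _ hx hy => rw [smul_add]; exact add_mem hx hy
    | smul c x _ hx => rw [smul_comm]; exact Submodule.smul_mem _ c hx
  lsmul_mem j s x hx := by
    induction hx using Submodule.span_induction with
    | mem x h =>
      obtain ⟨a, b, v, u, hv, hu, rfl, rfl⟩ := h
      rw [BTen.lsmul_tm]
      exact tm_mem_tgr V W (V.lsmul_mem _ _ _ hv) hu
    | zero => rw [smul_zero]; exact zero_mem _
    | add x y _ _ hx hy => rw [smul_add]; exact add_mem hx hy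
    | smul c x _ hx => rw [smul_comm]; exact Submodule.smul_mem _ c hx

variable (k S) in
/-- The bimodule `S`, concentrated in degree `0` (in a universe that is large enough). -/
abbrev unit : GrBimod.{uk, uS, max uS w} k S where
  carrier := ULift.{w} S
  comm := ⟨fun a b x => ULift.ext _ _ (smul_comm a b x.down)⟩
  gr j := if j = 0 then ⊤ else ⊥
  rsmul_mem j s x hx := by
    split_ifs at hx ⊢ with h
    · trivial
    · rw [(Submodule.mem_bot k).1 hx, smul_zero]; exact zero_mem _
  lsmul_mem j s x hx := by
    split_ifs at hx ⊢ with h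
    · trivial
    · rw [(Submodule.mem_bot k).1 hx, smul_zero]; exact zero_mem _
  internal := by
    refine GrMod.internal_of_proj _ (fun j => if j = 0 then LinearMap.id else 0) ?_ ?_ ?_
    · intro j x hx
      split_ifs at hx ⊢ with h
      · rfl
      · simpa using ((Submodule.mem_bot k).1 hx).symm
    · intro i j x hx hij
      by_cases h : i = 0
      · have h' : j ≠ 0 := fun h' => hij (h.trans h'.symm)
        rw [if_neg h', Submodule.mem_bot] at hx
        rw [hx, map_zero]
      · rw [if_neg h]; rfl
    · rw [eq_top_iff]
      exact le_iSup_of_le 0 (by simp)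

/-- The tensor power `V^{⊗ n}` over `S`, with `V^{⊗ 0} = S` and `V^{⊗ (n+1)} = V ⊗ V^{⊗ n}`. -/
@[reducible] noncomputable def tpow (V : GrBimod.{uk, uS, w} k S) : ℕ → GrBimod.{uk, uS, max uS w} k S
  | 0 => unit.{uk, uS, w} k S
  | n + 1 => tensor V (tpow V n)

section TS

variable (V : GrBimod.{uk, uS, w} k S)

/-- The underlying space of `T_S(V) = ⨁_n V^{⊗ n}`. -/
abbrev TSc : Type (max uS w) := ⨁ n : ℕ, (tpow V n).carrier

noncomputable instance : AddCommGroup (TSc V) := inferInstance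

noncomputable instance : AddCommMonoid (TSc V) := inferInstance

noncomputable instance : AddGroup (TSc V) := inferInstance

noncomputable instance : SubNegMonoid (TSc V) := inferInstance

noncomputable instance : AddMonoid (TSc V) := inferInstance

noncomputable instance : AddZeroClass (TSc V) := inferInstance

noncomputable instance : AddZero (TSc V) := inferInstance

noncomputable instance : Add (TSc V) := inferInstance

noncomputable instance : Zero (TSc V) := inferInstance

noncomputable instance : AddCommSemigroup (TSc V) := inferInstance

noncomputable instance : AddSemigroup (TSc V) := inferInstance

noncomputable instance : Module k (TSc V) := inferInstance

lemma TSc.induction {p : TSc V → Prop} (hm : ∀ n x, p (DirectSum.lof k ℕ _ n x))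
    (ha : ∀ x y, p x → p y → p (x + y)) (x : TSc V) : p x := by
  induction x using DirectSum.induction_on with
  | zero => have := hm 0 0; rwa [map_zero] at this
  | of n x => exact hm n x
  | add x y hx hy => exact ha x y hx hy

/-- The graded bimodule `T_S(V) = ⨁_n V^{⊗ n}`. -/
noncomputable abbrev TS : GrBimod.{uk, uS, max uS w} k S where
  carrier := TSc V
  gr j :=
    { carrier := {x | ∀ n, x n ∈ (tpow V n).gr j}
      add_mem' := fun hx hy n => add_mem (hx n) (hy n)
      zero_mem' := fun n => zero_mem _
      smul_mem' := fun c x hx n => Submodule.smul_mem _ c (hx n) }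
  rsmul_mem j s x hx n := (tpow V n).rsmul_mem j s _ (hx n)
  lsmul_mem j s x hx n := (tpow V n).lsmul_mem j s _ (hx n)
  internal := by
    refine GrMod.internal_of_proj _
      (fun j => DFinsupp.mapRange.linearMap (fun n => (tpow V n).proj j)) ?_ ?_ ?_
    · intro j x hx
      refine DFinsupp.ext fun n => ?_
      exact (tpow V n).proj_of_mem (hx n)
    · intro i j x hx hij
      refine DFinsupp.ext fun n => ?_
      exact (tpow V n).proj_of_mem_ne (hx n) hij
    · rw [eq_top_iff]
      rintro x -
      induction x using TSc.induction with
      | hm n x =>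
        induction x using (tpow V n).toGrMod.induction_homog with
        | hm j x hx =>
          refine Submodule.mem_iSup_of_mem j fun m => ?_
          by_cases h : m = n
          · subst h; rw [DirectSum.lof_apply]; exact hx
          · rw [DirectSum.lof_eq_of, DirectSum.of_eq_of_ne _ _ _ h]; exact zero_mem _
        | ha x y hx hy => rw [map_add]; exact add_mem hx hy
      | ha x y hx hy => exact add_mem hx hy

lemma lof_mem_TS {n : ℕ} {j : ℤ} {x : tpow V n} (hx : x ∈ (tpow V n).gr j) :
    (DirectSum.lof k ℕ (fun n => (tpow V n).carrier) n x) ∈ (TS V).gr j := by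
  intro m
  by_cases h : m = n
  · subst h; rw [DirectSum.lof_apply]; exact hx
  · rw [DirectSum.lof_eq_of, DirectSum.of_eq_of_ne _ _ _ h]; exact zero_mem _

/-- The operation `v, x ↦ v ⊗ x` on `T_S(V)`. -/
noncomputable def consT : V →ₗ[k] TSc V →ₗ[k] TSc V :=
  LinearMap.flip (DirectSum.toModule k ℕ (V →ₗ[k] TSc V) (fun n =>
    ((BTen.mk k S (M := V) (N := tpow V n)).compr₂
      (DirectSum.lof k ℕ (fun n => (tpow V n).carrier) (n + 1))).flip))

lemma consT_lof (v : V) (n : ℕ) (x : tpow V n) :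
    consT V v (DirectSum.lof k ℕ (fun n => (tpow V n).carrier) n x) =
      DirectSum.lof k ℕ (fun n => (tpow V n).carrier) (n + 1) (BTen.tm k S v x) := by
  simp only [consT, LinearMap.flip_apply, DirectSum.toModule_lof]; rfl

/-- The pure tensor `v_1 ⊗ ⋯ ⊗ v_n` in `T_S(V)`. -/
noncomputable def tp : List V → TSc V
  | [] => DirectSum.lof k ℕ (fun n => (tpow V n).carrier) 0 (ULift.up 1)
  | v :: l => consT V v (tp l)

lemma lof_smul (n : ℕ) (a : Sᵐᵒᵖ) (x : tpow V n) :
    DirectSum.lof k ℕ (fun n => (tpow V n).carrier) n (a • x) =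
      a • DirectSum.lof k ℕ (fun n => (tpow V n).carrier) n x :=
  (DirectSum.lof Sᵐᵒᵖ ℕ (fun n => (tpow V n).carrier) n).map_smul a x

lemma lof_lsmul (n : ℕ) (a : S) (x : tpow V n) :
    DirectSum.lof k ℕ (fun n => (tpow V n).carrier) n (a • x) =
      a • DirectSum.lof k ℕ (fun n => (tpow V n).carrier) n x :=
  (DirectSum.lof S ℕ (fun n => (tpow V n).carrier) n).map_smul a x

lemma consT_smul (v : V) (s : S) (x : TSc V) : consT V v (op s • x) = op s • consT V v x := by
  induction x using TSc.induction with
  | hm n x => rw [← lof_smul, consT_lof, consT_lof, ← lof_smul]; rfl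
  | ha x y hx hy => rw [smul_add, map_add, map_add, smul_add, hx, hy]

lemma consT_lsmul (v : V) (s : S) (x : TSc V) : consT V (s • v) x = s • consT V v x := by
  induction x using TSc.induction with
  | hm n x => rw [consT_lof, consT_lof, ← lof_lsmul]; rfl
  | ha x y hx hy => rw [map_add, map_add, smul_add, hx, hy]

lemma consT_bal (v : V) (s : S) (x : TSc V) : consT V (op s • v) x = consT V v (s • x) := by
  induction x using TSc.induction with
  | hm n x => rw [consT_lof, ← lof_lsmul, consT_lof, BTen.tm_bal]
  | ha x y hx hy => rw [smul_add, map_add, map_add, hx, hy]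

/-- `T_S(V)` is generated by the pure tensors as a right module. -/
lemma tp_induction {p : TSc V → Prop} (ht : ∀ (l : List V) (s : S), p (op s • tp V l))
    (ha : ∀ x y, p x → p y → p (x + y)) (x : TSc V) : p x := by
  have key : ∀ x : TSc V, x ∈ AddSubmonoid.closure {y : TSc V | ∃ (l : List V) (s : S), y = op s • tp V l} := by
    intro x
    induction x using TSc.induction with
    | hm n x =>
      induction n with
      | zero =>
        refine AddSubmonoid.subset_closure ⟨[], x.down, ?_⟩
        rw [tp, ← lof_smul]
        congr 1
        refine ULift.ext _ _ ?_
        change x.down = (1 : S) * x.down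
        rw [one_mul]
      | succ n ih =>
        induction x using BTen.induction with
        | ht v x =>
          have h2 : ∀ y ∈ AddSubmonoid.closure {y : TSc V | ∃ (l : List V) (s : S), y = op s • tp V l},
              consT V v y ∈ AddSubmonoid.closure {y : TSc V | ∃ (l : List V) (s : S), y = op s • tp V l} := by
            intro y hy
            induction hy using AddSubmonoid.closure_induction with
            | mem y h =>
              obtain ⟨l, s, rfl⟩ := h
              exact AddSubmonoid.subset_closure ⟨v :: l, s, consT_smul V v s _⟩
            | zero => rw [map_zero]; exact zero_mem _
            | add x y _ _ hx hy => rw [map_add]; exact add_mem hx hy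
          have := h2 _ (ih x)
          rwa [consT_lof] at this
        | ha x y hx hy => rw [map_add]; exact add_mem hx hy
    | ha x y hx hy => exact add_mem hx hy
  have h0 : p 0 := by simpa using ht [] 0
  induction key x using AddSubmonoid.closure_induction with
  | mem y h => obtain ⟨l, s, rfl⟩ := h; exact ht l s
  | zero => exact h0
  | add x y _ _ hx hy => exact ha x y hx hy

end TS

section Multilinear

variable (V : GrBimod.{uk, uS, w} k S)
variable {N : Type*} [AddCommGroup N] [Module k N] [Module Sᵐᵒᵖ N] [IsScalarTower k Sᵐᵒᵖ N]

/-- A function on lists whose restriction to lists of length `n ≥ 1` is `k`-multilinear,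
`S`-balanced and right `S`-linear; equivalently, a family of right `S`-linear maps
`V^{⊗ n} → N`, `n ≥ 0`, (the map `S → N` being determined by the image of `1`). -/
structure IsML (F : List V → N) : Prop where
  add : ∀ (p q : List V) (a b : V), F (p ++ (a + b) :: q) = F (p ++ a :: q) + F (p ++ b :: q)
  smul : ∀ (p q : List V) (c : k) (a : V), F (p ++ (c • a) :: q) = c • F (p ++ a :: q)
  bal : ∀ (p q : List V) (s : S) (a b : V),
    F (p ++ (op s • a) :: b :: q) = F (p ++ a :: (s • b) :: q)
  right : ∀ (p : List V) (s : S) (a : V), F (p ++ [op s • a]) = op s • F (p ++ [a])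

lemma IsML.cons {F : List V → N} (h : IsML V F) (v : V) : IsML V (fun l => F (v :: l)) where
  add p q a b := h.add (v :: p) q a b
  smul p q c a := h.smul (v :: p) q c a
  bal p q s a b := h.bal (v :: p) q s a b
  right p s a := h.right (v :: p) s a

variable (N) in
/-- The space of the functions satisfying `IsML`. -/
def mlSub : Submodule k (List V → N) where
  carrier := {F | IsML V F}
  zero_mem' := ⟨fun _ _ _ _ => by simp, fun _ _ _ _ => by simp, fun _ _ _ _ _ => rfl,
    fun _ _ _ => by simp⟩
  add_mem' {F G} hF hG := ⟨
    fun p q a b => by simp only [Pi.add_apply, hF.add, hG.add]; abel,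
    fun p q c a => by simp only [Pi.add_apply, hF.smul, hG.smul, smul_add],
    fun p q s a b => by simp only [Pi.add_apply, hF.bal, hG.bal],
    fun p s a => by simp only [Pi.add_apply, hF.right, hG.right, smul_add]⟩
  smul_mem' c F hF := ⟨
    fun p q a b => by simp only [Pi.smul_apply, hF.add, smul_add],
    fun p q d a => by simp only [Pi.smul_apply, hF.smul, smul_comm c d],
    fun p q s a b => by simp only [Pi.smul_apply, hF.bal],
    fun p s a => by simp only [Pi.smul_apply, hF.right, smul_comm c (op s)]⟩

/-- Fixing the first entry. -/
def consF : mlSub V N →ₗ[k] V →ₗ[k] mlSub V N where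
  toFun F :=
    { toFun := fun v => ⟨fun l => F.1 (v :: l), F.2.cons V v⟩
      map_add' := fun a b => Subtype.ext (funext fun l => F.2.add [] l a b)
      map_smul' := fun c a => Subtype.ext (funext fun l => F.2.smul [] l c a) }
  map_add' _ _ := rfl
  map_smul' _ _ := rfl

/-- The recursion step for `liftAux`. -/
noncomputable def liftSucc {W : Type*} [AddCommGroup W] [Module k W] [Module S W]
    (L : mlSub V N →ₗ[k] W →ₗ[k] N)
    (h : ∀ F v (s : S) x, L (consF V F (op s • v)) x = L (consF V F v) (s • x)) :
    mlSub V N →ₗ[k] BTen k S V W →ₗ[k] N where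
  toFun F := BTen.lift (S := S) (M := V) (N := W) (L ∘ₗ consF V F) (h F)
  map_add' F G := BTen.ext fun v x => by
    change L (consF V (F + G) v) x = L (consF V F v) x + L (consF V G v) x
    rw [map_add, LinearMap.add_apply, map_add, LinearMap.add_apply]
  map_smul' c F := BTen.ext fun v x => by
    change L (consF V (c • F) v) x = c • L (consF V F v) x
    rw [map_smul, LinearMap.smul_apply, map_smul, LinearMap.smul_apply]

lemma liftSucc_tm {W : Type*} [AddCommGroup W] [Module k W] [Module S W]
    (L : mlSub V N →ₗ[k] W →ₗ[k] N) (h) (F : mlSub V N) (v : V) (x : W) :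
    liftSucc V L h F (BTen.tm k S v x) = L (consF V F v) x := rfl

lemma liftSucc_bal {W : Type*} [AddCommGroup W] [Module k W] [Module S W]
    (L : mlSub V N →ₗ[k] W →ₗ[k] N) (h) (F : mlSub V N) (v : V) (s : S) (x : BTen k S V W) :
    liftSucc V L h (consF V F (op s • v)) x = liftSucc V L h (consF V F v) (s • x) := by
  induction x using BTen.induction with
  | ht u x =>
    have : consF V (consF V F (op s • v)) u = consF V (consF V F v) (s • u) :=
      Subtype.ext (funext fun l => F.2.bal [] l s v u)
    rw [BTen.lsmul_tm, liftSucc_tm, liftSucc_tm, this]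
  | ha x y hx hy => rw [map_add, hx, hy, smul_add, map_add]

/-- The linear maps on the tensor powers that correspond to balanced multilinear functions. -/
noncomputable def liftAux : (n : ℕ) →
    {L : mlSub V N →ₗ[k] (tpow V n) →ₗ[k] N //
      ∀ F v (s : S) x, L (consF V F (op s • v)) x = L (consF V F v) (s • x)}
  | 0 => ⟨
    { toFun := fun F =>
        { toFun := fun x => op x.down • F.1 []
          map_add' := fun x y => by
            change op (x.down + y.down) • _ = _
            rw [MulOpposite.op_add, add_smul]
          map_smul' := fun c x => by
            change op (c • x.down) • _ = c • _
            rw [MulOpposite.op_smul, smul_assoc] }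
      map_add' := fun F G => LinearMap.ext fun x => smul_add _ _ _
      map_smul' := fun c F => LinearMap.ext fun x => smul_comm _ _ _ },
    fun F v s x => by
      change op x.down • F.1 [op s • v] = op (s * x.down) • F.1 [v]
      rw [op_mul, mul_smul]
      exact congrArg _ (F.2.right [] s v)⟩
  | n + 1 => ⟨liftSucc V (liftAux n).1 (liftAux n).2, liftSucc_bal V (liftAux n).1 (liftAux n).2⟩

/-- The right `S`-linear map `T_S(V) → N` with `v_1 ⊗ ⋯ ⊗ v_n ↦ F [v_1, …, v_n]`. -/
noncomputable def liftTS (F : List V → N) (hF : IsML V F) : TSc V →ₗ[k] N :=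
  DirectSum.toModule k ℕ N (fun n => (liftAux V n).1 ⟨F, hF⟩)

lemma liftTS_consT (F : List V → N) (hF : IsML V F) (v : V) (x : TSc V) :
    liftTS V F hF (consT V v x) = liftTS V (fun l => F (v :: l)) (hF.cons V v) x := by
  induction x using TSc.induction with
  | hm n x =>
    rw [consT_lof, liftTS, liftTS, DirectSum.toModule_lof, DirectSum.toModule_lof]; rfl
  | ha x y hx hy => rw [map_add, map_add, map_add, hx, hy]

lemma liftTS_smul_tp (F : List V → N) (hF : IsML V F) (l : List V) (s : S) :
    liftTS V F hF (op s • tp V l) = op s • F l := by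
  induction l generalizing F with
  | nil =>
    rw [tp, ← lof_smul, liftTS, DirectSum.toModule_lof]
    change op (1 * s) • F [] = op s • F []
    rw [one_mul]
  | cons v l ih => rw [tp, ← consT_smul, liftTS_consT, ih]

@[simp] lemma liftTS_tp (F : List V → N) (hF : IsML V F) (l : List V) :
    liftTS V F hF (tp V l) = F l := by
  simpa using liftTS_smul_tp V F hF l 1

lemma liftTS_rsmul (F : List V → N) (hF : IsML V F) (s : S) (x : TSc V) :
    liftTS V F hF (op s • x) = op s • liftTS V F hF x := by
  induction x using tp_induction with
  | ht l t => rw [smul_smul, ← op_mul, liftTS_smul_tp, liftTS_smul_tp, op_mul, mul_smul]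
  | ha x y hx hy => rw [smul_add, map_add, map_add, smul_add, hx, hy]

lemma tp_ext {f g : TSc V →ₗ[k] N} (hf : ∀ (s : S) x, f (op s • x) = op s • f x)
    (hg : ∀ (s : S) x, g (op s • x) = op s • g x) (h : ∀ l, f (tp V l) = g (tp V l)) : f = g := by
  refine LinearMap.ext fun x => ?_
  induction x using tp_induction with
  | ht l s => rw [hf, hg, h]
  | ha x y hx hy => rw [map_add, map_add, hx, hy]

lemma isML_tp : IsML V (tp V) where
  add p q a b := by
    induction p with
    | nil => simp [tp]
    | cons v p ih => simp only [List.cons_append, tp] at ih ⊢; rw [ih, map_add]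
  smul p q c a := by
    induction p with
    | nil => simp [tp]
    | cons v p ih => simp only [List.cons_append, tp] at ih ⊢; rw [ih, map_smul]
  bal p q s a b := by
    induction p with
    | nil => simp [tp, consT_bal, consT_lsmul]
    | cons v p ih => simp only [List.cons_append, tp] at ih ⊢; rw [ih]
  right p s a := by
    induction p with
    | nil =>
      simp only [List.nil_append, tp]
      rw [consT_bal, ← consT_smul, ← lof_smul, ← lof_lsmul]
      congr 2
      refine ULift.ext _ _ ?_
      change s * 1 = 1 * s
      simp
    | cons v p ih => simp only [List.cons_append, tp] at ih ⊢; rw [ih, consT_smul]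

/-- A list of homogeneous elements with given degrees. -/
def HomList (l : List V) (ds : List ℤ) : Prop := List.Forall₂ (fun a d => a ∈ V.gr d) l ds

lemma tp_mem {l : List V} {ds : List ℤ} (h : HomList V l ds) : tp V l ∈ (TS V).gr ds.sum := by
  induction h with
  | nil =>
    rw [tp]; exact lof_mem_TS V (j := 0) (by
      change _ ∈ (if (0 : ℤ) = 0 then (⊤ : Submodule k _) else ⊥)
      rw [if_pos rfl]; trivial)
  | @cons v d l ds hv _ ih =>
    rw [tp, List.sum_cons]
    have key : ∀ (j : ℤ) (x : TSc V), x ∈ (TS V).gr j → consT V v x ∈ (TS V).gr (d + j) := by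
      intro j x hx
      classical
      rw [← DirectSum.sum_support_of x, map_sum]
      refine sum_mem fun n _ => ?_
      rw [← DirectSum.lof_eq_of k, consT_lof]
      exact lof_mem_TS V (tm_mem_tgr V (tpow V n) hv (hx n))
    exact key _ _ ih

/-- The homogeneous components of `T_S(V)` are generated by the homogeneous pure tensors. -/
lemma TS_gr_le (j : ℤ) (P : Submodule k (TSc V)) (hP : ∀ (s : S) x, x ∈ P → op s • x ∈ P)
    (h : ∀ l ds, HomList V l ds → ds.sum = j → tp V l ∈ P) : (TS V).gr j ≤ P := by
  have key : ∀ (n : ℕ) (j : ℤ) (P : Submodule k (TSc V)),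
      (∀ (s : S) x, x ∈ P → op s • x ∈ P) →
      (∀ l ds, HomList V l ds → ds.sum = j → tp V l ∈ P) → ∀ x ∈ (tpow V n).gr j,
      DirectSum.lof k ℕ (fun n => (tpow V n).carrier) n x ∈ P := by
    intro n
    induction n with
    | zero =>
      intro j P hP h x hx
      change x ∈ (if j = 0 then (⊤ : Submodule k _) else ⊥) at hx
      split_ifs at hx with hj
      · have h1 := hP x.down _ (h [] [] List.Forall₂.nil (by simp [hj]))
        rw [tp, ← lof_smul] at h1
        convert h1 using 2
        refine ULift.ext _ _ ?_
        change x.down = 1 * x.down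
        rw [one_mul]
      · rw [(Submodule.mem_bot k).1 hx, map_zero]; exact zero_mem _
    | succ n ih =>
      intro j P hP h x hx
      induction hx using Submodule.span_induction with
      | mem x hx =>
        obtain ⟨a, b, v, u, hv, hu, hab, rfl⟩ := hx
        have h1 := ih b (P.comap (consT V v))
          (fun s x hx => by
            rw [Submodule.mem_comap, consT_smul]; exact hP s _ hx)
          (fun l ds hl hs => h (v :: l) (a :: ds) (List.Forall₂.cons hv hl)
            (by rw [List.sum_cons, hs, hab])) u hu
        rwa [Submodule.mem_comap, consT_lof] at h1
      | zero => rw [map_zero]; exact zero_mem _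
      | add x y _ _ hx hy => rw [map_add]; exact add_mem hx hy
      | smul c x _ hx => rw [map_smul]; exact Submodule.smul_mem _ c hx
  intro x hx
  classical
  rw [← DirectSum.sum_support_of x]
  refine sum_mem fun n _ => ?_
  rw [← DirectSum.lof_eq_of k]
  exact key n j P hP h _ (hx n)

end Multilinear

end GrBimod

section Bocs

/-- The map `e ⊗ id : C ⊗_S N → S ⊗_S N = N`, `c ⊗ n ↦ e(c) n`. -/
noncomputable def epsL {C N : Type*} [AddCommGroup C] [Module k C] [Module Sᵐᵒᵖ C]
    [AddCommGroup N] [Module k N] [Module S N] [IsScalarTower k S N] (e : C →ₗ[k] S)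
    (he : ∀ (s : S) c, e (op s • c) = e c * s) : BTen k S C N →ₗ[k] N :=
  BTen.lift (LinearMap.mk₂ k (fun c n => e c • n)
    (fun a b n => by rw [map_add, add_smul]) (fun c a n => by rw [map_smul, smul_assoc])
    (fun a m n => smul_add _ _ _) (fun c a n => smul_comm _ _ _))
    (fun c s n => by
      change e (op s • c) • n = e c • s • n
      rw [he, mul_smul])

@[simp] lemma epsL_tm {C N : Type*} [AddCommGroup C] [Module k C] [Module Sᵐᵒᵖ C]
    [AddCommGroup N] [Module k N] [Module S N] [IsScalarTower k S N] (e : C →ₗ[k] S)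
    (he : ∀ (s : S) c, e (op s • c) = e c * s) (c : C) (n : N) :
    epsL e he (BTen.tm k S c n) = e c • n := rfl

/-- The map `id ⊗ e : N ⊗_S C → N ⊗_S S = N`, `n ⊗ c ↦ n e(c)`. -/
noncomputable def epsR {C N : Type*} [AddCommGroup C] [Module k C] [Module S C]
    [AddCommGroup N] [Module k N] [Module Sᵐᵒᵖ N] [IsScalarTower k Sᵐᵒᵖ N] (e : C →ₗ[k] S)
    (he : ∀ (s : S) c, e (s • c) = s * e c) : BTen k S N C →ₗ[k] N :=
  BTen.lift (LinearMap.mk₂ k (fun n c => op (e c) • n)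
    (fun a m n => smul_add _ _ _) (fun c a n => smul_comm _ _ _)
    (fun a b n => by rw [map_add, MulOpposite.op_add, add_smul])
    (fun c a n => by rw [map_smul, MulOpposite.op_smul, smul_assoc]))
    (fun n s c => by
      change op (e c) • op s • n = op (e (s • c)) • n
      rw [he, op_mul, mul_smul])

@[simp] lemma epsR_tm {C N : Type*} [AddCommGroup C] [Module k C] [Module S C]
    [AddCommGroup N] [Module k N] [Module Sᵐᵒᵖ N] [IsScalarTower k Sᵐᵒᵖ N] (e : C →ₗ[k] S)
    (he : ∀ (s : S) c, e (s • c) = s * e c) (n : N) (c : C) :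
    epsR e he (BTen.tm k S n c) = op (e c) • n := rfl

variable (k S)

/-- A differential graded `S`-bocs: a graded `S`-bimodule `C` with a coassociative comultiplication
`mu` and a counit `eps`, which are bimodule maps of degree `0`, and a differential `delta`, which is
a bimodule map of degree `1`, a coderivation (where, by the Koszul sign rule,
`(id ⊗ delta)(c ⊗ c') = (-1)^{|c|} c ⊗ delta c'`), and satisfies `delta ∘ delta = 0`. -/
structure DGBocs where
  C : GrBimod.{uk, uS, uC} k S
  mu : C →ₗ[k] BTen k S C C
  mu_lsmul : ∀ (s : S) c, mu (s • c) = s • mu c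
  mu_rsmul : ∀ (s : S) c, mu (op s • c) = op s • mu c
  mu_mem : ∀ j, ∀ c ∈ C.gr j, mu c ∈ (C.tensor C).gr j
  eps : C →ₗ[k] S
  eps_lsmul : ∀ (s : S) c, eps (s • c) = s * eps c
  eps_rsmul : ∀ (s : S) c, eps (op s • c) = eps c * s
  eps_of_ne : ∀ j, ∀ c ∈ C.gr j, j ≠ 0 → eps c = 0
  coassoc : ∀ c, BTen.map mu LinearMap.id mu_rsmul (fun _ _ => rfl) (mu c) =
    BTen.assocInv k S (BTen.map LinearMap.id mu (fun _ _ => rfl) mu_lsmul (mu c))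
  counit_left : ∀ c, epsL eps eps_rsmul (mu c) = c
  counit_right : ∀ c, epsR eps eps_lsmul (mu c) = c
  delta : C →ₗ[k] C
  delta_lsmul : ∀ (s : S) c, delta (s • c) = s • delta c
  delta_rsmul : ∀ (s : S) c, delta (op s • c) = op s • delta c
  delta_mem : ∀ j, ∀ c ∈ C.gr j, delta c ∈ C.gr (j + 1)
  coder : ∀ c, mu (delta c) =
    BTen.map (C.tw 1) delta (C.tw_rsmul 1) delta_lsmul (mu c) +
      BTen.map delta LinearMap.id delta_rsmul (fun _ _ => rfl) (mu c)
  delta_delta : ∀ c, delta (delta c) = 0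

/-- A normal bocs: a differential graded bocs `C = S ⊕ ker eps`, where `S` is embedded in `C` as
`s ↦ s • one`, such that `mu one = one ⊗ one`. -/
structure NormalBocs extends DGBocs.{uk, uS, uC} k S where
  one : C
  one_mem : one ∈ C.gr 0
  smul_one : ∀ s : S, s • one = op s • one
  eps_one : eps one = 1
  mu_one : mu one = BTen.tm k S one one

end Bocs

namespace DGBocs

variable (B : DGBocs.{uk, uS, uC} k S)

/-- The morphisms (of all degrees) `M ⟶ N` of right `B`-modules: the morphisms of right
`S`-modules `M ⊗_S C → N`. -/
abbrev BMor (M : GrMod.{uk, uS, w} k S) (N : GrMod.{uk, uS, w'} k S) :=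
  BTen k S M B.C →ₗ[Sᵐᵒᵖ] N

variable {M : GrMod.{uk, uS, w} k S} {N : GrMod.{uk, uS, w} k S} {L : GrMod.{uk, uS, w} k S}
  {X : GrMod.{uk, uS, w} k S}

variable {B}

lemma bmor_ext {f g : B.BMor M N} (h : ∀ m c, f (BTen.tm k S m c) = g (BTen.tm k S m c)) :
    f = g := by
  refine LinearMap.ext fun x => ?_
  induction x using BTen.induction with
  | ht m n => exact h m n
  | ha x y hx hy => rw [map_add, map_add, hx, hy]

/-- A right linear map on `M ⊗_S C` from a `k`-linear one. -/
noncomputable def mkMor (f : BTen k S M B.C →ₗ[k] N) (h : ∀ (s : S) m c,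
    f (BTen.tm k S m (op s • c)) = op s • f (BTen.tm k S m c)) : B.BMor M N where
  toFun := f
  map_add' := f.map_add
  map_smul' a x := by
    induction x using BTen.induction with
    | ht m c => exact h a.unop m c
    | ha x y hx hy => rw [smul_add, map_add, hx, hy, map_add, smul_add]

/-- The map `f(m ⊗ -) : C → N`. -/
noncomputable def at_ (f : B.BMor M N) (m : M) : B.C →ₗ[k] N :=
  f.restrictScalars k ∘ₗ BTen.mk k S m

@[simp] lemma at_apply (f : B.BMor M N) (m : M) (c : B.C) : at_ f m c = f (BTen.tm k S m c) := rfl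

lemma at_rsmul (f : B.BMor M N) (m : M) (s : S) (c : B.C) :
    at_ f m (op s • c) = op s • at_ f m c := f.map_smul (op s) (BTen.tm k S m c)

lemma assocInv_eq (m : M) (y : BTen k S B.C B.C) : BTen.assocInv k S (BTen.tm k S m y) =
    BTen.map (BTen.mk k S m) LinearMap.id (fun _ _ => rfl) (fun _ _ => rfl) y := by
  induction y using BTen.induction with
  | ht c c' => rfl
  | ha x y hx hy => rw [BTen.tm_add, map_add, map_add, hx, hy]

lemma map_at (f : B.BMor M N) (m : M) (y : BTen k S B.C B.C) :
    BTen.map (f.restrictScalars k) LinearMap.id (fun s x => f.map_smul (op s) x) (fun _ _ => rfl)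
      (BTen.assocInv k S (BTen.tm k S m y)) =
      BTen.map (at_ f m) LinearMap.id (at_rsmul f m) (fun _ _ => rfl) y := by
  rw [assocInv_eq]
  induction y using BTen.induction with
  | ht c c' => rfl
  | ha x y hx hy => rw [map_add, map_add, map_add, hx, hy]

lemma map_at_rsmul (f : B.BMor M N) (m : M) (s : S) (y : BTen k S B.C B.C) :
    BTen.map (at_ f m) LinearMap.id (at_rsmul f m) (fun _ _ => rfl) (op s • y) =
      op s • BTen.map (at_ f m) LinearMap.id (at_rsmul f m) (fun _ _ => rfl) y := by
  induction y using BTen.induction with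
  | ht c c' => rfl
  | ha x y hx hy => rw [smul_add, map_add, map_add, hx, hy, smul_add]

/-- The composition `g * f = g ∘ (f ⊗ id_C) ∘ (id_M ⊗ mu)`. -/
noncomputable def comp (g : B.BMor N L) (f : B.BMor M N) : B.BMor M L :=
  mkMor (g.restrictScalars k ∘ₗ
    BTen.map (f.restrictScalars k) LinearMap.id (fun s x => f.map_smul (op s) x) (fun _ _ => rfl) ∘ₗ
    BTen.assocInv k S ∘ₗ BTen.map LinearMap.id B.mu (fun _ _ => rfl) B.mu_lsmul) (by
  intro s m c
  refine (congrArg g (map_at f m (B.mu (op s • c)))).trans ?_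
  rw [B.mu_rsmul, map_at_rsmul, g.map_smul]
  exact congrArg (fun z => op s • g z) (map_at f m (B.mu c)).symm)

lemma comp_tm (g : B.BMor N L) (f : B.BMor M N) (m : M) (c : B.C) :
    comp g f (BTen.tm k S m c) =
      g (BTen.map (at_ f m) LinearMap.id (at_rsmul f m) (fun _ _ => rfl) (B.mu c)) :=
  congrArg g (map_at f m (B.mu c))

/-- The identity morphism `m ⊗ c ↦ m eps(c)`. -/
noncomputable def id_ (M : GrMod.{uk, uS, w} k S) : B.BMor M M :=
  mkMor (epsR B.eps B.eps_lsmul) (fun s m c => by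
    rw [epsR_tm, epsR_tm, B.eps_rsmul, op_mul, mul_smul])

/-- The operation `f ↦ f ∘ (id_M ⊗ delta)`. -/
noncomputable def dd (f : B.BMor M N) : B.BMor M N :=
  mkMor (f.restrictScalars k ∘ₗ BTen.map (M.tw 1) B.delta (M.tw_rsmul 1) B.delta_lsmul) (by
    intro s m c
    change f (BTen.tm k S _ (B.delta (op s • c))) = op s • f (BTen.tm k S _ _)
    rw [B.delta_rsmul, ← BTen.rsmul_tm, f.map_smul])

lemma dd_tm (f : B.BMor M N) (m : M) (c : B.C) :
    dd f (BTen.tm k S m c) = f (BTen.tm k S (M.tw 1 m) (B.delta c)) := rfl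

variable (B) in
/-- The morphisms of right `B`-modules that are homogeneous of degree `d`. -/
def BHom (d : ℤ) (M : GrMod.{uk, uS, w} k S) (N : GrMod.{uk, uS, w} k S) :
    Submodule k (B.BMor M N) where
  carrier := {f | ∀ i j (m : M) (c : B.C), m ∈ M.gr i → c ∈ B.C.gr j →
    f (BTen.tm k S m c) ∈ N.gr (i + j + d)}
  add_mem' hf hg i j m c hm hc := add_mem (hf i j m c hm hc) (hg i j m c hm hc)
  zero_mem' _ _ _ _ _ _ := zero_mem _
  smul_mem' a _ hf i j m c hm hc := Submodule.smul_mem _ a (hf i j m c hm hc)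

/-- The differential `f ↦ (-1)^{d + 1} f ∘ (id_M ⊗ delta)` on the morphisms of degree `d`. -/
noncomputable def dhat (d : ℤ) (f : B.BMor M N) : B.BMor M N := sgn (d + 1) • dd f

lemma comp_assoc (h : B.BMor L X) (g : B.BMor N L) (f : B.BMor M N) :
    comp (comp h g) f = comp h (comp g f) := by
  refine bmor_ext fun m c => ?_
  rw [comp_tm, comp_tm]
  -- the common value is obtained from `((id ⊗ mu) mu c)` and `((mu ⊗ id) mu c)`
  let A : BTen k S B.C B.C →ₗ[k] L := g.restrictScalars k ∘ₗ
    BTen.map (at_ f m) LinearMap.id (at_rsmul f m) (fun _ _ => rfl)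
  have hA : ∀ (s : S) y, A (op s • y) = op s • A y := fun s y => by
    change g _ = op s • g _
    rw [map_at_rsmul, g.map_smul]
  let Φ : BTen k S (BTen k S B.C B.C) B.C →ₗ[k] X := h.restrictScalars k ∘ₗ
    BTen.map A LinearMap.id hA (fun _ _ => rfl)
  have h1 : ∀ y, comp h g (BTen.map (at_ f m) LinearMap.id (at_rsmul f m) (fun _ _ => rfl) y) =
      Φ (BTen.assocInv k S (BTen.map LinearMap.id B.mu (fun _ _ => rfl) B.mu_lsmul y)) := by
    intro y
    induction y using BTen.induction with
    | ht a b =>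
      change comp h g (BTen.tm k S (f (BTen.tm k S m a)) b) =
        Φ (BTen.assocInv k S (BTen.tm k S a (B.mu b)))
      rw [comp_tm]
      generalize B.mu b = z
      induction z using BTen.induction with
      | ht c c' => rfl
      | ha x y hx hy => simp only [map_add, BTen.tm_add, hx, hy]
    | ha x y hx hy => simp only [map_add, hx, hy]
  have h2 : ∀ y, h (BTen.map (at_ (comp g f) m) LinearMap.id (at_rsmul _ m) (fun _ _ => rfl) y) =
      Φ (BTen.map B.mu LinearMap.id B.mu_rsmul (fun _ _ => rfl) y) := by
    intro y
    induction y using BTen.induction with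
    | ht a b =>
      change h (BTen.tm k S (comp g f (BTen.tm k S m a)) b) = h (BTen.tm k S (A (B.mu a)) b)
      rw [comp_tm]; rfl
    | ha x y hx hy => simp only [map_add, hx, hy]
  rw [h1, h2, B.coassoc]

lemma comp_id (f : B.BMor M N) : comp f (id_ M) = f := by
  refine bmor_ext fun m c => ?_
  rw [comp_tm]
  conv_rhs => rw [← B.counit_left c]
  generalize B.mu c = y
  induction y using BTen.induction with
  | ht a b =>
    change f (BTen.tm k S (op (B.eps a) • m) b) = f (BTen.tm k S m (B.eps a • b))
    rw [BTen.tm_bal]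
  | ha x y hx hy => simp only [map_add, BTen.tm_add, hx, hy]

lemma id_comp (f : B.BMor M N) : comp (id_ N) f = f := by
  refine bmor_ext fun m c => ?_
  rw [comp_tm]
  conv_rhs => rw [← B.counit_right c]
  generalize B.mu c = y
  induction y using BTen.induction with
  | ht a b =>
    change op (B.eps b) • f (BTen.tm k S m a) = f (BTen.tm k S m (op (B.eps b) • a))
    rw [← BTen.rsmul_tm, f.map_smul]
  | ha x y hx hy => simp only [map_add, BTen.tm_add, hx, hy]

lemma comp_add (g : B.BMor N L) (f f' : B.BMor M N) : comp g (f + f') = comp g f + comp g f' := by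
  refine bmor_ext fun m c => ?_
  rw [LinearMap.add_apply, comp_tm, comp_tm, comp_tm, ← map_add]
  congr 1
  generalize B.mu c = y
  induction y using BTen.induction with
  | ht a b => exact BTen.add_tm _ _ _ _ _
  | ha x y hx hy => simp only [map_add, hx, hy]; abel

lemma add_comp (g g' : B.BMor N L) (f : B.BMor M N) : comp (g + g') f = comp g f + comp g' f :=
  bmor_ext fun m c => by rw [LinearMap.add_apply, comp_tm, comp_tm, comp_tm]; rfl

lemma comp_smul (a : k) (g : B.BMor N L) (f : B.BMor M N) : comp g (a • f) = a • comp g f := by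
  refine bmor_ext fun m c => ?_
  rw [LinearMap.smul_apply, comp_tm, comp_tm]
  generalize B.mu c = y
  induction y using BTen.induction with
  | ht u v =>
    change g (BTen.tm k S (a • f _) v) = a • g (BTen.tm k S (f _) v)
    rw [BTen.smul_tm]; exact (g.restrictScalars k).map_smul a _
  | ha x y hx hy => simp only [map_add, smul_add, hx, hy]

lemma smul_comp (a : k) (g : B.BMor N L) (f : B.BMor M N) : comp (a • g) f = a • comp g f :=
  bmor_ext fun m c => by rw [LinearMap.smul_apply, comp_tm, comp_tm]; rfl

lemma comp_zsmul (a : ℤ) (g : B.BMor N L) (f : B.BMor M N) : comp g (a • f) = a • comp g f :=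
  (AddMonoidHom.mk' (fun f => comp g f) (comp_add g)).map_zsmul a f

lemma zsmul_comp (a : ℤ) (g : B.BMor N L) (f : B.BMor M N) : comp (a • g) f = a • comp g f :=
  (AddMonoidHom.mk' (fun g => comp g f) (fun g g' => add_comp g g' f)).map_zsmul a g

lemma comp_neg (g : B.BMor N L) (f : B.BMor M N) : comp g (-f) = - comp g f :=
  (AddMonoidHom.mk' (fun f => comp g f) (comp_add g)).map_neg f

lemma neg_comp (g : B.BMor N L) (f : B.BMor M N) : comp (-g) f = - comp g f :=
  (AddMonoidHom.mk' (fun g => comp g f) (fun g g' => add_comp g g' f)).map_neg g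

lemma comp_sub (g : B.BMor N L) (f f' : B.BMor M N) : comp g (f - f') = comp g f - comp g f' :=
  (AddMonoidHom.mk' (fun f => comp g f) (comp_add g)).map_sub f f'

lemma sub_comp (g g' : B.BMor N L) (f : B.BMor M N) : comp (g - g') f = comp g f - comp g' f :=
  (AddMonoidHom.mk' (fun g => comp g f) (fun g g' => add_comp g g' f)).map_sub g g'

lemma dd_neg (f : B.BMor M N) : dd (-f) = - dd f := rfl

lemma dd_add (f g : B.BMor M N) : dd (f + g) = dd f + dd g := rfl

lemma dd_smul (a : k) (f : B.BMor M N) : dd (a • f) = a • dd f := rfl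

lemma BHom.tw {d : ℤ} {f : B.BMor M N} (hf : f ∈ B.BHom d M N) (n : ℤ) (m : M) (c : B.C) :
    f (BTen.tm k S (M.tw n m) (B.C.tw n c)) = sgn (n * d) • N.tw n (f (BTen.tm k S m c)) := by
  induction m using M.induction_homog with
  | hm i m hm =>
    induction c using B.C.toGrMod.induction_homog with
    | hm j c hc =>
      rw [M.tw_of_mem n hm, B.C.tw_of_mem n hc, N.tw_of_mem n (hf i j m c hm hc), BTen.tm_zsmul,
        BTen.zsmul_tm, map_zsmul, map_zsmul, smul_smul, smul_smul, ← sgn_add, ← sgn_add]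
      congr 1
      exact sgn_eq_of_even ⟨-(n * d), by ring⟩
    | ha x y hx hy => simp only [map_add, BTen.tm_add, hx, hy, smul_add]
  | ha x y hx hy => simp only [map_add, BTen.add_tm, hx, hy, smul_add]

/-- The Leibniz rule, up to the signs in the definition of the differential. -/
lemma dd_comp (g : B.BMor N L) {d : ℤ} {f : B.BMor M N} (hf : f ∈ B.BHom d M N) :
    dd (comp g f) = comp g (dd f) + sgn d • comp (dd g) f := by
  refine bmor_ext fun m c => ?_
  rw [dd_tm, comp_tm, B.coder, LinearMap.add_apply, LinearMap.smul_apply, comp_tm, comp_tm]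
  generalize B.mu c = y
  induction y using BTen.induction with
  | ht a b =>
    simp only [map_add, BTen.map_tm, LinearMap.id_apply, at_apply, dd_tm]
    rw [BHom.tw hf, BTen.zsmul_tm, map_zsmul, one_mul, add_comm]
  | ha x y hx hy =>
    simp only [map_add, smul_add] at hx hy ⊢
    rw [add_add_add_comm, hx, hy]; abel

lemma dhat_comp {e d : ℤ} (g : B.BMor N L) {f : B.BMor M N} (hf : f ∈ B.BHom d M N) :
    dhat (e + d) (comp g f) = comp (dhat e g) f + sgn e • comp g (dhat d f) := by
  simp only [dhat, dd_comp g hf, comp_zsmul, zsmul_comp, smul_add, smul_smul, ← sgn_add]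
  rw [add_comm]
  congr 2 <;> exact sgn_eq_of_even (by first | exact ⟨d, by ring1⟩ | exact ⟨0, by ring1⟩)

lemma eps_delta (B : DGBocs.{uk, uS, uC} k S) (c : B.C) : B.eps (B.delta c) = 0 := by
  have e1 : ∀ n x, B.eps (B.C.tw n x) = B.eps x := by
    intro n x
    induction x using B.C.toGrMod.induction_homog with
    | hm j x hx =>
      rw [B.C.tw_of_mem n hx, map_zsmul]
      by_cases hj : j = 0
      · subst hj; simp
      · rw [B.eps_of_ne j x hx hj, smul_zero]
    | ha x y hx hy => simp only [map_add, hx, hy]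
  have h := congrArg (epsR B.eps B.eps_lsmul) (B.coder c)
  rw [B.counit_right, map_add] at h
  have h2 : epsR B.eps B.eps_lsmul
      (BTen.map B.delta LinearMap.id B.delta_rsmul (fun _ _ => rfl) (B.mu c)) = B.delta c := by
    conv_rhs => rw [← B.counit_right c]
    generalize B.mu c = y
    induction y using BTen.induction with
    | ht a b => simp [B.delta_rsmul]
    | ha x y hx hy => simp only [map_add, hx, hy]
  rw [h2, eq_comm, add_eq_right] at h
  have h3 := congrArg B.eps h
  rw [map_zero] at h3
  rw [← h3]
  conv_lhs => rw [← B.counit_left c]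
  generalize B.mu c = y
  induction y using BTen.induction with
  | ht a b => simp [B.delta_lsmul, B.eps_lsmul, B.eps_rsmul, e1]
  | ha x y hx hy => simp only [map_add, hx, hy]

lemma dd_id : dd (B := B) (id_ M) = 0 := by
  refine bmor_ext fun m c => ?_
  rw [dd_tm]
  change op (B.eps (B.delta c)) • M.tw 1 m = 0
  rw [eps_delta]; simp

lemma BHom.id_mem : id_ M ∈ B.BHom 0 M M := by
  intro i j m c hm hc
  change op (B.eps c) • m ∈ _
  by_cases hj : j = 0
  · subst hj; simpa using M.rsmul_mem i _ m hm
  · rw [B.eps_of_ne j c hc hj, MulOpposite.op_zero, zero_smul]; exact zero_mem _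

lemma BHom.comp_mem {e d : ℤ} {g : B.BMor N L} {f : B.BMor M N} (hg : g ∈ B.BHom e N L)
    (hf : f ∈ B.BHom d M N) : comp g f ∈ B.BHom (e + d) M L := by
  intro i j m c hm hc
  rw [comp_tm]
  have := B.mu_mem j c hc
  generalize B.mu c = y at this
  induction this using Submodule.span_induction with
  | mem x h =>
    obtain ⟨a, b, u, v, hu, hv, rfl, rfl⟩ := h
    have := hg _ _ _ _ (hf i a m u hm hu) hv
    rw [show i + (a + b) + (e + d) = i + a + d + b + e by ring]
    exact this
  | zero => simp
  | add x y _ _ hx hy => rw [map_add, map_add]; exact add_mem hx hy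
  | smul c x _ hx =>
    rw [map_smul]
    have : g (c • BTen.map (at_ f m) LinearMap.id (at_rsmul f m) (fun _ _ => rfl) x) = c • g _ :=
      (g.restrictScalars k).map_smul c _
    rw [this]; exact Submodule.smul_mem _ c hx

end DGBocs

namespace DGBocs

variable {B : DGBocs.{uk, uS, uC} k S}
variable {M M' M'' N N' N'' L : GrMod.{uk, uS, w} k S}

/-- The diagonal morphism `a ⊕ b : M ⊕ M' → N ⊕ N'`. -/
noncomputable def diag (a : B.BMor M N) (b : B.BMor M' N') : B.BMor (M.prod M') (N.prod N') :=
  mkMor (LinearMap.prod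
    (a.restrictScalars k ∘ₗ BTen.map (LinearMap.fst k M M') LinearMap.id
      (fun _ _ => rfl) (fun _ _ => rfl))
    (b.restrictScalars k ∘ₗ BTen.map (LinearMap.snd k M M') LinearMap.id
      (fun _ _ => rfl) (fun _ _ => rfl)))
    (fun s m c => Prod.ext (a.map_smul (op s) (BTen.tm k S m.1 c))
      (b.map_smul (op s) (BTen.tm k S m.2 c)))

lemma diag_tm (a : B.BMor M N) (b : B.BMor M' N') (m : M.prod M') (c : B.C) :
    diag a b (BTen.tm k S m c) = (a (BTen.tm k S m.1 c), b (BTen.tm k S m.2 c)) := rfl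

/-- The morphism `M ⊕ M' → N ⊕ N'` with the only component `t : M' → N`. -/
noncomputable def corner (t : B.BMor M' N) : B.BMor (M.prod M') (N.prod N') :=
  mkMor (LinearMap.prod
    (t.restrictScalars k ∘ₗ BTen.map (LinearMap.snd k M M') LinearMap.id
      (fun _ _ => rfl) (fun _ _ => rfl)) 0)
    (fun s m c => Prod.ext (t.map_smul (op s) (BTen.tm k S m.2 c)) (smul_zero _).symm)

lemma corner_tm (t : B.BMor M' N) (m : M.prod M') (c : B.C) :
    (corner t : B.BMor (M.prod M') (N.prod N')) (BTen.tm k S m c) =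
      (t (BTen.tm k S m.2 c), 0) := rfl

lemma comp_diag_diag (a : B.BMor N L) (b : B.BMor N' N'') (a' : B.BMor M N) (b' : B.BMor M' N') :
    comp (diag a b) (diag a' b') = diag (comp a a') (comp b b') := by
  refine bmor_ext fun m c => ?_
  rw [comp_tm, diag_tm, comp_tm, comp_tm]
  generalize B.mu c = y
  induction y using BTen.induction with
  | ht u v => rfl
  | ha x y hx hy => rw [map_add, map_add, hx, hy]; simp only [map_add]; rfl

lemma comp_diag_corner (a : B.BMor N L) (b : B.BMor N' N'') (t : B.BMor M' N) :
    comp (diag a b) (corner t : B.BMor (M.prod M') (N.prod N')) = corner (comp a t) := by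
  refine bmor_ext fun m c => ?_
  rw [comp_tm, corner_tm, comp_tm]
  generalize B.mu c = y
  induction y using BTen.induction with
  | ht u v =>
    refine Prod.ext rfl ?_
    change b (BTen.tm k S 0 v) = 0
    rw [BTen.zero_tm, map_zero]
  | ha x y hx hy => rw [map_add, map_add, hx, hy]; simp only [map_add, Prod.mk_add_mk, add_zero]

lemma comp_corner_diag (t : B.BMor N' L) (a : B.BMor M N) (b : B.BMor M' N') :
    comp (corner t : B.BMor (N.prod N') (L.prod N'')) (diag a b) = corner (comp t b) := by
  refine bmor_ext fun m c => ?_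
  rw [comp_tm, corner_tm, comp_tm]
  generalize B.mu c = y
  induction y using BTen.induction with
  | ht u v => rfl
  | ha x y hx hy => rw [map_add, map_add, hx, hy]; simp only [map_add, Prod.mk_add_mk, add_zero]

lemma comp_corner_corner (t : B.BMor N' L) (s : B.BMor M' N) :
    comp (corner t : B.BMor (N.prod N') (L.prod N''))
      (corner s : B.BMor (M.prod M') (N.prod N')) = 0 := by
  refine bmor_ext fun m c => ?_
  rw [comp_tm]
  generalize B.mu c = y
  induction y using BTen.induction with
  | ht u v =>
    refine Prod.ext ?_ rfl
    change t (BTen.tm k S 0 v) = 0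
    rw [BTen.zero_tm, map_zero]
  | ha x y hx hy => rw [map_add, map_add, hx, hy, LinearMap.zero_apply, add_zero]

lemma dd_diag (a : B.BMor M N) (b : B.BMor M' N') : dd (diag a b) = diag (dd a) (dd b) :=
  bmor_ext fun m c => by
    rw [dd_tm, GrMod.prod_tw]; rfl

lemma dd_corner (t : B.BMor M' N) :
    dd (corner t : B.BMor (M.prod M') (N.prod N')) = corner (dd t) :=
  bmor_ext fun m c => by
    rw [dd_tm, GrMod.prod_tw]; rfl

/-- A morphism `f : M → N` of degree `d`, considered as the morphism
`f[1] = σ * f * σ⁻¹ : M[1] → N[1]` of degree `d`. -/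
abbrev bshift (f : B.BMor M N) : B.BMor M.shift N.shift := f

lemma dd_bshift (f : B.BMor M N) : dd (bshift f) = - bshift (dd f) :=
  bmor_ext fun m c => by
    rw [dd_tm, GrMod.shift_tw, sgn_one, neg_one_smul]
    have h : BTen.tm k S (- M.tw 1 m) (B.delta c) = - BTen.tm k S (M.tw 1 m) (B.delta c) := by
      rw [BTen.tm, map_neg]; rfl
    exact (congrArg f h).trans (f.map_neg _)

lemma bshift_mem {d : ℤ} {f : B.BMor M N} (hf : f ∈ B.BHom d M N) :
    bshift f ∈ B.BHom d M.shift N.shift := by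
  intro i j m c hm hc
  have := hf (i + 1) j m c hm hc
  change _ ∈ N.gr (i + j + d + 1)
  rwa [show i + j + d + 1 = i + 1 + j + d by ring]

/-- The morphism `σ_M⁻¹ : M[1] → M` of degree `1`, `m ⊗ c ↦ m eps(c)`. -/
noncomputable abbrev bsigmaInv (M : GrMod.{uk, uS, w} k S) : B.BMor M.shift M := id_ M

lemma diag_mem {d : ℤ} {a : B.BMor M N} {b : B.BMor M' N'} (ha : a ∈ B.BHom d M N)
    (hb : b ∈ B.BHom d M' N') : diag a b ∈ B.BHom d (M.prod M') (N.prod N') :=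
  fun i j m c hm hc => ⟨ha i j m.1 c hm.1 hc, hb i j m.2 c hm.2 hc⟩

lemma corner_mem {d : ℤ} {t : B.BMor M' N} (ht : t ∈ B.BHom d M' N) :
    corner t ∈ B.BHom d (M.prod M') (N.prod N') :=
  fun i j m c hm hc => ⟨ht i j m.2 c hm.2 hc, zero_mem _⟩

lemma bsigmaInv_mem : bsigmaInv M ∈ B.BHom 1 M.shift M := by
  intro i j m c hm hc
  have := BHom.id_mem (B := B) (M := M) (i + 1) j m c hm hc
  rwa [show i + j + 1 = i + 1 + j + 0 by ring]

variable (B) in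
/-- A twisted (right) `B`-module `(M, u)`. -/
structure TwMod where
  M : GrMod.{uk, uS, w} k S
  u : B.BMor M M
  u_mem : u ∈ B.BHom 1 M M
  mc : dhat 1 u + comp u u = 0

/-- The homogeneous morphisms of twisted `B`-modules of degree `d`. -/
def THom (d : ℤ) (X Y : B.TwMod) : Submodule k (B.BMor X.M Y.M) where
  carrier := {f | f ∈ B.BHom d X.M Y.M ∧ dhat d f + comp Y.u f - sgn d • comp f X.u = 0}
  add_mem' := by
    rintro f g ⟨hf, hf'⟩ ⟨hg, hg'⟩
    refine ⟨add_mem hf hg, ?_⟩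
    have := congrArg₂ (· + ·) hf' hg'
    simp only [add_zero] at this
    rw [← this, dhat, dhat, dhat, dd_add, comp_add, add_comp, smul_add, smul_add]
    abel
  zero_mem' := ⟨zero_mem _, by
    have h1 := comp_smul (0 : k) Y.u (0 : B.BMor X.M Y.M)
    have h2 := smul_comp (0 : k) (0 : B.BMor X.M Y.M) X.u
    have h3 := dd_smul (0 : k) (0 : B.BMor X.M Y.M)
    simp only [zero_smul] at h1 h2 h3
    rw [dhat, h1, h2, h3]; simp⟩
  smul_mem' := by
    rintro a f ⟨hf, hf'⟩
    refine ⟨Submodule.smul_mem _ a hf, ?_⟩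
    rw [dhat, dd_smul, comp_smul, smul_comp, smul_comm, smul_comm (sgn d) a, ← smul_add,
      ← smul_sub, ← dhat, hf', smul_zero]

lemma THom.id_mem (X : B.TwMod) : id_ X.M ∈ THom 0 X X :=
  ⟨BHom.id_mem, by rw [dhat, dd_id, comp_id, id_comp]; simp⟩

lemma THom.comp_mem {e d : ℤ} {X Y Z : B.TwMod} {g : B.BMor Y.M Z.M} {f : B.BMor X.M Y.M}
    (hg : g ∈ THom e Y Z) (hf : f ∈ THom d X Y) : comp g f ∈ THom (e + d) X Z := by
  refine ⟨BHom.comp_mem hg.1 hf.1, ?_⟩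
  have h1 : dhat e g = sgn e • comp g Y.u - comp Z.u g := by
    have := hg.2
    rw [sub_eq_zero] at this
    exact eq_sub_of_add_eq this
  have h2 : dhat d f = sgn d • comp f X.u - comp Y.u f := by
    have := hf.2
    rw [sub_eq_zero] at this
    exact eq_sub_of_add_eq this
  rw [dhat_comp g hf.1, h1, h2, comp_sub, sub_comp, zsmul_comp, comp_zsmul, smul_sub, smul_smul, sgn_add,
    comp_assoc, comp_assoc, comp_assoc]
  abel

/-- The category `TGMod⁰-B` of twisted `B`-modules, with the morphisms of degree `0`. -/
noncomputable instance : Category B.TwMod where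
  Hom X Y := THom 0 X Y
  id X := ⟨id_ X.M, THom.id_mem X⟩
  comp f g := ⟨comp g.1 f.1, by simpa using THom.comp_mem g.2 f.2⟩
  id_comp f := Subtype.ext (comp_id f.1)
  comp_id f := Subtype.ext (id_comp f.1)
  assoc f g h := Subtype.ext (comp_assoc h.1 g.1 f.1).symm

noncomputable instance : Preadditive B.TwMod where
  homGroup X Y := inferInstanceAs (AddCommGroup (THom 0 X Y))
  add_comp _ _ _ f f' g := Subtype.ext (comp_add g.1 f.1 f'.1)
  comp_add _ _ _ f g g' := Subtype.ext (add_comp g.1 g'.1 f.1)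

noncomputable instance : Linear k B.TwMod where
  homModule X Y := inferInstanceAs (Module k (THom 0 X Y))
  smul_comp _ _ _ a f g := Subtype.ext (comp_smul a g.1 f.1)
  comp_smul _ _ _ f a g := Subtype.ext (smul_comp a g.1 f.1)

/-- The translate `(M[1], -u[1])` of a twisted module. -/
noncomputable def tshift (X : B.TwMod) : B.TwMod where
  M := X.M.shift
  u := - bshift X.u
  u_mem := neg_mem (bshift_mem X.u_mem)
  mc := by
    have h := X.mc
    have h1 : comp (-bshift X.u) (-bshift X.u) = comp X.u X.u := by
      rw [comp_neg, neg_comp, neg_neg]; rfl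
    have h2 : dd (-bshift X.u) = bshift (dd X.u) := by
      rw [dd_neg, dd_bshift, neg_neg]
    rw [dhat, h1, h2]
    exact h

lemma tshift_mem {d : ℤ} {X Y : B.TwMod} {f : B.BMor X.M Y.M} (hf : f ∈ THom d X Y) :
    bshift f ∈ THom d (tshift X) (tshift Y) := by
  refine ⟨bshift_mem hf.1, ?_⟩
  have h : dhat d (bshift f) + comp (-bshift Y.u) (bshift f) -
      sgn d • comp (bshift f) (-bshift X.u) = 0 := by
    rw [dhat, dd_bshift, comp_neg, neg_comp, smul_neg, smul_neg]
    have := congrArg Neg.neg hf.2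
    rw [neg_zero] at this
    rw [← this, dhat]
    change -(_ • dd f) + -(comp Y.u f) - -(sgn d • comp f X.u) = _
    abel
  exact h

/-- The object `J(M, u) = (M ⊕ M[1], (u, σ⁻¹; 0, -u[1]))`. -/
noncomputable def tJ (X : B.TwMod) : B.TwMod where
  M := X.M.prod X.M.shift
  u := diag X.u (- bshift X.u) + corner (bsigmaInv X.M)
  u_mem := add_mem (diag_mem X.u_mem (neg_mem (bshift_mem X.u_mem))) (corner_mem bsigmaInv_mem)
  mc := by
    have h2 := (tshift X).mc
    have h1 := X.mc
    have h3 : dd (B := B) (bsigmaInv X.M) = 0 := by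
      have := dd_bshift (B := B) (id_ X.M)
      rw [dd_id] at this
      exact this.trans neg_zero
    have a2 : comp (bsigmaInv X.M) (bshift X.u) = X.u := id_comp X.u
    have a3 : comp X.u (bsigmaInv X.M) = X.u := comp_id X.u
    have e : dhat 1 (diag X.u (-bshift X.u)) +
        comp (diag X.u (-bshift X.u)) (diag X.u (-bshift X.u)) = 0 := by
      rw [dhat, dd_diag, comp_diag_diag]
      refine bmor_ext fun m c => Prod.ext ?_ ?_
      · exact congrArg (fun f : B.BMor X.M X.M => f (BTen.tm k S m.1 c)) h1
      · exact congrArg (fun f : B.BMor X.M.shift X.M.shift => f (BTen.tm k S m.2 c)) h2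
    have e2 : (corner (comp X.u (bsigmaInv X.M)) + corner (comp (bsigmaInv X.M) (- bshift X.u)) :
        B.BMor (X.M.prod X.M.shift) (X.M.prod X.M.shift)) = 0 := by
      rw [comp_neg, a2, a3]
      refine bmor_ext fun m c => Prod.ext ?_ ?_
      · exact add_neg_cancel _
      · exact add_zero _
    have e3 : dd (corner (bsigmaInv X.M) : B.BMor (X.M.prod X.M.shift) (X.M.prod X.M.shift)) =
        0 := by
      rw [dd_corner, h3]; rfl
    rw [comp_add, add_comp, add_comp, comp_diag_corner, comp_corner_diag, comp_corner_corner,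
      add_zero, dhat, dd_add, e3, add_zero, ← dhat]
    rw [add_assoc, add_comm (corner _) (corner _), e2, add_zero, e]

/-- The action of `J` on a morphism `f` of degree `d`: `J(f) = (f, 0; 0, (-1)^d f[1])`. -/
noncomputable def tJmor (d : ℤ) (f : B.BMor M N) : B.BMor (M.prod M.shift) (N.prod N.shift) :=
  diag f (sgn d • bshift f)

lemma tJ_mem {d : ℤ} {X Y : B.TwMod} {f : B.BMor X.M Y.M} (hf : f ∈ THom d X Y) :
    tJmor d f ∈ THom d (tJ X) (tJ Y) := by
  have hs := (AddSubgroup.zsmul_mem (THom d (tshift X) (tshift Y)).toAddSubgroup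
    (tshift_mem hf) (sgn d))
  refine ⟨diag_mem hf.1 hs.1, ?_⟩
  have h1 := hf.2
  have h2 := hs.2
  have a2 : comp (bsigmaInv Y.M) (bshift f) = f := id_comp f
  have a3 : comp f (bsigmaInv X.M) = f := comp_id f
  have e : dhat d (tJmor d f) + comp (diag Y.u (-bshift Y.u)) (tJmor d f) -
      sgn d • comp (tJmor d f) (diag X.u (-bshift X.u)) = 0 := by
    rw [tJmor, dhat, dd_diag, comp_diag_diag, comp_diag_diag]
    refine bmor_ext fun m c => Prod.ext ?_ ?_
    · exact congrArg (fun f : B.BMor X.M Y.M => f (BTen.tm k S m.1 c)) h1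
    · exact congrArg (fun f : B.BMor X.M.shift Y.M.shift => f (BTen.tm k S m.2 c)) h2
  have e2 : comp (corner (bsigmaInv Y.M)) (tJmor d f) =
      sgn d • comp (tJmor d f) (corner (bsigmaInv X.M) :
        B.BMor (X.M.prod X.M.shift) (X.M.prod X.M.shift)) := by
    rw [tJmor, comp_corner_diag, comp_diag_corner, comp_zsmul, a2, a3]
    refine bmor_ext fun m c => Prod.ext rfl ?_
    exact (smul_zero (sgn d)).symm
  have key : dhat d (tJmor d f) + comp (diag Y.u (-bshift Y.u) + corner (bsigmaInv Y.M) :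
      B.BMor (Y.M.prod Y.M.shift) (Y.M.prod Y.M.shift)) (tJmor d f) - sgn d • comp (tJmor d f)
        (diag X.u (-bshift X.u) + corner (bsigmaInv X.M) :
          B.BMor (X.M.prod X.M.shift) (X.M.prod X.M.shift)) = 0 := by
    rw [comp_add, add_comp, e2, smul_add, ← add_assoc, add_sub_add_right_eq_sub, e]
  exact key

end DGBocs

namespace NormalBocs

variable {B : NormalBocs.{uk, uS, uC} k S}

/-- The first component `f⁰ : M → N`, `f⁰(m) = f(m ⊗ 1)`. -/
noncomputable def fst {M N : GrMod.{uk, uS, w} k S} (f : B.BMor M N) : M →ₗ[k] N :=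
  f.restrictScalars k ∘ₗ (BTen.mk k S).flip B.one

/-- The class of the pairs of composable morphisms of `TGMod⁰-B` with composition zero whose first
components form a short exact sequence of graded `S`-modules. -/
def E (B : NormalBocs.{uk, uS, uC} k S) (P : ShortComplex (DGBocs.TwMod.{uk, uS, uC, w} B.toDGBocs)) :
    Prop :=
  Function.Injective (fst P.f.1) ∧ Function.Exact (fst P.f.1) (fst P.g.1) ∧
    Function.Surjective (fst P.g.1)

end NormalBocs

section Lists

variable {α : Type*} {N : Type*} [AddCommGroup N]

/-- The sum `∑ G(l', l'')` over all the decompositions `l = l' ++ l''` of a list. -/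
def splitSum (G : List α → List α → N) (l : List α) : N :=
  ∑ r ∈ Finset.range (l.length + 1), G (l.take r) (l.drop r)

@[simp] lemma splitSum_nil (G : List α → List α → N) : splitSum G [] = G [] [] := by
  simp [splitSum]

lemma splitSum_cons (G : List α → List α → N) (a : α) (l : List α) :
    splitSum G (a :: l) = G [] (a :: l) + splitSum (fun p q => G (a :: p) q) l := by
  rw [splitSum, List.length_cons, Finset.sum_range_succ', add_comm]
  simp [splitSum]

lemma splitSum_add (G H : List α → List α → N) (l : List α) :
    splitSum (fun p q => G p q + H p q) l = splitSum G l + splitSum H l :=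
  Finset.sum_add_distrib

lemma splitSum_map {P : Type*} [AddCommGroup P] (f : N →+ P) (G : List α → List α → N)
    (l : List α) : f (splitSum G l) = splitSum (fun p q => f (G p q)) l := map_sum f _ _

lemma splitSum_congr {G H : List α → List α → N} {l : List α}
    (h : ∀ p q, p ++ q = l → G p q = H p q) : splitSum G l = splitSum H l :=
  Finset.sum_congr rfl fun _ _ => h _ _ (List.take_append_drop _ _)

lemma splitSum_eq_zero {G : List α → List α → N} {l : List α}
    (h : ∀ p q, p ++ q = l → G p q = 0) : splitSum G l = 0 :=
  Finset.sum_eq_zero fun _ _ => h _ _ (List.take_append_drop _ _)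

lemma splitSum_splitSum (G : List α → List α → List α → N) (l : List α) :
    splitSum (fun p q => splitSum (fun p' p'' => G p' p'' q) p) l =
      splitSum (fun p q => splitSum (fun q' q'' => G p q' q'') q) l := by
  induction l generalizing G with
  | nil => simp
  | cons a l ih =>
    rw [splitSum_cons, splitSum_cons, splitSum_nil, splitSum_cons]
    simp only [splitSum_cons, splitSum_add, ih]
    rw [add_assoc]

lemma splitSum_mem {σ : Type*} [SetLike σ N] [AddSubgroupClass σ N] (P : σ)
    {G : List α → List α → N} {l : List α} (h : ∀ p q, p ++ q = l → G p q ∈ P) :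
    splitSum G l ∈ P :=
  sum_mem fun _ _ => h _ _ (List.take_append_drop _ _)

/-- The sum `∑ G(l', l'', l''')` over all the decompositions `l = l' ++ l'' ++ l'''`. -/
def splitSum₃ (G : List α → List α → List α → N) (l : List α) : N :=
  splitSum (fun p x => splitSum (G p) x) l

lemma splitSum₃_cons (G : List α → List α → List α → N) (a : α) (l : List α) :
    splitSum₃ G (a :: l) = splitSum (G []) (a :: l) + splitSum₃ (fun p => G (a :: p)) l :=
  splitSum_cons _ _ _

end Lists

namespace GrBimod

section

variable (V : GrBimod.{uk, uS, w} k S)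

/-- The Koszul signs `a_1, …, a_n ↦ (-1)^{∑ (n - i) |a_i|} a_1, …, a_n`. -/
noncomputable def twist : List V → List V
  | [] => []
  | a :: l => V.tw l.length a :: twist l

@[simp] lemma twist_length (l : List V) : (V.twist l).length = l.length := by
  induction l with
  | nil => rfl
  | cons a l ih => simp [twist, ih]

lemma twist_append (p q : List V) :
    V.twist (p ++ q) = (V.twist p).map (V.tw q.length) ++ V.twist q := by
  induction p with
  | nil => rfl
  | cons a p ih =>
    simp only [List.cons_append, twist, ih, List.map_cons, List.length_append]
    rw [GrMod.tw_tw]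
    congr 2
    push_cast
    ring_nf

lemma splitSum_twist {N : Type*} [AddCommGroup N] (G : List V → List V → N) (l : List V) :
    splitSum G (V.twist l) =
      splitSum (fun p q => G ((V.twist p).map (V.tw q.length)) (V.twist q)) l := by
  induction l generalizing G with
  | nil => simp [twist]
  | cons a l ih =>
    rw [twist, splitSum_cons, splitSum_cons, ih]
    congr 1
    refine splitSum_congr fun p q h => ?_
    subst h
    simp only [twist, List.map_cons, GrMod.tw_tw, List.length_append]
    congr 3
    push_cast
    ring_nf

lemma map_tw_tw (a b : ℤ) (l : List V) : (l.map (V.tw b)).map (V.tw a) = l.map (V.tw (a + b)) := by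
  simp [List.map_map, Function.comp_def, GrMod.tw_tw]

lemma map_tw_congr {a b : ℤ} (h : Even (a - b)) (l : List V) : l.map (V.tw a) = l.map (V.tw b) :=
  List.map_congr_left fun x _ => V.tw_eq_of_even h x

lemma twist_map_tw (n : ℤ) (l : List V) : V.twist (l.map (V.tw n)) = (V.twist l).map (V.tw n) := by
  induction l with
  | nil => rfl
  | cons a l ih => simp only [List.map_cons, twist, ih, GrMod.tw_tw, List.length_map, add_comm]

lemma twist_twist (l : List V) : V.twist (V.twist l) = l := by
  induction l with
  | nil => rfl
  | cons a l ih =>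
    rw [twist, twist, ih, GrMod.tw_tw, twist_length, V.tw_even (by simp)]

lemma IsML.twist {N : Type*} [AddCommGroup N] [Module k N] [Module Sᵐᵒᵖ N]
    [IsScalarTower k Sᵐᵒᵖ N] {F : List V → N} (h : V.IsML F) : V.IsML (fun l => F (V.twist l)) where
  add p q a b := by simp only [twist_append, GrBimod.twist, map_add, h.add, List.length_cons]
  smul p q c a := by simp only [twist_append, GrBimod.twist, map_smul, h.smul, List.length_cons]
  bal p q s a b := by
    simp only [twist_append, GrBimod.twist, List.length_cons, GrMod.tw_rsmul, tw_lsmul, h.bal]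
  right p s a := by simp only [twist_append, GrBimod.twist, GrMod.tw_rsmul, h.right, List.length_cons]

lemma IsML.map_tw {N : Type*} [AddCommGroup N] [Module k N] [Module Sᵐᵒᵖ N]
    [IsScalarTower k Sᵐᵒᵖ N] {F : List V → N} (h : V.IsML F) (n : ℤ) :
    V.IsML (fun l => F (l.map (V.tw n))) where
  add p q a b := by simp only [List.map_append, List.map_cons, map_add, h.add]
  smul p q c a := by simp only [List.map_append, List.map_cons, map_smul, h.smul]
  bal p q s a b := by
    simp only [List.map_append, List.map_cons, GrMod.tw_rsmul, tw_lsmul, h.bal]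
  right p s a := by
    simp only [List.map_append, List.map_cons, List.map_nil, GrMod.tw_rsmul, h.right]

/-- Additive functions that agree on the lists of homogeneous elements are equal. -/
lemma eq_of_homList {N : Type*} [AddCommGroup N] {F G : List V → N}
    (hF : ∀ (p q : List V) (a b : V), F (p ++ (a + b) :: q) = F (p ++ a :: q) + F (p ++ b :: q))
    (hG : ∀ (p q : List V) (a b : V), G (p ++ (a + b) :: q) = G (p ++ a :: q) + G (p ++ b :: q))
    (h : ∀ l ds, V.HomList l ds → F l = G l) (l : List V) : F l = G l := by
  have key : ∀ q p ds, V.HomList p ds → F (p ++ q) = G (p ++ q) := by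
    intro q
    induction q with
    | nil => intro p ds hp; simpa using h p ds hp
    | cons a q ih =>
      intro p ds hp
      induction a using V.toGrMod.induction_homog with
      | hm j x hx =>
        have := ih (p ++ [x]) (ds ++ [j]) (List.rel_append hp (List.Forall₂.cons hx .nil))
        simpa using this
      | ha x y hx hy => rw [hF, hG, hx, hy]
  exact key l [] [] .nil

lemma homList_shift {l : List V} {ds : List ℤ} (h : V.shift.HomList l ds) :
    V.HomList l (ds.map (· + 1)) := by
  induction h with
  | nil => exact .nil
  | cons h _ ih => exact .cons h ih

lemma homList_append {p q : List V} {ds : List ℤ} (h : V.HomList (p ++ q) ds) :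
    ∃ d1 d2, ds = d1 ++ d2 ∧ V.HomList p d1 ∧ V.HomList q d2 := by
  refine ⟨ds.take p.length, ds.drop p.length, (List.take_append_drop _ _).symm, ?_, ?_⟩
  · simpa [HomList] using List.forall₂_take p.length h
  · simpa [HomList] using List.forall₂_drop p.length h

lemma homList_tw {l : List V} {ds : List ℤ} (h : V.HomList l ds) (n : ℤ) :
    V.HomList (l.map (V.tw n)) ds := by
  induction h with
  | nil => exact .nil
  | cons h _ ih => exact .cons (V.tw_mem n h) ih

lemma homList_twist {l : List V} {ds : List ℤ} (h : V.HomList l ds) : V.HomList (V.twist l) ds := by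
  induction h with
  | nil => exact .nil
  | cons h _ ih => exact .cons (V.tw_mem _ h) ih

end

end GrBimod

namespace GrBimod

section

variable (V : GrBimod.{uk, uS, w} k S)

section

variable {N : Type*} [AddCommGroup N] [Module k N] [Module Sᵐᵒᵖ N] [IsScalarTower k Sᵐᵒᵖ N]

lemma IsML.zsmul {F : List V → N} (h : V.IsML F) (p q : List V) (c : ℤ) (a : V) :
    F (p ++ (c • a) :: q) = c • F (p ++ a :: q) :=
  (AddMonoidHom.mk' (fun a => F (p ++ a :: q)) (h.add p q)).map_zsmul c a

lemma IsML.zero {F : List V → N} (h : V.IsML F) (p q : List V) : F (p ++ 0 :: q) = 0 :=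
  (AddMonoidHom.mk' (fun a => F (p ++ a :: q)) (h.add p q)).map_zero

lemma IsML.map_tw_of_homList {F : List V → N} (h : V.IsML F) {l : List V} {ds : List ℤ}
    (hl : V.HomList l ds) (n : ℤ) : F (l.map (V.tw n)) = sgn (n * ds.sum) • F l := by
  induction hl generalizing F with
  | nil => simp
  | @cons a d l ds ha _ ih =>
    have h1 := h.zsmul V [] (l.map (V.tw n)) (sgn (n * d)) a
    have h2 := ih (h.cons V a)
    simp only [List.nil_append] at h1
    rw [List.map_cons, V.tw_of_mem n ha, h1, h2, smul_smul, ← sgn_add, List.sum_cons, mul_add]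

lemma IsML.map_tw_eq {N : GrMod.{uk, uS, w'} k S} {F : List V → N} (h : V.IsML F) (e : ℕ → ℤ)
    (hd : ∀ l ds, V.HomList l ds → F l ∈ N.gr (ds.sum + e l.length)) (n : ℤ) (l : List V) :
    F (l.map (V.tw n)) = sgn (n * e l.length) • N.tw n (F l) := by
  refine V.eq_of_homList (F := fun l => F (l.map (V.tw n)))
    (G := fun l => sgn (n * e l.length) • N.tw n (F l)) ?_ ?_ ?_ l
  · exact (h.map_tw V n).add
  · intro p q a b
    simp only [h.add, map_add, smul_add, List.length_append, List.length_cons]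
  · intro l ds hl
    rw [h.map_tw_of_homList V hl, N.tw_of_mem n (hd l ds hl), smul_smul, ← sgn_add]
    congr 1
    exact sgn_eq_of_even ⟨-(n * e l.length), by ring1⟩

lemma IsML.map_shift_tw {F : List V → N} (h : V.IsML F) (n : ℤ) (p q : List V) :
    F (p.map (V.shift.tw n) ++ q) = sgn (n * p.length) • F (p.map (V.tw n) ++ q) := by
  induction p generalizing F with
  | nil => simp
  | cons a p ih =>
    have h1 := h.zsmul V [] (p.map (V.shift.tw n) ++ q) (sgn n) (V.tw n a)
    have h2 := ih (h.cons V (V.tw n a))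
    simp only [List.nil_append] at h1
    rw [List.map_cons, List.cons_append, GrMod.shift_tw, h1, h2, smul_smul, ← sgn_add]
    congr 2
    push_cast [List.length_cons]
    ring

end

lemma tw_tp (n : ℤ) (l : List V) : (TS V).tw n (tp V l) = tp V (l.map (V.tw n)) := by
  have := IsML.map_tw_eq V (N := (TS V).toGrMod) (isML_tp V) (fun _ => 0)
    (fun l ds h => by rw [add_zero]; exact tp_mem V h) n l
  rw [this, mul_zero, sgn_zero, one_smul]

lemma lsmul_tp_nil (s : S) : s • tp V [] = op s • tp V [] := by
  rw [tp, ← lof_smul, ← lof_lsmul]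
  congr 1
  refine ULift.ext _ _ ?_
  change s * 1 = 1 * s
  simp

lemma lsmul_tp_cons (s : S) (a : V) (l : List V) : s • tp V (a :: l) = tp V ((s • a) :: l) := by
  rw [tp, tp, consT_lsmul]

lemma liftTS_lsmul {N : Type*} [AddCommGroup N] [Module k N] [Module Sᵐᵒᵖ N]
    [IsScalarTower k Sᵐᵒᵖ N] [Module S N] [SMulCommClass S Sᵐᵒᵖ N] (F : List V → N)
    (hF : V.IsML F) (h0 : ∀ s : S, s • F [] = op s • F [])
    (h1 : ∀ (s : S) a l, F ((s • a) :: l) = s • F (a :: l)) (s : S) (x : TSc V) :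
    liftTS V F hF (s • x) = s • liftTS V F hF x := by
  induction x using tp_induction with
  | ht l t =>
    rw [smul_comm, liftTS_rsmul, liftTS_rsmul, smul_comm s]
    congr 1
    cases l with
    | nil => rw [lsmul_tp_nil, liftTS_rsmul, liftTS_tp, h0]
    | cons a l => rw [lsmul_tp_cons, liftTS_tp, liftTS_tp, h1]
  | ha x y hx hy => rw [smul_add, map_add, map_add, smul_add, hx, hy]

/-- The deconcatenation `v_1 ⊗ ⋯ ⊗ v_n ↦ ∑ (v_1 ⊗ ⋯ ⊗ v_i) ⊗ (v_{i+1} ⊗ ⋯ ⊗ v_n)` on lists. -/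
noncomputable def muF (l : List V) : BTen k S (TSc V) (TSc V) :=
  splitSum (fun p q => BTen.tm k S (tp V p) (tp V q)) l

/-- The map `x ⊗ y ↦ (v ⊗ x) ⊗ y`. -/
noncomputable def consL (v : V) : BTen k S (TSc V) (TSc V) →ₗ[k] BTen k S (TSc V) (TSc V) :=
  BTen.map (consT V v) LinearMap.id (consT_smul V v) (fun _ _ => rfl)

lemma consL_tm (v : V) (x y : TSc V) :
    consL V v (BTen.tm k S x y) = BTen.tm k S (consT V v x) y := rfl

lemma consL_add (v v' : V) (z : BTen k S (TSc V) (TSc V)) :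
    consL V (v + v') z = consL V v z + consL V v' z := by
  induction z using BTen.induction with
  | ht x y => simp only [consL_tm, map_add, LinearMap.add_apply, BTen.add_tm]
  | ha x y hx hy => simp only [map_add, hx, hy]; abel

lemma consL_smul (c : k) (v : V) (z : BTen k S (TSc V) (TSc V)) :
    consL V (c • v) z = c • consL V v z := by
  induction z using BTen.induction with
  | ht x y => simp only [consL_tm, map_smul, LinearMap.smul_apply, BTen.smul_tm]
  | ha x y hx hy => simp only [map_add, hx, hy, smul_add]

lemma consL_bal (s : S) (v : V) (z : BTen k S (TSc V) (TSc V)) :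
    consL V (op s • v) z = consL V v (s • z) := by
  induction z using BTen.induction with
  | ht x y => rw [BTen.lsmul_tm, consL_tm, consL_tm, consT_bal]
  | ha x y hx hy => simp only [map_add, hx, hy, smul_add]

lemma consL_lsmul (s : S) (v : V) (z : BTen k S (TSc V) (TSc V)) :
    consL V (s • v) z = s • consL V v z := by
  induction z using BTen.induction with
  | ht x y => rw [consL_tm, consL_tm, BTen.lsmul_tm, consT_lsmul]
  | ha x y hx hy => simp only [map_add, hx, hy, smul_add]

lemma consL_rsmul (s : S) (v : V) (z : BTen k S (TSc V) (TSc V)) :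
    consL V v (op s • z) = op s • consL V v z := by
  induction z using BTen.induction with
  | ht x y => rfl
  | ha x y hx hy => simp only [map_add, hx, hy, smul_add]

lemma muF_nil : muF V [] = BTen.tm k S (tp V []) (tp V []) := splitSum_nil _

lemma muF_cons (a : V) (l : List V) :
    muF V (a :: l) = BTen.tm k S (tp V []) (tp V (a :: l)) + consL V a (muF V l) := by
  rw [muF, splitSum_cons, muF]
  congr 1
  exact (splitSum_map (consL V a).toAddMonoidHom
    (fun p q => BTen.tm k S (tp V p) (tp V q)) l).symm

lemma muF_lsmul (s : S) (a : V) (l : List V) : muF V ((s • a) :: l) = s • muF V (a :: l) := by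
  rw [muF_cons, muF_cons, smul_add, consL_lsmul, ← lsmul_tp_cons, BTen.lsmul_tm, lsmul_tp_nil,
    BTen.tm_bal]

lemma isML_muF : V.IsML (muF V) where
  add p q a b := by
    induction p with
    | nil =>
      have := (isML_tp V).add [] q a b
      simp only [List.nil_append] at this ⊢
      rw [muF_cons, muF_cons, muF_cons, this, BTen.tm_add, consL_add]; abel
    | cons c p ih =>
      have := (isML_tp V).add (c :: p) q a b
      simp only [List.cons_append] at this ⊢
      rw [muF_cons, muF_cons, muF_cons, this, BTen.tm_add, ih, map_add]; abel
  smul p q c a := by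
    induction p with
    | nil =>
      have := (isML_tp V).smul [] q c a
      simp only [List.nil_append] at this ⊢
      rw [muF_cons, muF_cons, this, BTen.tm_smul, consL_smul, smul_add]
    | cons d p ih =>
      have := (isML_tp V).smul (d :: p) q c a
      simp only [List.cons_append] at this ⊢
      rw [muF_cons, muF_cons, this, BTen.tm_smul, ih, map_smul, smul_add]
  bal p q s a b := by
    induction p with
    | nil =>
      have := (isML_tp V).bal [] q s a b
      simp only [List.nil_append] at this ⊢
      rw [muF_cons, this, consL_bal, ← muF_lsmul, ← muF_cons]
    | cons d p ih =>
      have := (isML_tp V).bal (d :: p) q s a b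
      simp only [List.cons_append] at this ⊢
      rw [muF_cons, muF_cons, this, ih]
  right p s a := by
    induction p with
    | nil =>
      have := (isML_tp V).right [] s a
      simp only [List.nil_append] at this ⊢
      rw [muF_cons, muF_cons, this, smul_add, BTen.rsmul_tm, consL_bal, muF_nil, ← consL_rsmul,
        BTen.lsmul_tm, BTen.rsmul_tm, lsmul_tp_nil, BTen.tm_bal, lsmul_tp_nil]
    | cons d p ih =>
      have := (isML_tp V).right (d :: p) s a
      simp only [List.cons_append] at this ⊢
      rw [muF_cons, muF_cons, this, ih, smul_add, BTen.rsmul_tm, consL_rsmul]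

/-- The comultiplication of the tensor coalgebra `T_S(V)`. -/
noncomputable def muT : TSc V →ₗ[k] BTen k S (TSc V) (TSc V) := liftTS V (muF V) (isML_muF V)

lemma muT_tp (l : List V) : muT V (tp V l) = muF V l := liftTS_tp V _ _ l

lemma muT_rsmul (s : S) (x : TSc V) : muT V (op s • x) = op s • muT V x := liftTS_rsmul V _ _ s x

lemma muT_lsmul (s : S) (x : TSc V) : muT V (s • x) = s • muT V x :=
  liftTS_lsmul V _ _ (fun s => by
    rw [muF_nil, BTen.lsmul_tm, BTen.rsmul_tm, lsmul_tp_nil, BTen.tm_bal, lsmul_tp_nil])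
    (muF_lsmul V) s x

lemma muT_consT (v : V) (x : TSc V) :
    muT V (consT V v x) = BTen.tm k S (tp V []) (consT V v x) + consL V v (muT V x) := by
  induction x using tp_induction with
  | ht l s =>
    have : consT V v (tp V l) = tp V (v :: l) := rfl
    rw [consT_smul, muT_rsmul, muT_rsmul, this, muT_tp, muT_tp, muF_cons, smul_add, BTen.rsmul_tm,
      consL_rsmul]
  | ha x y hx hy => simp only [map_add, hx, hy, BTen.tm_add]; abel

/-- The projection `T_S(V) → S` onto `V^{⊗ 0}`, on lists. -/
def epsF : List V → S
  | [] => 1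
  | _ :: _ => 0

lemma isML_epsF : V.IsML (epsF V) := by
  constructor <;> intro p <;> cases p <;> simp [epsF]

/-- The projection `T_S(V) → S`. -/
noncomputable def epsT : TSc V →ₗ[k] S := liftTS V (epsF V) (isML_epsF V)

lemma epsT_tp (l : List V) : epsT V (tp V l) = epsF V l := liftTS_tp V _ _ l

lemma epsT_rsmul (s : S) (x : TSc V) : epsT V (op s • x) = epsT V x * s := liftTS_rsmul V _ _ s x

lemma epsT_lsmul (s : S) (x : TSc V) : epsT V (s • x) = s * epsT V x :=
  liftTS_lsmul V _ _ (fun s => by simp [epsF]) (fun s a l => by simp [epsF]) s x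

lemma epsT_consT (v : V) (x : TSc V) : epsT V (consT V v x) = 0 := by
  induction x using tp_induction with
  | ht l s =>
    have : consT V v (tp V l) = tp V (v :: l) := rfl
    rw [consT_smul, epsT_rsmul, this, epsT_tp, epsF, zero_mul]
  | ha x y hx hy => simp only [map_add, hx, hy, add_zero]

/-- The projection `T_S(V) → V`, on lists. -/
def prF : List V → V
  | [a] => a
  | _ => 0

lemma isML_prF : V.IsML (prF V) where
  add p q a b := by rcases p with _ | ⟨c, _ | ⟨d, p⟩⟩ <;> rcases q with _ | ⟨e, q⟩ <;> simp [prF]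
  smul p q a b := by rcases p with _ | ⟨c, _ | ⟨d, p⟩⟩ <;> rcases q with _ | ⟨e, q⟩ <;> simp [prF]
  bal p q s a b := by rcases p with _ | ⟨c, _ | ⟨d, p⟩⟩ <;> rcases q with _ | ⟨e, q⟩ <;> simp [prF]
  right p a b := by rcases p with _ | ⟨c, _ | ⟨d, p⟩⟩ <;> simp [prF]

/-- The projection `T_S(V) → V`. -/
noncomputable def prT : TSc V →ₗ[k] V := liftTS V (prF V) (isML_prF V)

lemma prT_tp (l : List V) : prT V (tp V l) = prF V l := liftTS_tp V _ _ l

lemma prT_rsmul (s : S) (x : TSc V) : prT V (op s • x) = op s • prT V x := liftTS_rsmul V _ _ s x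

lemma prT_consT (v : V) (x : TSc V) : prT V (consT V v x) = op (epsT V x) • v := by
  induction x using tp_induction with
  | ht l s =>
    have : consT V v (tp V l) = tp V (v :: l) := rfl
    rw [consT_smul, prT_rsmul, epsT_rsmul, op_mul, mul_smul, this, prT_tp, epsT_tp]
    congr 1
    cases l <;> simp [prF, epsF]
  | ha x y hx hy => simp only [map_add, hx, hy, MulOpposite.op_add, add_smul]

/-- The map `v ⊗ x ↦ v ⊗ x` from `V ⊗ T_S(V)` to `T_S(V)`. -/
noncomputable def joinT : BTen k S V (TSc V) →ₗ[k] TSc V :=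
  BTen.lift (consT V) (fun v s x => consT_bal V v s x)

lemma epsL_consL (v : V) (z : BTen k S (TSc V) (TSc V)) :
    epsL (epsT V) (epsT_rsmul V) (consL V v z) = 0 := by
  induction z using BTen.induction with
  | ht x y => rw [consL_tm, epsL_tm, epsT_consT, zero_smul]
  | ha x y hx hy => simp only [map_add, hx, hy, add_zero]

lemma epsL_rsmul (s : S) (z : BTen k S (TSc V) (TSc V)) :
    epsL (epsT V) (epsT_rsmul V) (op s • z) = op s • epsL (epsT V) (epsT_rsmul V) z := by
  induction z using BTen.induction with
  | ht x y => rw [BTen.rsmul_tm, epsL_tm, epsL_tm, smul_comm]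
  | ha x y hx hy => simp only [map_add, hx, hy, smul_add]

lemma counitL (x : TSc V) : epsL (epsT V) (epsT_rsmul V) (muT V x) = x := by
  induction x using tp_induction with
  | ht l s =>
    rw [muT_rsmul, epsL_rsmul, muT_tp]
    congr 1
    cases l with
    | nil => rw [muF_nil, epsL_tm, epsT_tp, epsF, one_smul]
    | cons a l => rw [muF_cons, map_add, epsL_consL, epsL_tm, epsT_tp, epsF, one_smul, add_zero]
  | ha x y hx hy => simp only [map_add, hx, hy]

lemma epsR_rsmul (s : S) (z : BTen k S (TSc V) (TSc V)) :
    epsR (epsT V) (epsT_lsmul V) (op s • z) = op s • epsR (epsT V) (epsT_lsmul V) z := by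
  induction z using BTen.induction with
  | ht x y => rw [BTen.rsmul_tm, epsR_tm, epsR_tm, epsT_rsmul, op_mul, mul_smul]
  | ha x y hx hy => simp only [map_add, hx, hy, smul_add]

lemma epsR_consL (v : V) (z : BTen k S (TSc V) (TSc V)) :
    epsR (epsT V) (epsT_lsmul V) (consL V v z) = consT V v (epsR (epsT V) (epsT_lsmul V) z) := by
  induction z using BTen.induction with
  | ht x y => rw [consL_tm, epsR_tm, epsR_tm, consT_smul]
  | ha x y hx hy => simp only [map_add, hx, hy]

lemma counitR (x : TSc V) : epsR (epsT V) (epsT_lsmul V) (muT V x) = x := by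
  induction x using tp_induction with
  | ht l s =>
    rw [muT_rsmul, epsR_rsmul, muT_tp]
    congr 1
    induction l with
    | nil => rw [muF_nil, epsR_tm, epsT_tp, epsF, op_one, one_smul]
    | cons a l ih =>
      rw [muF_cons, map_add, epsR_consL, epsR_tm, epsT_tp, epsF, op_zero, zero_smul, zero_add, ih]
      rfl
  | ha x y hx hy => simp only [map_add, hx, hy]

/-- The map `x ⊗ y ↦ pr(x) ⊗ y` followed by `v ⊗ y ↦ v ⊗ y`. -/
noncomputable def prJoin : BTen k S (TSc V) (TSc V) →ₗ[k] TSc V :=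
  joinT V ∘ₗ BTen.map (prT V) LinearMap.id (prT_rsmul V) (fun _ _ => rfl)

lemma prJoin_tm (x y : TSc V) : prJoin V (BTen.tm k S x y) = consT V (prT V x) y := rfl

lemma prJoin_consL (v : V) (z : BTen k S (TSc V) (TSc V)) :
    prJoin V (consL V v z) = consT V v (epsL (epsT V) (epsT_rsmul V) z) := by
  induction z using BTen.induction with
  | ht x y => rw [consL_tm, prJoin_tm, prT_consT, epsL_tm, consT_bal]
  | ha x y hx hy => simp only [map_add, hx, hy]

lemma prJoin_rsmul (s : S) (z : BTen k S (TSc V) (TSc V)) :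
    prJoin V (op s • z) = op s • prJoin V z := by
  induction z using BTen.induction with
  | ht x y => rw [BTen.rsmul_tm, prJoin_tm, prJoin_tm, consT_smul]
  | ha x y hx hy => simp only [map_add, hx, hy, smul_add]

lemma eq_join (x : TSc V) : x = op (epsT V x) • tp V [] + prJoin V (muT V x) := by
  induction x using tp_induction with
  | ht l s =>
    rw [epsT_rsmul, muT_rsmul, prJoin_rsmul, op_mul, mul_smul, ← smul_add, muT_tp, epsT_tp]
    congr 1
    cases l with
    | nil => rw [muF_nil, prJoin_tm, prT_tp]; simp [epsF, prF]
    | cons a l =>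
      rw [muF_cons, map_add, prJoin_tm, prT_tp, prJoin_consL, ← muT_tp, counitL]
      simp [epsF, prF, tp]
  | ha x y hx hy =>
    conv_lhs => rw [hx, hy]
    simp only [map_add, MulOpposite.op_add, add_smul]; abel

lemma muT_mem (j : ℤ) (x : TSc V) (hx : x ∈ (TS V).gr j) :
    muT V x ∈ ((TS V).tensor (TS V)).gr j := by
  refine TS_gr_le V j ((((TS V).tensor (TS V)).gr j).comap (muT V)) ?_ ?_ hx
  · intro s x hx
    rw [Submodule.mem_comap, muT_rsmul]
    exact ((TS V).tensor (TS V)).rsmul_mem _ s _ hx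
  · rintro l ds hl rfl
    rw [Submodule.mem_comap, muT_tp, muF]
    refine splitSum_mem (((TS V).tensor (TS V)).gr ds.sum) fun p q h => ?_
    subst h
    obtain ⟨d1, d2, rfl, h1, h2⟩ := homList_append V hl
    rw [List.sum_append]
    exact tm_mem_tgr _ _ (tp_mem V h1) (tp_mem V h2)

lemma epsT_of_ne (j : ℤ) (x : TSc V) (hx : x ∈ (TS V).gr j) (hj : j ≠ 0) : epsT V x = 0 := by
  refine TS_gr_le V j (LinearMap.ker (epsT V)) ?_ ?_ hx
  · intro s x hx
    rw [LinearMap.mem_ker, epsT_rsmul, LinearMap.mem_ker.1 hx, zero_mul]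
  · rintro l ds hl rfl
    cases hl with
    | nil => exact absurd rfl hj
    | cons h _ => rw [LinearMap.mem_ker, epsT_tp, epsF]

lemma muT_coassoc (x : TSc V) :
    BTen.map (muT V) LinearMap.id (muT_rsmul V) (fun _ _ => rfl) (muT V x) =
      BTen.assocInv k S (BTen.map LinearMap.id (muT V) (fun _ _ => rfl) (muT_lsmul V)
        (muT V x)) := by
  set f : BTen k S (TSc V) (TSc V) →ₗ[k] BTen k S (BTen k S (TSc V) (TSc V)) (TSc V) :=
    BTen.map (muT V) LinearMap.id (muT_rsmul V) (fun _ _ => rfl) with hf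
  set g : BTen k S (TSc V) (TSc V) →ₗ[k] BTen k S (BTen k S (TSc V) (TSc V)) (TSc V) :=
    BTen.assocInv k S ∘ₗ BTen.map LinearMap.id (muT V) (fun _ _ => rfl) (muT_lsmul V) with hg
  change f (muT V x) = g (muT V x)
  have ff : ∀ (s : S) z, f (op s • z) = op s • f z := fun s z => by
    induction z using BTen.induction with
    | ht x y => rfl
    | ha x y hx hy => simp only [map_add, hx, hy, smul_add]
  have gg : ∀ (s : S) z, g (op s • z) = op s • g z := fun s z => by
    induction z using BTen.induction with
    | ht x y =>
      change BTen.assocInv k S (BTen.tm k S x (muT V (op s • y))) =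
        op s • BTen.assocInv k S (BTen.tm k S x (muT V y))
      rw [muT_rsmul]
      generalize muT V y = z
      induction z using BTen.induction with
      | ht x y => rfl
      | ha x y hx hy => simp only [map_add, hx, hy, smul_add, BTen.tm_add]
    | ha x y hx hy => simp only [map_add, hx, hy, smul_add]
  induction x using tp_induction with
  | ht l s =>
    rw [muT_rsmul, ff, gg]
    congr 1
    rw [muT_tp, muF]
    have e1 := splitSum_map f.toAddMonoidHom (fun p q => BTen.tm k S (tp V p) (tp V q)) l
    have e2 := splitSum_map g.toAddMonoidHom (fun p q => BTen.tm k S (tp V p) (tp V q)) l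
    refine e1.trans (Eq.trans ?_ e2.symm)
    have e3 := splitSum_splitSum
      (fun p q r => BTen.tm k S (BTen.tm k S (tp V p) (tp V q)) (tp V r)) l
    refine Eq.trans (splitSum_congr fun p q _ => ?_) (e3.trans (splitSum_congr fun p q _ => ?_))
    · change BTen.tm k S (muT V (tp V p)) (tp V q) = _
      rw [muT_tp, muF]
      exact splitSum_map (((BTen.mk k S).flip (tp V q)).toAddMonoidHom :
        BTen k S (TSc V) (TSc V) →+ _) (fun p q => BTen.tm k S (tp V p) (tp V q)) p
    · change _ = BTen.assocInv k S (BTen.tm k S (tp V p) (muT V (tp V q)))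
      rw [muT_tp, muF]
      exact (splitSum_map (((BTen.assocInv k S) ∘ₗ (BTen.mk k S (tp V p))).toAddMonoidHom :
        BTen k S (TSc V) (TSc V) →+ _) (fun p q => BTen.tm k S (tp V p) (tp V q)) q).symm
  | ha x y hx hy => simp only [map_add, hx, hy]

end

end GrBimod

section Algebra

variable (k S)

/-- An `A_∞`-algebra `(A, {m_n}_{n ≥ 1})` over `S`: the function `m` on lists packs the operations
`m_n : A^{⊗ n} → A`, `m_n(a_1 ⊗ ⋯ ⊗ a_n) = m [a_1, …, a_n]`, which are homogeneous maps of
`S`-bimodules of degree `2 - n` and satisfy, by the Koszul sign rule,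
`∑_{r + s + t = n} (-1)^{r + st} m_{r + 1 + t} (id^{⊗ r} ⊗ m_s ⊗ id^{⊗ t}) = 0`. -/
structure AInfAlg where
  A : GrBimod.{uk, uS, uA} k S
  m : List A → A
  isML : A.IsML m
  m_left : ∀ (s : S) (a : A) (l : List A), m ((s • a) :: l) = s • m (a :: l)
  m_nil : m [] = 0
  m_mem : ∀ l ds, A.HomList l ds → m l ∈ A.gr (ds.sum + (2 - l.length))
  stasheff : ∀ l, splitSum₃ (fun p q r => sgn (p.length + q.length * r.length) •
    m (p.map (A.tw q.length) ++ m q :: r)) l = 0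

end Algebra

namespace AInfAlg

variable (𝒜 : AInfAlg.{uk, uS, uA} k S)

/-- The operations `b_n` on `A[1]`, with `b_n (σ ⊗ ⋯ ⊗ σ) = σ m_n`. -/
noncomputable def b (l : List 𝒜.A.shift) : 𝒜.A.shift := 𝒜.m (𝒜.A.twist l)

lemma isML_b : 𝒜.A.shift.IsML 𝒜.b where
  add := (𝒜.isML.twist 𝒜.A).add
  smul := (𝒜.isML.twist 𝒜.A).smul
  bal := (𝒜.isML.twist 𝒜.A).bal
  right := (𝒜.isML.twist 𝒜.A).right

lemma b_nil : 𝒜.b [] = 0 := 𝒜.m_nil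

lemma b_left (s : S) (a : 𝒜.A.shift) (l : List 𝒜.A.shift) : 𝒜.b ((s • a) :: l) = s • 𝒜.b (a :: l) := by
  change 𝒜.m (𝒜.A.tw l.length (s • a) :: _) = s • 𝒜.m (𝒜.A.tw l.length a :: _)
  rw [GrBimod.tw_lsmul]
  exact 𝒜.m_left s _ _

lemma m_map_tw (n : ℤ) (l : List 𝒜.A) :
    𝒜.m (l.map (𝒜.A.tw n)) = sgn (n * (2 - l.length)) • 𝒜.A.tw n (𝒜.m l) :=
  𝒜.isML.map_tw_eq 𝒜.A (N := 𝒜.A.toGrMod) (fun r => 2 - r) 𝒜.m_mem n l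

lemma b_b (l : List 𝒜.A.shift) : splitSum₃ (fun p q r =>
    𝒜.b (p.map (𝒜.A.shift.tw 1) ++ 𝒜.b q :: r)) l = 0 := by
  rw [← 𝒜.stasheff (𝒜.A.twist l), splitSum₃, splitSum₃, GrBimod.splitSum_twist]
  refine splitSum_congr fun p x _ => ?_
  rw [GrBimod.splitSum_twist]
  refine splitSum_congr fun q r h => ?_
  subst h
  refine ((𝒜.isML.twist 𝒜.A).map_shift_tw 𝒜.A 1 p (𝒜.b q :: r)).trans ?_
  have h1 := 𝒜.m_map_tw r.length (𝒜.A.twist q)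
  rw [GrBimod.twist_length] at h1
  have h2 : 𝒜.m ((𝒜.A.twist q).map (𝒜.A.tw r.length)) =
      sgn (r.length * q.length) • 𝒜.A.tw r.length (𝒜.b q) := by
    rw [h1]
    have : sgn (r.length * (2 - q.length)) = sgn (r.length * q.length) :=
      sgn_eq_of_even ⟨r.length * (1 - q.length), by ring1⟩
    rw [this]; rfl
  rw [h2, 𝒜.isML.zsmul, smul_smul, GrBimod.map_tw_tw, GrBimod.twist_append, GrBimod.twist_map_tw,
    GrBimod.map_tw_tw]
  simp only [List.length_map, GrBimod.twist_length, List.length_cons, List.length_append,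
    GrBimod.twist]
  rw [← sgn_add]
  congr 1
  · exact sgn_eq_of_even ⟨-(q.length * r.length), by ring1⟩
  · congr 2
    exact GrBimod.map_tw_congr _ ⟨1 - q.length, by push_cast; ring1⟩ _

/-- Auxiliary sums for the differential. -/
noncomputable def headF (β : List 𝒜.A.shift → 𝒜.A.shift) (l : List 𝒜.A.shift) :
    GrBimod.TSc 𝒜.A.shift :=
  splitSum (fun q r => GrBimod.tp 𝒜.A.shift (β q :: r)) l

/-- The differential of the bar construction on lists: 
`∑ id^{⊗ r} ⊗ b_s ⊗ id^{⊗ t}`, with the Koszul signs. -/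
noncomputable def dF (l : List 𝒜.A.shift) : GrBimod.TSc 𝒜.A.shift :=
  splitSum₃ (fun p q r => GrBimod.tp 𝒜.A.shift (p.map (𝒜.A.shift.tw 1) ++ 𝒜.b q :: r)) l

lemma headF_cons (β : List 𝒜.A.shift → 𝒜.A.shift) (a : 𝒜.A.shift) (l : List 𝒜.A.shift) :
    𝒜.headF β (a :: l) = GrBimod.tp 𝒜.A.shift (β [] :: a :: l) +
      𝒜.headF (fun q => β (a :: q)) l := splitSum_cons _ _ _

lemma headF_nil (β : List 𝒜.A.shift → 𝒜.A.shift) :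
    𝒜.headF β [] = GrBimod.tp 𝒜.A.shift [β []] := splitSum_nil _

lemma dF_nil : 𝒜.dF [] = 0 := by
  rw [dF, splitSum₃, splitSum_nil, splitSum_nil, b_nil]
  exact (GrBimod.isML_tp 𝒜.A.shift).zero 𝒜.A.shift [] []

lemma dF_cons (a : 𝒜.A.shift) (l : List 𝒜.A.shift) : 𝒜.dF (a :: l) =
    𝒜.headF 𝒜.b (a :: l) + GrBimod.consT 𝒜.A.shift (𝒜.A.shift.tw 1 a) (𝒜.dF l) := by
  rw [dF, splitSum₃_cons, dF]
  congr 1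
  rw [splitSum₃]
  refine Eq.trans ?_ (splitSum_map (GrBimod.consT 𝒜.A.shift (𝒜.A.shift.tw 1 a)).toAddMonoidHom
    _ _).symm
  refine splitSum_congr fun p x _ => ?_
  exact (splitSum_map (GrBimod.consT 𝒜.A.shift (𝒜.A.shift.tw 1 a)).toAddMonoidHom _ _).symm

lemma isML_headF {β : List 𝒜.A.shift → 𝒜.A.shift} (h : 𝒜.A.shift.IsML β) :
    𝒜.A.shift.IsML (𝒜.headF β) where
  add p q a b := by
    induction p generalizing β with
    | nil =>
      have h1 := (GrBimod.isML_tp 𝒜.A.shift).add [β []] q a b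
      have h2 := fun p => h.add [] p a b
      simp only [List.nil_append, List.cons_append] at h1 h2 ⊢
      rw [headF_cons, headF_cons, headF_cons, h1, add_add_add_comm]
      congr 1
      rw [headF, headF, headF, ← splitSum_add]
      refine splitSum_congr fun x y _ => ?_
      rw [h2]
      exact (GrBimod.isML_tp 𝒜.A.shift).add [] y _ _
    | cons c p ih =>
      have h1 := (GrBimod.isML_tp 𝒜.A.shift).add (β [] :: c :: p) q a b
      simp only [List.cons_append] at h1 ⊢
      rw [headF_cons, headF_cons, headF_cons, h1, ih (h.cons _ c), add_add_add_comm]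
  smul p q c a := by
    induction p generalizing β with
    | nil =>
      have h1 := (GrBimod.isML_tp 𝒜.A.shift).smul [β []] q c a
      have h2 := fun p => h.smul [] p c a
      simp only [List.nil_append, List.cons_append] at h1 h2 ⊢
      rw [headF_cons, headF_cons, h1, smul_add]
      congr 1
      refine Eq.trans ?_ (splitSum_map (DistribSMul.toAddMonoidHom _ c) _ _).symm
      refine splitSum_congr fun x y _ => ?_
      beta_reduce
      rw [h2]
      exact (GrBimod.isML_tp 𝒜.A.shift).smul [] y _ _
    | cons d p ih =>
      have h1 := (GrBimod.isML_tp 𝒜.A.shift).smul (β [] :: d :: p) q c a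
      simp only [List.cons_append] at h1 ⊢
      rw [headF_cons, headF_cons, h1, ih (h.cons _ d), smul_add]
  bal p q s a b := by
    induction p generalizing β with
    | nil =>
      have h1 := (GrBimod.isML_tp 𝒜.A.shift).bal [β []] q s a b
      have h2 := fun p => h.bal [] p s a b
      have h3 := h.right [] s a
      have h4 := (GrBimod.isML_tp 𝒜.A.shift).bal [] q s (β [a]) b
      simp only [List.nil_append, List.cons_append] at h1 h2 h3 h4 ⊢
      rw [headF_cons, headF_cons, h1, headF_cons, headF_cons, h3, h4]
      simp only [h2]
    | cons d p ih =>
      have h1 := (GrBimod.isML_tp 𝒜.A.shift).bal (β [] :: d :: p) q s a b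
      simp only [List.cons_append] at h1 ⊢
      rw [headF_cons, headF_cons, h1, ih (h.cons _ d)]
  right p s a := by
    induction p generalizing β with
    | nil =>
      have h1 := (GrBimod.isML_tp 𝒜.A.shift).right [β []] s a
      have h3 := h.right [] s a
      have h4 := (GrBimod.isML_tp 𝒜.A.shift).right [] s (β [a])
      simp only [List.nil_append, List.cons_append] at h1 h3 h4 ⊢
      rw [headF_cons, headF_cons, h1, headF_nil, headF_nil, h3, h4, smul_add]
    | cons d p ih =>
      have h1 := (GrBimod.isML_tp 𝒜.A.shift).right (β [] :: d :: p) s a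
      simp only [List.cons_append] at h1 ⊢
      rw [headF_cons, headF_cons, h1, ih (h.cons _ d), smul_add]

lemma headF_left (s : S) (a : 𝒜.A.shift) (l : List 𝒜.A.shift) :
    𝒜.headF 𝒜.b ((s • a) :: l) = s • 𝒜.headF 𝒜.b (a :: l) := by
  have h1 : ∀ l, GrBimod.tp 𝒜.A.shift (𝒜.b [] :: l) = 0 := fun l => by
    rw [b_nil]; exact (GrBimod.isML_tp 𝒜.A.shift).zero 𝒜.A.shift [] l
  rw [headF_cons, headF_cons, h1, h1, zero_add, zero_add]
  refine Eq.trans ?_ (splitSum_map (DistribSMul.toAddMonoidHom _ s) _ _).symm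
  refine splitSum_congr fun x y _ => ?_
  beta_reduce
  rw [b_left]
  exact (GrBimod.lsmul_tp_cons _ _ _ _).symm

lemma dF_left (s : S) (a : 𝒜.A.shift) (l : List 𝒜.A.shift) :
    𝒜.dF ((s • a) :: l) = s • 𝒜.dF (a :: l) := by
  rw [dF_cons, dF_cons, headF_left, GrBimod.tw_lsmul, GrBimod.consT_lsmul, smul_add]

lemma isML_dF : 𝒜.A.shift.IsML 𝒜.dF where
  add p q a b := by
    have h := 𝒜.isML_headF 𝒜.isML_b
    induction p with
    | nil =>
      have h1 := h.add [] q a b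
      simp only [List.nil_append] at h1 ⊢
      rw [dF_cons, dF_cons, dF_cons, h1, map_add, map_add, LinearMap.add_apply, add_add_add_comm]
    | cons c p ih =>
      have h1 := h.add (c :: p) q a b
      simp only [List.cons_append] at h1 ⊢
      rw [dF_cons, dF_cons, dF_cons, h1, ih, map_add, add_add_add_comm]
  smul p q c a := by
    have h := 𝒜.isML_headF 𝒜.isML_b
    induction p with
    | nil =>
      have h1 := h.smul [] q c a
      simp only [List.nil_append] at h1 ⊢
      rw [dF_cons, dF_cons, h1, map_smul, map_smul, LinearMap.smul_apply, smul_add]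
    | cons d p ih =>
      have h1 := h.smul (d :: p) q c a
      simp only [List.cons_append] at h1 ⊢
      rw [dF_cons, dF_cons, h1, ih, map_smul, smul_add]
  bal p q s a b := by
    have h := 𝒜.isML_headF 𝒜.isML_b
    induction p with
    | nil =>
      have h1 := h.bal [] q s a b
      simp only [List.nil_append] at h1 ⊢
      rw [dF_cons, dF_cons 𝒜 a, h1, GrMod.tw_rsmul, GrBimod.consT_bal, dF_left]
    | cons d p ih =>
      have h1 := h.bal (d :: p) q s a b
      simp only [List.cons_append] at h1 ⊢
      rw [dF_cons, dF_cons, h1, ih]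
  right p s a := by
    have h := 𝒜.isML_headF 𝒜.isML_b
    induction p with
    | nil =>
      have h1 := h.right [] s a
      simp only [List.nil_append] at h1 ⊢
      rw [dF_cons, dF_cons, h1, dF_nil, map_zero, map_zero, add_zero, add_zero]
    | cons d p ih =>
      have h1 := h.right (d :: p) s a
      simp only [List.cons_append] at h1 ⊢
      rw [dF_cons, dF_cons, h1, ih, GrBimod.consT_smul, smul_add]

/-- The differential of the bar construction. -/
noncomputable def delta : GrBimod.TSc 𝒜.A.shift →ₗ[k] GrBimod.TSc 𝒜.A.shift :=
  GrBimod.liftTS 𝒜.A.shift 𝒜.dF 𝒜.isML_dF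

lemma delta_tp (l : List 𝒜.A.shift) : 𝒜.delta (GrBimod.tp 𝒜.A.shift l) = 𝒜.dF l :=
  GrBimod.liftTS_tp _ _ _ l

lemma delta_rsmul (s : S) (x) : 𝒜.delta (op s • x) = op s • 𝒜.delta x :=
  GrBimod.liftTS_rsmul _ _ _ s x

lemma delta_lsmul (s : S) (x) : 𝒜.delta (s • x) = s • 𝒜.delta x :=
  GrBimod.liftTS_lsmul _ _ _ (fun s => by rw [dF_nil, smul_zero, smul_zero]) 𝒜.dF_left s x

lemma delta_mem (j : ℤ) (x) (hx : x ∈ (GrBimod.TS 𝒜.A.shift).gr j) :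
    𝒜.delta x ∈ (GrBimod.TS 𝒜.A.shift).gr (j + 1) := by
  refine GrBimod.TS_gr_le 𝒜.A.shift j
    (((GrBimod.TS 𝒜.A.shift).gr (j + 1)).comap 𝒜.delta) ?_ ?_ hx
  · intro s x hx
    rw [Submodule.mem_comap, delta_rsmul]
    exact (GrBimod.TS 𝒜.A.shift).rsmul_mem _ s _ hx
  · rintro l ds hl rfl
    rw [Submodule.mem_comap, delta_tp, dF, splitSum₃]
    refine splitSum_mem ((GrBimod.TS 𝒜.A.shift).gr (ds.sum + 1)) fun p x h => ?_
    refine splitSum_mem ((GrBimod.TS 𝒜.A.shift).gr (ds.sum + 1)) fun q r h' => ?_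
    subst h' h
    obtain ⟨d1, d', rfl, h1, h'⟩ := GrBimod.homList_append _ hl
    obtain ⟨d2, d3, rfl, h2, h3⟩ := GrBimod.homList_append _ h'
    have hb : 𝒜.b q ∈ 𝒜.A.shift.gr (d2.sum + 1) := by
      have := 𝒜.m_mem _ _ (GrBimod.homList_twist 𝒜.A (GrBimod.homList_shift 𝒜.A h2))
      have hs : ∀ d : List ℤ, (d.map (· + 1)).sum = d.sum + d.length := fun d => by
        induction d with
        | nil => simp
        | cons a d ih => simp only [List.map_cons, List.sum_cons, List.length_cons, ih]; push_cast; ring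
      rw [hs, GrBimod.twist_length, ← List.Forall₂.length_eq h2] at this
      rw [show d2.sum + (q.length : ℤ) + (2 - q.length) = d2.sum + 1 + 1 by ring] at this
      exact this
    have := GrBimod.tp_mem 𝒜.A.shift
      (List.rel_append (GrBimod.homList_tw 𝒜.A.shift h1 1) (List.Forall₂.cons hb h3))
    convert this using 2
    simp only [List.sum_append, List.sum_cons]
    ring

lemma mu_headF (l : List 𝒜.A.shift) : GrBimod.muT 𝒜.A.shift (𝒜.headF 𝒜.b l) =
    BTen.tm k S (GrBimod.tp 𝒜.A.shift []) (𝒜.headF 𝒜.b l) +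
      splitSum (fun p q => BTen.tm k S (𝒜.headF 𝒜.b p) (GrBimod.tp 𝒜.A.shift q)) l := by
  let V := 𝒜.A.shift
  have e1 := splitSum_map (GrBimod.muT V).toAddMonoidHom (fun q r => GrBimod.tp V (𝒜.b q :: r)) l
  have e2 := splitSum_map (BTen.mk k S (GrBimod.tp V [])).toAddMonoidHom
    (fun q r => GrBimod.tp V (𝒜.b q :: r)) l
  refine e1.trans ?_
  have e3 : ∀ q r, (GrBimod.muT V).toAddMonoidHom (GrBimod.tp V (𝒜.b q :: r)) =
      (BTen.mk k S (GrBimod.tp V [])).toAddMonoidHom (GrBimod.tp V (𝒜.b q :: r)) +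
        splitSum (fun r' r'' => BTen.tm k S (GrBimod.tp V (𝒜.b q :: r')) (GrBimod.tp V r'')) r := by
    intro q r
    change GrBimod.muT V (GrBimod.tp V (𝒜.b q :: r)) = _
    rw [GrBimod.muT_tp, GrBimod.muF_cons, GrBimod.muF]
    congr 1
    exact splitSum_map (GrBimod.consL V (𝒜.b q)).toAddMonoidHom _ _
  simp only [e3]
  rw [splitSum_add]
  congr 1
  · exact e2.symm
  · rw [← splitSum_splitSum
      (fun q r' r'' => BTen.tm k S (GrBimod.tp V (𝒜.b q :: r')) (GrBimod.tp V r''))]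
    refine splitSum_congr fun p q _ => ?_
    exact (splitSum_map ((BTen.mk k S).flip (GrBimod.tp V q)).toAddMonoidHom
      (fun q r => GrBimod.tp V (𝒜.b q :: r)) p).symm

lemma headF_b_nil : 𝒜.headF 𝒜.b [] = 0 := by
  rw [headF_nil, b_nil]
  exact (GrBimod.isML_tp 𝒜.A.shift).zero 𝒜.A.shift [] []

lemma mu_dF (l : List 𝒜.A.shift) : GrBimod.muT 𝒜.A.shift (𝒜.dF l) =
    splitSum (fun p q =>
      BTen.tm k S ((GrBimod.TS 𝒜.A.shift).tw 1 (GrBimod.tp 𝒜.A.shift p)) (𝒜.dF q) +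
        BTen.tm k S (𝒜.dF p) (GrBimod.tp 𝒜.A.shift q)) l := by
  induction l with
  | nil => rw [splitSum_nil, dF_nil]; simp
  | cons a l ih =>
    have hc : ∀ p, (GrBimod.TS 𝒜.A.shift).tw 1 (GrBimod.tp 𝒜.A.shift (a :: p)) =
        GrBimod.consT 𝒜.A.shift (𝒜.A.shift.tw 1 a)
          ((GrBimod.TS 𝒜.A.shift).tw 1 (GrBimod.tp 𝒜.A.shift p)) := fun p => by
      rw [GrBimod.tw_tp, GrBimod.tw_tp]; rfl
    have h0 : (GrBimod.TS 𝒜.A.shift).tw 1 (GrBimod.tp 𝒜.A.shift []) = GrBimod.tp 𝒜.A.shift [] := by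
      rw [GrBimod.tw_tp]; rfl
    have e1 := splitSum_map (GrBimod.consL 𝒜.A.shift (𝒜.A.shift.tw 1 a)).toAddMonoidHom
      (fun p q =>
        BTen.tm k S ((GrBimod.TS 𝒜.A.shift).tw 1 (GrBimod.tp 𝒜.A.shift p)) (𝒜.dF q) +
          BTen.tm k S (𝒜.dF p) (GrBimod.tp 𝒜.A.shift q)) l
    rw [dF_cons, map_add, mu_headF, GrBimod.muT_consT, ih]
    refine (congrArg (fun z => _ + (_ + z)) e1).trans ?_
    rw [splitSum_cons, splitSum_cons, headF_b_nil, dF_nil, h0, dF_cons, BTen.tm_add]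
    simp only [BTen.zero_tm, add_zero, zero_add]
    have e2 : splitSum (fun p q =>
        BTen.tm k S ((GrBimod.TS 𝒜.A.shift).tw 1 (GrBimod.tp 𝒜.A.shift (a :: p))) (𝒜.dF q) +
          BTen.tm k S (𝒜.dF (a :: p)) (GrBimod.tp 𝒜.A.shift q)) l =
        splitSum (fun p q => BTen.tm k S (𝒜.headF 𝒜.b (a :: p)) (GrBimod.tp 𝒜.A.shift q)) l +
        splitSum (fun p q => (GrBimod.consL 𝒜.A.shift (𝒜.A.shift.tw 1 a)).toAddMonoidHom
          (BTen.tm k S ((GrBimod.TS 𝒜.A.shift).tw 1 (GrBimod.tp 𝒜.A.shift p)) (𝒜.dF q) +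
            BTen.tm k S (𝒜.dF p) (GrBimod.tp 𝒜.A.shift q))) l := by
      rw [← splitSum_add]
      refine splitSum_congr fun p q _ => ?_
      rw [map_add, hc, dF_cons, BTen.add_tm]
      exact add_left_comm _ _ _
    rw [e2]
    abel

lemma mu_delta (x) : GrBimod.muT 𝒜.A.shift (𝒜.delta x) =
    BTen.map ((GrBimod.TS 𝒜.A.shift).tw 1) 𝒜.delta ((GrBimod.TS 𝒜.A.shift).tw_rsmul 1)
      𝒜.delta_lsmul (GrBimod.muT 𝒜.A.shift x) +
      BTen.map 𝒜.delta LinearMap.id 𝒜.delta_rsmul (fun _ _ => rfl) (GrBimod.muT 𝒜.A.shift x) := by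
  set f := BTen.map ((GrBimod.TS 𝒜.A.shift).tw 1) 𝒜.delta ((GrBimod.TS 𝒜.A.shift).tw_rsmul 1)
      𝒜.delta_lsmul + BTen.map 𝒜.delta LinearMap.id 𝒜.delta_rsmul (fun _ _ => rfl) with hf
  have ff : ∀ (s : S) z, f (op s • z) = op s • f z := fun s z => by
    induction z using BTen.induction with
    | ht x y =>
      change BTen.tm k S _ (𝒜.delta (op s • y)) + _ = op s • (BTen.tm k S _ (𝒜.delta y) + _)
      rw [delta_rsmul, smul_add]; rfl
    | ha x y hx hy => simp only [map_add, hx, hy, smul_add]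
  change _ = f (GrBimod.muT 𝒜.A.shift x)
  induction x using GrBimod.tp_induction with
  | ht l s =>
    rw [delta_rsmul, GrBimod.muT_rsmul, GrBimod.muT_rsmul, ff, delta_tp, mu_dF, GrBimod.muT_tp,
      GrBimod.muF]
    congr 1
    refine Eq.trans ?_ (splitSum_map f.toAddMonoidHom _ l).symm
    refine splitSum_congr fun p q _ => ?_
    rw [← delta_tp, ← delta_tp]; rfl
  | ha x y hx hy => simp only [map_add, hx, hy]

lemma eps_dF (l : List 𝒜.A.shift) : GrBimod.epsT 𝒜.A.shift (𝒜.dF l) = 0 := by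
  cases l with
  | nil => rw [dF_nil, map_zero]
  | cons a l =>
    rw [dF_cons, map_add, GrBimod.epsT_consT, add_zero, headF]
    refine (splitSum_map (GrBimod.epsT 𝒜.A.shift).toAddMonoidHom _ _).trans ?_
    exact splitSum_eq_zero fun p q _ => GrBimod.epsT_consT _ _ _

lemma eps_delta (x) : GrBimod.epsT 𝒜.A.shift (𝒜.delta x) = 0 := by
  induction x using GrBimod.tp_induction with
  | ht l s => rw [delta_rsmul, GrBimod.epsT_rsmul, delta_tp, eps_dF, zero_mul]
  | ha x y hx hy => simp only [map_add, hx, hy, add_zero]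

lemma pr_headF (β : List 𝒜.A.shift → 𝒜.A.shift) (l : List 𝒜.A.shift) :
    GrBimod.prT 𝒜.A.shift (𝒜.headF β l) = β l := by
  induction l generalizing β with
  | nil => rw [headF_nil, GrBimod.prT_tp]; rfl
  | cons a l ih => rw [headF_cons, map_add, GrBimod.prT_tp, ih]; simp [GrBimod.prF]

lemma pr_dF (l : List 𝒜.A.shift) : GrBimod.prT 𝒜.A.shift (𝒜.dF l) = 𝒜.b l := by
  cases l with
  | nil => rw [dF_nil, map_zero, b_nil]
  | cons a l =>
    rw [dF_cons, map_add, pr_headF, GrBimod.prT_consT, eps_dF, op_zero, zero_smul, add_zero]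

/-- The map `T_S(A[1]) → A[1]` with components `b_n`. -/
noncomputable def bT : GrBimod.TSc 𝒜.A.shift →ₗ[k] 𝒜.A.shift :=
  GrBimod.liftTS 𝒜.A.shift 𝒜.b 𝒜.isML_b

lemma pr_delta (x) : GrBimod.prT 𝒜.A.shift (𝒜.delta x) = 𝒜.bT x := by
  induction x using GrBimod.tp_induction with
  | ht l s =>
    rw [delta_rsmul, GrBimod.prT_rsmul, bT, GrBimod.liftTS_rsmul, GrBimod.liftTS_tp, delta_tp,
      pr_dF]
  | ha x y hx hy => simp only [map_add, hx, hy]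

lemma bT_dF (l : List 𝒜.A.shift) : 𝒜.bT (𝒜.dF l) = 0 := by
  rw [← 𝒜.b_b l]
  refine (splitSum_map 𝒜.bT.toAddMonoidHom _ _).trans (splitSum_congr fun p x _ => ?_)
  refine (splitSum_map 𝒜.bT.toAddMonoidHom _ _).trans (splitSum_congr fun q r _ => ?_)
  exact GrBimod.liftTS_tp _ _ _ _

lemma delta_delta (x) : 𝒜.delta (𝒜.delta x) = 0 := by
  have hmu : ∀ x, GrBimod.muT 𝒜.A.shift (𝒜.delta (𝒜.delta x)) =
      BTen.map LinearMap.id (𝒜.delta ∘ₗ 𝒜.delta) (fun _ _ => rfl)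
        (fun s y => by simp only [LinearMap.comp_apply, delta_lsmul])
        (GrBimod.muT 𝒜.A.shift x) +
      BTen.map (𝒜.delta ∘ₗ 𝒜.delta) LinearMap.id
        (fun s y => by simp only [LinearMap.comp_apply, delta_rsmul]) (fun _ _ => rfl)
        (GrBimod.muT 𝒜.A.shift x) := by
    intro x
    have ht : ∀ x, (GrBimod.TS 𝒜.A.shift).tw 1 (𝒜.delta x) =
        - 𝒜.delta ((GrBimod.TS 𝒜.A.shift).tw 1 x) := by
      intro x
      induction x using (GrBimod.TS 𝒜.A.shift).toGrMod.induction_homog with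
      | hm j x hx =>
        rw [GrMod.tw_of_mem _ 1 (𝒜.delta_mem j x hx), GrMod.tw_of_mem _ 1 hx, map_zsmul, mul_add,
          mul_one, sgn_add, sgn_one, mul_neg, mul_one, neg_smul]
      | ha x y hx hy => simp only [map_add, hx, hy, neg_add]
    rw [mu_delta, mu_delta]
    refine LinearMap.congr_fun (BTen.ext (f := (BTen.map ((GrBimod.TS 𝒜.A.shift).tw 1) 𝒜.delta
      ((GrBimod.TS 𝒜.A.shift).tw_rsmul 1) 𝒜.delta_lsmul +
      BTen.map 𝒜.delta LinearMap.id 𝒜.delta_rsmul (fun _ _ => rfl)) ∘ₗ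
        (BTen.map ((GrBimod.TS 𝒜.A.shift).tw 1) 𝒜.delta
      ((GrBimod.TS 𝒜.A.shift).tw_rsmul 1) 𝒜.delta_lsmul +
      BTen.map 𝒜.delta LinearMap.id 𝒜.delta_rsmul (fun _ _ => rfl)))
      (g := BTen.map LinearMap.id (𝒜.delta ∘ₗ 𝒜.delta) _ _ +
        BTen.map (𝒜.delta ∘ₗ 𝒜.delta) LinearMap.id _ _) fun u v => ?_) _
    simp only [LinearMap.add_apply, map_add, BTen.map_tm, LinearMap.id_apply, LinearMap.comp_apply]
    rw [GrMod.tw_tw, GrMod.tw_even _ (by decide), ht]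
    have : BTen.tm k S (- 𝒜.delta ((GrBimod.TS 𝒜.A.shift).tw 1 u)) (𝒜.delta v) =
      - BTen.tm k S (𝒜.delta ((GrBimod.TS 𝒜.A.shift).tw 1 u)) (𝒜.delta v) := by simp [BTen.tm]
    rw [this]
    abel
  have key : ∀ l, 𝒜.delta (𝒜.delta (GrBimod.tp 𝒜.A.shift l)) = 0 := by
    intro l
    induction l with
    | nil => rw [delta_tp, dF_nil, map_zero]
    | cons a l ih =>
      have h0 : ∀ x : GrBimod.TSc 𝒜.A.shift, GrBimod.prT 𝒜.A.shift (𝒜.delta (𝒜.delta x)) = 0 := by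
        intro x
        rw [pr_delta]
        induction x using GrBimod.tp_induction with
        | ht l s => rw [delta_rsmul, bT, GrBimod.liftTS_rsmul, ← bT, delta_tp, bT_dF, smul_zero]
        | ha x y hx hy => simp only [map_add, hx, hy, add_zero]
      rw [GrBimod.eq_join 𝒜.A.shift (𝒜.delta (𝒜.delta (GrBimod.tp 𝒜.A.shift (a :: l)))), eps_delta,
        op_zero, zero_smul, zero_add, hmu, map_add]
      have h1 : ∀ z, GrBimod.prJoin 𝒜.A.shift (BTen.map (𝒜.delta ∘ₗ 𝒜.delta) LinearMap.id
          (fun s y => by simp only [LinearMap.comp_apply, delta_rsmul]) (fun _ _ => rfl) z) = 0 := by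
        intro z
        induction z using BTen.induction with
        | ht x y =>
          rw [BTen.map_tm, GrBimod.prJoin_tm, LinearMap.comp_apply, h0, map_zero,
            LinearMap.zero_apply]
        | ha x y hx hy => simp only [map_add, hx, hy, add_zero]
      rw [h1, add_zero, GrBimod.muT_tp, GrBimod.muF_cons, map_add, BTen.map_tm, map_add,
        GrBimod.prJoin_tm, LinearMap.id_apply, GrBimod.prT_tp]
      have h2 : ∀ z, GrBimod.prJoin 𝒜.A.shift (BTen.map LinearMap.id (𝒜.delta ∘ₗ 𝒜.delta)
          (fun _ _ => rfl) (fun s y => by simp only [LinearMap.comp_apply, delta_lsmul])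
          (GrBimod.consL 𝒜.A.shift a z)) = GrBimod.consT 𝒜.A.shift a (𝒜.delta (𝒜.delta
            (epsL (GrBimod.epsT 𝒜.A.shift) (GrBimod.epsT_rsmul 𝒜.A.shift) z))) := by
        intro z
        induction z using BTen.induction with
        | ht x y =>
          rw [GrBimod.consL_tm, BTen.map_tm, GrBimod.prJoin_tm, LinearMap.id_apply,
            GrBimod.prT_consT, GrBimod.consT_bal, epsL_tm, delta_lsmul, delta_lsmul]
          rfl
        | ha x y hx hy => simp only [map_add, hx, hy]
      rw [h2, ← GrBimod.muT_tp, GrBimod.counitL, ih, map_zero]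
      simp [GrBimod.prF]
  induction x using GrBimod.tp_induction with
  | ht l s => rw [delta_rsmul, delta_rsmul, key, smul_zero]
  | ha x y hx hy => simp only [map_add, hx, hy, add_zero]

end AInfAlg

namespace AInfAlg

variable (𝒜 : AInfAlg.{uk, uS, uA} k S)

/-- The bar construction of `A`: the bocs `B_A = T_S(A[1])`, with the deconcatenation
comultiplication, the projection `T_S(A[1]) → S` as counit, and the differential
`∑ id^{⊗ r} ⊗ b_s ⊗ id^{⊗ t}`. -/
noncomputable def bar : NormalBocs.{uk, uS, max uS uA} k S where
  C := GrBimod.TS 𝒜.A.shift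
  mu := GrBimod.muT 𝒜.A.shift
  mu_lsmul := GrBimod.muT_lsmul 𝒜.A.shift
  mu_rsmul := GrBimod.muT_rsmul 𝒜.A.shift
  mu_mem := GrBimod.muT_mem 𝒜.A.shift
  eps := GrBimod.epsT 𝒜.A.shift
  eps_lsmul := GrBimod.epsT_lsmul 𝒜.A.shift
  eps_rsmul := GrBimod.epsT_rsmul 𝒜.A.shift
  eps_of_ne := GrBimod.epsT_of_ne 𝒜.A.shift
  coassoc := GrBimod.muT_coassoc 𝒜.A.shift
  counit_left := GrBimod.counitL 𝒜.A.shift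
  counit_right := GrBimod.counitR 𝒜.A.shift
  delta := 𝒜.delta
  delta_lsmul := 𝒜.delta_lsmul
  delta_rsmul := 𝒜.delta_rsmul
  delta_mem := 𝒜.delta_mem
  coder := 𝒜.mu_delta
  delta_delta := 𝒜.delta_delta
  one := GrBimod.tp 𝒜.A.shift []
  one_mem := GrBimod.tp_mem 𝒜.A.shift (ds := []) .nil
  smul_one := GrBimod.lsmul_tp_nil 𝒜.A.shift
  eps_one := GrBimod.epsT_tp 𝒜.A.shift []
  mu_one := by rw [GrBimod.muT_tp, GrBimod.muF_nil]

variable {M N L P : GrMod.{uk, uS, w} k S}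

/-- A family `{f_n}_{n ≥ 1}` of right `S`-linear maps `f_n : M ⊗_S A^{⊗ (n - 1)} → N`, packed in
the function `f` with `f_n(x ⊗ a_1 ⊗ ⋯ ⊗ a_{n-1}) = f x [a_1, …, a_{n-1}]`. -/
structure IsFam (f : M → List 𝒜.A → N) : Prop where
  add : ∀ x y l, f (x + y) l = f x l + f y l
  smul : ∀ (c : k) x l, f (c • x) l = c • f x l
  isML : ∀ x, 𝒜.A.IsML (f x)
  bal : ∀ (s : S) x a l, f (op s • x) (a :: l) = f x ((s • a) :: l)
  right : ∀ (s : S) x, f (op s • x) [] = op s • f x []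

/-- The homogeneous morphisms `f = {f_n}` of degree `d` in `GMod-A`: each
`f_n : M ⊗_S A^{⊗ (n - 1)} → N` is a homogeneous map of right `S`-modules of degree `d + 1 - n`. -/
def FHom (d : ℤ) (M N : GrMod.{uk, uS, w} k S) : Submodule k (M → List 𝒜.A → N) where
  carrier := {f | 𝒜.IsFam f ∧ ∀ i x l ds, x ∈ M.gr i → 𝒜.A.HomList l ds →
    f x l ∈ N.gr (i + ds.sum + (d - l.length))}
  add_mem' := by
    rintro f g ⟨hf, hf'⟩ ⟨hg, hg'⟩
    exact ⟨{
      add := fun x y l => by simp only [Pi.add_apply, hf.add, hg.add]; abel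
      smul := fun c x l => by simp only [Pi.add_apply, hf.smul, hg.smul, smul_add]
      isML := fun x => (GrBimod.mlSub 𝒜.A N).add_mem (hf.isML x) (hg.isML x)
      bal := fun s x a l => by simp only [Pi.add_apply, hf.bal, hg.bal]
      right := fun s x => by simp only [Pi.add_apply, hf.right, hg.right, smul_add] },
      fun i x l ds hx hl => add_mem (hf' i x l ds hx hl) (hg' i x l ds hx hl)⟩
  zero_mem' := ⟨{
      add := fun x y l => (add_zero _).symm
      smul := fun c x l => (smul_zero _).symm
      isML := fun x => (GrBimod.mlSub 𝒜.A N).zero_mem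
      bal := fun s x a l => rfl
      right := fun s x => (smul_zero _).symm }, fun _ _ _ _ _ _ => zero_mem _⟩
  smul_mem' := by
    rintro c f ⟨hf, hf'⟩
    exact ⟨{
      add := fun x y l => by simp only [Pi.smul_apply, hf.add, smul_add]
      smul := fun c' x l => by simp only [Pi.smul_apply, hf.smul, smul_comm c c']
      isML := fun x => (GrBimod.mlSub 𝒜.A N).smul_mem c (hf.isML x)
      bal := fun s x a l => by simp only [Pi.smul_apply, hf.bal]
      right := fun s x => by simp only [Pi.smul_apply, hf.right, smul_comm c (op s)] },
      fun i x l ds hx hl => Submodule.smul_mem _ c (hf' i x l ds hx hl)⟩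

variable {𝒜}

lemma IsFam.zsmul {f : M → List 𝒜.A → N} (hf : 𝒜.IsFam f) (c : ℤ) (x : M) (l : List 𝒜.A) :
    f (c • x) l = c • f x l :=
  (AddMonoidHom.mk' (fun x => f x l) (fun x y => hf.add x y l)).map_zsmul c x

lemma FHom.tw {d : ℤ} {f : M → List 𝒜.A → N} (hf : f ∈ 𝒜.FHom d M N) (n : ℤ) (x : M)
    (l : List 𝒜.A) : f (M.tw n x) (l.map (𝒜.A.tw n)) =
      sgn (n * (d - l.length)) • N.tw n (f x l) := by
  induction x using M.induction_homog with
  | hm i x hx =>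
    have := (hf.1.isML x).map_tw_eq 𝒜.A (N := N) (fun r => i + (d - r)) (fun l ds hl => by
      have := hf.2 i x l ds hx hl
      rwa [show i + ds.sum + (d - (l.length : ℤ)) = ds.sum + (i + (d - l.length)) by ring] at this)
      n l
    rw [M.tw_of_mem n hx, hf.1.zsmul, this, smul_smul, ← sgn_add]
    congr 1
    exact sgn_eq_of_even ⟨n * i, by ring1⟩
  | ha x y hx hy => simp only [map_add, hf.1.add, hx, hy, smul_add]

lemma IsFam.isML_hat {f : M → List 𝒜.A → N} (hf : 𝒜.IsFam f) (x : M) :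
    𝒜.A.shift.IsML (fun l => f (M.tw l.length x) (𝒜.A.twist l)) where
  add p q a b := by
    have := ((hf.isML (M.tw (p.length + (q.length + 1) : ℕ) x)).twist 𝒜.A).add p q a b
    simpa only [List.length_append, List.length_cons] using this
  smul p q c a := by
    have := ((hf.isML (M.tw (p.length + (q.length + 1) : ℕ) x)).twist 𝒜.A).smul p q c a
    simpa only [List.length_append, List.length_cons] using this
  bal p q s a b := by
    have := ((hf.isML (M.tw (p.length + (q.length + 1 + 1) : ℕ) x)).twist 𝒜.A).bal p q s a b
    simpa only [List.length_append, List.length_cons] using this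
  right p s a := by
    have := ((hf.isML (M.tw (p.length + (0 + 1) : ℕ) x)).twist 𝒜.A).right p s a
    simpa only [List.length_append, List.length_cons, List.length_nil] using this

/-- The linear map `f̂(x ⊗ -)` on `T_S(A[1])`. -/
noncomputable def hatAux (f : M → List 𝒜.A → N) (hf : 𝒜.IsFam f) (x : M) :
    GrBimod.TSc 𝒜.A.shift →ₗ[k] N :=
  GrBimod.liftTS 𝒜.A.shift (fun l => f (M.tw l.length x) (𝒜.A.twist l)) (hf.isML_hat x)

lemma hatAux_tp (f : M → List 𝒜.A → N) (hf : 𝒜.IsFam f) (x : M) (l : List 𝒜.A.shift) :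
    hatAux f hf x (GrBimod.tp 𝒜.A.shift l) = f (M.tw l.length x) (𝒜.A.twist l) :=
  GrBimod.liftTS_tp _ _ _ l

lemma hatAux_rsmul (f : M → List 𝒜.A → N) (hf : 𝒜.IsFam f) (x : M) (s : S) (c) :
    hatAux f hf x (op s • c) = op s • hatAux f hf x c := GrBimod.liftTS_rsmul _ _ _ s c

lemma hatAux_add (f : M → List 𝒜.A → N) (hf : 𝒜.IsFam f) (x y : M) :
    hatAux f hf (x + y) = hatAux f hf x + hatAux f hf y :=
  GrBimod.tp_ext _ (hatAux_rsmul f hf _)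
    (fun s c => by
      rw [LinearMap.add_apply, LinearMap.add_apply, hatAux_rsmul, hatAux_rsmul, smul_add])
    (fun l => by rw [LinearMap.add_apply, hatAux_tp, hatAux_tp, hatAux_tp, map_add, hf.add])

lemma hatAux_smul (f : M → List 𝒜.A → N) (hf : 𝒜.IsFam f) (c : k) (x : M) :
    hatAux f hf (c • x) = c • hatAux f hf x :=
  GrBimod.tp_ext _ (hatAux_rsmul f hf _)
    (fun s y => by
      rw [LinearMap.smul_apply, LinearMap.smul_apply, hatAux_rsmul, smul_comm])
    (fun l => by rw [LinearMap.smul_apply, hatAux_tp, hatAux_tp, map_smul, hf.smul])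

lemma hatAux_bal (f : M → List 𝒜.A → N) (hf : 𝒜.IsFam f) (x : M) (s : S)
    (c : GrBimod.TSc 𝒜.A.shift) : hatAux f hf (op s • x) c = hatAux f hf x (s • c) := by
  induction c using GrBimod.tp_induction with
  | ht l t =>
    rw [smul_comm s, hatAux_rsmul, hatAux_rsmul]
    congr 1
    cases l with
    | nil =>
      rw [GrBimod.lsmul_tp_nil, hatAux_rsmul, hatAux_tp, hatAux_tp, GrMod.tw_rsmul]
      exact hf.right s _
    | cons a l =>
      rw [GrBimod.lsmul_tp_cons, hatAux_tp, hatAux_tp, GrMod.tw_rsmul]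
      refine (hf.bal s _ _ _).trans ?_
      rw [← GrBimod.tw_lsmul]; rfl
  | ha x y hx hy => simp only [map_add, smul_add, hx, hy]

/-- The morphism `f̂ : M[1] → N[1]` of `B_A`-modules that corresponds to a family `f`, with
`f̂ ∘ (σ_M ⊗ σ^{⊗ n}) = σ_N ∘ f_{n + 1}`. -/
noncomputable def hat (f : M → List 𝒜.A → N) (hf : 𝒜.IsFam f) :
    𝒜.bar.BMor M.shift N.shift :=
  DGBocs.mkMor (BTen.lift (S := S) (M := M) (P := N)
    { toFun := hatAux f hf
      map_add' := hatAux_add f hf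
      map_smul' := hatAux_smul f hf }
    (fun x s c => hatAux_bal f hf x s c))
    (fun s m c => hatAux_rsmul f hf m s c)

lemma hat_tp (f : M → List 𝒜.A → N) (hf : 𝒜.IsFam f) (x : M) (l : List 𝒜.A) :
    hat f hf (BTen.tm k S x (GrBimod.tp 𝒜.A.shift l)) = f (M.tw l.length x) (𝒜.A.twist l) :=
  hatAux_tp f hf x l

/-- The linear map `φ(x ⊗ -)` on `T_S(A[1])`. -/
noncomputable def unAux (φ : 𝒜.bar.BMor M.shift N.shift) (x : M) :
    GrBimod.TSc 𝒜.A.shift →ₗ[k] N := DGBocs.at_ φ x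

lemma unAux_add (φ : 𝒜.bar.BMor M.shift N.shift) (x y : M) (c : GrBimod.TSc 𝒜.A.shift) :
    unAux φ (x + y) c = unAux φ x c + unAux φ y c :=
  (congrArg φ (BTen.add_tm k S (M := M.shift) (N := 𝒜.bar.C) x y c)).trans (φ.map_add _ _)

lemma unAux_smul (φ : 𝒜.bar.BMor M.shift N.shift) (a : k) (x : M) (c : GrBimod.TSc 𝒜.A.shift) :
    unAux φ (a • x) c = a • unAux φ x c :=
  (congrArg φ (BTen.smul_tm k S (M := M.shift) (N := 𝒜.bar.C) a x c)).trans
    ((φ.restrictScalars k).map_smul a _)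

lemma unAux_bal (φ : 𝒜.bar.BMor M.shift N.shift) (s : S) (x : M) (c : GrBimod.TSc 𝒜.A.shift) :
    unAux φ (op s • x) c = unAux φ x (s • c) :=
  congrArg φ (BTen.tm_bal k S (M := M.shift) (N := 𝒜.bar.C) x s c)

lemma unAux_rsmul (φ : 𝒜.bar.BMor M.shift N.shift) (x : M) (s : S) (c : GrBimod.TSc 𝒜.A.shift) :
    unAux φ x (op s • c) = op s • unAux φ x c := DGBocs.at_rsmul φ x s c

/-- The family that corresponds to a morphism of `B_A`-modules. -/
noncomputable def unhat (φ : 𝒜.bar.BMor M.shift N.shift) : M → List 𝒜.A → N := fun x l =>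
  unAux φ (M.tw l.length x) (GrBimod.tp 𝒜.A.shift (𝒜.A.twist l))

lemma bmor_ext_tp {φ ψ : 𝒜.bar.BMor M N} (h : ∀ x l,
    φ (BTen.tm k S x (GrBimod.tp 𝒜.A.shift l)) = ψ (BTen.tm k S x (GrBimod.tp 𝒜.A.shift l))) :
    φ = ψ := by
  refine DGBocs.bmor_ext fun x c => ?_
  exact LinearMap.congr_fun (GrBimod.tp_ext 𝒜.A.shift (f := DGBocs.at_ φ x) (g := DGBocs.at_ ψ x)
    (DGBocs.at_rsmul φ x) (DGBocs.at_rsmul ψ x) (h x)) c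

lemma unhat_inj {φ ψ : 𝒜.bar.BMor M.shift N.shift} (h : unhat φ = unhat ψ) : φ = ψ := by
  refine bmor_ext_tp fun x l => ?_
  have := congrFun (congrFun h (M.tw l.length x)) (𝒜.A.twist l)
  simp only [unhat, GrBimod.twist_twist, GrBimod.twist_length, GrMod.tw_tw,
    GrMod.tw_even _ (Even.add_self _)] at this
  exact this

lemma unhat_hat (f : M → List 𝒜.A → N) (hf : 𝒜.IsFam f) : unhat (hat f hf) = f := by
  funext x l
  refine (hat_tp f hf _ _).trans ?_
  rw [GrBimod.twist_twist, GrBimod.twist_length, GrMod.tw_tw,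
    GrMod.tw_even _ (Even.add_self _)]

lemma isFam_unhat (φ : 𝒜.bar.BMor M.shift N.shift) : 𝒜.IsFam (unhat φ) where
  add x y l := by simp only [unhat, map_add, unAux_add]
  smul c x l := by simp only [unhat, map_smul, unAux_smul]
  isML x := by
    have h : 𝒜.A.IsML (fun l => GrBimod.tp 𝒜.A.shift (𝒜.A.twist l)) :=
      GrBimod.IsML.twist 𝒜.A ⟨(GrBimod.isML_tp 𝒜.A.shift).add, (GrBimod.isML_tp 𝒜.A.shift).smul,
        (GrBimod.isML_tp 𝒜.A.shift).bal, (GrBimod.isML_tp 𝒜.A.shift).right⟩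
    refine ⟨fun p q a b => ?_, fun p q c a => ?_, fun p q s a b => ?_, fun p s a => ?_⟩
    · simp only [unhat, h.add, map_add, List.length_append, List.length_cons]
    · simp only [unhat, h.smul, map_smul, List.length_append, List.length_cons]
    · simp only [unhat, h.bal, List.length_append, List.length_cons]
    · have := h.right p s a
      simp only [unhat, this, unAux_rsmul, List.length_append, List.length_cons, List.length_nil]
  bal s x a l := by
    simp only [unhat, GrMod.tw_rsmul, List.length_cons, GrBimod.twist, GrBimod.tw_lsmul, unAux_bal]
    exact congrArg (unAux φ _) (GrBimod.lsmul_tp_cons 𝒜.A.shift s _ _)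
  right s x := by
    simp only [unhat, GrMod.tw_rsmul, GrBimod.twist, unAux_bal]
    rw [GrBimod.lsmul_tp_nil, unAux_rsmul]

lemma hat_unhat (φ : 𝒜.bar.BMor M.shift N.shift) : hat (unhat φ) (isFam_unhat φ) = φ :=
  unhat_inj (unhat_hat _ _)

lemma hat_mem {d : ℤ} {f : M → List 𝒜.A → N} (hf : f ∈ 𝒜.FHom d M N) :
    hat f hf.1 ∈ 𝒜.bar.BHom d M.shift N.shift := by
  intro i j x c hx hc
  have h := GrBimod.TS_gr_le 𝒜.A.shift j ((N.gr (i + j + d + 1)).comap (hatAux f hf.1 x))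
    (fun s c hc => by
      rw [Submodule.mem_comap, hatAux_rsmul]
      exact N.rsmul_mem _ s _ hc)
    (fun l ds hl hs => by
      rw [Submodule.mem_comap, hatAux_tp]
      have := hf.2 (i + 1) _ _ _ (M.tw_mem l.length hx)
        (GrBimod.homList_twist 𝒜.A (GrBimod.homList_shift 𝒜.A hl))
      have hs' : ∀ d : List ℤ, (d.map (· + 1)).sum = d.sum + d.length := fun d => by
        induction d with
        | nil => simp
        | cons a d ih => simp only [List.map_cons, List.sum_cons, List.length_cons, ih]; push_cast; ring
      rw [hs', GrBimod.twist_length, ← List.Forall₂.length_eq hl, hs] at this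
      rwa [show i + 1 + (j + (l.length : ℤ)) + (d - l.length) = i + j + d + 1 by ring] at this)
  exact h hc

lemma homList_unshift {l : List 𝒜.A} {ds : List ℤ} (h : 𝒜.A.HomList l ds) :
    𝒜.A.shift.HomList l (ds.map (· - 1)) := by
  induction h with
  | nil => exact .nil
  | @cons a d l ds h _ ih =>
    refine .cons ?_ ih
    change a ∈ 𝒜.A.gr (d - 1 + 1)
    rwa [sub_add_cancel]

lemma unhat_mem {d : ℤ} {φ : 𝒜.bar.BMor M.shift N.shift} (h : φ ∈ 𝒜.bar.BHom d M.shift N.shift) :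
    unhat φ ∈ 𝒜.FHom d M N := by
  refine ⟨isFam_unhat φ, fun i x l ds hx hl => ?_⟩
  have hx' : M.tw l.length x ∈ M.shift.gr (i - 1) := by
    change _ ∈ M.gr (i - 1 + 1)
    rw [sub_add_cancel]; exact M.tw_mem _ hx
  have h1 := h _ _ _ _ hx' (GrBimod.tp_mem _ (homList_unshift (GrBimod.homList_twist 𝒜.A hl)))
  have hs' : ∀ d : List ℤ, (d.map (· - 1)).sum = d.sum - d.length := fun d => by
    induction d with
    | nil => simp
    | cons a d ih => simp only [List.map_cons, List.sum_cons, List.length_cons, ih]; push_cast; ring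
  rw [hs', ← List.Forall₂.length_eq hl] at h1
  change _ ∈ N.gr (i - 1 + (ds.sum - l.length) + d + 1) at h1
  rwa [show i - 1 + (ds.sum - (l.length : ℤ)) + d + 1 = i + ds.sum + (d - l.length) by ring] at h1

/-- The composition of `f : M → N` of degree `d` with `g : N → L` in `GMod-A`:
`(g ∘ f)_n = ∑_{r + s = n, r ≥ 1, s ≥ 0} (-1)^{(d + r + 1) s} g_{1 + s} (f_r ⊗ id^{⊗ s})`. -/
def fcomp (d : ℤ) (g : N → List 𝒜.A → L) (f : M → List 𝒜.A → N) : M → List 𝒜.A → L := fun x l =>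
  splitSum (fun p q => sgn ((d + (p.length + 1) + 1) * q.length) • g (f x p) q) l

/-- The identity of `M` in `GMod-A`: `(id_M, 0, 0, …)`. -/
def fid (M : GrMod.{uk, uS, w} k S) : M → List 𝒜.A → M
  | x, [] => x
  | _, _ :: _ => 0

/-- The expression `f(id ⊗ m)`:
`∑_{r + s + t = n, r, s ≥ 1} (-1)^{r + st} f_{r + 1 + t} (id^{⊗ r} ⊗ m_s ⊗ id^{⊗ t})`. -/
noncomputable def fins (f : M → List 𝒜.A → N) : M → List 𝒜.A → N := fun x l =>
  splitSum₃ (fun p q r => sgn ((p.length + 1) + q.length * r.length) •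
    f (M.tw q.length x) (p.map (𝒜.A.tw q.length) ++ 𝒜.m q :: r)) l

lemma comp_hat (g : N → List 𝒜.A → L) (hg : 𝒜.IsFam g) (f : M → List 𝒜.A → N) (hf : 𝒜.IsFam f)
    (x : M) (l : List 𝒜.A) :
    DGBocs.comp (hat g hg) (hat f hf) (BTen.tm k S x (GrBimod.tp 𝒜.A.shift l)) =
      splitSum (fun p q => g (N.tw q.length (f (M.tw p.length x) (𝒜.A.twist p))) (𝒜.A.twist q))
        l := by
  refine (DGBocs.comp_tm (hat g hg) (hat f hf) x (GrBimod.tp 𝒜.A.shift l)).trans ?_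
  have h1 : 𝒜.bar.mu (GrBimod.tp 𝒜.A.shift l) = splitSum (fun p q =>
      BTen.tm k S (GrBimod.tp 𝒜.A.shift p) (GrBimod.tp 𝒜.A.shift q)) l :=
    GrBimod.muT_tp 𝒜.A.shift l
  rw [h1]
  have h2 := splitSum_map (((hat g hg).restrictScalars k) ∘ₗ
    (BTen.map (DGBocs.at_ (hat f hf) x) LinearMap.id (DGBocs.at_rsmul (hat f hf) x)
      (fun _ _ => rfl))).toAddMonoidHom
      (fun p q => BTen.tm k S (GrBimod.tp 𝒜.A.shift p) (GrBimod.tp 𝒜.A.shift q)) l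
  refine h2.trans (splitSum_congr fun p q _ => ?_)
  change hat g hg (BTen.tm k S (hat f hf (BTen.tm k S x (GrBimod.tp 𝒜.A.shift p))) _) = _
  rw [hat_tp, LinearMap.id_apply]
  exact hat_tp g hg _ q

lemma fcomp_eq {d : ℤ} (g : N → List 𝒜.A → L) (hg : 𝒜.IsFam g) {f : M → List 𝒜.A → N}
    (hf : f ∈ 𝒜.FHom d M N) :
    fcomp d g f = unhat (DGBocs.comp (hat g hg) (hat f hf.1)) := by
  funext x l
  refine Eq.trans ?_ (comp_hat g hg f hf.1 (M.tw l.length x) (𝒜.A.twist l)).symm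
  rw [GrBimod.splitSum_twist, fcomp]
  refine splitSum_congr fun p q h => ?_
  subst h
  rw [GrBimod.twist_length, List.length_map, GrBimod.twist_length, GrBimod.twist_map_tw,
    GrBimod.twist_twist, GrBimod.twist_twist, GrMod.tw_tw]
  have h1 : M.tw (p.length + (p ++ q).length) x = M.tw q.length x :=
    M.tw_eq_of_even ⟨p.length, by rw [List.length_append]; push_cast; ring1⟩ x
  rw [h1, FHom.tw hf, map_zsmul, GrMod.tw_tw, GrMod.tw_even _ (Even.add_self _), hg.zsmul]
  congr 1
  exact sgn_eq_of_even ⟨q.length * (p.length + 1), by ring1⟩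

lemma fins_eq (f : M → List 𝒜.A → N) (hf : 𝒜.IsFam f) :
    fins f = unhat (DGBocs.dd (hat f hf)) := by
  funext x l
  change _ = hatAux f hf (M.shift.tw 1 (M.tw l.length x))
    (𝒜.delta (GrBimod.tp 𝒜.A.shift (𝒜.A.twist l)))
  rw [delta_tp, dF, fins, splitSum₃, splitSum₃]
  refine Eq.trans ?_ (splitSum_map (hatAux f hf _).toAddMonoidHom _ _).symm
  refine Eq.trans ?_ (GrBimod.splitSum_twist 𝒜.A _ l).symm
  refine splitSum_congr fun p y h => ?_
  refine Eq.trans ?_ (splitSum_map (hatAux f hf _).toAddMonoidHom _ _).symm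
  refine Eq.trans ?_ (GrBimod.splitSum_twist 𝒜.A _ y).symm
  refine splitSum_congr fun q r h' => ?_
  subst h'
  subst h
  refine Eq.trans ?_ (hatAux_tp f hf _ _).symm
  have e1 : M.shift.tw 1 (M.tw (p ++ (q ++ r)).length x) =
      sgn 1 • M.tw (1 + (p ++ (q ++ r)).length) x := by
    rw [GrMod.shift_tw, GrMod.tw_tw]
  refine Eq.trans ?_ (((hf.isML _).twist 𝒜.A).map_shift_tw 𝒜.A 1 _ _).symm
  rw [e1, map_zsmul, hf.zsmul, GrMod.tw_tw, smul_smul]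
  have h1 := 𝒜.m_map_tw r.length (𝒜.A.twist q)
  rw [GrBimod.twist_length] at h1
  have h3 : 𝒜.b ((𝒜.A.twist q).map (𝒜.A.tw r.length)) =
      sgn (r.length * q.length) • 𝒜.A.tw r.length (𝒜.m q) := by
    rw [b, GrBimod.twist_map_tw, GrBimod.twist_twist, 𝒜.m_map_tw]
    have : sgn (r.length * (2 - q.length)) = sgn (r.length * q.length) :=
      sgn_eq_of_even ⟨r.length * (1 - q.length), by ring1⟩
    rw [this]
  rw [h3]
  rw [((hf.isML _).twist 𝒜.A).zsmul]
  rw [smul_smul, GrBimod.map_tw_tw, GrBimod.twist_append, GrBimod.twist_map_tw,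
    GrBimod.twist_twist, GrBimod.map_tw_tw]
  simp only [List.length_map, GrBimod.twist_length, List.length_cons, List.length_append,
    GrBimod.twist, GrBimod.twist_twist, GrMod.tw_tw, GrMod.tw_even _ (Even.add_self _)]
  rw [← sgn_add, ← sgn_add]
  have e2 : ∀ y : M, M.tw (((p.length + (r.length + 1) : ℕ) : ℤ) +
      (1 + ((p.length + (q.length + r.length) : ℕ) : ℤ))) y = M.tw q.length y := fun y =>
    M.tw_eq_of_even ⟨p.length + r.length + 1, by push_cast; ring1⟩ y
  have e3 : p.map (𝒜.A.tw (((r.length + 1 : ℕ) : ℤ) + (1 + ((q.length + r.length : ℕ) : ℤ)))) =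
      p.map (𝒜.A.tw q.length) :=
    GrBimod.map_tw_congr _ ⟨r.length + 1, by push_cast; ring1⟩ _
  rw [e2, e3]
  congr 1
  exact sgn_eq_of_even ⟨0, by ring1⟩

end AInfAlg

namespace AInfAlg

variable {𝒜 : AInfAlg.{uk, uS, uA} k S}

section

variable {M N L P : GrMod.{uk, uS, w} k S}

lemma fcomp_mem {e d : ℤ} {g : N → List 𝒜.A → L} (hg : g ∈ 𝒜.FHom e N L) {f : M → List 𝒜.A → N}
    (hf : f ∈ 𝒜.FHom d M N) : fcomp d g f ∈ 𝒜.FHom (e + d) M L := by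
  rw [fcomp_eq g hg.1 hf]
  exact unhat_mem (DGBocs.BHom.comp_mem (hat_mem hg) (hat_mem hf))

lemma hat_congr {f g : M → List 𝒜.A → N} (h : f = g) (hf : 𝒜.IsFam f) (hg : 𝒜.IsFam g) :
    hat f hf = hat g hg := by subst h; rfl

lemma hat_fcomp {e d : ℤ} {g : N → List 𝒜.A → L} (hg : g ∈ 𝒜.FHom e N L) {f : M → List 𝒜.A → N}
    (hf : f ∈ 𝒜.FHom d M N) : hat (fcomp d g f) (fcomp_mem hg hf).1 =
      DGBocs.comp (hat g hg.1) (hat f hf.1) :=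
  (hat_congr (fcomp_eq g hg.1 hf) _ (isFam_unhat _)).trans (hat_unhat _)

lemma IsFam.zero : 𝒜.IsFam (0 : M → List 𝒜.A → N) := (𝒜.FHom 0 M N).zero_mem.1

lemma unhat_add (φ ψ : 𝒜.bar.BMor M.shift N.shift) : unhat (φ + ψ) = unhat φ + unhat ψ := rfl

lemma unhat_smul (a : k) (φ : 𝒜.bar.BMor M.shift N.shift) : unhat (a • φ) = a • unhat φ := rfl

lemma unhat_zsmul (a : ℤ) (φ : 𝒜.bar.BMor M.shift N.shift) : unhat (a • φ) = a • unhat φ := rfl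

lemma unhat_sub (φ ψ : 𝒜.bar.BMor M.shift N.shift) : unhat (φ - ψ) = unhat φ - unhat ψ := rfl

lemma unhat_zero : unhat (0 : 𝒜.bar.BMor M.shift N.shift) = 0 := rfl

lemma unhat_eq_zero (φ : 𝒜.bar.BMor M.shift N.shift) : unhat φ = 0 ↔ φ = 0 :=
  ⟨fun h => unhat_inj (h.trans unhat_zero.symm), fun h => by rw [h, unhat_zero]⟩

lemma fid_eq : fid M = unhat (𝒜 := 𝒜) (DGBocs.id_ M.shift) := by
  funext x l
  change _ = op (GrBimod.epsT 𝒜.A.shift (GrBimod.tp 𝒜.A.shift (𝒜.A.twist l))) • M.tw l.length x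
  cases l with
  | nil =>
    rw [GrBimod.twist, GrBimod.epsT_tp]
    exact ((one_smul Sᵐᵒᵖ _).trans (M.tw_zero x)).symm
  | cons a l =>
    rw [GrBimod.twist, GrBimod.epsT_tp]
    exact (zero_smul Sᵐᵒᵖ _).symm

lemma fid_mem : fid M ∈ 𝒜.FHom 0 M M := by
  rw [fid_eq]; exact unhat_mem DGBocs.BHom.id_mem

lemma hat_fid : hat (fid M) (fid_mem (𝒜 := 𝒜)).1 = DGBocs.id_ M.shift :=
  (hat_congr fid_eq _ (isFam_unhat _)).trans (hat_unhat _)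

end

variable (𝒜)

/-- A right `A_∞`-module `(M, {m_n}_{n ≥ 1})` over `A`: the operations
`m_n : M ⊗_S A^{⊗ (n - 1)} → M` are homogeneous maps of right `S`-modules of degree `2 - n`, with
`∑_{r + s + t = n, r ≥ 1} (-1)^{r + st} m_{r + 1 + t} (id^{⊗ r} ⊗ m_s ⊗ id^{⊗ t}) +
  ∑_{s + t = n} (-1)^{st} m_{1 + t} (m_s ⊗ id^{⊗ t}) = 0`,
where `m_s` stands for the operations of `A` in the first sum, and for those of `M` in the
second one. -/
structure Mod where
  M : GrMod.{uk, uS, w} k S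
  m : M → List 𝒜.A → M
  m_mem : m ∈ 𝒜.FHom 1 M M
  stasheff : ∀ x l,
    splitSum₃ (fun p q r => sgn ((p.length + 1) + q.length * r.length) •
      m (M.tw q.length x) (p.map (𝒜.A.tw q.length) ++ 𝒜.m q :: r)) l +
    splitSum (fun p q => sgn ((p.length + 1) * q.length) • m (m x p) q) l = 0

/-- The homogeneous morphisms `f = {f_n}_{n ≥ 1}` of `A_∞`-modules of degree `d`. -/
def TGHom (d : ℤ) (X Y : Mod.{uk, uS, uA, w} 𝒜) : Submodule k (X.M → List 𝒜.A → Y.M) where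
  carrier := {f | f ∈ 𝒜.FHom d X.M Y.M ∧ ∀ x l,
    splitSum₃ (fun p q r => sgn (d + (p.length + 1) + q.length * r.length) •
      f (X.M.tw q.length x) (p.map (𝒜.A.tw q.length) ++ 𝒜.m q :: r)) l +
    splitSum (fun p q => sgn (d + (p.length + 1) * q.length) • f (X.m x p) q) l +
    splitSum (fun p q => sgn ((d + (p.length + 1) + 1) * q.length + 1) • Y.m (f x p) q) l = 0}
  add_mem' := by
    rintro f g ⟨hf, hf'⟩ ⟨hg, hg'⟩
    refine ⟨add_mem hf hg, fun x l => ?_⟩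
    have := congrArg₂ (fun a b : Y.M => a + b) (hf' x l) (hg' x l)
    simp only [add_zero] at this
    rw [← this]
    have h : ∀ (x y : Y.M) l, Y.m (x + y) l = Y.m x l + Y.m y l := Y.m_mem.1.add
    simp only [Pi.add_apply, smul_add, splitSum₃, splitSum_add, h]
    abel
  zero_mem' := ⟨zero_mem _, fun x l => by
    have h : ∀ l, Y.m 0 l = 0 := fun l => by
      have := Y.m_mem.1.smul 0 0 l
      rwa [zero_smul, zero_smul] at this
    simp only [Pi.zero_apply, smul_zero, splitSum₃, h]
    rw [splitSum_eq_zero fun p q _ => splitSum_eq_zero fun _ _ _ => rfl,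
      splitSum_eq_zero fun _ _ _ => rfl]
    simp⟩
  smul_mem' := by
    rintro a f ⟨hf, hf'⟩
    refine ⟨Submodule.smul_mem _ a hf, fun x l => ?_⟩
    have h : ∀ (x : Y.M) l, Y.m (a • x) l = a • Y.m x l := Y.m_mem.1.smul a
    have h' : ∀ (G : List 𝒜.A → List 𝒜.A → Y.M) (l : List 𝒜.A), splitSum (fun p q => a • G p q) l =
        a • splitSum G l := fun G l => (splitSum_map (DistribSMul.toAddMonoidHom _ a) G l).symm
    have := congrArg (fun b : Y.M => a • b) (hf' x l)
    simp only [smul_zero] at this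
    rw [← this]
    simp only [Pi.smul_apply, splitSum₃, h, smul_comm _ a, h', smul_add]

variable {𝒜}

lemma Mod.mc (X : Mod.{uk, uS, uA, w} 𝒜) : fins X.m + fcomp 1 X.m X.m = 0 := by
  funext x l
  refine Eq.trans ?_ (X.stasheff x l)
  refine congrArg (fun b : X.M => splitSum₃ _ l + b) (splitSum_congr fun p q _ => ?_)
  congr 1
  exact sgn_eq_of_even ⟨q.length, by ring1⟩

lemma splitSum_zsmul {N : Type*} [AddCommGroup N] {α : Type*} (a : ℤ) (G : List α → List α → N)
    (l : List α) : splitSum (fun p q => a • G p q) l = a • splitSum G l :=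
  (splitSum_map (DistribSMul.toAddMonoidHom N a) G l).symm

lemma mem_TGHom {d : ℤ} {X Y : Mod.{uk, uS, uA, w} 𝒜} {f : X.M → List 𝒜.A → Y.M} :
    f ∈ TGHom 𝒜 d X Y ↔ f ∈ 𝒜.FHom d X.M Y.M ∧
      sgn d • (fins f + fcomp 1 f X.m) - fcomp d Y.m f = 0 := by
  refine and_congr Iff.rfl ?_
  rw [funext_iff]
  refine forall_congr' fun x => ?_
  rw [funext_iff]
  refine forall_congr' fun l => ?_
  refine Eq.congr ?_ rfl
  change _ = sgn d • (fins f x l + fcomp 1 f X.m x l) - fcomp d Y.m f x l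
  rw [smul_add, sub_eq_add_neg, ← neg_one_smul ℤ (fcomp d Y.m f x l), fins, fcomp, fcomp, splitSum₃,
    splitSum₃]
  simp only [← splitSum_zsmul, smul_smul]
  refine congrArg₂ (· + ·) (congrArg₂ (· + ·) ?_ ?_) ?_
  · refine splitSum_congr fun p y _ => splitSum_congr fun q r _ => ?_
    rw [← sgn_add, add_assoc]
  · refine splitSum_congr fun p q _ => ?_
    rw [← sgn_add]
    congr 1
    exact sgn_eq_of_even ⟨-q.length, by ring1⟩
  · refine splitSum_congr fun p q _ => ?_
    rw [sgn_add, sgn_one, mul_comm]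

end AInfAlg

namespace AInfAlg

variable {𝒜 : AInfAlg.{uk, uS, uA} k S}

lemma Mod.dd_hat (X : Mod.{uk, uS, uA, w} 𝒜) : DGBocs.dhat 1 (hat X.m X.m_mem.1) +
    DGBocs.comp (hat X.m X.m_mem.1) (hat X.m X.m_mem.1) = 0 := by
  rw [← unhat_eq_zero, unhat_add, DGBocs.dhat, unhat_zsmul, ← fins_eq, ← fcomp_eq _ _ X.m_mem,
    sgn_even (by decide), one_smul]
  exact X.mc

lemma mem_TGHom_iff_hat {d : ℤ} {X Y : Mod.{uk, uS, uA, w} 𝒜} {f : X.M → List 𝒜.A → Y.M}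
    (hf : f ∈ 𝒜.FHom d X.M Y.M) : f ∈ TGHom 𝒜 d X Y ↔
      DGBocs.dhat d (hat f hf.1) + DGBocs.comp (hat Y.m Y.m_mem.1) (hat f hf.1) -
        sgn d • DGBocs.comp (hat f hf.1) (hat X.m X.m_mem.1) = 0 := by
  rw [mem_TGHom, and_iff_right hf, ← unhat_eq_zero, unhat_sub, unhat_add, DGBocs.dhat, unhat_zsmul,
    unhat_zsmul, ← fins_eq, ← fcomp_eq _ _ hf, ← fcomp_eq _ _ X.m_mem, ← neg_eq_zero, sgn_add,
    sgn_one, mul_neg_one, neg_smul, smul_add]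
  refine Eq.congr ?_ rfl
  abel

variable (𝒜) in
/-- The object `(M[1], m̂)` of `TGMod-B_A` that corresponds to an `A_∞`-module. -/
noncomputable def Gobj (X : Mod.{uk, uS, uA, w} 𝒜) : 𝒜.bar.TwMod where
  M := X.M.shift
  u := hat X.m X.m_mem.1
  u_mem := hat_mem X.m_mem
  mc := X.dd_hat

lemma hat_mem_THom {d : ℤ} {X Y : Mod.{uk, uS, uA, w} 𝒜} {f : X.M → List 𝒜.A → Y.M}
    (hf : f ∈ TGHom 𝒜 d X Y) : hat f hf.1.1 ∈ DGBocs.THom d (Gobj 𝒜 X) (Gobj 𝒜 Y) :=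
  ⟨hat_mem hf.1, (mem_TGHom_iff_hat hf.1).1 hf⟩

lemma mem_TGHom_of_unhat {d : ℤ} {X Y : Mod.{uk, uS, uA, w} 𝒜} {f : X.M → List 𝒜.A → Y.M}
    {φ : 𝒜.bar.BMor X.M.shift Y.M.shift} (h : f = unhat φ)
    (hφ : φ ∈ DGBocs.THom d (Gobj 𝒜 X) (Gobj 𝒜 Y)) : f ∈ TGHom 𝒜 d X Y := by
  subst h
  have h1 := unhat_mem hφ.1
  refine (mem_TGHom_iff_hat h1).2 ?_
  have e : hat (unhat φ) h1.1 = φ := hat_unhat φ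
  rw [e]
  exact hφ.2

lemma TGHom.fam {d : ℤ} {X Y : Mod.{uk, uS, uA, w} 𝒜} (f : TGHom 𝒜 d X Y) :
    f.1 ∈ 𝒜.FHom d X.M Y.M := f.2.1

lemma hat_add {M N : GrMod.{uk, uS, w} k S} {f g : M → List 𝒜.A → N} (hf : 𝒜.IsFam f)
    (hg : 𝒜.IsFam g) (h : 𝒜.IsFam (f + g)) : hat (f + g) h = hat f hf + hat g hg :=
  unhat_inj (by rw [unhat_add, unhat_hat, unhat_hat, unhat_hat])

lemma hat_smul {M N : GrMod.{uk, uS, w} k S} (a : k) {f : M → List 𝒜.A → N} (hf : 𝒜.IsFam f)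
    (h : 𝒜.IsFam (a • f)) : hat (a • f) h = a • hat f hf :=
  unhat_inj (by rw [unhat_smul, unhat_hat, unhat_hat])

variable (𝒜) in
/-- The action of `𝔾` on the morphisms of degree `d`. -/
noncomputable def Gd (d : ℤ) (X Y : Mod.{uk, uS, uA, w} 𝒜) :
    TGHom 𝒜 d X Y →ₗ[k] DGBocs.THom d (Gobj 𝒜 X) (Gobj 𝒜 Y) where
  toFun f := ⟨hat f.1 (TGHom.fam f).1, hat_mem_THom f.2⟩
  map_add' f g := Subtype.ext (hat_add (TGHom.fam f).1 (TGHom.fam g).1 _)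
  map_smul' a f := Subtype.ext (hat_smul a (TGHom.fam f).1 _)

lemma fcomp_mem_TGHom {e d n : ℤ} (hn : e + d = n) {X Y Z : Mod.{uk, uS, uA, w} 𝒜}
    (g : TGHom 𝒜 e Y Z) (f : TGHom 𝒜 d X Y) : fcomp d g.1 f.1 ∈ TGHom 𝒜 n X Z := by
  subst hn
  have h := DGBocs.THom.comp_mem (Gd 𝒜 e Y Z g).2 (Gd 𝒜 d X Y f).2
  exact mem_TGHom_of_unhat (fcomp_eq g.1 (TGHom.fam g).1 (TGHom.fam f)) h

/-- The composition of homogeneous morphisms of `A_∞`-modules. -/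
def TGHom.comp {e d : ℤ} {X Y Z : Mod.{uk, uS, uA, w} 𝒜} (g : TGHom 𝒜 e Y Z) (f : TGHom 𝒜 d X Y) :
    TGHom 𝒜 (e + d) X Z := ⟨fcomp d g.1 f.1, fcomp_mem_TGHom rfl g f⟩

/-- The composition of morphisms of degree `0`. -/
def TGHom.comp₀ {X Y Z : Mod.{uk, uS, uA, w} 𝒜} (g : TGHom 𝒜 0 Y Z) (f : TGHom 𝒜 0 X Y) :
    TGHom 𝒜 0 X Z := ⟨fcomp 0 g.1 f.1, fcomp_mem_TGHom (add_zero 0) g f⟩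

/-- The identity morphism of an `A_∞`-module. -/
def TGHom.id (X : Mod.{uk, uS, uA, w} 𝒜) : TGHom 𝒜 0 X X :=
  ⟨fid X.M, mem_TGHom_of_unhat fid_eq (DGBocs.THom.id_mem (Gobj 𝒜 X))⟩

lemma TGHom.ext_hat {d : ℤ} {X Y : Mod.{uk, uS, uA, w} 𝒜} {f g : TGHom 𝒜 d X Y}
    (h : Gd 𝒜 d X Y f = Gd 𝒜 d X Y g) : f = g := by
  have h1 : hat f.1 (TGHom.fam f).1 = hat g.1 (TGHom.fam g).1 := congrArg Subtype.val h
  have := congrArg unhat h1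
  rw [unhat_hat, unhat_hat] at this
  exact Subtype.ext this

lemma Gd_comp {e d : ℤ} {X Y Z : Mod.{uk, uS, uA, w} 𝒜} (g : TGHom 𝒜 e Y Z) (f : TGHom 𝒜 d X Y) :
    (Gd 𝒜 (e + d) X Z (TGHom.comp g f)).1 = DGBocs.comp (Gd 𝒜 e Y Z g).1 (Gd 𝒜 d X Y f).1 :=
  hat_fcomp (TGHom.fam g) (TGHom.fam f)

lemma Gd_comp₀ {X Y Z : Mod.{uk, uS, uA, w} 𝒜} (g : TGHom 𝒜 0 Y Z) (f : TGHom 𝒜 0 X Y) :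
    Gd 𝒜 0 X Z (TGHom.comp₀ g f) = (show Gobj 𝒜 X ⟶ Gobj 𝒜 Y from Gd 𝒜 0 X Y f) ≫
      (show Gobj 𝒜 Y ⟶ Gobj 𝒜 Z from Gd 𝒜 0 Y Z g) :=
  Subtype.ext (hat_fcomp (TGHom.fam g) (TGHom.fam f))

lemma Gd_id (X : Mod.{uk, uS, uA, w} 𝒜) : Gd 𝒜 0 X X (TGHom.id X) = 𝟙 (Gobj 𝒜 X) :=
  Subtype.ext hat_fid

/-- The category `Mod_∞-A` of right `A_∞`-modules, with the morphisms of degree `0`. -/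
instance : Category (Mod.{uk, uS, uA, w} 𝒜) where
  Hom X Y := TGHom 𝒜 0 X Y
  id X := TGHom.id X
  comp f g := TGHom.comp₀ g f
  id_comp f := TGHom.ext_hat (by rw [Gd_comp₀, Gd_id]; exact Category.id_comp _)
  comp_id f := TGHom.ext_hat (by rw [Gd_comp₀, Gd_id]; exact Category.comp_id _)
  assoc f g h := TGHom.ext_hat (by
    rw [Gd_comp₀, Gd_comp₀, Gd_comp₀, Gd_comp₀]; exact Category.assoc _ _ _)

instance : Preadditive (Mod.{uk, uS, uA, w} 𝒜) where
  homGroup X Y := inferInstanceAs (AddCommGroup (TGHom 𝒜 0 X Y))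
  add_comp X Y Z f f' g := TGHom.ext_hat (by
    refine (Gd_comp₀ _ _).trans ?_
    refine Eq.trans ?_ ((Gd 𝒜 0 X Z).map_add (TGHom.comp₀ g f) (TGHom.comp₀ g f')).symm
    rw [Gd_comp₀, Gd_comp₀]
    refine Eq.trans ?_ (Preadditive.add_comp (Gobj 𝒜 X) (Gobj 𝒜 Y) (Gobj 𝒜 Z) _ _ _)
    exact congrArg (fun z : Gobj 𝒜 X ⟶ Gobj 𝒜 Y => z ≫ (show Gobj 𝒜 Y ⟶ Gobj 𝒜 Z from Gd 𝒜 0 Y Z g))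
      ((Gd 𝒜 0 X Y).map_add f f'))
  comp_add X Y Z f g g' := TGHom.ext_hat (by
    refine (Gd_comp₀ _ _).trans ?_
    refine Eq.trans ?_ ((Gd 𝒜 0 X Z).map_add (TGHom.comp₀ g f) (TGHom.comp₀ g' f)).symm
    rw [Gd_comp₀, Gd_comp₀]
    refine Eq.trans ?_ (Preadditive.comp_add (Gobj 𝒜 X) (Gobj 𝒜 Y) (Gobj 𝒜 Z) _ _ _)
    exact congrArg (fun z : Gobj 𝒜 Y ⟶ Gobj 𝒜 Z => (show Gobj 𝒜 X ⟶ Gobj 𝒜 Y from Gd 𝒜 0 X Y f) ≫ z)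
      ((Gd 𝒜 0 Y Z).map_add g g'))

instance : Linear k (Mod.{uk, uS, uA, w} 𝒜) where
  homModule X Y := inferInstanceAs (Module k (TGHom 𝒜 0 X Y))
  smul_comp X Y Z a f g := TGHom.ext_hat (by
    refine (Gd_comp₀ _ _).trans ?_
    refine Eq.trans ?_ ((Gd 𝒜 0 X Z).map_smul a (TGHom.comp₀ g f)).symm
    rw [Gd_comp₀]
    refine Eq.trans ?_ (Linear.smul_comp (Gobj 𝒜 X) (Gobj 𝒜 Y) (Gobj 𝒜 Z) a _ _)
    exact congrArg (fun z : Gobj 𝒜 X ⟶ Gobj 𝒜 Y => z ≫ (show Gobj 𝒜 Y ⟶ Gobj 𝒜 Z from Gd 𝒜 0 Y Z g))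
      ((Gd 𝒜 0 X Y).map_smul a f))
  comp_smul X Y Z f a g := TGHom.ext_hat (by
    refine (Gd_comp₀ _ _).trans ?_
    refine Eq.trans ?_ ((Gd 𝒜 0 X Z).map_smul a (TGHom.comp₀ g f)).symm
    rw [Gd_comp₀]
    refine Eq.trans ?_ (Linear.comp_smul (Gobj 𝒜 X) (Gobj 𝒜 Y) (Gobj 𝒜 Z) _ a _)
    exact congrArg (fun z : Gobj 𝒜 Y ⟶ Gobj 𝒜 Z => (show Gobj 𝒜 X ⟶ Gobj 𝒜 Y from Gd 𝒜 0 X Y f) ≫ z)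
      ((Gd 𝒜 0 Y Z).map_smul a g))

variable (𝒜) in
/-- The functor `𝔾 : Mod_∞-A → TGMod⁰-B_A`. -/
noncomputable def G : Mod.{uk, uS, uA, w} 𝒜 ⥤ 𝒜.bar.TwMod where
  obj X := Gobj 𝒜 X
  map {X Y} f := Gd 𝒜 0 X Y f
  map_id X := Gd_id X
  map_comp f g := Gd_comp₀ g f

instance : (G.{uk, uS, uA, w} 𝒜).Additive where
  map_add {X Y f g} := (Gd 𝒜 0 X Y).map_add f g

instance : (G.{uk, uS, uA, w} 𝒜).Linear k where
  map_smul {X Y} f a := (Gd 𝒜 0 X Y).map_smul a f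

end AInfAlg

namespace AInfAlg

variable {𝒜 : AInfAlg.{uk, uS, uA} k S}

/-- The objects of the category `GMod⁰-A`: the graded right `S`-modules. -/
structure GObj (𝒜 : AInfAlg.{uk, uS, uA} k S) where
  M : GrMod.{uk, uS, w} k S

lemma fam_ext_hat {M N : GrMod.{uk, uS, w} k S} {f g : 𝒜.FHom 0 M N}
    (h : hat f.1 f.2.1 = hat g.1 g.2.1) : f = g := by
  have := congrArg unhat h
  rw [unhat_hat, unhat_hat] at this
  exact Subtype.ext this

/-- The composition in `GMod⁰-A`. -/
def gcomp {M N L : GrMod.{uk, uS, w} k S} (g : 𝒜.FHom 0 N L) (f : 𝒜.FHom 0 M N) : 𝒜.FHom 0 M L :=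
  ⟨fcomp 0 g.1 f.1, by simpa using fcomp_mem g.2 f.2⟩

lemma hat_gcomp {M N L : GrMod.{uk, uS, w} k S} (g : 𝒜.FHom 0 N L) (f : 𝒜.FHom 0 M N) :
    hat (gcomp g f).1 (gcomp g f).2.1 = DGBocs.comp (hat g.1 g.2.1) (hat f.1 f.2.1) :=
  hat_fcomp g.2 f.2

/-- The category `GMod⁰-A`. -/
instance : Category (GObj.{uk, uS, uA, w} 𝒜) where
  Hom X Y := 𝒜.FHom 0 X.M Y.M
  id X := ⟨fid X.M, fid_mem⟩
  comp f g := gcomp g f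
  id_comp f := fam_ext_hat (by rw [hat_gcomp, hat_fid, DGBocs.comp_id])
  comp_id f := fam_ext_hat (by rw [hat_gcomp, hat_fid, DGBocs.id_comp])
  assoc f g h := fam_ext_hat (by
    rw [hat_gcomp, hat_gcomp, hat_gcomp, hat_gcomp, DGBocs.comp_assoc])

lemma gcomp_add {M N L : GrMod.{uk, uS, w} k S} (g : 𝒜.FHom 0 N L) (f f' : 𝒜.FHom 0 M N) :
    gcomp g (f + f') = gcomp g f + gcomp g f' := fam_ext_hat (by
  rw [hat_gcomp]
  refine Eq.trans ?_ (hat_add (gcomp g f).2.1 (gcomp g f').2.1 (gcomp g f + gcomp g f').2.1).symm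
  rw [hat_gcomp, hat_gcomp, ← DGBocs.comp_add]
  exact congrArg _ (hat_add f.2.1 f'.2.1 _))

lemma add_gcomp {M N L : GrMod.{uk, uS, w} k S} (g g' : 𝒜.FHom 0 N L) (f : 𝒜.FHom 0 M N) :
    gcomp (g + g') f = gcomp g f + gcomp g' f := fam_ext_hat (by
  rw [hat_gcomp]
  refine Eq.trans ?_ (hat_add (gcomp g f).2.1 (gcomp g' f).2.1 (gcomp g f + gcomp g' f).2.1).symm
  rw [hat_gcomp, hat_gcomp, ← DGBocs.add_comp]
  exact congrArg (fun z => DGBocs.comp z _) (hat_add g.2.1 g'.2.1 _))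

instance : Preadditive (GObj.{uk, uS, uA, w} 𝒜) where
  homGroup X Y := inferInstanceAs (AddCommGroup (𝒜.FHom 0 X.M Y.M))
  add_comp _ _ _ f f' g := gcomp_add g f f'
  comp_add _ _ _ f g g' := add_gcomp g g' f

variable (𝒜) in
/-- The functor `Mod_∞-A → GMod⁰-A` that forgets the second components of the objects. -/
def forgetOps : Mod.{uk, uS, uA, w} 𝒜 ⥤ GObj.{uk, uS, uA, w} 𝒜 where
  obj X := ⟨X.M⟩
  map f := ⟨f.1, TGHom.fam f⟩
  map_id _ := rfl
  map_comp _ _ := rfl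

instance : (forgetOps.{uk, uS, uA, w} 𝒜).Additive where
  map_add := rfl

/-- The first component `f_1 : M → N` of a family of maps. -/
def fst₁ {M N : GrMod.{uk, uS, w} k S} (f : 𝒜.FHom 0 M N) : M →ₗ[k] N where
  toFun x := f.1 x []
  map_add' x y := f.2.1.add x y []
  map_smul' c x := f.2.1.smul c x []

/-- The first component `f_1 : M → N` of a morphism of `A_∞`-modules. -/
def Mod.fst {X Y : Mod.{uk, uS, uA, w} 𝒜} (f : X ⟶ Y) : X.M →ₗ[k] Y.M :=
  fst₁ ((forgetOps 𝒜).map f)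

variable (𝒜) in
/-- The class `E_∞` of the composable morphisms `f`, `g` of `Mod_∞-A` such that `g ∘ f = 0` and
`0 → M → E → N → 0`, with the maps `f_1` and `g_1`, is an exact sequence. -/
def Einf (P : ShortComplex (Mod.{uk, uS, uA, w} 𝒜)) : Prop :=
  Function.Injective (Mod.fst P.f) ∧ Function.Exact (Mod.fst P.f) (Mod.fst P.g) ∧
    Function.Surjective (Mod.fst P.g)

section Shift

variable {M N : GrMod.{uk, uS, w} k S}

/-- The family `f[1]`, with `f[1]_n = (-1)^{n - 1} σ_N f_n (σ_M⁻¹ ⊗ id^{⊗ (n - 1)})`. -/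
def shiftF (f : M → List 𝒜.A → N) : M.shift → List 𝒜.A → N.shift := fun x l =>
  sgn l.length • f x l

lemma shiftF_eq {f : M → List 𝒜.A → N} (hf : 𝒜.IsFam f) :
    shiftF f = unhat (DGBocs.bshift (hat f hf)) := by
  funext x l
  change sgn l.length • f x l = hatAux f hf (M.shift.tw l.length x) (GrBimod.tp _ (𝒜.A.twist l))
  rw [hatAux_tp, GrBimod.twist_twist, GrBimod.twist_length, GrMod.shift_tw, map_zsmul, hf.zsmul,
    GrMod.tw_tw, GrMod.tw_even _ (Even.add_self _)]

lemma stasheff_of_mc {m : M → List 𝒜.A → M} {φ : 𝒜.bar.BMor M.shift M.shift} (h : m = unhat φ)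
    (hφ : φ ∈ 𝒜.bar.BHom 1 M.shift M.shift)
    (mc : DGBocs.dhat 1 φ + DGBocs.comp φ φ = 0) (x : M) (l : List 𝒜.A) :
    splitSum₃ (fun p q r => sgn ((p.length + 1) + q.length * r.length) •
      m (M.tw q.length x) (p.map (𝒜.A.tw q.length) ++ 𝒜.m q :: r)) l +
    splitSum (fun p q => sgn ((p.length + 1) * q.length) • m (m x p) q) l = 0 := by
  have hm : m ∈ 𝒜.FHom 1 M M := by rw [h]; exact unhat_mem hφ
  have e : hat m hm.1 = φ := (hat_congr h hm.1 (isFam_unhat φ)).trans (hat_unhat φ)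
  have h1 : fins m + fcomp 1 m m = 0 := by
    rw [fins_eq m hm.1, fcomp_eq m hm.1 hm, e]
    have := (unhat_eq_zero _).2 mc
    rw [unhat_add, DGBocs.dhat, unhat_zsmul, sgn_even (by decide), one_smul] at this
    exact this
  refine Eq.trans ?_ (congrFun (congrFun h1 x) l)
  refine congrArg (fun b : M => splitSum₃ _ l + b) (splitSum_congr fun p q _ => ?_)
  congr 1
  exact sgn_eq_of_even ⟨-q.length, by ring1⟩

end Shift

/-- The operations of the translate of `(M, m)`: `m'_n = (-1)^n σ_M m_n (σ_M⁻¹ ⊗ id^{⊗ (n - 1)})`. -/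
def Tops (X : Mod.{uk, uS, uA, w} 𝒜) : X.M.shift → List 𝒜.A → X.M.shift :=
  fun x l => sgn (l.length + 1) • X.m x l

/-- The morphism `-m̂[1]` of `B_A`-modules that corresponds to the operations of the translate. -/
noncomputable def Thatm (X : Mod.{uk, uS, uA, w} 𝒜) : 𝒜.bar.BMor X.M.shift.shift X.M.shift.shift :=
  (DGBocs.tshift (Gobj 𝒜 X)).u

lemma Tops_eq (X : Mod.{uk, uS, uA, w} 𝒜) : Tops X = unhat (Thatm X) := by
  have h1 : Tops X = - shiftF X.m := by
    funext x l
    change sgn (l.length + 1) • X.m x l = - (sgn l.length • X.m x l)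
    rw [sgn_add, sgn_one, mul_neg_one, neg_smul]
  exact h1.trans (congrArg Neg.neg (shiftF_eq X.m_mem.1))

/-- The translate `(M, m)[1] = (M[1], m')` of an `A_∞`-module. -/
def Tobj (X : Mod.{uk, uS, uA, w} 𝒜) : Mod.{uk, uS, uA, w} 𝒜 where
  M := X.M.shift
  m := Tops X
  m_mem := by rw [Tops_eq]; exact unhat_mem (DGBocs.tshift (Gobj 𝒜 X)).u_mem
  stasheff := stasheff_of_mc (Tops_eq X) (DGBocs.tshift (Gobj 𝒜 X)).u_mem
    (DGBocs.tshift (Gobj 𝒜 X)).mc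

/-- The action of `J` on a family of degree `d`: the matrix `(f, 0; 0, (-1)^d f[1])`. -/
def Jfam (d : ℤ) {M N : GrMod.{uk, uS, w} k S} (f : M → List 𝒜.A → N) :
    M.prod M.shift → List 𝒜.A → N.prod N.shift := fun z l => (f z.1 l, sgn (d + l.length) • f z.2 l)

/-- The operations of `J(M, m)`: the matrix `(m, σ_M⁻¹; 0, m')`, where `(M[1], m')` is the translate
of `(M, m)` and `σ_M⁻¹ : M[1] → M` is strict. -/
def Jops (X : Mod.{uk, uS, uA, w} 𝒜) : X.M.prod X.M.shift → List 𝒜.A → X.M.prod X.M.shift :=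
  fun z l => (X.m z.1 l + fid X.M z.2 l, sgn (l.length + 1) • X.m z.2 l)

/-- The morphism of `B_A`-modules that corresponds to the operations of `J(M, m)`. -/
noncomputable def Jhatm (X : Mod.{uk, uS, uA, w} 𝒜) :
    𝒜.bar.BMor (X.M.prod X.M.shift).shift (X.M.prod X.M.shift).shift := (DGBocs.tJ (Gobj 𝒜 X)).u

lemma Jops_eq (X : Mod.{uk, uS, uA, w} 𝒜) : Jops X = unhat (Jhatm X) := by
  have h1 := (unhat_hat X.m X.m_mem.1).symm
  have h2 := shiftF_eq X.m_mem.1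
  have h3 : fid X.M.shift = unhat (𝒜 := 𝒜) (DGBocs.id_ X.M.shift.shift) := fid_eq
  funext z l
  change _ = unAux _ ((X.M.prod X.M.shift).tw l.length z) _
  rw [GrMod.prod_tw]
  refine Prod.ext ?_ ?_
  · refine congrArg₂ (fun a b : X.M => a + b) (congrFun (congrFun h1 z.1) l) ?_
    refine Eq.trans ?_ (congrFun (congrFun h3 z.2) l)
    cases l <;> rfl
  · refine Eq.trans ?_ (add_zero _).symm
    refine Eq.trans ?_ (congrArg (fun a : X.M => -a) (congrFun (congrFun h2 z.2) l))
    change sgn (l.length + 1) • X.m z.2 l = - (sgn l.length • X.m z.2 l)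
    rw [sgn_add, sgn_one, mul_neg_one, neg_smul]

/-- The `A_∞`-module `J(M, m) = (M ⊕ M[1], (m, σ_M⁻¹; 0, m'))`. -/
def Jobj (X : Mod.{uk, uS, uA, w} 𝒜) : Mod.{uk, uS, uA, w} 𝒜 where
  M := X.M.prod X.M.shift
  m := Jops X
  m_mem := by rw [Jops_eq]; exact unhat_mem (DGBocs.tJ (Gobj 𝒜 X)).u_mem
  stasheff := stasheff_of_mc (Jops_eq X) (DGBocs.tJ (Gobj 𝒜 X)).u_mem (DGBocs.tJ (Gobj 𝒜 X)).mc

lemma hat_eq_of_eq_unhat {M N : GrMod.{uk, uS, w} k S} {f : M → List 𝒜.A → N} (hf : 𝒜.IsFam f)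
    {φ : 𝒜.bar.BMor M.shift N.shift} (h : f = unhat φ) : hat f hf = φ :=
  (hat_congr h hf (isFam_unhat φ)).trans (hat_unhat φ)

lemma mem_TGHom_of_eq {d : ℤ} {X Y : Mod.{uk, uS, uA, w} 𝒜} {φ : 𝒜.bar.BMor X.M.shift X.M.shift}
    (hX : X.m = unhat φ) {ψ : 𝒜.bar.BMor Y.M.shift Y.M.shift} (hY : Y.m = unhat ψ)
    {f : X.M → List 𝒜.A → Y.M} {χ : 𝒜.bar.BMor X.M.shift Y.M.shift} (h : f = unhat χ)
    (hχ : χ ∈ 𝒜.bar.BHom d X.M.shift Y.M.shift)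
    (he : DGBocs.dhat d χ + DGBocs.comp ψ χ - sgn d • DGBocs.comp χ φ = 0) :
    f ∈ TGHom 𝒜 d X Y := by
  have hf : f ∈ 𝒜.FHom d X.M Y.M := by rw [h]; exact unhat_mem hχ
  refine (mem_TGHom_iff_hat hf).2 ?_
  rw [hat_eq_of_eq_unhat hf.1 h, hat_eq_of_eq_unhat X.m_mem.1 hX, hat_eq_of_eq_unhat Y.m_mem.1 hY,
    he]

end AInfAlg

namespace DGBocs

variable {B : DGBocs.{uk, uS, uC} k S}

variable (B) in
/-- The translation functor `T(M, u) = (M[1], -u[1])` of `TGMod⁰-B`. -/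
noncomputable def T : TwMod.{uk, uS, uC, w} B ⥤ TwMod.{uk, uS, uC, w} B where
  obj X := tshift X
  map f := ⟨bshift f.1, tshift_mem f.2⟩
  map_id _ := rfl
  map_comp _ _ := rfl

lemma tJmor_comp {e d : ℤ} {M N L : GrMod.{uk, uS, w} k S} (g : B.BMor N L) (f : B.BMor M N) :
    tJmor (e + d) (comp g f) = comp (tJmor e g) (tJmor d f) := by
  rw [tJmor, tJmor, tJmor, comp_diag_diag, zsmul_comp, comp_zsmul, smul_smul, ← sgn_add]; rfl

lemma tJmor_id (M : GrMod.{uk, uS, w} k S) :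
    tJmor 0 (id_ M : B.BMor M M) = id_ (M.prod M.shift) := by
  rw [tJmor, sgn_zero, one_smul]; exact bmor_ext fun m c => rfl

variable (B) in
/-- The functor `J(M, u) = (M ⊕ M[1], (u, σ⁻¹; 0, -u[1]))`, `J(f) = (f, 0; 0, f[1])` of
`TGMod⁰-B`. -/
noncomputable def J : TwMod.{uk, uS, uC, w} B ⥤ TwMod.{uk, uS, uC, w} B where
  obj X := tJ X
  map f := ⟨tJmor 0 f.1, tJ_mem f.2⟩
  map_id X := Subtype.ext (tJmor_id X.M)
  map_comp f g := Subtype.ext (tJmor_comp (e := 0) (d := 0) g.1 f.1)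

end DGBocs

namespace AInfAlg

variable {𝒜 : AInfAlg.{uk, uS, uA} k S}

lemma shiftF_mem {d : ℤ} {X Y : Mod.{uk, uS, uA, w} 𝒜} (f : TGHom 𝒜 d X Y) :
    shiftF f.1 ∈ TGHom 𝒜 d (Tobj X) (Tobj Y) := by
  have h := DGBocs.tshift_mem (Gd 𝒜 d X Y f).2
  exact mem_TGHom_of_eq (X := Tobj X) (Y := Tobj Y) (Tops_eq X) (Tops_eq Y)
    (shiftF_eq (TGHom.fam f).1) h.1 h.2

lemma Jfam_eq {d : ℤ} {M N : GrMod.{uk, uS, w} k S} {f : M → List 𝒜.A → N} (hf : 𝒜.IsFam f) :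
    Jfam d f = unhat (M := M.prod M.shift) (N := N.prod N.shift)
      (DGBocs.tJmor d (hat f hf)) := by
  have h1 := (unhat_hat f hf).symm
  have h2 := shiftF_eq hf
  funext z l
  change _ = unAux _ ((M.prod M.shift).tw l.length z) _
  rw [GrMod.prod_tw]
  refine Prod.ext (congrFun (congrFun h1 z.1) l) ?_
  refine Eq.trans ?_ (congrArg (fun a : N => sgn d • a) (congrFun (congrFun h2 z.2) l))
  change sgn (d + l.length) • f z.2 l = sgn d • sgn l.length • f z.2 l
  rw [sgn_add, mul_smul]

lemma Jfam_mem {d : ℤ} {X Y : Mod.{uk, uS, uA, w} 𝒜} (f : TGHom 𝒜 d X Y) :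
    Jfam d f.1 ∈ TGHom 𝒜 d (Jobj X) (Jobj Y) := by
  have h := DGBocs.tJ_mem (Gd 𝒜 d X Y f).2
  exact mem_TGHom_of_eq (X := Jobj X) (Y := Jobj Y) (Jops_eq X) (Jops_eq Y)
    (Jfam_eq (TGHom.fam f).1) h.1 h.2

/-- The action of `T` on the homogeneous morphisms of degree `d`: `T(f) = f[1]`. -/
def Td (d : ℤ) (X Y : Mod.{uk, uS, uA, w} 𝒜) : TGHom 𝒜 d X Y →ₗ[k] TGHom 𝒜 d (Tobj X) (Tobj Y) where
  toFun f := ⟨shiftF f.1, shiftF_mem f⟩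
  map_add' _ _ := Subtype.ext (funext fun _ => funext fun _ => smul_add _ _ _)
  map_smul' a _ := Subtype.ext (funext fun _ => funext fun _ => smul_comm (α := Y.M) _ a _)

/-- The action of `J` on the homogeneous morphisms of degree `d`: the matrix
`(f, 0; 0, (-1)^d f[1])`. -/
def Jd (d : ℤ) (X Y : Mod.{uk, uS, uA, w} 𝒜) : TGHom 𝒜 d X Y →ₗ[k] TGHom 𝒜 d (Jobj X) (Jobj Y) where
  toFun f := ⟨Jfam d f.1, Jfam_mem f⟩
  map_add' _ _ := Subtype.ext (funext fun _ => funext fun _ => Prod.ext rfl (smul_add _ _ _))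
  map_smul' a _ := Subtype.ext (funext fun _ => funext fun _ => Prod.ext rfl (smul_comm (α := Y.M) _ a _))

lemma shiftF_fcomp (d : ℤ) {M N L : GrMod.{uk, uS, w} k S} {g : N → List 𝒜.A → L} (hg : 𝒜.IsFam g)
    (f : M → List 𝒜.A → N) : shiftF (fcomp d g f) = fcomp d (shiftF g) (shiftF f) := by
  funext x l
  refine (splitSum_zsmul _ _ l).symm.trans (splitSum_congr fun p q h => ?_)
  subst h
  change _ = sgn _ • sgn q.length • g (sgn p.length • f x p) q
  rw [hg.zsmul, smul_smul, smul_smul, smul_smul, ← sgn_add, ← sgn_add, ← sgn_add]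
  congr 2
  rw [List.length_append]; push_cast; ring

lemma splitSum_prod {α N N' : Type*} [AddCommGroup N] [AddCommGroup N']
    (G : List α → List α → N) (G' : List α → List α → N') (l : List α) :
    splitSum (fun p q => (G p q, G' p q)) l = (splitSum G l, splitSum G' l) :=
  Prod.ext (splitSum_map (AddMonoidHom.fst N N') _ l) (splitSum_map (AddMonoidHom.snd N N') _ l)

lemma Jfam_fcomp (e d : ℤ) {M N L : GrMod.{uk, uS, w} k S} {g : N → List 𝒜.A → L}
    (hg : 𝒜.IsFam g) (f : M → List 𝒜.A → N) :
    Jfam (e + d) (fcomp d g f) = fcomp d (Jfam e g) (Jfam d f) := by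
  funext z l
  let G : List 𝒜.A → List 𝒜.A → L := fun p q =>
    sgn ((d + (p.length + 1) + 1) * q.length) • g (f z.1 p) q
  let G' : List 𝒜.A → List 𝒜.A → L := fun p q => sgn ((d + (p.length + 1) + 1) * q.length) •
    sgn (e + q.length) • g (sgn (d + p.length) • f z.2 p) q
  refine Eq.trans ?_ (splitSum_prod G G' l).symm
  refine Prod.ext rfl ?_
  change sgn (e + d + l.length) • splitSum _ l = splitSum G' l
  refine (splitSum_zsmul _ _ l).symm.trans (splitSum_congr fun p q h => ?_)
  subst h
  change _ = sgn _ • sgn (e + q.length) • g (sgn (d + p.length) • f z.2 p) q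
  rw [hg.zsmul, smul_smul, smul_smul, smul_smul, ← sgn_add, ← sgn_add, ← sgn_add]
  congr 2
  rw [List.length_append]; push_cast; ring

lemma shiftF_fid (M : GrMod.{uk, uS, w} k S) :
    shiftF (fid M : M → List 𝒜.A → M) = fid M.shift := by
  funext x l
  cases l with
  | nil => change sgn (0 : ℕ) • x = x; rw [Nat.cast_zero, sgn_zero, one_smul]
  | cons a l => exact smul_zero (A := M) _

lemma Jfam_fid (M : GrMod.{uk, uS, w} k S) :
    Jfam 0 (fid M : M → List 𝒜.A → M) = fid (M.prod M.shift) := by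
  funext z l
  cases l with
  | nil =>
    refine Prod.ext rfl ?_
    change sgn (0 + (0 : ℕ)) • z.2 = z.2
    rw [Nat.cast_zero, add_zero, sgn_zero, one_smul]
  | cons a l => exact Prod.ext rfl (smul_zero (A := M) _)

variable (𝒜) in
/-- The translation functor `T` of `Mod_∞-A`. -/
noncomputable def T : Mod.{uk, uS, uA, w} 𝒜 ⥤ Mod.{uk, uS, uA, w} 𝒜 where
  obj X := Tobj X
  map {X Y} f := Td 0 X Y f
  map_id X := Subtype.ext (shiftF_fid X.M)
  map_comp f g := Subtype.ext (shiftF_fcomp 0 (TGHom.fam g).1 f.1)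

variable (𝒜) in
/-- The functor `J` of `Mod_∞-A`. -/
noncomputable def J : Mod.{uk, uS, uA, w} 𝒜 ⥤ Mod.{uk, uS, uA, w} 𝒜 where
  obj X := Jobj X
  map {X Y} f := Jd 0 X Y f
  map_id X := Subtype.ext (Jfam_fid X.M)
  map_comp f g := Subtype.ext (Jfam_fcomp 0 0 (TGHom.fam g).1 f.1)

instance : (T.{uk, uS, uA, w} 𝒜).Additive where
  map_add {X Y} f g := (Td 0 X Y).map_add f g

instance : (J.{uk, uS, uA, w} 𝒜).Additive where
  map_add {X Y} f g := (Jd 0 X Y).map_add f g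

/-- A morphism `f = {f_n}` is strict if `f_n = 0` for all `n ≥ 2`. -/
def IsStrict {X Y : Mod.{uk, uS, uA, w} 𝒜} (f : X ⟶ Y) : Prop := ∀ x a l, f.1 x (a :: l) = 0

end AInfAlg

/-! Exact categories and Frobenius categories. -/

section Exact

open Limits

variable {C : Type*} [Category C] [Preadditive C] (E : ShortComplex C → Prop)

/-- `f` is an `E`-inflation: it is the first morphism of a pair in `E`. -/
def IsInflation {X Y : C} (f : X ⟶ Y) : Prop :=
  ∃ (Z : C) (g : Y ⟶ Z) (h : f ≫ g = 0), E (ShortComplex.mk f g h)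

/-- `g` is an `E`-deflation: it is the second morphism of a pair in `E`. -/
def IsDeflation {Y Z : C} (g : Y ⟶ Z) : Prop :=
  ∃ (X : C) (f : X ⟶ Y) (h : f ≫ g = 0), E (ShortComplex.mk f g h)

/-- An exact structure on an additive category: a class `E` of kernel-cokernel pairs that is closed
under isomorphisms, such that the identities are inflations and deflations, inflations and
deflations are closed under composition, the pushout of an inflation along any morphism exists and
is an inflation, and the pullback of a deflation along any morphism exists and is a deflation. -/
structure IsExactStructure : Prop where
  of_iso : ∀ P Q : ShortComplex C, Nonempty (P ≅ Q) → E P → E Q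
  kernel : ∀ P : ShortComplex C, E P → Nonempty (IsLimit (KernelFork.ofι P.f P.zero))
  cokernel : ∀ P : ShortComplex C, E P → Nonempty (IsColimit (CokernelCofork.ofπ P.g P.zero))
  id_inflation : ∀ X : C, IsInflation E (𝟙 X)
  id_deflation : ∀ X : C, IsDeflation E (𝟙 X)
  comp_inflation : ∀ {X Y Z : C} (f : X ⟶ Y) (g : Y ⟶ Z),
    IsInflation E f → IsInflation E g → IsInflation E (f ≫ g)
  comp_deflation : ∀ {X Y Z : C} (f : X ⟶ Y) (g : Y ⟶ Z),
    IsDeflation E f → IsDeflation E g → IsDeflation E (f ≫ g)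
  pushout : ∀ {X Y X' : C} (i : X ⟶ Y) (f : X ⟶ X'), IsInflation E i →
    ∃ (Y' : C) (f' : Y ⟶ Y') (i' : X' ⟶ Y'), IsPushout i f f' i' ∧ IsInflation E i'
  pullback : ∀ {Y Z Z' : C} (p : Y ⟶ Z) (f : Z' ⟶ Z), IsDeflation E p →
    ∃ (Y' : C) (f' : Y' ⟶ Y) (p' : Y' ⟶ Z'), IsPullback f' p' p f ∧ IsDeflation E p'

/-- `E`-projective objects. -/
def IsEProjective (Q : C) : Prop :=
  ∀ {Y Z : C} (p : Y ⟶ Z) (h : Q ⟶ Z), IsDeflation E p → ∃ h' : Q ⟶ Y, h' ≫ p = h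

/-- `E`-injective objects. -/
def IsEInjective (I : C) : Prop :=
  ∀ {X Y : C} (i : X ⟶ Y) (h : X ⟶ I), IsInflation E i → ∃ h' : Y ⟶ I, i ≫ h' = h

/-- An additive category with split idempotents and an exact structure `E` is a Frobenius category
if it has enough `E`-projectives and enough `E`-injectives, and they coincide. -/
structure IsFrobenius : Prop where
  additive : HasFiniteBiproducts C
  split : IsIdempotentComplete C
  exact : IsExactStructure E
  enoughProjectives : ∀ X : C, ∃ (Q : C) (p : Q ⟶ X), IsEProjective E Q ∧ IsDeflation E p
  enoughInjectives : ∀ X : C, ∃ (I : C) (i : X ⟶ I), IsEInjective E I ∧ IsInflation E i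
  projective_iff_injective : ∀ X : C, IsEProjective E X ↔ IsEInjective E X

/-- `T` is an automorphism of the exact category `(C, E)`: an additive functor with a (strict)
inverse such that a pair belongs to `E` if and only if its image does. -/
structure IsExactAut (T : C ⥤ C) [T.Additive] : Prop where
  inverse : ∃ T' : C ⥤ C, T ⋙ T' = 𝟭 C ∧ T' ⋙ T = 𝟭 C
  exact : ∀ P : ShortComplex C, E (P.map T) ↔ E P

/-- A special Frobenius category: a Frobenius category with an exact automorphism `T`, an
endofunctor `J` with `E`-projective values and natural transformations `α : id → J` and
`β : J → T` such that `M → J(M) → T(M)` is in `E` for all `M`. -/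
structure IsSpecialFrobenius : Prop extends IsFrobenius E where
  special : ∃ (T J : C ⥤ C) (_ : T.Additive) (_ : J.Additive) (α : 𝟭 C ⟶ J) (β : J ⟶ T),
    IsExactAut E T ∧ (∀ X, IsEProjective E (J.obj X)) ∧
      ∀ X, ∃ h : α.app X ≫ β.app X = 0, E (ShortComplex.mk (α.app X) (β.app X) h)

end Exact

end AInfinity

open AInfinity

/-! The proof rests on two devices: a differential that turns the definition of $A_\infty$-modules
and of their morphisms into cocycle conditions, and a splitting principle in
$\mathrm{GMod}^0\text{-}A$, where the operations are forgotten.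

The differential. Passing to the bar construction identifies families $f$ with maps $\hat
f:M[1]\otimes C\to N[1]$, turns $\circ$ into $*$, and makes the operations of a module a
Maurer-Cartan element $u$, $\hat\delta(u)+u*u=0$. On maps of degree $d$ from $(M,u)$ to $(N,v)$ put
$D(f)=\hat\delta(f)+v*f-(-1)^df*u$ (`tdiff`). It satisfies the Leibniz rule (`tdiff_comp`) and
$D^2=0$ (`tdiff_tdiff`), and the morphisms of $A_\infty$-modules are exactly its cocycles
(`tdiff_u`, `exists_u`).

The splitting principle. The $n$-th power of an endomorphism with zero first component vanishes on
tensors with fewer than $n$ factors from $A$, so the geometric series makes every endomorphism of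
$\mathrm{GMod}^0\text{-}A$ with identity first component invertible (`isIso_of_fst_eq_id`). Since
$S$ is semisimple, injections and surjections of graded modules split homogeneously. Together these
facts split every pair with zero composition whose first components form a short exact sequence
(`GObj.exists_splitting`). Hence $\mathcal E_\infty$ consists of the pairs that split after
forgetting the operations.

Kernels and cokernels. A map $f$ that is split in $\mathrm{GMod}^0\text{-}A$ allows cancellation in
equations for $D$. Therefore operations descend to a summand as soon as $\hat\delta(f)+v*f$ factors
through $f$ (`exists_sub_twist`, and dually `exists_quot_twist`), and maps that factor through split
morphisms are automatically cocycles (`exists_lift`, `exists_desc`). This yields kernels of all $g$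
with $g_1$ surjective, cokernels of all $f$ with $f_1$ injective, and split idempotents. Pullbacks
and pushouts are kernels and cokernels of maps out of and into direct sums, so the axioms of an
exact category reduce to facts about injective and surjective linear maps.

The Frobenius property. The module $J(X)$ has a contraction $\kappa$ of degree $-1$ with
$D(\kappa)=id$ (`contractible_tJ`). If $p$ is a deflation with a section $s$ in
$\mathrm{GMod}^0\text{-}A$, then a morphism $h$ from $J(X)$ lifts along $p$ to the cocycle
$D(s*h*\kappa)$; a dual formula extends morphisms into $J(X)$. Since every module is a translate,
the conflations $X\to J(X)\to T(X)$ provide enough projectives and injectives, and both classes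
consist of the retracts of modules $J(X)$.

The functors. Every graded module is literally a shift, so $\mathbb G$ and $T$ are bijective on
objects as well as on morphisms. The exact structure on twisted modules is transported along
$\mathbb G$, and $T$ has a strict inverse. -/

namespace AInfinity

variable {k : Type uk} {S : Type uS} [Field k] [Ring S] [Algebra k S]

/-! ### Graded modules over a semisimple ring: homogeneous splittings, kernels, inverse shift -/

namespace GrMod

variable {M N L : GrMod.{uk, uS, w} k S}

lemma proj_mem (M : GrMod.{uk, uS, w} k S) (j : ℤ) (x : M) : M.proj j x ∈ M.gr j :=
  Subtype.property _

lemma proj_rsmul (M : GrMod.{uk, uS, w} k S) (j : ℤ) (s : S) (x : M) :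
    M.proj j (op s • x) = op s • M.proj j x := by
  induction x using M.induction_homog with
  | hm i x hx =>
    by_cases h : j = i
    · subst h; rw [M.proj_of_mem hx, M.proj_of_mem (M.rsmul_mem _ s x hx)]
    · rw [M.proj_of_mem_ne hx h, M.proj_of_mem_ne (M.rsmul_mem _ s x hx) h, smul_zero]
  | ha x y hx hy => rw [smul_add, map_add, map_add, smul_add, hx, hy]

/-- The finite set is the support of the decomposition of $x$. This form is convenient for showing
that a submodule stable under the projections is graded. -/
lemma exists_sum_proj (M : GrMod.{uk, uS, w} k S) (x : M) :
    ∃ F : Finset ℤ, x = ∑ j ∈ F, M.proj j x := by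
  classical
  refine ⟨(M.decomp x).support, ?_⟩
  have h : DirectSum.coeLinearMap M.gr (M.decomp x) = x :=
    (LinearEquiv.ofBijective (DirectSum.coeLinearMap M.gr) M.internal).apply_symm_apply x
  conv_lhs => rw [← h, DirectSum.coeLinearMap_eq_dfinsuppSum]
  rfl

/-- The homogeneous maps of degree `0` of graded right `S`-modules. -/
structure IsGrHom (a : M →ₗ[k] N) : Prop where
  rsmul : ∀ (s : S) (x : M), a (op s • x) = op s • a x
  mem : ∀ (j : ℤ) (x : M), x ∈ M.gr j → a x ∈ N.gr j

namespace IsGrHom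

variable {a : M →ₗ[k] N}

/-- A homogeneous map of degree `0`, as a map of right `S`-modules. -/
def toLin (h : IsGrHom a) : M →ₗ[Sᵐᵒᵖ] N where
  toFun := a
  map_add' := a.map_add
  map_smul' s x := h.rsmul s.unop x

lemma proj_comm (h : IsGrHom a) (j : ℤ) (x : M) : N.proj j (a x) = a (M.proj j x) := by
  induction x using M.induction_homog with
  | hm i x hx =>
    by_cases hj : j = i
    · subst hj; rw [M.proj_of_mem hx, N.proj_of_mem (h.mem _ _ hx)]
    · rw [M.proj_of_mem_ne hx hj, N.proj_of_mem_ne (h.mem _ _ hx) hj, map_zero]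
  | ha x y hx hy => simp only [map_add, hx, hy]

end IsGrHom

/-- The homogeneous component of degree `0` of a map of right `S`-modules. -/
noncomputable def gpart (t : M →ₗ[Sᵐᵒᵖ] N) : M →ₗ[k] N :=
  DirectSum.toModule k ℤ N
    (fun j => N.proj j ∘ₗ t.restrictScalars k ∘ₗ (M.gr j).subtype) ∘ₗ M.decomp.toLinearMap

lemma gpart_of_mem (t : M →ₗ[Sᵐᵒᵖ] N) {j : ℤ} {x : M} (hx : x ∈ M.gr j) :
    gpart t x = N.proj j (t x) := by
  simp [gpart, M.decomp_of_mem hx]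

lemma isGrHom_gpart (t : M →ₗ[Sᵐᵒᵖ] N) : IsGrHom (gpart t) where
  rsmul s x := by
    induction x using M.induction_homog with
    | hm i x hx =>
      rw [gpart_of_mem t hx, gpart_of_mem t (M.rsmul_mem _ s _ hx), map_smul, proj_rsmul]
    | ha x y hx hy => simp only [map_add, smul_add, hx, hy]
  mem j x hx := by rw [gpart_of_mem t hx]; exact N.proj_mem j _

/-- An injective homogeneous map of degree `0` has a homogeneous retraction. -/
lemma IsGrHom.exists_retraction [IsSemisimpleRing S] {a : M →ₗ[k] N} (h : IsGrHom a)
    (hi : Function.Injective a) : ∃ r : N →ₗ[k] M, IsGrHom r ∧ ∀ x, r (a x) = x := by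
  -- Semisimplicity extends the identity along $a$ to a retraction $t$ that need not respect the
  -- gradings; its component of degree $0$ does, and is still a retraction.
  obtain ⟨t, ht⟩ := IsSemisimpleModule.extension_property h.toLin hi LinearMap.id
  refine ⟨gpart t, isGrHom_gpart t, fun x => ?_⟩
  induction x using M.induction_homog with
  | hm i x hx =>
    -- For homogeneous $x$ the value $t(a(x))=x$ already lies in the degree that the projection
    -- selects.
    rw [gpart_of_mem t (h.mem _ _ hx), show t (a x) = x from LinearMap.congr_fun ht x,
      M.proj_of_mem hx]
  | ha x y hx hy => simp only [map_add, hx, hy]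

/-- A surjective homogeneous map of degree `0` has a homogeneous section. -/
lemma IsGrHom.exists_section [IsSemisimpleRing S] {a : M →ₗ[k] N} (h : IsGrHom a)
    (hs : Function.Surjective a) : ∃ s : N →ₗ[k] M, IsGrHom s ∧ ∀ x, a (s x) = x := by
  -- Modules over a semisimple ring are projective, so $a$ has a section $t$; again only its
  -- component of degree $0$ is kept, and this remains a section because $a$ commutes with the
  -- projections.
  have : Module.Projective Sᵐᵒᵖ N := Module.projective_of_isSemisimpleRing ..
  obtain ⟨t, ht⟩ := Module.projective_lifting_property h.toLin LinearMap.id hs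
  refine ⟨gpart t, isGrHom_gpart t, fun x => ?_⟩
  induction x using N.induction_homog with
  | hm i x hx =>
    rw [gpart_of_mem t hx, ← h.proj_comm, show a (t x) = x from LinearMap.congr_fun ht x,
      N.proj_of_mem hx]
  | ha x y hx hy => simp only [map_add, hx, hy]

/-- The kernel of a homogeneous map of degree `0`. -/
noncomputable abbrev ker (a : M →ₗ[k] N) (h : IsGrHom a) : GrMod.{uk, uS, w} k S where
  carrier := LinearMap.ker h.toLin
  gr j := (M.gr j).comap ((LinearMap.ker h.toLin).subtype.restrictScalars k)
  rsmul_mem j s x hx := M.rsmul_mem j s x.1 hx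
  internal := by
    -- A map of degree $0$ commutes with the projections onto homogeneous components, so these
    -- restrict to its kernel and grade it.
    have hp : ∀ j x, x ∈ LinearMap.ker h.toLin → M.proj j x ∈ LinearMap.ker h.toLin := by
      intro j x hx
      change a (M.proj j x) = 0
      rw [← h.proj_comm, show a x = 0 from hx, map_zero]
    refine internal_of_proj _ (fun j =>
      { toFun := fun x => ⟨M.proj j x.1, hp j x.1 x.2⟩
        map_add' := fun x y => Subtype.ext (map_add (M.proj j) x.1 y.1)
        map_smul' := fun c x => Subtype.ext (map_smul (M.proj j) c x.1) }) ?_ ?_ ?_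
    · exact fun j x hx => Subtype.ext (M.proj_of_mem hx)
    · exact fun i j x hx hij => Subtype.ext (M.proj_of_mem_ne hx hij)
    · rw [eq_top_iff]
      rintro x -
      obtain ⟨F, hF⟩ := M.exists_sum_proj x.1
      have : x = ∑ j ∈ F, ⟨M.proj j x.1, hp j x.1 x.2⟩ := by
        refine Subtype.ext ?_
        rw [AddSubmonoidClass.coe_finsetSum]
        exact hF
      rw [this]
      exact sum_mem fun j _ => Submodule.mem_iSup_of_mem j (M.proj_mem j x.1)

/-- The inclusion of the kernel of a homogeneous map. -/
noncomputable def kerι (a : M →ₗ[k] N) (h : IsGrHom a) : ker a h →ₗ[k] M :=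
  (LinearMap.ker h.toLin).subtype.restrictScalars k

lemma isGrHom_kerι (a : M →ₗ[k] N) (h : IsGrHom a) : IsGrHom (kerι a h) where
  rsmul _ _ := rfl
  mem _ _ hx := hx

lemma kerι_injective (a : M →ₗ[k] N) (h : IsGrHom a) : Function.Injective (kerι a h) :=
  Subtype.val_injective

lemma apply_kerι (a : M →ₗ[k] N) (h : IsGrHom a) (x : ker a h) : a (kerι a h x) = 0 := x.2

lemma exists_kerι (a : M →ₗ[k] N) (h : IsGrHom a) {x : M} (hx : a x = 0) :
    ∃ y, kerι a h y = x := ⟨⟨x, hx⟩, rfl⟩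

/-- The translate `M[-1]`. -/
abbrev unshift (M : GrMod.{uk, uS, w} k S) : GrMod.{uk, uS, w} k S where
  carrier := M
  gr j := M.gr (j - 1)
  rsmul_mem j s x hx := M.rsmul_mem _ s x hx
  internal := by
    refine internal_of_proj _ (fun j => M.proj (j - 1)) (fun j x hx => M.proj_of_mem hx)
      (fun i j x hx hij => M.proj_of_mem_ne hx (by simpa using hij)) ?_
    rw [eq_top_iff, ← M.iSup_gr]
    refine iSup_le fun j => ?_
    have := le_iSup (fun j => M.gr (j - 1)) (j + 1)
    simpa using this

/-- Shifting leaves the underlying module unchanged, so only the gradings have to be compared. The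
resulting equalities of objects, rather than isomorphisms, are what a strict inverse of $T$ and the
surjectivity of $\mathbb G$ on objects require. -/
lemma ext_gr {X : Type w} [AddCommGroup X] [Module k X] [Module Sᵐᵒᵖ X] [IsScalarTower k Sᵐᵒᵖ X]
    {g g' : ℤ → Submodule k X} (h : g = g') (h1 h2 h3 h4) :
    (⟨X, g, h1, h2⟩ : GrMod.{uk, uS, w} k S) = ⟨X, g', h3, h4⟩ := by subst h; rfl

lemma unshift_shift (M : GrMod.{uk, uS, w} k S) : M.shift.unshift = M :=
  ext_gr (funext fun j => congrArg M.gr (sub_add_cancel j 1)) _ _ _ _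

lemma shift_unshift (M : GrMod.{uk, uS, w} k S) : M.unshift.shift = M :=
  ext_gr (funext fun j => congrArg M.gr (add_sub_cancel_right j 1)) _ _ _ _

end GrMod

/-! ### Sums with a single surviving term and strict families -/

section Lists

variable {α : Type*} {N : Type*} [AddCommGroup N]

/-- This and its mirror image evaluate compositions with strict families: a strict inner or outer
factor leaves only the decomposition with an empty first or second part. -/
lemma splitSum_eq_left {G : List α → List α → N} (h : ∀ a p q, G (a :: p) q = 0) (l : List α) :
    splitSum G l = G [] l := by
  cases l with
  | nil => exact splitSum_nil G
  | cons a l => rw [splitSum_cons, splitSum_eq_zero fun p q _ => h a p q, add_zero]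

lemma splitSum_eq_right {G : List α → List α → N} (h : ∀ p b q, G p (b :: q) = 0) (l : List α) :
    splitSum G l = G l [] := by
  induction l generalizing G with
  | nil => exact splitSum_nil G
  | cons a l ih => rw [splitSum_cons, h, zero_add, ih fun p b q => h (a :: p) b q]

end Lists

namespace AInfAlg

variable {𝒜 : AInfAlg.{uk, uS, uA} k S}

/-- The strict family `(a, 0, 0, …)`. -/
def strictFam {M N : GrMod.{uk, uS, w} k S} (a : M →ₗ[k] N) : M → List 𝒜.A → N
  | x, [] => a x
  | _, _ :: _ => 0

lemma strictFam_append_cons {M N : GrMod.{uk, uS, w} k S} (a : M →ₗ[k] N) (x : M)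
    (p q : List 𝒜.A) (b : 𝒜.A) : strictFam a x (p ++ b :: q) = 0 := by cases p <;> rfl

lemma isFam_strictFam {M N : GrMod.{uk, uS, w} k S} {a : M →ₗ[k] N}
    (ha : ∀ (s : S) x, a (op s • x) = op s • a x) : 𝒜.IsFam (strictFam a) where
  add x y l := by
    cases l with
    | nil => exact a.map_add x y
    | cons b l => exact (add_zero (0 : N)).symm
  smul c x l := by
    cases l with
    | nil => exact a.map_smul c x
    | cons b l => exact (smul_zero c).symm
  isML x :=
    { add := fun p q b c => by simp only [strictFam_append_cons, add_zero]
      smul := fun p q c b => by simp only [strictFam_append_cons, smul_zero]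
      bal := fun p q s b c => by simp only [strictFam_append_cons]
      right := fun p s b => by simp only [strictFam_append_cons, smul_zero] }
  bal s x b l := rfl
  right s x := ha s x

lemma strictFam_mem {M N : GrMod.{uk, uS, w} k S} {a : M →ₗ[k] N} (ha : GrMod.IsGrHom a) :
    strictFam a ∈ 𝒜.FHom 0 M N := by
  refine ⟨isFam_strictFam ha.rsmul, fun i x l ds hx hl => ?_⟩
  cases hl with
  | nil =>
    change a x ∈ _
    rw [show i + ([] : List ℤ).sum + (0 - (([] : List 𝒜.A).length : ℤ)) = i by simp]
    exact ha.mem i x hx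
  | cons => exact zero_mem _

lemma IsFam.map_zero {M N : GrMod.{uk, uS, w} k S} {f : M → List 𝒜.A → N} (hf : 𝒜.IsFam f)
    (l : List 𝒜.A) : f 0 l = 0 := by
  have := hf.zsmul 0 0 l
  rwa [zero_smul, zero_smul] at this

/-- A strict outer factor sees only the empty list, so $s=0$ in the composition formula and the sign
is $1$ for every degree $d$. -/
lemma fcomp_strictFam_left {M N L : GrMod.{uk, uS, w} k S} (d : ℤ) (a : N →ₗ[k] L)
    (f : M → List 𝒜.A → N) (x : M) (l : List 𝒜.A) :
    fcomp d (strictFam a) f x l = a (f x l) := by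
  refine (splitSum_eq_right (fun p b q => smul_zero _) l).trans ?_
  rw [List.length_nil, Nat.cast_zero, mul_zero, sgn_zero, one_smul]; rfl

lemma fcomp_strictFam_right {M N L : GrMod.{uk, uS, w} k S} {g : N → List 𝒜.A → L}
    (hg : 𝒜.IsFam g) (a : M →ₗ[k] N) (x : M) (l : List 𝒜.A) :
    fcomp 0 g (strictFam a) x l = g (a x) l := by
  refine (splitSum_eq_left (fun b p q => ?_) l).trans ?_
  · change _ • g 0 q = 0
    rw [hg.map_zero, smul_zero]
  -- With inner degree $0$ and $r=1$ the sign exponent is $(0+1+1)s$, which is even whatever $s$ is.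
  · rw [sgn_even, one_smul]
    · rfl
    · exact Even.mul_right ⟨1, by simp⟩ _

/-! ### $\mathrm{GMod}^0\text{-}A$: invertibility and splittings detected by first components -/

namespace GObj

variable {X Y Z : GObj.{uk, uS, uA, w} 𝒜}

/-- The first component of a morphism of `GMod⁰-A`. -/
def fst (f : X ⟶ Y) : X.M →ₗ[k] Y.M := fst₁ f

lemma fam (f : X ⟶ Y) : 𝒜.IsFam f.1 := f.2.1

lemma isGrHom_fst (f : X ⟶ Y) : GrMod.IsGrHom (fst f) where
  rsmul s x := f.2.1.right s x
  mem j x hx := by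
    have : fst f x ∈ _ := f.2.2 j x [] [] hx .nil
    rwa [show j + ([] : List ℤ).sum + (0 - (([] : List 𝒜.A).length : ℤ)) = j by simp] at this

@[ext] lemma hom_ext {f g : X ⟶ Y} (h : ∀ x l, f.1 x l = g.1 x l) : f = g :=
  Subtype.ext (funext fun x => funext fun l => h x l)

lemma comp_apply (f : X ⟶ Y) (g : Y ⟶ Z) (x : X.M) (l : List 𝒜.A) :
    (f ≫ g).1 x l = fcomp 0 g.1 f.1 x l := rfl

@[simp] lemma fst_comp (f : X ⟶ Y) (g : Y ⟶ Z) (x : X.M) :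
    fst (f ≫ g) x = fst g (fst f x) := by
  change fcomp 0 g.1 f.1 x [] = _
  rw [fcomp, splitSum_nil]
  rw [List.length_nil, Nat.cast_zero, mul_zero, sgn_zero, one_smul]; rfl

@[simp] lemma fst_id (X : GObj.{uk, uS, uA, w} 𝒜) (x : X.M) : fst (𝟙 X) x = x := rfl

@[simp] lemma fst_add (f g : X ⟶ Y) (x : X.M) : fst (f + g) x = fst f x + fst g x := rfl

@[simp] lemma fst_sub (f g : X ⟶ Y) (x : X.M) : fst (f - g) x = fst f x - fst g x := rfl

@[simp] lemma fst_zero (x : X.M) : fst (0 : X ⟶ Y) x = 0 := rfl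

/-- The strict morphism with the given first component. -/
def strict (a : X.M →ₗ[k] Y.M) (ha : GrMod.IsGrHom a) : X ⟶ Y := ⟨strictFam a, strictFam_mem ha⟩

@[simp] lemma fst_strict (a : X.M →ₗ[k] Y.M) (ha : GrMod.IsGrHom a) (x : X.M) :
    fst (strict (𝒜 := 𝒜) a ha) x = a x := rfl

/-- The components `f_n` of `f` vanish for `n ≤ i`. -/
def Below (i : ℕ) (f : X ⟶ Y) : Prop := ∀ x (l : List 𝒜.A), l.length < i → f.1 x l = 0

/-- If a list of length less than $i+j$ is cut in two, the first part is shorter than $i$ or the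
second is shorter than $j$; hence each summand of the composition vanishes. -/
lemma Below.comp {i j : ℕ} {f : X ⟶ Y} {g : Y ⟶ Z} (hf : Below i f) (hg : Below j g) :
    Below (i + j) (f ≫ g) := by
  intro x l hl
  rw [comp_apply, fcomp]
  refine splitSum_eq_zero fun p q h => ?_
  subst h
  rw [List.length_append] at hl
  by_cases hp : p.length < i
  · have : f.1 x p = 0 := hf x p hp
    rw [this, (fam g).map_zero, smul_zero]
  · have : g.1 (f.1 x p) q = 0 := hg _ q (by omega)
    rw [this, smul_zero]

/-- The powers of an endomorphism. -/
def npow (n : X ⟶ X) (i : ℕ) : X ⟶ X := (show End X from n) ^ i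

lemma Below.npow {n : X ⟶ X} (hn : Below 1 n) (i : ℕ) : Below i (npow n i) := by
  induction i with
  | zero => intro x l hl; omega
  | succ i ih =>
    have h := Below.comp hn ih
    rw [add_comm] at h
    exact h

/-- The partial sums of the geometric series. -/
def geom (n : X ⟶ X) (K : ℕ) : X ⟶ X := ∑ i ∈ Finset.range K, npow n i

lemma geom_succ (n : X ⟶ X) (K : ℕ) : geom n (K + 1) = geom n K + npow n K :=
  Finset.sum_range_succ _ _

/-- The partial sums are stationary on each list, because $n^K$ vanishes on lists of length less
than $K$. The infinite geometric series is thus a well-defined family although no single partial sum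
equals it in general. -/
lemma geom_apply {n : X ⟶ X} (hn : Below 1 n) (x : X.M) (l : List 𝒜.A) {K : ℕ}
    (hK : l.length < K) : (geom n K).1 x l = (geom n (l.length + 1)).1 x l := by
  induction K with
  | zero => omega
  | succ K ih =>
    by_cases h : l.length = K
    · rw [h]
    · rw [geom_succ, ← ih (by omega)]
      change (geom n K).1 x l + (npow n K).1 x l = _
      rw [hn.npow K x l (by omega), add_zero]

/-- The inverse of `1 - n`. -/
noncomputable def geomInv (n : X ⟶ X) : X ⟶ X :=
  ⟨fun x l => (geom n (l.length + 1)).1 x l,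
    { add := fun x y l => (fam (geom n _)).add x y l
      smul := fun c x l => (fam (geom n _)).smul c x l
      isML := fun x =>
        { add := fun p q a b => by
            -- Each axiom compares values on lists of one common length, on which the series is
            -- given by one and the same partial sum.
            have := ((fam (geom n (p.length + (q.length + 1) + 1))).isML x).add p q a b
            simpa only [List.length_append, List.length_cons] using this
          smul := fun p q c a => by
            have := ((fam (geom n (p.length + (q.length + 1) + 1))).isML x).smul p q c a
            simpa only [List.length_append, List.length_cons] using this
          bal := fun p q s a b => by
            have := ((fam (geom n (p.length + (q.length + 1 + 1) + 1))).isML x).bal p q s a b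
            simpa only [List.length_append, List.length_cons] using this
          right := fun p s a => by
            have := ((fam (geom n (p.length + (0 + 1) + 1))).isML x).right p s a
            simpa only [List.length_append, List.length_cons, List.length_nil] using this }
      bal := fun s x a l => (fam (geom n _)).bal s x a l
      right := fun s x => (fam (geom n _)).right s x },
    fun i x l ds hx hl => (geom n _).2.2 i x l ds hx hl⟩

lemma geomInv_apply {n : X ⟶ X} (hn : Below 1 n) (x : X.M) (l : List 𝒜.A) {K : ℕ}
    (hK : l.length < K) : (geomInv n).1 x l = (geom n K).1 x l :=
  (geom_apply hn x l hK).symm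

/-- The product telescopes to $1-n^{L+1}$ with $L$ the length of $l$, and $n^{L+1}$ vanishes on $l$.
-/
lemma geom_mul {n : X ⟶ X} (hn : Below 1 n) (x : X.M) (l : List 𝒜.A) :
    ((𝟙 X - n) ≫ geom n (l.length + 1)).1 x l = (𝟙 X : X ⟶ X).1 x l ∧
    (geom n (l.length + 1) ≫ (𝟙 X - n)).1 x l = (𝟙 X : X ⟶ X).1 x l := by
  have h1 : (𝟙 X - n) ≫ geom n (l.length + 1) = 𝟙 X - npow n (l.length + 1) :=
    geom_sum_mul_neg (show End X from n) (l.length + 1)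
  have h2 : geom n (l.length + 1) ≫ (𝟙 X - n) = 𝟙 X - npow n (l.length + 1) :=
    mul_neg_geom_sum (show End X from n) (l.length + 1)
  have h3 : (𝟙 X - npow n (l.length + 1)).1 x l = (𝟙 X : X ⟶ X).1 x l := by
    change (𝟙 X : X ⟶ X).1 x l - (npow n (l.length + 1)).1 x l = _
    rw [hn.npow _ x l (Nat.lt_succ_self _), sub_zero]
  rw [h1, h2]
  exact ⟨h3, h3⟩

lemma comp_geomInv {n : X ⟶ X} (hn : Below 1 n) : (𝟙 X - n) ≫ geomInv n = 𝟙 X := by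
  ext x l
  rw [← (geom_mul hn x l).1, comp_apply, comp_apply, fcomp, fcomp]
  refine splitSum_congr fun p q h => ?_
  -- The composition evaluates the series only on parts of $l$, where the partial sum belonging to
  -- $l$ itself may be used uniformly.
  rw [geomInv_apply hn _ q (K := l.length + 1) (by rw [← h, List.length_append]; omega)]

lemma geomInv_comp {n : X ⟶ X} (hn : Below 1 n) : geomInv n ≫ (𝟙 X - n) = 𝟙 X := by
  ext x l
  rw [← (geom_mul hn x l).2, comp_apply, comp_apply, fcomp, fcomp]
  refine splitSum_congr fun p q h => ?_
  rw [geomInv_apply hn _ p (K := l.length + 1) (by rw [← h, List.length_append]; omega)]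

/-- An endomorphism whose first component is the identity is invertible. -/
lemma isIso_of_fst_eq_id {f : X ⟶ X} (h : ∀ x, fst f x = x) : IsIso f := by
  -- The inverse of $f=1-(1-f)$ is the geometric series in $n=1-f$, whose first component is zero.
  have hn : Below 1 (𝟙 X - f) := by
    intro x l hl
    obtain rfl : l = [] := List.length_eq_zero_iff.1 (by omega)
    change fst (𝟙 X - f) x = 0
    rw [fst_sub, fst_id, h, sub_self]
  have e : 𝟙 X - (𝟙 X - f) = f := sub_sub_cancel _ _
  have h1 := comp_geomInv hn
  have h2 := geomInv_comp hn
  rw [e] at h1 h2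
  exact ⟨geomInv (𝟙 X - f), h1, h2⟩

/-- An idempotent whose first component vanishes is zero. -/
lemma eq_zero_of_idem {e : X ⟶ X} (he : e ≫ e = e) (h : ∀ x, fst e x = 0) : e = 0 := by
  -- Here $1-e$ is invertible and annihilates $e$.
  have : IsIso (𝟙 X - e) := isIso_of_fst_eq_id fun x => by rw [fst_sub, h, fst_id, sub_zero]
  rw [← cancel_mono (𝟙 X - e), Preadditive.comp_sub, he, Category.comp_id, sub_self,
    Limits.zero_comp]

variable [IsSemisimpleRing S]

/-- A homogeneous retraction $a$ of $f_1$, viewed as a strict morphism, composes with $f$ to an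
endomorphism with identity first component. That endomorphism is invertible, and its inverse
corrects $a$ to a retraction of $f$. -/
lemma exists_retraction {f : X ⟶ Y} (h : Function.Injective (fst f)) : ∃ r : Y ⟶ X, f ≫ r = 𝟙 X := by
  obtain ⟨a, ha, h1⟩ := (isGrHom_fst f).exists_retraction h
  have : IsIso (f ≫ strict a ha) := isIso_of_fst_eq_id fun x => by
    rw [fst_comp, fst_strict, h1]
  exact ⟨strict a ha ≫ inv (f ≫ strict a ha), by rw [← Category.assoc, IsIso.hom_inv_id]⟩

/-- Dual to the construction of retractions: a strict lift of a homogeneous section of $f_1$ is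
corrected by an automorphism of the target. -/
lemma exists_section {f : X ⟶ Y} (h : Function.Surjective (fst f)) : ∃ s : Y ⟶ X, s ≫ f = 𝟙 Y := by
  obtain ⟨a, ha, h1⟩ := (isGrHom_fst f).exists_section h
  have : IsIso (strict a ha ≫ f) := isIso_of_fst_eq_id fun x => by
    rw [fst_comp, fst_strict, h1]
  exact ⟨inv (strict a ha ≫ f) ≫ strict a ha, by rw [Category.assoc, IsIso.inv_hom_id]⟩

/-- A pair of composable morphisms with composition zero whose first components form a short exact
sequence splits. -/
lemma exists_splitting {f : X ⟶ Y} {g : Y ⟶ Z} (w : f ≫ g = 0) (hf : Function.Injective (fst f))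
    (he : Function.Exact (fst f) (fst g)) (hg : Function.Surjective (fst g)) :
    ∃ (r : Y ⟶ X) (s : Z ⟶ Y), f ≫ r = 𝟙 X ∧ s ≫ g = 𝟙 Z ∧ r ≫ f + g ≫ s = 𝟙 Y := by
  obtain ⟨r, hr⟩ := exists_retraction hf
  obtain ⟨s, hs⟩ := exists_section hg
  -- The retraction and the section are chosen independently of each other. Subtracting the part of
  -- $r$ that passes through $s$ makes the new retraction vanish on $s$ and leaves it a retraction
  -- of $f$, since $gf=0$.
  refine ⟨r - g ≫ s ≫ r, s, ?_, hs, ?_⟩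
  · rw [Preadditive.comp_sub, hr, reassoc_of% w, Limits.zero_comp, sub_zero]
  · have h1 : f ≫ (r - g ≫ s ≫ r) = 𝟙 X := by
      rw [Preadditive.comp_sub, hr, reassoc_of% w, Limits.zero_comp, sub_zero]
    have h2 : s ≫ (r - g ≫ s ≫ r) = 0 := by
      rw [Preadditive.comp_sub, reassoc_of% hs, sub_self]
    generalize r - g ≫ s ≫ r = t at h1 h2
    -- The two complementary projections are orthogonal idempotents, so the defect of their sum from
    -- the identity is idempotent. Exactness of the first components forces the first component of
    -- this defect to vanish.
    refine (sub_eq_zero.1 (eq_zero_of_idem (e := 𝟙 Y - (t ≫ f + g ≫ s)) ?_ fun y => ?_)).symm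
    · simp only [Preadditive.comp_sub, Preadditive.sub_comp, Preadditive.comp_add,
        Preadditive.add_comp, Category.comp_id, Category.id_comp, Category.assoc, reassoc_of% h1,
        reassoc_of% h2, reassoc_of% hs, reassoc_of% w, Limits.zero_comp, Limits.comp_zero, add_zero,
        zero_add]
      abel
    -- By exactness $y-s_1g_1(y)=f_1(x)$ for some $x$, and applying $t_1$, which kills $s_1$, gives
    -- $x=t_1(y)$.
    · have h3 : fst g (y - fst s (fst g y)) = 0 := by
        rw [map_sub, ← fst_comp s g, hs, fst_id, sub_self]
      obtain ⟨x, hx⟩ := (he _).1 h3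
      have h4 : fst t y = x := by
        have e1 : fst t (fst f x) = x := by rw [← fst_comp, h1, fst_id]
        have e2 : fst t (fst s (fst g y)) = 0 := by rw [← fst_comp s t, h2, fst_zero]
        rw [← e1, hx, map_sub, e2, sub_zero]
      rw [fst_sub, fst_add, fst_comp, fst_comp, fst_id, h4, hx]
      abel

end GObj

end AInfAlg

/-! ### The twisted differential and Maurer-Cartan elements on summands -/

namespace DGBocs

variable {B : DGBocs.{uk, uS, uC} k S}
variable {M N L : GrMod.{uk, uS, w} k S}

lemma dd_zsmul (a : ℤ) (f : B.BMor M N) : dd (a • f) = a • dd f := rfl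

lemma dd_sub (f g : B.BMor M N) : dd (f - g) = dd f - dd g := rfl

lemma comp_zero (g : B.BMor N L) : comp g (0 : B.BMor M N) = 0 := by
  have := comp_zsmul 0 g (0 : B.BMor M N)
  rwa [zero_smul, zero_smul] at this

lemma zero_comp (f : B.BMor M N) : comp (0 : B.BMor N L) f = 0 := rfl

lemma dd_dd (f : B.BMor M N) : dd (dd f) = 0 :=
  bmor_ext fun m c => by
    rw [dd_tm, dd_tm, B.delta_delta, BTen.tm_zero, map_zero]; rfl

lemma dd_mem {d : ℤ} {f : B.BMor M N} (hf : f ∈ B.BHom d M N) : dd f ∈ B.BHom (d + 1) M N := by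
  intro i j m c hm hc
  rw [dd_tm, show i + j + (d + 1) = i + (j + 1) + d by ring]
  exact hf _ _ _ _ (M.tw_mem 1 hm) (B.delta_mem j c hc)

lemma BHom.zsmul_mem {d : ℤ} {f : B.BMor M N} (hf : f ∈ B.BHom d M N) (a : ℤ) :
    a • f ∈ B.BHom d M N := AddSubgroup.zsmul_mem (B.BHom d M N).toAddSubgroup hf a

lemma dhat_mem {d : ℤ} {f : B.BMor M N} (hf : f ∈ B.BHom d M N) :
    dhat d f ∈ B.BHom (d + 1) M N := BHom.zsmul_mem (dd_mem hf) _

lemma dhat_dhat (e d : ℤ) (f : B.BMor M N) : dhat e (dhat d f) = 0 := by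
  rw [dhat, dhat, dd_zsmul, dd_dd, smul_zero, smul_zero]

/-- The differential `f ↦ δ̂(f) + v * f - (-1)^d f * u` on the morphisms `(M, u) → (N, v)` of
degree `d`. -/
noncomputable def tdiff (d : ℤ) (u : B.BMor M M) (v : B.BMor N N) (f : B.BMor M N) : B.BMor M N :=
  dhat d f + comp v f - sgn d • comp f u

/-- The Leibniz rule for $\hat\delta$ extends because the two terms in $g*v*f$ cancel. The
Maurer-Cartan equation plays no role here, so the rule also applies when a summand is provisionally
given the zero twist. -/
lemma tdiff_comp {e d n : ℤ} (hn : e + d = n) (u : B.BMor M M) (v : B.BMor N N) (t : B.BMor L L)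
    (g : B.BMor N L) {f : B.BMor M N} (hf : f ∈ B.BHom d M N) :
    tdiff n u t (comp g f) = comp (tdiff e v t g) f + sgn e • comp g (tdiff d u v f) := by
  subst hn
  rw [tdiff, tdiff, tdiff, dhat_comp g hf, sub_comp, add_comp, comp_sub, comp_add, zsmul_comp,
    comp_zsmul, comp_assoc, comp_assoc, comp_assoc, smul_sub, smul_add, smul_smul, sgn_add]
  abel

lemma tdiff_mem {d : ℤ} {u : B.BMor M M} {v : B.BMor N N} (hu : u ∈ B.BHom 1 M M)
    (hv : v ∈ B.BHom 1 N N) {f : B.BMor M N} (hf : f ∈ B.BHom d M N) :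
    tdiff d u v f ∈ B.BHom (d + 1) M N := by
  have h := BHom.comp_mem hv hf
  rw [add_comm 1 d] at h
  exact sub_mem (add_mem (dhat_mem hf) h) (BHom.zsmul_mem (BHom.comp_mem hf hu) _)

/-- Since $\hat\delta^2=0$ and the mixed terms cancel by sign, what remains of $D^2(f)$ is the
curvature $\hat\delta(v)+v*v$ applied after $f$ and $\hat\delta(u)+u*u$ applied before it; both
vanish. -/
lemma tdiff_tdiff {d n : ℤ} (hn : d + 1 = n) {u : B.BMor M M} {v : B.BMor N N}
    (hu : u ∈ B.BHom 1 M M) (mu : dhat 1 u + comp u u = 0) (mv : dhat 1 v + comp v v = 0)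
    {f : B.BMor M N} (hf : f ∈ B.BHom d M N) : tdiff n u v (tdiff d u v f) = 0 := by
  have e1 : dhat n (comp v f) = comp (dhat 1 v) f - comp v (dhat d f) := by
    rw [← hn, add_comm d 1, dhat_comp v hf, sgn_one, neg_one_smul, sub_eq_add_neg]
  have e2 : dhat n (comp f u) = comp (dhat d f) u + sgn d • comp f (dhat 1 u) := by
    rw [← hn, dhat_comp f hu]
  have e3 : dhat n (dhat d f + comp v f - sgn d • comp f u) =
      dhat n (dhat d f) + dhat n (comp v f) - sgn d • dhat n (comp f u) := by
    rw [dhat, dhat, dhat, dhat, dd_sub, dd_add, smul_sub, smul_add, dd_zsmul (sgn d),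
      smul_comm (sgn (n + 1)) (sgn d)]; rfl
  have e4 : sgn n = - sgn d := by rw [← hn, sgn_add, sgn_one, mul_neg_one]
  have e5 : sgn d * sgn d = 1 := by rw [← sgn_add, sgn_even (Even.add_self d)]
  have hv : dhat 1 v = - comp v v := eq_neg_of_add_eq_zero_left mv
  have hu' : dhat 1 u = - comp u u := eq_neg_of_add_eq_zero_left mu
  rw [tdiff, tdiff, e3, dhat_dhat, e1, e2, e4, hv, hu', comp_sub, comp_add, sub_comp, add_comp,
    comp_zsmul, zsmul_comp, neg_comp, comp_neg, comp_assoc, comp_assoc, comp_assoc]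
  simp only [smul_sub, smul_add, smul_smul, smul_neg, neg_smul, e5, one_smul, neg_mul]
  abel

/-- The operation on `K` induced by a split monomorphism `f : K → E`. -/
lemma exists_sub_twist {K E : GrMod.{uk, uS, w} k S} {v : B.BMor E E} (hv : v ∈ B.BHom 1 E E)
    (mv : dhat 1 v + comp v v = 0) {f : B.BMor K E} (hf : f ∈ B.BHom 0 K E) {r : B.BMor E K}
    (hr : r ∈ B.BHom 0 E K) (hrf : comp r f = id_ K)
    (H : comp f (comp r (dhat 0 f + comp v f)) = dhat 0 f + comp v f) :
    ∃ u ∈ B.BHom 1 K K, dhat 1 u + comp u u = 0 ∧ tdiff 0 u v f = 0 := by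
  -- For $f$ to become a cocycle, $f*u$ must equal $\hat\delta(f)+v*f$; composing with the
  -- retraction $r$ dictates $u$, and `H` says that this choice works.
  obtain ⟨u, hu⟩ : ∃ u, u = comp r (dhat 0 f + comp v f) := ⟨_, rfl⟩
  have hu1 : u ∈ B.BHom 1 K K := by
    have h1 := BHom.comp_mem hv hf
    have h2 := BHom.comp_mem hr (add_mem (dhat_mem hf) h1)
    rw [hu]; exact h2
  rw [← hu] at H
  have hv' : dhat 1 v = - comp v v := eq_neg_of_add_eq_zero_left mv
  refine ⟨u, hu1, ?_, ?_⟩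
  -- Applying $\hat\delta$ to both sides of $f*u=\hat\delta(f)+v*f$ and using the Maurer-Cartan
  -- equation of $v$ gives $f*(\hat\delta(u)+u*u)=0$, and $f$ can be cancelled by $r$.
  · have h1 : dhat 1 (comp f u) = comp (dhat 0 f) u + comp f (dhat 1 u) := by
      have := dhat_comp (e := 0) f hu1
      rwa [sgn_zero, one_smul] at this
    have h2 : dhat 1 (comp f u) = comp (dhat 1 v) f - comp v (dhat 0 f) := by
      have := dhat_comp (e := 1) v hf
      rw [sgn_one, neg_one_smul] at this
      have e : dhat 1 (dhat 0 f + comp v f) = dhat 1 (dhat 0 f) + dhat 1 (comp v f) := by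
        rw [dhat, dd_add, smul_add]; rfl
      rw [H, e, dhat_dhat, zero_add, sub_eq_add_neg]
      exact this
    have h3 : comp f (dhat 1 u + comp u u) = 0 := by
      have h4 : comp f (dhat 1 u) = comp (dhat 1 v) f - comp v (dhat 0 f) - comp (dhat 0 f) u := by
        rw [← h2, h1]; abel
      rw [comp_add, h4, ← comp_assoc, H, add_comp, comp_assoc v f u, H, comp_add, hv', neg_comp,
        comp_assoc]
      abel
    have h5 := congrArg (comp r) h3
    rwa [← comp_assoc, hrf, id_comp, comp_zero] at h5
  · rw [tdiff, H, sgn_zero, one_smul, sub_self]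

/-- The operation on `Q` induced by a split epimorphism `g : E → Q`. -/
lemma exists_quot_twist {Q E : GrMod.{uk, uS, w} k S} {v : B.BMor E E} (hv : v ∈ B.BHom 1 E E)
    (mv : dhat 1 v + comp v v = 0) {g : B.BMor E Q} (hg : g ∈ B.BHom 0 E Q) {s : B.BMor Q E}
    (hs : s ∈ B.BHom 0 Q E) (hgs : comp g s = id_ Q)
    (H : comp (comp (dhat 0 g - comp g v) s) g = dhat 0 g - comp g v) :
    ∃ u ∈ B.BHom 1 Q Q, dhat 1 u + comp u u = 0 ∧ tdiff 0 v u g = 0 := by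
  -- The cocycle condition for $g$ reads $u*g=g*v-\hat\delta(g)$, whence the sign; composing with
  -- the section $s$ determines $u$.
  obtain ⟨u, hu⟩ : ∃ u, u = - comp (dhat 0 g - comp g v) s := ⟨_, rfl⟩
  have hu1 : u ∈ B.BHom 1 Q Q := by
    have h1 := BHom.comp_mem hg hv
    have h2 := BHom.comp_mem (sub_mem (dhat_mem hg) h1) hs
    rw [hu]; exact neg_mem h2
  replace H : comp u g = comp g v - dhat 0 g := by rw [hu, neg_comp, H, neg_sub]
  have hv' : dhat 1 v = - comp v v := eq_neg_of_add_eq_zero_left mv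
  refine ⟨u, hu1, ?_, ?_⟩
  -- As for summands: $\hat\delta$ of both expressions for $u*g$ yields $(\hat\delta(u)+u*u)*g=0$,
  -- and $g$ is cancelled by $s$ on the right.
  · have h1 : dhat 1 (comp u g) = comp (dhat 1 u) g - comp u (dhat 0 g) := by
      have := dhat_comp (e := 1) u hg
      rwa [sgn_one, neg_one_smul, ← sub_eq_add_neg] at this
    have h2 : dhat 1 (comp u g) = comp (dhat 0 g) v + comp g (dhat 1 v) := by
      have := dhat_comp (e := 0) g hv
      rw [sgn_zero, one_smul] at this
      have e : dhat 1 (comp g v - dhat 0 g) = dhat 1 (comp g v) - dhat 1 (dhat 0 g) := by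
        rw [dhat, dd_sub, smul_sub]; rfl
      rw [H, e, dhat_dhat, sub_zero]
      exact this
    have h3 : comp (dhat 1 u + comp u u) g = 0 := by
      have h4 : comp (dhat 1 u) g = comp (dhat 0 g) v + comp g (dhat 1 v) + comp u (dhat 0 g) := by
        rw [← h2, h1]; abel
      rw [add_comp, h4, comp_assoc, H, comp_sub, ← comp_assoc, H, sub_comp, comp_assoc, hv', comp_neg]
      abel
    have h5 := congrArg (fun z => comp z s) h3
    change comp (comp _ g) s = comp 0 s at h5
    rwa [comp_assoc, hgs, comp_id, zero_comp] at h5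
  · rw [tdiff, H, sgn_zero, one_smul]; abel

end DGBocs

/-! ### $A_\infty$-modules inside $\mathrm{GMod}^0\text{-}A$: cocycles, lifts and induced operations
-/

namespace AInfAlg

open DGBocs

variable {𝒜 : AInfAlg.{uk, uS, uA} k S}

namespace GObj

variable {X Y Z : GObj.{uk, uS, uA, w} 𝒜}

/-- The morphism of `B_A`-modules that corresponds to a morphism of `GMod⁰-A`. -/
noncomputable def hatG (f : X ⟶ Y) : 𝒜.bar.BMor X.M.shift Y.M.shift := hat f.1 f.2.1

lemma hatG_mem (f : X ⟶ Y) : hatG f ∈ 𝒜.bar.BHom 0 X.M.shift Y.M.shift := hat_mem f.2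

lemma hatG_comp (f : X ⟶ Y) (g : Y ⟶ Z) : hatG (f ≫ g) = DGBocs.comp (hatG g) (hatG f) :=
  hat_gcomp g f

lemma hatG_id (X : GObj.{uk, uS, uA, w} 𝒜) : hatG (𝟙 X) = DGBocs.id_ X.M.shift := hat_fid

lemma hatG_add (f g : X ⟶ Y) : hatG (f + g) = hatG f + hatG g := hat_add f.2.1 g.2.1 _

lemma hatG_zero : hatG (0 : X ⟶ Y) = 0 := by
  have := hatG_add (0 : X ⟶ Y) 0
  rwa [add_zero, left_eq_add] at this

lemma exists_hatG {φ : 𝒜.bar.BMor X.M.shift Y.M.shift} (h : φ ∈ 𝒜.bar.BHom 0 X.M.shift Y.M.shift) :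
    ∃ f : X ⟶ Y, hatG f = φ := ⟨⟨unhat φ, unhat_mem h⟩, hat_unhat φ⟩

end GObj

open GObj

namespace Mod

variable {X Y Z W : Mod.{uk, uS, uA, w} 𝒜}

/-- The underlying object of `GMod⁰-A`. -/
abbrev o (X : Mod.{uk, uS, uA, w} 𝒜) : GObj.{uk, uS, uA, w} 𝒜 := (forgetOps 𝒜).obj X

/-- The underlying morphism of `GMod⁰-A`. -/
abbrev u (f : X ⟶ Y) : X.o ⟶ Y.o := (forgetOps 𝒜).map f

lemma u_inj {f g : X ⟶ Y} (h : u f = u g) : f = g := Subtype.ext (congrArg (fun z : X.o ⟶ Y.o => z.1) h)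

/-- The operations of an `A_∞`-module, as a morphism of `B_A`-modules. -/
noncomputable def op (X : Mod.{uk, uS, uA, w} 𝒜) : 𝒜.bar.BMor X.o.M.shift X.o.M.shift :=
  hat X.m X.m_mem.1

lemma op_mem (X : Mod.{uk, uS, uA, w} 𝒜) : X.op ∈ 𝒜.bar.BHom 1 X.o.M.shift X.o.M.shift :=
  hat_mem X.m_mem

lemma op_mc (X : Mod.{uk, uS, uA, w} 𝒜) : dhat 1 X.op + DGBocs.comp X.op X.op = 0 := X.dd_hat

/-- With its converse below, this describes $\mathrm{Mod}_\infty\text{-}A$ as the cocycles of degree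
$0$ among the morphisms of $\mathrm{GMod}^0\text{-}A$. All further arguments use only this
description, never the signed sums. -/
lemma tdiff_u (f : X ⟶ Y) : tdiff 0 X.op Y.op (hatG (u f)) = 0 :=
  (mem_TGHom_iff_hat (TGHom.fam f)).1 f.2

lemma exists_u {f : X.o ⟶ Y.o} (h : tdiff 0 X.op Y.op (hatG f) = 0) : ∃ g : X ⟶ Y, u g = f :=
  ⟨⟨f.1, (mem_TGHom_iff_hat f.2).2 h⟩, rfl⟩

/-- The `A_∞`-module that corresponds to a twisted module over the bar construction. -/
noncomputable def ofTw (M : GrMod.{uk, uS, w} k S) (φ : 𝒜.bar.BMor M.shift M.shift)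
    (hφ : φ ∈ 𝒜.bar.BHom 1 M.shift M.shift) (mc : dhat 1 φ + DGBocs.comp φ φ = 0) :
    Mod.{uk, uS, uA, w} 𝒜 where
  M := M
  m := unhat φ
  m_mem := unhat_mem hφ
  stasheff := stasheff_of_mc rfl hφ mc

lemma op_ofTw (M : GrMod.{uk, uS, w} k S) (φ : 𝒜.bar.BMor M.shift M.shift) (hφ mc) :
    (ofTw M φ hφ mc).op = φ := hat_unhat φ

/-- A morphism of `GMod⁰-A` into `Y` is a morphism of `A_∞`-modules if its composition with a
morphism `f` that splits in `GMod⁰-A` is one. -/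
lemma exists_lift {f : Y ⟶ Z} {r : Z.o ⟶ Y.o} (hr : u f ≫ r = 𝟙 _) {h : X.o ⟶ Y.o} {l : X ⟶ Z}
    (e : h ≫ u f = u l) : ∃ h' : X ⟶ Y, u h' = h ∧ h' ≫ f = l := by
  have h1 : tdiff 0 X.op Y.op (hatG h) = 0 := by
    -- By the Leibniz rule $0=D(l)=f*D(h)$, because $f$ is a cocycle of degree $0$; composing with
    -- the retraction $r$ leaves $D(h)=0$.
    have h2 := tdiff_u l
    rw [← e, hatG_comp, tdiff_comp (add_zero 0) X.op Y.op Z.op _ (hatG_mem h), tdiff_u f, zero_comp,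
      zero_add, sgn_zero, one_smul] at h2
    have h3 := congrArg (DGBocs.comp (hatG r)) h2
    rwa [← comp_assoc, ← hatG_comp, hr, hatG_id, id_comp, comp_zero] at h3
  obtain ⟨h', rfl⟩ := exists_u h1
  exact ⟨h', rfl, u_inj e⟩

/-- A morphism of `GMod⁰-A` from `Y` is a morphism of `A_∞`-modules if its composition with a
morphism `g` that splits in `GMod⁰-A` is one. -/
lemma exists_desc {g : X ⟶ Y} {s : Y.o ⟶ X.o} (hs : s ≫ u g = 𝟙 _) {h : Y.o ⟶ Z.o} {l : X ⟶ Z}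
    (e : u g ≫ h = u l) : ∃ h' : Y ⟶ Z, u h' = h ∧ g ≫ h' = l := by
  have h1 : tdiff 0 Y.op Z.op (hatG h) = 0 := by
    -- Dually, $0=D(l)=D(h)*g$, and the section $s$ cancels $g$.
    have h2 := tdiff_u l
    rw [← e, hatG_comp, tdiff_comp (add_zero 0) X.op Y.op Z.op _ (hatG_mem _), tdiff_u g, comp_zero,
      smul_zero, add_zero] at h2
    have h3 := congrArg (fun z => DGBocs.comp z (hatG s)) h2
    change DGBocs.comp (DGBocs.comp _ _) _ = DGBocs.comp 0 _ at h3
    rwa [comp_assoc, ← hatG_comp, hs, hatG_id, comp_id, zero_comp] at h3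
  obtain ⟨h', rfl⟩ := exists_u h1
  exact ⟨h', rfl, u_inj e⟩

/-- The hypothesis `H` says that $\hat\delta(f)+m^E*f$ is fixed by the idempotent $f*r$, that is,
factors through $f$; so the Maurer-Cartan element of $E$ restricts to $K$. The isomorphism $\theta$
keeps the identification of the new module with $K$ formal. -/
lemma exists_sub {E : Mod.{uk, uS, uA, w} 𝒜} {K : GObj.{uk, uS, uA, w} 𝒜} {f : K ⟶ E.o} {r : E.o ⟶ K}
    (hr : f ≫ r = 𝟙 K) (H : DGBocs.comp (hatG (r ≫ f)) (dhat 0 (hatG f) + DGBocs.comp E.op (hatG f)) =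
      dhat 0 (hatG f) + DGBocs.comp E.op (hatG f)) :
    ∃ (Z : Mod.{uk, uS, uA, w} 𝒜) (θ : Z.o ≅ K) (i : Z ⟶ E), u i = θ.hom ≫ f := by
  obtain ⟨φ, hφ, mc, h⟩ := exists_sub_twist E.op_mem E.op_mc (hatG_mem f) (hatG_mem r)
    (by rw [← hatG_comp, hr, hatG_id]) (by rw [← comp_assoc, ← hatG_comp, H])
  have h' : tdiff 0 (ofTw K.M φ hφ mc).op E.op (hatG f) = 0 := by rw [op_ofTw]; exact h
  obtain ⟨i, hi⟩ := exists_u (X := ofTw K.M φ hφ mc) (f := f) h'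
  exact ⟨ofTw K.M φ hφ mc, Iso.refl K, i, hi.trans (Category.id_comp f).symm⟩

/-- The dual of `exists_sub`: the obstruction must factor through $g$, so that the operations of $E$
pass to the quotient $Q$. -/
lemma exists_quot {E : Mod.{uk, uS, uA, w} 𝒜} {Q : GObj.{uk, uS, uA, w} 𝒜} {g : E.o ⟶ Q} {s : Q ⟶ E.o}
    (hs : s ≫ g = 𝟙 Q) (H : DGBocs.comp (dhat 0 (hatG g) - DGBocs.comp (hatG g) E.op) (hatG (g ≫ s)) =
      dhat 0 (hatG g) - DGBocs.comp (hatG g) E.op) :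
    ∃ (Z : Mod.{uk, uS, uA, w} 𝒜) (θ : Q ≅ Z.o) (p : E ⟶ Z), u p = g ≫ θ.hom := by
  obtain ⟨φ, hφ, mc, h⟩ := exists_quot_twist E.op_mem E.op_mc (hatG_mem g) (hatG_mem s)
    (by rw [← hatG_comp, hs, hatG_id]) (by rw [comp_assoc, ← hatG_comp, H])
  have h' : tdiff 0 E.op (ofTw Q.M φ hφ mc).op (hatG g) = 0 := by rw [op_ofTw]; exact h
  obtain ⟨i, hi⟩ := exists_u (Y := ofTw Q.M φ hφ mc) (f := g) h'
  exact ⟨ofTw Q.M φ hφ mc, Iso.refl Q, i, hi.trans (Category.comp_id g).symm⟩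

end Mod

end AInfAlg

/-! ### Conflations, kernels, cokernels and split idempotents -/

namespace AInfAlg

open DGBocs GObj

variable {𝒜 : AInfAlg.{uk, uS, uA} k S}

namespace Mod

variable {X Y Z W : Mod.{uk, uS, uA, w} 𝒜}

lemma fst_comp (f : X ⟶ Y) (g : Y ⟶ Z) (x : X.M) : fst (f ≫ g) x = fst g (fst f x) :=
  GObj.fst_comp (u f) (u g) x

lemma fst_id (x : X.M) : fst (𝟙 X) x = x := rfl

lemma fst_neg (f : X ⟶ Y) (x : X.M) : fst (-f) x = - fst f x := rfl

lemma fst_zero (x : X.M) : fst (0 : X ⟶ Y) x = 0 := rfl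

lemma u_comp (f : X ⟶ Y) (g : Y ⟶ Z) : u (f ≫ g) = u f ≫ u g := rfl

lemma u_id : u (𝟙 X) = 𝟙 X.o := rfl

lemma u_zero : u (0 : X ⟶ Y) = 0 := rfl

end Mod

open AInfinity.AInfAlg.Mod

lemma einf_of_splitting {P : ShortComplex (Mod.{uk, uS, uA, w} 𝒜)} {r : P.X₂.o ⟶ P.X₁.o}
    {s : P.X₃.o ⟶ P.X₂.o} (hr : u P.f ≫ r = 𝟙 _) (hs : s ≫ u P.g = 𝟙 _)
    (h : r ≫ u P.f + u P.g ≫ s = 𝟙 _) : Einf 𝒜 P := by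
  have h1 : ∀ x, GObj.fst r (GObj.fst (u P.f) x) = x := fun x => by
    rw [← GObj.fst_comp, hr, GObj.fst_id]
  have h2 : ∀ x, GObj.fst (u P.g) (GObj.fst s x) = x := fun x => by
    rw [← GObj.fst_comp, hs, GObj.fst_id]
  refine ⟨Function.LeftInverse.injective h1, fun y => ⟨fun hy => ⟨GObj.fst r y, ?_⟩, ?_⟩,
    Function.RightInverse.surjective h2⟩
  · have h3 : ∀ y, GObj.fst (u P.f) (GObj.fst r y) + GObj.fst s (GObj.fst (u P.g) y) = y := by
      intro y
      rw [← GObj.fst_comp, ← GObj.fst_comp, ← GObj.fst_add, h, GObj.fst_id]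
    have hy' : GObj.fst (u P.g) y = 0 := hy
    refine Eq.trans ?_ (h3 y)
    rw [hy', map_zero, add_zero]; rfl
  · rintro ⟨x, rfl⟩
    rw [← Mod.fst_comp, P.zero, Mod.fst_zero]

variable [IsSemisimpleRing S]

/-- Exactness is a condition on first components only, but it splits the whole pair once the
operations are forgotten. The splitting maps are in general not morphisms of $A_\infty$-modules. -/
lemma Einf.exists_splitting {P : ShortComplex (Mod.{uk, uS, uA, w} 𝒜)} (h : Einf 𝒜 P) :
    ∃ (r : P.X₂.o ⟶ P.X₁.o) (s : P.X₃.o ⟶ P.X₂.o), u P.f ≫ r = 𝟙 _ ∧ s ≫ u P.g = 𝟙 _ ∧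
      r ≫ u P.f + u P.g ≫ s = 𝟙 _ :=
  GObj.exists_splitting (by rw [← u_comp, P.zero, u_zero]) h.1 h.2.1 h.2.2

lemma einf_iff_splitting (P : ShortComplex (Mod.{uk, uS, uA, w} 𝒜)) :
    Einf 𝒜 P ↔ Nonempty (P.map (forgetOps 𝒜)).Splitting := by
  constructor
  · intro h
    obtain ⟨r, s, h1, h2, h3⟩ := h.exists_splitting
    exact ⟨⟨r, s, h1, h2, h3⟩⟩
  · rintro ⟨t⟩
    exact einf_of_splitting (r := t.r) (s := t.s) t.f_r t.s_g t.id

/-- Splittings are transported along isomorphisms, so the splitting criterion makes the class closed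
under them. -/
lemma Einf.of_iso {P Q : ShortComplex (Mod.{uk, uS, uA, w} 𝒜)} (e : P ≅ Q) (h : Einf 𝒜 P) :
    Einf 𝒜 Q := by
  rw [einf_iff_splitting] at h ⊢
  obtain ⟨t⟩ := h
  exact ⟨t.ofIso ((forgetOps 𝒜).mapShortComplex.mapIso e)⟩

/-- A kernel is first constructed in $\mathrm{GMod}^0\text{-}A$ on the graded kernel of $p_1$;
operations are then induced on it, which is possible because $p$ is a cocycle. -/
lemma exists_kernel {Y Z : Mod.{uk, uS, uA, w} 𝒜} (p : Y ⟶ Z) (hp : Function.Surjective (Mod.fst p)) :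
    ∃ (X : Mod.{uk, uS, uA, w} 𝒜) (i : X ⟶ Y) (h : i ≫ p = 0), Einf 𝒜 (ShortComplex.mk i p h) := by
  obtain ⟨s, hs⟩ := GObj.exists_section (f := u p) hp
  have ha := isGrHom_fst (u p)
  obtain ⟨f, hf, hf0⟩ : ∃ f : GObj.mk (𝒜 := 𝒜) (GrMod.ker (GObj.fst (u p)) ha) ⟶ Y.o,
      f ≫ u p = 0 ∧ ∀ x, GObj.fst f x = GrMod.kerι _ ha x := by
    -- The strict inclusion of the kernel of $p_1$ need not be killed by the higher components of
    -- $p$. Projecting along the section $s$ repairs this and does not alter the first component.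
    refine ⟨strict (GrMod.kerι _ ha) (GrMod.isGrHom_kerι _ ha) ≫ (𝟙 Y.o - u p ≫ s), ?_, fun x => ?_⟩
    · rw [Category.assoc, Preadditive.sub_comp, Category.id_comp, Category.assoc, hs,
        Category.comp_id, sub_self, Limits.comp_zero]
    · rw [GObj.fst_comp, fst_strict, fst_sub, GObj.fst_comp, GrMod.apply_kerι, map_zero, sub_zero,
        GObj.fst_id]
  obtain ⟨r, s', h1, h2, h3⟩ := GObj.exists_splitting hf
    (fun x y h => by
      rw [hf0, hf0] at h
      exact GrMod.kerι_injective _ _ h)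
    (fun y => ⟨fun hy => by
      obtain ⟨x, hx⟩ := GrMod.exists_kerι _ ha hy
      exact ⟨x, by rw [hf0, hx]⟩, by
      rintro ⟨x, rfl⟩
      rw [← GObj.fst_comp, hf, GObj.fst_zero]⟩) hp
  -- With the zero twist on the kernel, the Leibniz rule for $p*f=0$ gives $p*D(f)=0$, since $p$ is
  -- a cocycle.
  have H : DGBocs.comp (hatG (u p)) (tdiff 0 0 Y.op (hatG f)) = 0 := by
    have h4 := tdiff_comp (add_zero 0) 0 Y.op Z.op (hatG (u p)) (hatG_mem f)
    rw [← hatG_comp, hf, tdiff_u, hatG_zero, zero_comp, zero_add, sgn_zero, one_smul] at h4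
    rw [← h4, tdiff, dhat, comp_zero, comp_zero]
    change sgn (0 + 1) • (0 : 𝒜.bar.BMor _ _) + 0 - sgn 0 • 0 = 0
    rw [smul_zero, smul_zero, add_zero, sub_zero]
  have e : tdiff 0 0 Y.op (hatG f) = dhat 0 (hatG f) + DGBocs.comp Y.op (hatG f) := by
    rw [tdiff, comp_zero, smul_zero, sub_zero]
  -- As $p*D(f)=0$, the complementary projection $s'*p$ kills $D(f)$, so $D(f)$ factors through $f$.
  obtain ⟨X, θ, i, hi⟩ := exists_sub h1 (by
    have h5 : hatG (r ≫ f) + hatG (u p ≫ s') = DGBocs.id_ _ := by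
      rw [← hatG_add, h3, hatG_id]
    rw [eq_sub_of_add_eq h5, ← e, sub_comp, id_comp, hatG_comp, comp_assoc, H, comp_zero, sub_zero])
  have w : i ≫ p = 0 := u_inj (by rw [u_comp, hi, Category.assoc, hf, Limits.comp_zero, u_zero])
  refine ⟨X, i, w, einf_of_splitting (r := r ≫ θ.inv) (s := s') ?_ h2 ?_⟩
  · change u i ≫ _ = _
    rw [hi, Category.assoc, reassoc_of% h1, θ.hom_inv_id]
  · change _ ≫ u i + u p ≫ _ = _
    rw [hi, Category.assoc, θ.inv_hom_id_assoc, h3]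

/-- The cokernel is realised on a complement: the kernel of $r_1$ for a retraction $r$ of $i$ in
$\mathrm{GMod}^0\text{-}A$. The operations then descend by the argument dual to that for kernels. -/
lemma exists_cokernel {X Y : Mod.{uk, uS, uA, w} 𝒜} (i : X ⟶ Y) (hi : Function.Injective (Mod.fst i)) :
    ∃ (Z : Mod.{uk, uS, uA, w} 𝒜) (p : Y ⟶ Z) (h : i ≫ p = 0), Einf 𝒜 (ShortComplex.mk i p h) := by
  obtain ⟨r, hr⟩ := GObj.exists_retraction (f := u i) hi
  have hr0 : ∀ x, GObj.fst r (GObj.fst (u i) x) = x := fun x => by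
    rw [← GObj.fst_comp, hr, GObj.fst_id]
  have ha := isGrHom_fst r
  obtain ⟨ρ, hρ, hρ0⟩ := (GrMod.isGrHom_kerι _ ha).exists_retraction (GrMod.kerι_injective _ ha)
  obtain ⟨g, hg, hg0⟩ : ∃ g : Y.o ⟶ GObj.mk (𝒜 := 𝒜) (GrMod.ker (GObj.fst r) ha),
      u i ≫ g = 0 ∧ ∀ y, GObj.fst g y = ρ (y - GObj.fst (u i) (GObj.fst r y)) := by
    -- The projection $1-i\circ r$ annihilates $i$, and its first component takes values in the
    -- kernel of $r_1$, where $\rho$ is the identity.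
    refine ⟨(𝟙 Y.o - r ≫ u i) ≫ strict ρ hρ, ?_, fun y => ?_⟩
    · rw [Preadditive.sub_comp, Preadditive.comp_sub, Category.id_comp, Category.assoc,
        reassoc_of% hr, sub_self]
    · rw [GObj.fst_comp, fst_strict, fst_sub, GObj.fst_comp, GObj.fst_id]
  obtain ⟨r', s, h1, h2, h3⟩ := GObj.exists_splitting hg hi
    (fun y => ⟨fun hy => by
      rw [hg0] at hy
      obtain ⟨z, hz⟩ := GrMod.exists_kerι _ ha (x := y - GObj.fst (u i) (GObj.fst r y)) (by
        rw [map_sub, hr0, sub_self])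
      rw [← hz, hρ0] at hy
      rw [hy, map_zero] at hz
      exact ⟨_, (sub_eq_zero.1 hz.symm).symm⟩, by
      rintro ⟨x, rfl⟩
      rw [← GObj.fst_comp, hg, GObj.fst_zero]⟩)
    (fun q => ⟨GrMod.kerι _ ha q, by rw [hg0, GrMod.apply_kerι, map_zero, sub_zero, hρ0]⟩)
  -- Now the zero twist is put on the target of $g$, and the Leibniz rule is applied to $g*i=0$.
  have H : DGBocs.comp (tdiff 0 Y.op 0 (hatG g)) (hatG (u i)) = 0 := by
    have h4 := tdiff_comp (add_zero 0) X.op Y.op 0 (hatG g) (hatG_mem (u i))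
    rw [← hatG_comp, hg, tdiff_u, hatG_zero, comp_zero, smul_zero, add_zero] at h4
    rw [← h4, tdiff, dhat, comp_zero, zero_comp]
    change sgn (0 + 1) • (0 : 𝒜.bar.BMor _ _) + 0 - sgn 0 • 0 = 0
    rw [smul_zero, smul_zero, add_zero, sub_zero]
  have e : tdiff 0 Y.op 0 (hatG g) = dhat 0 (hatG g) - DGBocs.comp (hatG g) Y.op := by
    rw [tdiff, zero_comp, add_zero, sgn_zero, one_smul]
  obtain ⟨Z, θ, p, hp⟩ := exists_quot h2 (by
    have h5 : hatG (r' ≫ u i) + hatG (g ≫ s) = DGBocs.id_ _ := by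
      rw [← hatG_add, h3, hatG_id]
    rw [eq_sub_of_add_eq' h5, ← e, comp_sub, comp_id, hatG_comp r', ← comp_assoc, H, zero_comp,
      sub_zero])
  have w : i ≫ p = 0 := u_inj (by rw [u_comp, hp, reassoc_of% hg, Limits.zero_comp, u_zero])
  refine ⟨Z, p, w, einf_of_splitting (r := r') (s := θ.inv ≫ s) h1 ?_ ?_⟩
  · change _ ≫ u p = _
    rw [hp, Category.assoc, reassoc_of% h2, θ.inv_hom_id]
  · change _ ≫ u i + u p ≫ _ = _
    rw [hp, Category.assoc, θ.hom_inv_id_assoc, h3]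

lemma isInflation_iff {X Y : Mod.{uk, uS, uA, w} 𝒜} (f : X ⟶ Y) :
    IsInflation (Einf 𝒜) f ↔ Function.Injective (Mod.fst f) :=
  ⟨fun ⟨_, _, _, h⟩ => h.1, fun h => exists_cokernel f h⟩

lemma isDeflation_iff {X Y : Mod.{uk, uS, uA, w} 𝒜} (f : X ⟶ Y) :
    IsDeflation (Einf 𝒜) f ↔ Function.Surjective (Mod.fst f) :=
  ⟨fun ⟨_, _, _, h⟩ => h.2.2, fun h => exists_kernel f h⟩

/-- The idempotent is split on the image of its first component, that is, on the kernel of $1-e_1$.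
Operations are induced on this image because $e$ is a cocycle. -/
instance : IsIdempotentComplete (Mod.{uk, uS, uA, w} 𝒜) where
  idempotents_split X e he := by
    have he' : u e ≫ u e = u e := by rw [← u_comp, he]
    have he0 : ∀ x, GObj.fst (u e) (GObj.fst (u e) x) = GObj.fst (u e) x := fun x => by
      rw [← GObj.fst_comp, he']
    have ha := isGrHom_fst (𝟙 X.o - u e)
    obtain ⟨f, hf, hf0⟩ : ∃ f : GObj.mk (𝒜 := 𝒜) (GrMod.ker (GObj.fst (𝟙 X.o - u e)) ha) ⟶ X.o,
        f ≫ u e = f ∧ ∀ x, GObj.fst f x = GrMod.kerι _ ha x := by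
      -- Composing the strict inclusion with $e$ makes $f$ invariant under $e$ in all components;
      -- the first component is unchanged because $e_1$ is the identity on its image.
      refine ⟨strict (GrMod.kerι _ ha) (GrMod.isGrHom_kerι _ ha) ≫ u e, ?_, fun x => ?_⟩
      · rw [Category.assoc, he']
      · rw [GObj.fst_comp, fst_strict]
        have := GrMod.apply_kerι _ ha x
        rw [fst_sub, GObj.fst_id, sub_eq_zero] at this
        exact this.symm
    obtain ⟨r, hr⟩ := GObj.exists_retraction (f := f) (fun x y h => by
      rw [hf0, hf0] at h
      exact GrMod.kerι_injective _ _ h)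
    have h1 : f ≫ u e ≫ r = 𝟙 _ := by rw [reassoc_of% hf, hr]
    -- From $e\circ f=f$ and $r\circ f=1$ the difference is idempotent. Its first component
    -- vanishes, since $e_1$ takes values in the image of $f_1$.
    have h2 : u e - (u e ≫ r) ≫ f = 0 := by
      refine eq_zero_of_idem ?_ fun x => ?_
      · simp only [Preadditive.comp_sub, Preadditive.sub_comp, Category.assoc, he', hf, reassoc_of% he',
          reassoc_of% hf, reassoc_of% hr]
        abel
      · obtain ⟨z, hz⟩ := GrMod.exists_kerι _ ha (x := GObj.fst (u e) x) (by
          rw [fst_sub, GObj.fst_id, he0, sub_self])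
        have h3 : GObj.fst r (GObj.fst f z) = z := by rw [← GObj.fst_comp, hr, GObj.fst_id]
        rw [fst_sub, GObj.fst_comp, GObj.fst_comp, ← hz, ← hf0, h3, sub_self]
    replace h2 : (u e ≫ r) ≫ f = u e := (sub_eq_zero.1 h2).symm
    have e0 : tdiff 0 0 X.op (hatG f) = dhat 0 (hatG f) + DGBocs.comp X.op (hatG f) := by
      rw [tdiff, comp_zero, smul_zero, sub_zero]
    -- Applying the Leibniz rule to $e*f=f$ gives $e*D(f)=D(f)$, and $e$ equals $f\circ(r\circ e)$,
    -- so $D(f)$ factors through $f$.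
    obtain ⟨Y, θ, i, hi⟩ := exists_sub h1 (by
      have h4 := tdiff_comp (add_zero 0) 0 X.op X.op (hatG (u e)) (hatG_mem f)
      rw [← hatG_comp, hf, tdiff_u, zero_comp, zero_add, sgn_zero, one_smul, e0] at h4
      rw [h2, ← h4])
    have hr' : u i ≫ (u e ≫ r) ≫ θ.inv = 𝟙 _ := by
      rw [hi, Category.assoc, Category.assoc, reassoc_of% h1, θ.hom_inv_id]
    -- The projection onto the image is a cocycle because its composition with the split
    -- monomorphism $i$ is the morphism $e$.
    obtain ⟨q, hq, hq'⟩ := exists_lift hr' (h := (u e ≫ r) ≫ θ.inv) (l := e) (by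
      rw [hi, Category.assoc, θ.inv_hom_id_assoc, h2])
    exact ⟨Y, i, q, u_inj (by rw [u_comp, hq, hr', u_id]), hq'⟩

end AInfAlg

/-! ### Direct sums and the zero module -/

namespace DGBocs

variable {B : DGBocs.{uk, uS, uC} k S}

lemma diag_mc {M N : GrMod.{uk, uS, w} k S} {u : B.BMor M M} {v : B.BMor N N}
    (hu : dhat 1 u + comp u u = 0) (hv : dhat 1 v + comp v v = 0) :
    dhat 1 (diag u v) + comp (diag u v) (diag u v) = 0 := by
  rw [dhat, dd_diag, comp_diag_diag]
  refine bmor_ext fun m c => Prod.ext ?_ ?_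
  · exact congrArg (fun f : B.BMor M M => f (BTen.tm k S m.1 c)) hu
  · exact congrArg (fun f : B.BMor N N => f (BTen.tm k S m.2 c)) hv

/-- The direct sum of twisted modules. -/
noncomputable def tsum (X Y : TwMod.{uk, uS, uC, w} B) : TwMod.{uk, uS, uC, w} B where
  M := X.M.prod Y.M
  u := diag X.u Y.u
  u_mem := diag_mem X.u_mem Y.u_mem
  mc := diag_mc X.mc Y.mc

end DGBocs

namespace AInfAlg

open DGBocs GObj AInfinity.AInfAlg.Mod

variable {𝒜 : AInfAlg.{uk, uS, uA} k S}

section Biproducts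

/-- For a strict family the terms that insert an operation of $A$ vanish, as they are evaluated on
nonempty lists. The morphism equation reduces to commutation of $a$ with the operations. -/
lemma tdiff_strictFam {X Y : Mod.{uk, uS, uA, w} 𝒜} {a : X.M →ₗ[k] Y.M} (ha : GrMod.IsGrHom a)
    (h : ∀ x l, a (X.m x l) = Y.m (a x) l) : strictFam a ∈ TGHom 𝒜 0 X Y := by
  refine mem_TGHom.2 ⟨strictFam_mem ha, ?_⟩
  have e : fins (𝒜 := 𝒜) (strictFam a) = 0 := by
    funext x l
    rw [fins, splitSum₃]
    refine splitSum_eq_zero fun p y _ => splitSum_eq_zero fun q r _ => ?_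
    rw [strictFam_append_cons, smul_zero]
  rw [e, zero_add, sgn_zero, one_smul, sub_eq_zero]
  funext x l
  rw [fcomp_strictFam_left, fcomp_strictFam_right Y.m_mem.1, h]

/-- The strict morphism of `A_∞`-modules with the given first component. -/
def strictHom {X Y : Mod.{uk, uS, uA, w} 𝒜} (a : X.M →ₗ[k] Y.M) (ha : GrMod.IsGrHom a)
    (h : ∀ x l, a (X.m x l) = Y.m (a x) l) : X ⟶ Y := ⟨strictFam a, tdiff_strictFam ha h⟩

section

variable {X Y Z : Mod.{uk, uS, uA, w} 𝒜}

lemma strictHom_comp_apply {a : X.M →ₗ[k] Y.M} (ha : GrMod.IsGrHom a)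
    (h : ∀ x l, a (X.m x l) = Y.m (a x) l) (g : Y ⟶ Z) (x : X.M) (l : List 𝒜.A) :
    (strictHom a ha h ≫ g).1 x l = g.1 (a x) l := fcomp_strictFam_right (TGHom.fam g).1 a x l

lemma comp_strictHom_apply {a : Y.M →ₗ[k] Z.M} (ha : GrMod.IsGrHom a)
    (h : ∀ x l, a (Y.m x l) = Z.m (a x) l) (f : X ⟶ Y) (x : X.M) (l : List 𝒜.A) :
    (f ≫ strictHom a ha h).1 x l = a (f.1 x l) := fcomp_strictFam_left 0 a f.1 x l

lemma hom_ext {f g : X ⟶ Y} (h : ∀ x l, f.1 x l = g.1 x l) : f = g :=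
  Subtype.ext (funext fun x => funext fun l => h x l)

end

/-- The operations of a direct sum. -/
def sumOps (X Y : Mod.{uk, uS, uA, w} 𝒜) : X.M.prod Y.M → List 𝒜.A → X.M.prod Y.M :=
  fun z l => (X.m z.1 l, Y.m z.2 l)

/-- The operations of a direct sum, as a morphism of `B_A`-modules. -/
noncomputable def sumHat (X Y : Mod.{uk, uS, uA, w} 𝒜) :
    𝒜.bar.BMor (X.M.prod Y.M).shift (X.M.prod Y.M).shift :=
  (tsum (Gobj 𝒜 X) (Gobj 𝒜 Y)).u

lemma sumOps_eq (X Y : Mod.{uk, uS, uA, w} 𝒜) : sumOps X Y = unhat (sumHat X Y) := by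
  have h1 := (unhat_hat X.m X.m_mem.1).symm
  have h2 := (unhat_hat Y.m Y.m_mem.1).symm
  funext z l
  change _ = unAux _ ((X.M.prod Y.M).tw l.length z) _
  rw [GrMod.prod_tw]
  exact Prod.ext (congrFun (congrFun h1 z.1) l) (congrFun (congrFun h2 z.2) l)

/-- The modules $(M\oplus N)[1]$ and $M[1]\oplus N[1]$ coincide only after unfolding; the
heterogeneous equality carries the Maurer-Cartan equation from one description to the other. -/
lemma TwMod.mc_of_heq (Z : TwMod.{uk, uS, max uS uA, w} 𝒜.bar.toDGBocs)
    (M : GrMod.{uk, uS, w} k S) (h : Z.M = M.shift) (u : 𝒜.bar.BMor M.shift M.shift)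
    (hu : HEq u Z.u) : dhat 1 u + comp u u = 0 := by
  obtain ⟨M', u', _, h'⟩ := Z
  subst h
  obtain rfl := hu
  exact h'

lemma sumHat_mc (X Y : Mod.{uk, uS, uA, w} 𝒜) :
    dhat 1 (sumHat X Y) + comp (sumHat X Y) (sumHat X Y) = 0 :=
  TwMod.mc_of_heq (tsum (Gobj 𝒜 X) (Gobj 𝒜 Y)) (X.M.prod Y.M) rfl (sumHat X Y) HEq.rfl

/-- The direct sum of `A_∞`-modules. -/
def sumObj (X Y : Mod.{uk, uS, uA, w} 𝒜) : Mod.{uk, uS, uA, w} 𝒜 where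
  M := X.M.prod Y.M
  m := sumOps X Y
  m_mem := by rw [sumOps_eq]; exact unhat_mem (tsum (Gobj 𝒜 X) (Gobj 𝒜 Y)).u_mem
  stasheff := stasheff_of_mc (sumOps_eq X Y) (tsum (Gobj 𝒜 X) (Gobj 𝒜 Y)).u_mem
    (sumHat_mc X Y)

lemma Mod.m_zero (X : Mod.{uk, uS, uA, w} 𝒜) (l : List 𝒜.A) : X.m 0 l = 0 := X.m_mem.1.map_zero l

/-- The direct sum of `A_∞`-modules, as a biproduct. -/
def sumBicone (X Y : Mod.{uk, uS, uA, w} 𝒜) : Limits.BinaryBicone X Y where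
  pt := sumObj X Y
  fst := strictHom (X := sumObj X Y) (LinearMap.fst k X.M Y.M) ⟨fun _ _ => rfl, fun _ _ h => h.1⟩
    (fun _ _ => rfl)
  snd := strictHom (X := sumObj X Y) (LinearMap.snd k X.M Y.M) ⟨fun _ _ => rfl, fun _ _ h => h.2⟩
    (fun _ _ => rfl)
  inl := strictHom (Y := sumObj X Y) (LinearMap.inl k X.M Y.M)
    ⟨fun _ _ => Prod.ext rfl (smul_zero _).symm, fun _ _ h => ⟨h, zero_mem _⟩⟩
    (fun _ _ => Prod.ext rfl (Y.m_zero _).symm)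
  inr := strictHom (Y := sumObj X Y) (LinearMap.inr k X.M Y.M)
    ⟨fun _ _ => Prod.ext (smul_zero _).symm rfl, fun _ _ h => ⟨zero_mem _, h⟩⟩
    (fun _ _ => Prod.ext (X.m_zero _).symm rfl)
  -- For strict morphisms only the empty list needs a linear identity; on nonempty lists both sides
  -- are zero.
  inl_fst := hom_ext fun x l => (strictHom_comp_apply _ _ _ x l).trans (by
    cases l <;> rfl)
  inl_snd := hom_ext fun x l => (strictHom_comp_apply _ _ _ x l).trans (by
    cases l <;> rfl)
  inr_fst := hom_ext fun x l => (strictHom_comp_apply _ _ _ x l).trans (by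
    cases l <;> rfl)
  inr_snd := hom_ext fun x l => (strictHom_comp_apply _ _ _ x l).trans (by
    cases l <;> rfl)

lemma sumBicone_total (X Y : Mod.{uk, uS, uA, w} 𝒜) :
    (sumBicone X Y).fst ≫ (sumBicone X Y).inl + (sumBicone X Y).snd ≫ (sumBicone X Y).inr =
      𝟙 (sumBicone X Y).pt := hom_ext fun x l => by
  change ((sumBicone X Y).fst ≫ (sumBicone X Y).inl).1 x l +
    ((sumBicone X Y).snd ≫ (sumBicone X Y).inr).1 x l = fid (sumObj X Y).M x l
  have h1 : ((sumBicone X Y).fst ≫ (sumBicone X Y).inl).1 x l = (sumBicone X Y).inl.1 x.1 l :=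
    strictHom_comp_apply (X := sumObj X Y) (a := LinearMap.fst k X.M Y.M)
      ⟨fun _ _ => rfl, fun _ _ h => h.1⟩ (fun _ _ => rfl) _ x l
  have h2 : ((sumBicone X Y).snd ≫ (sumBicone X Y).inr).1 x l = (sumBicone X Y).inr.1 x.2 l :=
    strictHom_comp_apply (X := sumObj X Y) (a := LinearMap.snd k X.M Y.M)
      ⟨fun _ _ => rfl, fun _ _ h => h.2⟩ (fun _ _ => rfl) _ x l
  refine (congrArg₂ (fun a b : X.M.prod Y.M => a + b) h1 h2).trans ?_
  cases l with
  | nil => exact Prod.ext (add_zero _) (zero_add _)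
  | cons a l => exact Prod.ext (add_zero _) (add_zero _)

instance : Limits.HasBinaryBiproducts (Mod.{uk, uS, uA, w} 𝒜) where
  has_binary_biproduct X Y :=
    Limits.HasBinaryBiproduct.mk ⟨sumBicone X Y,
      Limits.isBinaryBilimitOfTotal (sumBicone X Y) (sumBicone_total X Y)⟩

/-- The zero module. -/
abbrev _root_.AInfinity.GrMod.zero (k : Type uk) (S : Type uS) [Field k] [Ring S] [Algebra k S] :
    GrMod.{uk, uS, w} k S where
  carrier := PUnit.{w + 1}
  gr _ := ⊥
  rsmul_mem _ _ _ _ := rfl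
  internal := GrMod.internal_of_proj _ 0 (fun _ _ _ => rfl) (fun _ _ _ _ _ => rfl)
    (Subsingleton.elim _ _)

variable (𝒜) in
/-- The zero `A_∞`-module. -/
def zeroObj : Mod.{uk, uS, uA, w} 𝒜 where
  M := GrMod.zero k S
  m := 0
  m_mem := zero_mem _
  stasheff _ _ := rfl

instance : Limits.HasZeroObject (Mod.{uk, uS, uA, w} 𝒜) :=
  ⟨zeroObj 𝒜, (Limits.IsZero.iff_id_eq_zero _).2 (hom_ext fun _ _ => rfl)⟩

instance : Limits.HasFiniteBiproducts (Mod.{uk, uS, uA, w} 𝒜) :=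
  have : Limits.HasFiniteProducts (Mod.{uk, uS, uA, w} 𝒜) :=
    hasFiniteProducts_of_has_binary_and_terminal
  Limits.HasFiniteBiproducts.of_hasFiniteProducts

end Biproducts

/-! ### The exact structure $\mathcal E_\infty$ -/

variable [IsSemisimpleRing S]

instance : (forgetOps.{uk, uS, uA, w} 𝒜).Faithful := ⟨fun h => u_inj h⟩

/-- In a split pair a map killed by the second morphism factors through the first by means of the
retraction. This factorization lives in $\mathrm{GMod}^0\text{-}A$ and is a morphism of
$A_\infty$-modules by `exists_lift`. -/
lemma einf_isLimit {P : ShortComplex (Mod.{uk, uS, uA, w} 𝒜)} (h : Einf 𝒜 P) :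
    Nonempty (Limits.IsLimit (Limits.KernelFork.ofι P.f P.zero)) := by
  obtain ⟨r, s, h1, h2, h3⟩ := h.exists_splitting
  have hm : Mono P.f := (forgetOps 𝒜).mono_of_mono_map (mono_of_mono_fac h1)
  have hl : ∀ {T : Mod.{uk, uS, uA, w} 𝒜} (t : T ⟶ P.X₂), t ≫ P.g = 0 → ∃ l : T ⟶ P.X₁, l ≫ P.f = t := by
    intro T t ht
    obtain ⟨l, -, hl⟩ := exists_lift h1 (h := u t ≫ r) (l := t) (by
      have h4 : u t ≫ u P.g = 0 := by rw [← u_comp, ht, u_zero]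
      rw [Category.assoc, eq_sub_of_add_eq h3, Preadditive.comp_sub, reassoc_of% h4,
        Limits.zero_comp, sub_zero, Category.comp_id])
    exact ⟨l, hl⟩
  exact ⟨Limits.KernelFork.IsLimit.ofι' _ _ fun t ht => ⟨(hl t ht).choose, (hl t ht).choose_spec⟩⟩

/-- Dually, the factorization through the second morphism is built from the section, and
`exists_desc` shows that it respects the operations. -/
lemma einf_isColimit {P : ShortComplex (Mod.{uk, uS, uA, w} 𝒜)} (h : Einf 𝒜 P) :
    Nonempty (Limits.IsColimit (Limits.CokernelCofork.ofπ P.g P.zero)) := by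
  obtain ⟨r, s, h1, h2, h3⟩ := h.exists_splitting
  have hm : Epi P.g := (forgetOps 𝒜).epi_of_epi_map (epi_of_epi_fac h2)
  have hl : ∀ {T : Mod.{uk, uS, uA, w} 𝒜} (t : P.X₂ ⟶ T), P.f ≫ t = 0 → ∃ l : P.X₃ ⟶ T, P.g ≫ l = t := by
    intro T t ht
    obtain ⟨l, -, hl⟩ := exists_desc h2 (h := s ≫ u t) (l := t) (by
      have h4 : u P.f ≫ u t = 0 := by rw [← u_comp, ht, u_zero]
      rw [← Category.assoc, eq_sub_of_add_eq' h3, Preadditive.sub_comp, Category.assoc, h4,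
        Limits.comp_zero, sub_zero, Category.id_comp])
    exact ⟨l, hl⟩
  exact ⟨Limits.CokernelCofork.IsColimit.ofπ' _ _ fun t ht => ⟨(hl t ht).choose, (hl t ht).choose_spec⟩⟩

lemma exists_pullback {Y Z Z' : Mod.{uk, uS, uA, w} 𝒜} (p : Y ⟶ Z) (f : Z' ⟶ Z)
    (hp : Function.Surjective (Mod.fst p)) : ∃ (Y' : Mod.{uk, uS, uA, w} 𝒜) (f' : Y' ⟶ Y) (p' : Y' ⟶ Z'),
      IsPullback f' p' p f ∧ Function.Surjective (Mod.fst p') := by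
  -- The pullback is the kernel of $(p,-f):Y\oplus Z'\to Z$, whose first component is surjective
  -- because $p_1$ is.
  obtain ⟨W, i, w, h⟩ := exists_kernel (Limits.biprod.desc p (-f)) (fun z => by
    obtain ⟨y, rfl⟩ := hp z
    exact ⟨Mod.fst Limits.biprod.inl y, by rw [← Mod.fst_comp, Limits.biprod.inl_desc]⟩)
  obtain ⟨f', hf⟩ : ∃ f', f' = i ≫ Limits.biprod.fst := ⟨_, rfl⟩
  obtain ⟨p', hp'⟩ : ∃ p', p' = i ≫ Limits.biprod.snd := ⟨_, rfl⟩
  obtain rfl : i = Limits.biprod.lift f' p' := by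
    apply Limits.biprod.hom_ext <;> simp [hf, hp']
  have sq : CommSq f' p' p f := ⟨by
    rw [Limits.biprod.lift_desc, Preadditive.comp_neg, ← sub_eq_add_neg, sub_eq_zero] at w
    exact w⟩
  refine ⟨W, f', p', ⟨sq, ⟨sq.isLimitEquivIsLimitKernelFork.symm (einf_isLimit h).some⟩⟩, fun z => ?_⟩
  -- Given $z$, a preimage $y$ of $f_1(z)$ under $p_1$ makes $(y,z)$ an element of the kernel, and
  -- exactness produces a preimage of $z$ under $p'_1$.
  obtain ⟨y, hy⟩ := hp (Mod.fst f z)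
  obtain ⟨x, hx⟩ := (h.2.1 (Mod.fst Limits.biprod.inl y + Mod.fst Limits.biprod.inr z)).1 (by
    change Mod.fst (Limits.biprod.desc p (-f)) _ = 0
    rw [map_add, ← Mod.fst_comp, ← Mod.fst_comp, Limits.biprod.inl_desc, Limits.biprod.inr_desc,
      Mod.fst_neg, hy, add_neg_cancel])
  refine ⟨x, ?_⟩
  rw [hp', Mod.fst_comp]
  refine (congrArg (Mod.fst Limits.biprod.snd) hx).trans ?_
  rw [map_add, ← Mod.fst_comp, ← Mod.fst_comp, Limits.biprod.inl_snd, Limits.biprod.inr_snd,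
    Mod.fst_zero, zero_add, Mod.fst_id]

lemma exists_pushout {X Y X' : Mod.{uk, uS, uA, w} 𝒜} (i : X ⟶ Y) (f : X ⟶ X')
    (hi : Function.Injective (Mod.fst i)) : ∃ (Y' : Mod.{uk, uS, uA, w} 𝒜) (f' : Y ⟶ Y') (i' : X' ⟶ Y'),
      IsPushout i f f' i' ∧ Function.Injective (Mod.fst i') := by
  -- The pushout is the cokernel of $(i,-f)^t:X\to Y\oplus X'$, whose first component is injective
  -- because $i_1$ is.
  obtain ⟨W, q, w, h⟩ := exists_cokernel (Limits.biprod.lift i (-f)) (fun x y hxy => by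
    have := congrArg (Mod.fst Limits.biprod.fst) hxy
    rw [← Mod.fst_comp, ← Mod.fst_comp, Limits.biprod.lift_fst] at this
    exact hi this)
  obtain ⟨f', hf⟩ : ∃ f', f' = Limits.biprod.inl ≫ q := ⟨_, rfl⟩
  obtain ⟨i', hi'⟩ : ∃ i', i' = Limits.biprod.inr ≫ q := ⟨_, rfl⟩
  obtain rfl : q = Limits.biprod.desc f' i' := by
    apply Limits.biprod.hom_ext' <;> simp [hf, hi']
  have sq : CommSq i f f' i' := ⟨by
    rw [Limits.biprod.lift_desc, Preadditive.neg_comp, ← sub_eq_add_neg, sub_eq_zero] at w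
    exact w⟩
  refine ⟨W, f', i', ⟨sq, ⟨sq.isColimitEquivIsColimitCokernelCofork.symm (einf_isColimit h).some⟩⟩, ?_⟩
  rw [injective_iff_map_eq_zero]
  intro z hz
  rw [hi', Mod.fst_comp] at hz
  -- If $i'_1(z)=0$, then by exactness $(0,z)=(i_1(x),-f_1(x))$ for some $x$; injectivity of $i_1$
  -- gives $x=0$, hence $z=0$.
  obtain ⟨x, hx⟩ := (h.2.1 _).1 hz
  change Mod.fst (Limits.biprod.lift i (-f)) x = Mod.fst Limits.biprod.inr z at hx
  have h1 := congrArg (Mod.fst Limits.biprod.fst) hx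
  have h2 := congrArg (Mod.fst Limits.biprod.snd) hx
  rw [← Mod.fst_comp, ← Mod.fst_comp, Limits.biprod.lift_fst, Limits.biprod.inr_fst,
    Mod.fst_zero] at h1
  rw [← Mod.fst_comp, ← Mod.fst_comp, Limits.biprod.lift_snd, Limits.biprod.inr_snd,
    Mod.fst_id] at h2
  have h4 : x = 0 := hi (h1.trans (map_zero _).symm)
  rw [← h2, h4, map_zero]

/-- Inflations and deflations are recognised by injectivity and surjectivity of first components,
and first components compose; so identities and compositions are settled by linear algebra. -/
theorem isExactStructure_einf : IsExactStructure (Einf.{uk, uS, uA, w} 𝒜) where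
  of_iso _ _ := fun ⟨e⟩ h => h.of_iso e
  kernel _ h := einf_isLimit h
  cokernel _ h := einf_isColimit h
  id_inflation _ := (isInflation_iff _).2 fun _ _ h => h
  id_deflation _ := (isDeflation_iff _).2 fun x => ⟨x, rfl⟩
  comp_inflation f g hf hg := by
    rw [isInflation_iff] at *
    intro x y h
    rw [Mod.fst_comp, Mod.fst_comp] at h
    exact hf (hg h)
  comp_deflation f g hf hg := by
    rw [isDeflation_iff] at *
    intro z
    obtain ⟨y, rfl⟩ := hg z
    obtain ⟨x, rfl⟩ := hf y
    exact ⟨x, Mod.fst_comp f g x⟩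
  pushout i f h := by
    obtain ⟨Y', f', i', h1, h2⟩ := exists_pushout i f ((isInflation_iff i).1 h)
    exact ⟨Y', f', i', h1, (isInflation_iff i').2 h2⟩
  pullback p f h := by
    obtain ⟨Y', f', p', h1, h2⟩ := exists_pullback p f ((isDeflation_iff p).1 h)
    exact ⟨Y', f', p', h1, (isDeflation_iff p').2 h2⟩

end AInfAlg

/-! ### Contractibility of $J(M,u)$ -/

namespace DGBocs

variable {B : DGBocs.{uk, uS, uC} k S}

section

variable {M M' N N' L L' : GrMod.{uk, uS, w} k S}

/-- The morphism `M ⊕ M' → N ⊕ N'` with the only component `t : M → N'`. -/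
noncomputable def cocorner (t : B.BMor M N') : B.BMor (M.prod M') (N.prod N') :=
  mkMor (LinearMap.prod 0
    (t.restrictScalars k ∘ₗ BTen.map (LinearMap.fst k M M') LinearMap.id
      (fun _ _ => rfl) (fun _ _ => rfl)))
    (fun s m c => Prod.ext (smul_zero _).symm (t.map_smul (op s) (BTen.tm k S m.1 c)))

lemma cocorner_tm (t : B.BMor M N') (m : M.prod M') (c : B.C) :
    (cocorner t : B.BMor (M.prod M') (N.prod N')) (BTen.tm k S m c) =
      (0, t (BTen.tm k S m.1 c)) := rfl

lemma cocorner_mem {d : ℤ} {t : B.BMor M N'} (ht : t ∈ B.BHom d M N') :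
    cocorner t ∈ B.BHom d (M.prod M') (N.prod N') :=
  fun i j m c hm hc => ⟨zero_mem _, ht i j m.1 c hm.1 hc⟩

lemma dd_cocorner (t : B.BMor M N') :
    dd (cocorner t : B.BMor (M.prod M') (N.prod N')) = cocorner (dd t) :=
  bmor_ext fun m c => by
    rw [dd_tm, GrMod.prod_tw]; rfl

lemma comp_diag_cocorner (a : B.BMor N L) (b : B.BMor N' L') (t : B.BMor M N') :
    comp (diag a b) (cocorner t : B.BMor (M.prod M') (N.prod N')) = cocorner (comp b t) := by
  refine bmor_ext fun m c => ?_
  rw [comp_tm, cocorner_tm, comp_tm]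
  generalize B.mu c = y
  induction y using BTen.induction with
  | ht u v =>
    refine Prod.ext ?_ rfl
    change a (BTen.tm k S 0 v) = 0
    rw [BTen.zero_tm, map_zero]
  | ha x y hx hy => rw [map_add, map_add, hx, hy]; simp only [map_add, Prod.mk_add_mk, add_zero]

lemma comp_cocorner_diag (t : B.BMor N L') (a : B.BMor M N) (b : B.BMor M' N') :
    comp (cocorner t : B.BMor (N.prod N') (L.prod L')) (diag a b) = cocorner (comp t a) := by
  refine bmor_ext fun m c => ?_
  rw [comp_tm, cocorner_tm, comp_tm]
  generalize B.mu c = y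
  induction y using BTen.induction with
  | ht u v => rfl
  | ha x y hx hy => rw [map_add, map_add, hx, hy]; simp only [map_add, Prod.mk_add_mk, add_zero]

lemma comp_corner_cocorner (t : B.BMor N' L) (s : B.BMor M N') :
    comp (corner t : B.BMor (N.prod N') (L.prod L'))
      (cocorner s : B.BMor (M.prod M') (N.prod N')) = diag (comp t s) 0 := by
  refine bmor_ext fun m c => ?_
  rw [comp_tm, diag_tm, comp_tm]
  generalize B.mu c = y
  induction y using BTen.induction with
  | ht u v => rfl
  | ha x y hx hy => rw [map_add, map_add, hx, hy]; simp only [map_add, Prod.mk_add_mk, LinearMap.zero_apply, add_zero]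

lemma comp_cocorner_corner (t : B.BMor N L') (s : B.BMor M' N) :
    comp (cocorner t : B.BMor (N.prod N') (L.prod L'))
      (corner s : B.BMor (M.prod M') (N.prod N')) = diag 0 (comp t s) := by
  refine bmor_ext fun m c => ?_
  rw [comp_tm, diag_tm, comp_tm]
  generalize B.mu c = y
  induction y using BTen.induction with
  | ht u v => rfl
  | ha x y hx hy => rw [map_add, map_add, hx, hy]; simp only [map_add, Prod.mk_add_mk, LinearMap.zero_apply, add_zero]

/-- The morphism `σ_M : M → M[1]` of degree `-1`, `m ⊗ c ↦ m eps(c)`. -/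
noncomputable abbrev bsigma (M : GrMod.{uk, uS, w} k S) : B.BMor M M.shift := id_ M

lemma bsigma_mem : bsigma M ∈ B.BHom (-1) M M.shift := by
  intro i j m c hm hc
  have := BHom.id_mem (B := B) (M := M) i j m c hm hc
  change _ ∈ M.gr _
  rwa [show i + j + -1 + 1 = i + j + 0 by ring]

end

/-- The twisted module `(M, u)` is contractible: its identity is the differential of a morphism of
degree `-1`. -/
def Contractible {M : GrMod.{uk, uS, w} k S} (u : B.BMor M M) : Prop :=
  ∃ κ ∈ B.BHom (-1) M M, tdiff (-1) u u κ = id_ M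

/-- The contraction is $\sigma:M\to M[1]$ placed opposite to the entry $\sigma^{-1}$ of the twist:
their products give the identities of both summands, while the terms $-u[1]\sigma$ and $\sigma u$
cancel. -/
lemma contractible_tJ (X : TwMod.{uk, uS, uC, w} B) : Contractible (tJ X).u := by
  obtain ⟨κ, hκ⟩ : ∃ κ : B.BMor (X.M.prod X.M.shift) (X.M.prod X.M.shift),
    κ = cocorner (bsigma X.M) := ⟨_, rfl⟩
  refine ⟨κ, by rw [hκ]; exact cocorner_mem bsigma_mem, ?_⟩
  -- The map $\sigma$ involves $C$ only through the counit, which vanishes on the image of $\delta$.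
  have h1 : dd κ = 0 := by
    rw [hκ, dd_cocorner]
    refine bmor_ext fun m c => Prod.ext rfl ?_
    exact congrArg (fun f : B.BMor X.M X.M => f (BTen.tm k S m.1 c)) dd_id
  have e1 : comp (bshift X.u) (bsigma X.M) = X.u := comp_id X.u
  have e2 : comp (bsigmaInv X.M) (bsigma X.M) = id_ X.M := id_comp (id_ X.M : B.BMor X.M X.M)
  have e3 : comp (bsigma X.M) X.u = X.u := id_comp X.u
  have e4 : comp (bsigma X.M) (bsigmaInv X.M) = id_ X.M := id_comp (id_ X.M : B.BMor X.M X.M)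
  have h2 : comp (diag X.u (- bshift X.u) + corner (bsigmaInv X.M)) κ =
      cocorner (- bshift X.u) + diag (id_ X.M) 0 := by
    rw [hκ, add_comp, comp_diag_cocorner, comp_corner_cocorner, neg_comp, e1, e2]; rfl
  have h3 : comp κ (diag X.u (- bshift X.u) + corner (bsigmaInv X.M)) =
      cocorner X.u + diag 0 (id_ X.M) := by
    rw [hκ, comp_add, comp_cocorner_diag, comp_cocorner_corner, e3, e4]; rfl
  -- Since $\kappa$ has odd degree, the two twisting terms of $D(\kappa)$ are added rather than
  -- subtracted.
  have e5 : sgn (-1) = -1 := (sgn_eq_of_even (b := 1) ⟨-1, rfl⟩).trans sgn_one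
  have key : tdiff (-1) (diag X.u (- bshift X.u) + corner (bsigmaInv X.M))
      (diag X.u (- bshift X.u) + corner (bsigmaInv X.M)) κ = id_ (X.M.prod X.M.shift) := by
    rw [tdiff, dhat, h1, h2, h3, smul_zero, zero_add, e5, neg_smul, one_smul, sub_neg_eq_add]
    refine bmor_ext fun m c => Prod.ext ?_ ?_
    · change (0 + id_ X.M (BTen.tm k S m.1 c)) + (0 + 0) = op (B.eps c) • m.1
      rw [zero_add, add_zero, add_zero]; rfl
    · change (- X.u (BTen.tm k S m.1 c) + 0) +
        (X.u (BTen.tm k S m.1 c) + id_ X.M (BTen.tm k S m.2 c)) = op (B.eps c) • m.2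
      rw [add_zero, neg_add_cancel_left]; rfl
  exact key

end DGBocs

/-! ### Contractible modules are projective and injective -/

namespace AInfAlg

open DGBocs GObj AInfinity.AInfAlg.Mod

variable {𝒜 : AInfAlg.{uk, uS, uA} k S}

lemma GObj.hatG_inj {X Y : GObj.{uk, uS, uA, w} 𝒜} {f g : X ⟶ Y} (h : hatG f = hatG g) : f = g :=
  fam_ext_hat h

/-- Needed because the twisted module of $J(X)$ has underlying module $(M\oplus M[1])[1]$, whereas
$J$ of the twisted module of $X$ is built on $M[1]\oplus M[1][1]$. -/
lemma contractible_of_heq (Z : TwMod.{uk, uS, max uS uA, w} 𝒜.bar.toDGBocs)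
    (M : GrMod.{uk, uS, w} k S) (h : Z.M = M.shift) (φ : 𝒜.bar.BMor M.shift M.shift)
    (hu : HEq φ Z.u) (hZ : Contractible Z.u) : Contractible φ := by
  obtain ⟨M', u', _, h'⟩ := Z
  subst h
  obtain rfl := hu
  exact hZ

lemma contractible_Jobj (X : Mod.{uk, uS, uA, w} 𝒜) : Contractible (Jobj X).op :=
  contractible_of_heq (tJ (Gobj 𝒜 X)) (X.M.prod X.M.shift) rfl _
    (heq_of_eq (hat_eq_of_eq_unhat _ (Jops_eq X))) (contractible_tJ _)

variable [IsSemisimpleRing S]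

/-- A deflation $p$ has a section $s$ that need not be a cocycle, so $s*h$ is not a lift of $h$ in
the category. The coboundary $D(s*h*\kappa)$ is a cocycle of degree $0$, and
$p*D(s*h*\kappa)=D(h*\kappa)=h*D(\kappa)=h$. -/
lemma isEProjective_of_contractible {Q : Mod.{uk, uS, uA, w} 𝒜} (hQ : Contractible Q.op) :
    IsEProjective (Einf 𝒜) Q := by
  obtain ⟨κ, hκ, H⟩ := hQ
  intro Y Z p h hp
  obtain ⟨s, hs⟩ := GObj.exists_section (f := u p) ((isDeflation_iff p).1 hp)
  have m1 : DGBocs.comp (hatG (u h)) κ ∈ 𝒜.bar.BHom (-1) Q.o.M.shift Z.o.M.shift := by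
    have := BHom.comp_mem (hatG_mem (u h)) hκ
    rwa [zero_add] at this
  have m2 : DGBocs.comp (hatG s) (DGBocs.comp (hatG (u h)) κ) ∈
      𝒜.bar.BHom (-1) Q.o.M.shift Y.o.M.shift := by
    have := BHom.comp_mem (hatG_mem s) m1
    rwa [zero_add] at this
  have m3 := tdiff_mem Q.op_mem Y.op_mem m2
  rw [neg_add_cancel] at m3
  obtain ⟨g, hg⟩ := exists_hatG (X := Q.o) (Y := Y.o) m3
  -- Being a coboundary, the candidate lift is a cocycle, hence a morphism of $A_\infty$-modules.
  obtain ⟨g', rfl⟩ := exists_u (X := Q) (Y := Y) (f := g) (by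
    rw [hg, tdiff_tdiff (neg_add_cancel 1) Q.op_mem Q.op_mc Y.op_mc m2])
  refine ⟨g', u_inj (hatG_inj ?_)⟩
  have h1 := tdiff_comp (zero_add (-1)) Q.op Y.op Z.op (hatG (u p)) m2
  rw [tdiff_u, zero_comp, zero_add, sgn_zero, one_smul, ← comp_assoc, ← hatG_comp, hs, hatG_id,
    id_comp, tdiff_comp (zero_add (-1)) Q.op Q.op Z.op (hatG (u h)) hκ, tdiff_u, zero_comp, zero_add,
    sgn_zero, one_smul, H, comp_id, ← hg, ← hatG_comp, ← u_comp] at h1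
  exact h1.symm

/-- With a retraction $r$ of the inflation $i$ in $\mathrm{GMod}^0\text{-}A$, the extension of $h$
is the coboundary $D(\kappa*h*r)$: composing it with $i$ gives $D(\kappa*h)=D(\kappa)*h=h$. -/
lemma isEInjective_of_contractible {Q : Mod.{uk, uS, uA, w} 𝒜} (hQ : Contractible Q.op) :
    IsEInjective (Einf 𝒜) Q := by
  obtain ⟨κ, hκ, H⟩ := hQ
  intro X Y i h hi
  obtain ⟨r, hr⟩ := GObj.exists_retraction (f := u i) ((isInflation_iff i).1 hi)
  have m1 : DGBocs.comp κ (hatG (u h)) ∈ 𝒜.bar.BHom (-1) X.o.M.shift Q.o.M.shift := by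
    have := BHom.comp_mem hκ (hatG_mem (u h))
    rwa [add_zero] at this
  have m2 : DGBocs.comp (DGBocs.comp κ (hatG (u h))) (hatG r) ∈
      𝒜.bar.BHom (-1) Y.o.M.shift Q.o.M.shift := by
    have := BHom.comp_mem m1 (hatG_mem r)
    rwa [add_zero] at this
  have m3 := tdiff_mem Y.op_mem Q.op_mem m2
  rw [neg_add_cancel] at m3
  obtain ⟨g, hg⟩ := exists_hatG (X := Y.o) (Y := Q.o) m3
  obtain ⟨g', rfl⟩ := exists_u (X := Y) (Y := Q) (f := g) (by
    rw [hg, tdiff_tdiff (neg_add_cancel 1) Y.op_mem Y.op_mc Q.op_mc m2])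
  refine ⟨g', u_inj (hatG_inj ?_)⟩
  have h1 := tdiff_comp (add_zero (-1)) X.op Y.op Q.op (DGBocs.comp (DGBocs.comp κ (hatG (u h))) (hatG r))
    (hatG_mem (u i))
  rw [tdiff_u, comp_zero, smul_zero, add_zero, comp_assoc, ← hatG_comp, hr, hatG_id, comp_id,
    tdiff_comp (add_zero (-1)) X.op Q.op Q.op κ (hatG_mem (u h)), tdiff_u, comp_zero, smul_zero,
    add_zero, H, id_comp, ← hg, ← hatG_comp, ← u_comp] at h1
  exact h1.symm

end AInfAlg

/-! ### The conflations $X\to J(X)\to T(X)$ and the equivalence $\mathbb G$ -/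

namespace AInfAlg

open DGBocs GObj AInfinity.AInfAlg.Mod

variable {𝒜 : AInfAlg.{uk, uS, uA} k S}

lemma fid_zero (M : GrMod.{uk, uS, w} k S) (l : List 𝒜.A) : fid M 0 l = 0 := by cases l <;> rfl

/-- The matrix of operations is upper triangular, so $M$ is a submodule of $J(X)$ and its inclusion
is strict; dually $M[1]$ is a strict quotient. -/
lemma Jops_inl (X : Mod.{uk, uS, uA, w} 𝒜) (x : X.M) (l : List 𝒜.A) :
    Jops X (x, 0) l = (X.m x l, 0) :=
  Prod.ext ((congrArg (fun y : X.M => X.m x l + y) (fid_zero X.M l)).trans (add_zero _))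
    ((congrArg (fun y : X.M => sgn (l.length + 1) • y) (X.m_zero l)).trans (smul_zero _))

/-- The strict inclusion `X → J(X)`. -/
def alphaApp (X : Mod.{uk, uS, uA, w} 𝒜) : X ⟶ Jobj X :=
  strictHom (Y := Jobj X) (LinearMap.inl k X.M X.M)
    ⟨fun _ _ => Prod.ext rfl (smul_zero _).symm, fun _ _ h => ⟨h, zero_mem _⟩⟩
    (fun x l => (Jops_inl X x l).symm)

/-- The strict projection `J(X) → T(X)`. -/
def betaApp (X : Mod.{uk, uS, uA, w} 𝒜) : Jobj X ⟶ Tobj X :=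
  strictHom (X := Jobj X) (Y := Tobj X) (LinearMap.snd k X.M X.M)
    ⟨fun _ _ => rfl, fun _ _ h => h.2⟩ (fun _ _ => rfl)

lemma alphaApp_comp {X Y : Mod.{uk, uS, uA, w} 𝒜} (g : Jobj X ⟶ Y) (x : X.M) (l : List 𝒜.A) :
    (alphaApp X ≫ g).1 x l = g.1 (x, (0 : X.M)) l := strictHom_comp_apply _ _ g x l

lemma comp_alphaApp {X Y : Mod.{uk, uS, uA, w} 𝒜} (g : X ⟶ Y) (x : X.M) (l : List 𝒜.A) :
    (g ≫ alphaApp Y).1 x l = (g.1 x l, (0 : Y.M)) := comp_strictHom_apply _ _ g x l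

lemma betaApp_comp {X Y : Mod.{uk, uS, uA, w} 𝒜} (g : Tobj X ⟶ Y) (z : X.M × X.M) (l : List 𝒜.A) :
    (betaApp X ≫ g).1 z l = g.1 z.2 l := strictHom_comp_apply (X := Jobj X) _ _ g z l

lemma comp_betaApp {X Y : Mod.{uk, uS, uA, w} 𝒜} (g : X ⟶ Jobj Y) (x : X.M) (l : List 𝒜.A) :
    (g ≫ betaApp Y).1 x l = (g.1 x l).2 := comp_strictHom_apply (Y := Jobj Y) _ _ g x l

variable (𝒜) in
/-- The natural transformation `α : id → J`. -/
noncomputable def alpha : 𝟭 (Mod.{uk, uS, uA, w} 𝒜) ⟶ J 𝒜 where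
  app X := alphaApp X
  naturality X Y f := hom_ext fun x l => by
    refine (comp_alphaApp f x l).trans (Eq.trans ?_ (alphaApp_comp ((J 𝒜).map f) x l).symm)
    exact Prod.ext rfl ((congrArg (fun y : Y.M => sgn (0 + l.length) • y)
      ((TGHom.fam f).1.map_zero l)).trans (smul_zero _)).symm

variable (𝒜) in
/-- The natural transformation `β : J → T`. -/
noncomputable def beta : J.{uk, uS, uA, w} 𝒜 ⟶ T 𝒜 where
  app X := betaApp X
  naturality X Y f := hom_ext fun x l => by
    refine (comp_betaApp ((J 𝒜).map f) x l).trans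
      (Eq.trans ?_ (betaApp_comp ((T 𝒜).map f) x l).symm)
    change sgn (0 + l.length) • f.1 x.2 l = sgn l.length • f.1 x.2 l
    rw [zero_add]

lemma alphaApp_betaApp (X : Mod.{uk, uS, uA, w} 𝒜) : alphaApp X ≫ betaApp X = 0 :=
  hom_ext fun x l => by
    refine (alphaApp_comp (betaApp X) x l).trans ?_
    cases l <;> rfl

lemma einf_alpha_beta (X : Mod.{uk, uS, uA, w} 𝒜) :
    Einf 𝒜 (ShortComplex.mk ((alpha 𝒜).app X) ((beta 𝒜).app X) (alphaApp_betaApp X)) := by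
  refine ⟨fun x y h => congrArg Prod.fst h, fun z => ⟨fun h => ⟨z.1, Prod.ext rfl h.symm⟩, ?_⟩,
    fun x => ⟨(0, x), rfl⟩⟩
  rintro ⟨x, rfl⟩
  rfl

/-- Families and maps on the bar construction determine each other through `hat` and `unhat`, and
the two morphism equations are equivalent in every degree. -/
lemma Gd_bijective (d : ℤ) (X Y : Mod.{uk, uS, uA, w} 𝒜) : Function.Bijective (Gd 𝒜 d X Y) :=
  ⟨fun _ _ h => TGHom.ext_hat h, fun φ =>
    ⟨⟨unhat (M := X.M) (N := Y.M) φ.1, mem_TGHom_of_unhat rfl φ.2⟩, Subtype.ext (hat_unhat φ.1)⟩⟩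

instance : (G.{uk, uS, uA, w} 𝒜).Full := ⟨fun φ => (Gd_bijective 0 _ _).2 φ⟩

instance : (G.{uk, uS, uA, w} 𝒜).Faithful := ⟨fun h => (Gd_bijective 0 _ _).1 h⟩

/-- Every graded module equals the shift of its inverse shift, and every Maurer-Cartan element comes
from operations; hence $\mathbb G$ is surjective on objects up to equality, not merely up to
isomorphism. -/
lemma exists_Gobj_eq (Z : 𝒜.bar.TwMod) : ∃ X : Mod.{uk, uS, uA, w} 𝒜, Gobj 𝒜 X = Z := by
  obtain ⟨N, u, hu, mc⟩ := Z
  obtain ⟨M, rfl⟩ : ∃ M : GrMod.{uk, uS, w} k S, M.shift = N := ⟨N.unshift, N.shift_unshift⟩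
  refine ⟨ofTw M u hu mc, ?_⟩
  have h := op_ofTw M u hu mc
  have : ∀ v (hv : v ∈ 𝒜.bar.BHom 1 M.shift M.shift) (mc' : dhat 1 v + DGBocs.comp v v = 0), v = u →
      TwMod.mk M.shift v hv mc' = TwMod.mk M.shift u hu mc := by
    rintro v hv mc' rfl; rfl
  exact this _ _ _ h

instance : (G.{uk, uS, uA, w} 𝒜).IsEquivalence where
  essSurj := ⟨fun Z => by
    obtain ⟨X, hX⟩ := exists_Gobj_eq Z
    exact ⟨X, ⟨eqToIso hX⟩⟩⟩

lemma fst_hat {M N : GrMod.{uk, uS, w} k S} (f : 𝒜.FHom 0 M N) (x : M) :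
    NormalBocs.fst (B := 𝒜.bar) (hat f.1 f.2.1) x = f.1 x [] := by
  have := hat_tp f.1 f.2.1 x []
  rw [List.length_nil, Nat.cast_zero, GrMod.tw_zero] at this
  exact this

/-- Shifting does not change underlying sets, and on tensors without factors from $A$ there is no
Koszul sign; so $\mathbb G$ preserves the underlying functions of first components and both
exactness conditions coincide. -/
lemma einf_iff_map_G (P : ShortComplex (Mod.{uk, uS, uA, w} 𝒜)) :
    Einf 𝒜 P ↔ NormalBocs.E 𝒜.bar (P.map (G 𝒜)) := by
  have h : ∀ {X Y : Mod.{uk, uS, uA, w} 𝒜} (f : X ⟶ Y),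
      (NormalBocs.fst (B := 𝒜.bar) ((G 𝒜).map f).1 : X.M → Y.M) = Mod.fst f :=
    fun f => funext fun x => fst_hat ⟨f.1, TGHom.fam f⟩ x
  have h1 := h P.f
  have h2 := h P.g
  change _ ↔ (Function.Injective (NormalBocs.fst (B := 𝒜.bar) ((G 𝒜).map P.f).1 : P.X₁.M → P.X₂.M) ∧
    Function.Exact (NormalBocs.fst (B := 𝒜.bar) ((G 𝒜).map P.f).1 : P.X₁.M → P.X₂.M)
      (NormalBocs.fst (B := 𝒜.bar) ((G 𝒜).map P.g).1 : P.X₂.M → P.X₃.M) ∧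
    Function.Surjective (NormalBocs.fst (B := 𝒜.bar) ((G 𝒜).map P.g).1 : P.X₂.M → P.X₃.M))
  rw [h1, h2]; rfl

end AInfAlg

/-! ### Strict inverses and transfer of exact structures -/

section Generic

variable {C D : Type*} [Category C] [Category D]

/-- A fully faithful functor that is bijective on objects has an inverse. -/
lemma exists_inverse_functor (F : C ⥤ D) [F.Full] [F.Faithful] (hF : Function.Bijective F.obj) :
    ∃ F' : D ⥤ C, F ⋙ F' = 𝟭 C ∧ F' ⋙ F = 𝟭 D := by
  choose o ho using hF.2
  let F' : D ⥤ C :=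
    { obj := o
      -- The chosen preimages of objects map back only up to an equality, which is inserted as an
      -- identification on either side of $g$.
      map := fun {Y Z} g => F.preimage (eqToHom (ho Y) ≫ g ≫ eqToHom (ho Z).symm)
      map_id := fun Y => F.map_injective (by simp)
      map_comp := fun f g => F.map_injective (by simp) }
  refine ⟨F', CategoryTheory.Functor.ext (fun X => hF.1 (ho _)) fun X Y f => F.map_injective ?_,
    CategoryTheory.Functor.ext ho fun Y Z g => ?_⟩
  · simp [F', eqToHom_map]
  · simp [F']

variable [Preadditive C] [Preadditive D]

/-- Surjectivity on objects allows the remaining object of a conflation to be taken of the form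
$F(Z)$; fullness and faithfulness then bring back the remaining morphism and the relation. -/
lemma isInflation_map_iff (F : C ⥤ D) [F.Full] [F.Faithful] [F.Additive]
    (hF : Function.Surjective F.obj) {E : ShortComplex C → Prop} {E' : ShortComplex D → Prop}
    (hE : ∀ P, E P ↔ E' (P.map F)) {X Y : C} (f : X ⟶ Y) :
    IsInflation E' (F.map f) ↔ IsInflation E f := by
  constructor
  · rintro ⟨Z, g, h, hg⟩
    obtain ⟨Z, rfl⟩ := hF Z
    obtain ⟨g, rfl⟩ := F.map_surjective g
    exact ⟨Z, g, F.map_injective (by rw [F.map_comp, h, F.map_zero]), (hE _).2 hg⟩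
  · rintro ⟨Z, g, h, hg⟩
    exact ⟨F.obj Z, F.map g, by rw [← F.map_comp, h, F.map_zero], (hE _).1 hg⟩

lemma isDeflation_map_iff (F : C ⥤ D) [F.Full] [F.Faithful] [F.Additive]
    (hF : Function.Surjective F.obj) {E : ShortComplex C → Prop} {E' : ShortComplex D → Prop}
    (hE : ∀ P, E P ↔ E' (P.map F)) {Y Z : C} (g : Y ⟶ Z) :
    IsDeflation E' (F.map g) ↔ IsDeflation E g := by
  constructor
  · rintro ⟨X, f, h, hf⟩
    obtain ⟨X, rfl⟩ := hF X
    obtain ⟨f, rfl⟩ := F.map_surjective f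
    exact ⟨X, f, F.map_injective (by rw [F.map_comp, h, F.map_zero]), (hE _).2 hf⟩
  · rintro ⟨X, f, h, hf⟩
    exact ⟨F.obj X, F.map f, by rw [← F.map_comp, h, F.map_zero], (hE _).1 hf⟩

lemma exists_map_shortComplex_eq (F : C ⥤ D) [F.Full] [F.Faithful] [F.Additive]
    (hF : Function.Surjective F.obj) (Q : ShortComplex D) : ∃ P : ShortComplex C, P.map F = Q := by
  obtain @⟨X, Y, Z, f, g, h⟩ := Q
  obtain ⟨X, rfl⟩ := hF X
  obtain ⟨Y, rfl⟩ := hF Y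
  obtain ⟨Z, rfl⟩ := hF Z
  obtain ⟨f, rfl⟩ := F.map_surjective f
  obtain ⟨g, rfl⟩ := F.map_surjective g
  exact ⟨ShortComplex.mk f g (F.map_injective (by rw [F.map_comp, h, F.map_zero])), rfl⟩

/-- Exact structures are transferred along equivalences. -/
lemma IsExactStructure.of_equivalence (F : C ⥤ D) [F.IsEquivalence] [F.Additive]
    (hF : Function.Surjective F.obj) {E : ShortComplex C → Prop} {E' : ShortComplex D → Prop}
    (hE : ∀ P, E P ↔ E' (P.map F)) (h : IsExactStructure E) : IsExactStructure E' where
  of_iso P Q := by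
    obtain ⟨P, rfl⟩ := exists_map_shortComplex_eq F hF P
    obtain ⟨Q, rfl⟩ := exists_map_shortComplex_eq F hF Q
    rintro ⟨e⟩ hP
    -- An isomorphism between image pairs is separated into its three components, which are lifted
    -- individually; faithfulness lifts the two commutative squares.
    obtain ⟨e₁, e₂, e₃, h₁, h₂⟩ : ∃ (e₁ : F.obj P.X₁ ≅ F.obj Q.X₁) (e₂ : F.obj P.X₂ ≅ F.obj Q.X₂)
        (e₃ : F.obj P.X₃ ≅ F.obj Q.X₃), e₁.hom ≫ F.map Q.f = F.map P.f ≫ e₂.hom ∧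
          e₂.hom ≫ F.map Q.g = F.map P.g ≫ e₃.hom :=
      ⟨ShortComplex.π₁.mapIso e, ShortComplex.π₂.mapIso e, ShortComplex.π₃.mapIso e,
        e.hom.comm₁₂, e.hom.comm₂₃⟩
    exact (hE Q).1 (h.of_iso P Q ⟨ShortComplex.isoMk (F.preimageIso e₁) (F.preimageIso e₂)
      (F.preimageIso e₃) (F.map_injective (by simpa using h₁))
      (F.map_injective (by simpa using h₂))⟩ ((hE P).2 hP))
  kernel P := by
    obtain ⟨P, rfl⟩ := exists_map_shortComplex_eq F hF P
    intro hP
    obtain ⟨l⟩ := h.kernel P ((hE P).2 hP)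
    exact ⟨Limits.isLimitForkMapOfIsLimit' F P.zero l⟩
  cokernel P := by
    obtain ⟨P, rfl⟩ := exists_map_shortComplex_eq F hF P
    intro hP
    obtain ⟨l⟩ := h.cokernel P ((hE P).2 hP)
    exact ⟨Limits.isColimitCoforkMapOfIsColimit' F P.zero l⟩
  id_inflation X := by
    obtain ⟨X, rfl⟩ := hF X
    rw [← F.map_id, isInflation_map_iff F hF hE]
    exact h.id_inflation X
  id_deflation X := by
    obtain ⟨X, rfl⟩ := hF X
    rw [← F.map_id, isDeflation_map_iff F hF hE]
    exact h.id_deflation X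
  comp_inflation {X Y Z} f g := by
    obtain ⟨X, rfl⟩ := hF X
    obtain ⟨Y, rfl⟩ := hF Y
    obtain ⟨Z, rfl⟩ := hF Z
    obtain ⟨f, rfl⟩ := F.map_surjective f
    obtain ⟨g, rfl⟩ := F.map_surjective g
    rw [← F.map_comp]
    simp only [isInflation_map_iff F hF hE]
    exact h.comp_inflation f g
  comp_deflation {X Y Z} f g := by
    obtain ⟨X, rfl⟩ := hF X
    obtain ⟨Y, rfl⟩ := hF Y
    obtain ⟨Z, rfl⟩ := hF Z
    obtain ⟨f, rfl⟩ := F.map_surjective f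
    obtain ⟨g, rfl⟩ := F.map_surjective g
    rw [← F.map_comp]
    simp only [isDeflation_map_iff F hF hE]
    exact h.comp_deflation f g
  pushout {X Y X'} i f hi := by
    obtain ⟨X, rfl⟩ := hF X
    obtain ⟨Y, rfl⟩ := hF Y
    obtain ⟨X', rfl⟩ := hF X'
    obtain ⟨i, rfl⟩ := F.map_surjective i
    obtain ⟨f, rfl⟩ := F.map_surjective f
    obtain ⟨Y', f', i', h1, h2⟩ := h.pushout i f ((isInflation_map_iff F hF hE i).1 hi)
    exact ⟨F.obj Y', F.map f', F.map i', h1.map F, (isInflation_map_iff F hF hE i').2 h2⟩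
  pullback {Y Z Z'} p f hp := by
    obtain ⟨Y, rfl⟩ := hF Y
    obtain ⟨Z, rfl⟩ := hF Z
    obtain ⟨Z', rfl⟩ := hF Z'
    obtain ⟨p, rfl⟩ := F.map_surjective p
    obtain ⟨f, rfl⟩ := F.map_surjective f
    obtain ⟨Y', f', p', h1, h2⟩ := h.pullback p f ((isDeflation_map_iff F hF hE p).1 hp)
    exact ⟨F.obj Y', F.map f', F.map p', h1.map F, (isDeflation_map_iff F hF hE p').2 h2⟩

lemma IsEProjective.of_retract {E : ShortComplex C → Prop} {Q X : C} (hQ : IsEProjective E Q)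
    (i : X ⟶ Q) (r : Q ⟶ X) (h : i ≫ r = 𝟙 X) : IsEProjective E X := fun p f hp => by
  obtain ⟨f', hf⟩ := hQ p (r ≫ f) hp
  exact ⟨i ≫ f', by rw [Category.assoc, hf, reassoc_of% h]⟩

lemma IsEInjective.of_retract {E : ShortComplex C → Prop} {Q X : C} (hQ : IsEInjective E Q)
    (i : X ⟶ Q) (r : Q ⟶ X) (h : i ≫ r = 𝟙 X) : IsEInjective E X := fun p f hp => by
  obtain ⟨f', hf⟩ := hQ p (f ≫ i) hp
  exact ⟨f' ≫ r, by rw [reassoc_of% hf, h, Category.comp_id]⟩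

end Generic

/-! ### The shift of twisted modules is bijective -/

namespace DGBocs

variable {B : DGBocs.{uk, uS, uC} k S}

lemma TwMod.ext_u {M : GrMod.{uk, uS, w} k S} {u v : B.BMor M M} {hu : u ∈ B.BHom 1 M M}
    {hv : v ∈ B.BHom 1 M M} {mu : dhat 1 u + comp u u = 0} {mv : dhat 1 v + comp v v = 0}
    (h : u = v) : TwMod.mk M u hu mu = TwMod.mk M v hv mv := by
  subst h; rfl

/-- Equalities of functors compare morphisms between objects that are equal but not identical by
definition; this reduces such a comparison to the underlying maps. -/
lemma TwMod.heq_hom {X X' Y Y' : TwMod.{uk, uS, uC, w} B} (hX : X = X') (hY : Y = Y') {f : X ⟶ Y}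
    {f' : X' ⟶ Y'} (h : HEq f.1 f'.1) : HEq f f' := by
  subst hX hY
  exact heq_of_eq (Subtype.ext (eq_of_heq h))

lemma THom.mem_of_heq {d : ℤ} {X X' Y Y' : TwMod.{uk, uS, uC, w} B} (hX : X = X') (hY : Y = Y')
    {f : B.BMor X.M Y.M} {f' : B.BMor X'.M Y'.M} (h : HEq f f') (hf : f ∈ THom d X Y) :
    f' ∈ THom d X' Y' := by
  subst hX hY
  obtain rfl := h
  exact hf

lemma mem_BHom_of_bshift {d : ℤ} {M N : GrMod.{uk, uS, w} k S} {f : B.BMor M N}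
    (hf : bshift f ∈ B.BHom d M.shift N.shift) : f ∈ B.BHom d M N := by
  intro i j m c hm hc
  have := hf (i - 1) j m c (by change m ∈ M.gr (i - 1 + 1); rwa [sub_add_cancel]) hc
  change _ ∈ N.gr (i - 1 + j + d + 1) at this
  rwa [show i - 1 + j + d + 1 = i + j + d by ring] at this

/-- Shifting changes the sign of $\hat\delta(f)$, through the Koszul sign on $M[1]$, and of both
twists. The equation for $f[1]$ is therefore the negative of the one for $f$. -/
lemma mem_THom_of_tshift {d : ℤ} {X Y : TwMod.{uk, uS, uC, w} B} {f : B.BMor X.M Y.M}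
    (hf : bshift f ∈ THom d (tshift X) (tshift Y)) : f ∈ THom d X Y := by
  refine ⟨mem_BHom_of_bshift hf.1, ?_⟩
  have h : dhat d (bshift f) + comp (-bshift Y.u) (bshift f) -
      sgn d • comp (bshift f) (-bshift X.u) = 0 := hf.2
  rw [dhat, dd_bshift, comp_neg, neg_comp, smul_neg, smul_neg] at h
  have h' := congrArg Neg.neg h
  rw [neg_zero] at h'
  rw [← h', dhat]
  change _ = -(-(_ • dd f) + -(comp Y.u f) - -(sgn d • comp f X.u))
  abel

lemma tshift_injective : Function.Injective (tshift : TwMod.{uk, uS, uC, w} B → TwMod B) := by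
  rintro ⟨M, u, hu, mu⟩ ⟨N, v, hv, mv⟩ h
  have hM : M.shift = N.shift := congrArg TwMod.M h
  obtain rfl : M = N := by rw [← M.unshift_shift, hM, N.unshift_shift]
  refine TwMod.ext_u ?_
  have h0 : ∀ X Y : TwMod.{uk, uS, uC, w} B, X = Y → HEq X.u Y.u := by rintro _ _ rfl; rfl
  have h1 : HEq (- bshift u) (- bshift v) := h0 _ _ h
  exact neg_injective (eq_of_heq h1)

/-- The preimage is the inverse shift with the twist negated; the Maurer-Cartan equation survives
because $u*u$ is unchanged and the two signs in $\hat\delta(-u[1])$ cancel. -/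
lemma exists_tshift_eq (Z : TwMod.{uk, uS, uC, w} B) : ∃ X : TwMod.{uk, uS, uC, w} B, tshift X = Z := by
  obtain ⟨N, u, hu, mc⟩ := Z
  obtain ⟨M, rfl⟩ : ∃ M : GrMod.{uk, uS, w} k S, M.shift = N := ⟨N.unshift, N.shift_unshift⟩
  obtain ⟨v, rfl⟩ : ∃ v : B.BMor M M, - bshift v = u := ⟨(-u : B.BMor M.shift M.shift), neg_neg u⟩
  have hv : bshift v ∈ B.BHom 1 M.shift M.shift := by simpa using neg_mem hu
  refine ⟨⟨M, v, mem_BHom_of_bshift hv, ?_⟩, rfl⟩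
  rw [dhat, dd_neg, dd_bshift, comp_neg, neg_comp, neg_neg, neg_neg] at mc
  exact mc

end DGBocs

/-! ### Compatibility of $\mathbb G$ with $T$ and $J$; the automorphism $T$ -/

namespace AInfAlg

open DGBocs GObj AInfinity.AInfAlg.Mod

variable {𝒜 : AInfAlg.{uk, uS, uA} k S}

/-- The graded module is recovered by the inverse shift and the operations by `unhat`. -/
lemma Gobj_injective : Function.Injective (Gobj.{uk, uS, uA, w} 𝒜) := by
  rintro ⟨M, m, hm, sm⟩ ⟨N, n, hn, sn⟩ h
  have hM : M.shift = N.shift := congrArg TwMod.M h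
  obtain rfl : M = N := by rw [← M.unshift_shift, hM, N.unshift_shift]
  have h0 : ∀ X Y : TwMod.{uk, uS, max uS uA, w} 𝒜.bar.toDGBocs, X = Y → HEq X.u Y.u := by
    rintro _ _ rfl; rfl
  have h1 : HEq (hat m hm.1) (hat n hn.1) := h0 _ _ h
  have h2 := congrArg unhat (eq_of_heq h1)
  rw [unhat_hat, unhat_hat] at h2
  subst h2
  rfl

lemma Gobj_Tobj (X : Mod.{uk, uS, uA, w} 𝒜) : Gobj 𝒜 (Tobj X) = tshift (Gobj 𝒜 X) :=
  TwMod.ext_u (M := X.M.shift.shift) (hat_eq_of_eq_unhat _ (Tops_eq X))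

lemma Gobj_Jobj (X : Mod.{uk, uS, uA, w} 𝒜) : Gobj 𝒜 (Jobj X) = tJ (Gobj 𝒜 X) :=
  TwMod.ext_u (M := (X.M.prod X.M.shift).shift) (hat_eq_of_eq_unhat _ (Jops_eq X))

lemma hat_shiftF {M N : GrMod.{uk, uS, w} k S} {f : M → List 𝒜.A → N} (hf : 𝒜.IsFam f)
    (h : 𝒜.IsFam (shiftF f)) : hat (shiftF f) h = bshift (hat f hf) :=
  hat_eq_of_eq_unhat h (shiftF_eq hf)

lemma hat_Jfam {d : ℤ} {M N : GrMod.{uk, uS, w} k S} {f : M → List 𝒜.A → N} (hf : 𝒜.IsFam f)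
    (h : 𝒜.IsFam (M := M.prod M.shift) (N := N.prod N.shift) (Jfam d f)) :
    hat (M := M.prod M.shift) (N := N.prod N.shift) (Jfam d f) h = tJmor d (hat f hf) :=
  hat_eq_of_eq_unhat h (Jfam_eq hf)

lemma T_comp_G : T 𝒜 ⋙ G.{uk, uS, uA, w} 𝒜 = G 𝒜 ⋙ DGBocs.T 𝒜.bar.toDGBocs :=
  CategoryTheory.Functor.hext Gobj_Tobj fun X Y f =>
    TwMod.heq_hom (Gobj_Tobj X) (Gobj_Tobj Y) (heq_of_eq (hat_shiftF (TGHom.fam f).1 _))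

lemma J_comp_G : J 𝒜 ⋙ G.{uk, uS, uA, w} 𝒜 = G 𝒜 ⋙ DGBocs.J 𝒜.bar.toDGBocs :=
  CategoryTheory.Functor.hext Gobj_Jobj fun X Y f =>
    TwMod.heq_hom (Gobj_Jobj X) (Gobj_Jobj Y) (heq_of_eq (hat_Jfam (TGHom.fam f).1 _))

/-- Since $\mathbb G$ is bijective on objects and intertwines the two shifts, bijectivity is
inherited from twisted modules. -/
lemma Tobj_bijective : Function.Bijective (Tobj : Mod.{uk, uS, uA, w} 𝒜 → Mod 𝒜) := by
  refine ⟨fun X Y h => Gobj_injective (tshift_injective ?_), fun Y => ?_⟩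
  · rw [← Gobj_Tobj, ← Gobj_Tobj, h]
  · obtain ⟨Z, hZ⟩ := exists_tshift_eq (Gobj 𝒜 Y)
    obtain ⟨X, rfl⟩ := exists_Gobj_eq Z
    exact ⟨X, Gobj_injective ((Gobj_Tobj X).trans hZ)⟩

lemma shiftF_injective {M N : GrMod.{uk, uS, w} k S} :
    Function.Injective (shiftF : (M → List 𝒜.A → N) → M.shift → List 𝒜.A → N.shift) := by
  intro f g h
  funext x l
  have h1 : sgn l.length • f x l = sgn l.length • g x l := congrFun (congrFun h x) l
  have h2 := congrArg (fun y : N => sgn l.length • y) h1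
  simp only [smul_smul, ← sgn_add] at h2
  rwa [sgn_even (Even.add_self _), one_smul, one_smul] at h2

/-- Injectivity holds because $f[1]$ differs from $f$ only by invertible signs. For surjectivity,
the map on the bar construction given by $g$ is read as a shifted map $\varphi[1]$; $\varphi$
satisfies the equation over the unshifted modules, and its family is the preimage. -/
lemma Td_bijective (d : ℤ) (X Y : Mod.{uk, uS, uA, w} 𝒜) : Function.Bijective (Td d X Y) := by
  refine ⟨fun f g h => Subtype.ext (shiftF_injective (congrArg Subtype.val h)), fun g => ?_⟩
  have hg := hat_mem_THom g.2
  obtain ⟨g, hg0⟩ := g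
  have hf : 𝒜.IsFam (M := X.M.shift) (N := Y.M.shift) g := hg0.1.1
  obtain ⟨φ, hφ⟩ : ∃ φ : 𝒜.bar.BMor X.M.shift Y.M.shift,
    bshift φ = hat (M := X.M.shift) (N := Y.M.shift) g hf := ⟨hat (M := X.M.shift) (N := Y.M.shift) g hf, rfl⟩
  have h : φ ∈ THom d (Gobj 𝒜 X) (Gobj 𝒜 Y) :=
    mem_THom_of_tshift (THom.mem_of_heq (Gobj_Tobj X) (Gobj_Tobj Y) (heq_of_eq hφ.symm) hg)
  refine ⟨⟨unhat φ, mem_TGHom_of_unhat rfl h⟩, Subtype.ext ?_⟩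
  change shiftF (unhat φ) = g
  rw [shiftF_eq (isFam_unhat φ), hat_unhat, hφ]
  exact unhat_hat g hf

instance : (T.{uk, uS, uA, w} 𝒜).Full := ⟨fun f => (Td_bijective 0 _ _).2 f⟩

instance : (T.{uk, uS, uA, w} 𝒜).Faithful := ⟨fun h => (Td_bijective 0 _ _).1 h⟩

lemma isExactAut_T : IsExactAut (Einf 𝒜) (T.{uk, uS, uA, w} 𝒜) where
  inverse := exists_inverse_functor (T 𝒜) Tobj_bijective
  exact P := by
    -- The sign $(-1)^{n-1}$ is trivial for $n=1$, so $T$ does not change the underlying functions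
    -- of first components.
    have h : ∀ {X Y : Mod.{uk, uS, uA, w} 𝒜} (f : X ⟶ Y),
        (Mod.fst ((T 𝒜).map f) : X.M → Y.M) = Mod.fst f := fun {X Y} f => funext fun x => by
      change sgn (0 : ℕ) • f.1 x [] = f.1 x []
      rw [Nat.cast_zero, sgn_zero, one_smul]
    have h1 := h P.f
    have h2 := h P.g
    change (Function.Injective (Mod.fst ((T 𝒜).map P.f) : P.X₁.M → P.X₂.M) ∧
      Function.Exact (Mod.fst ((T 𝒜).map P.f) : P.X₁.M → P.X₂.M)
        (Mod.fst ((T 𝒜).map P.g) : P.X₂.M → P.X₃.M) ∧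
      Function.Surjective (Mod.fst ((T 𝒜).map P.g) : P.X₂.M → P.X₃.M)) ↔ _
    rw [h1, h2]; rfl

lemma Gobj_surjective : Function.Surjective (G.{uk, uS, uA, w} 𝒜).obj := exists_Gobj_eq

/-! ### The special Frobenius structure -/

variable [IsSemisimpleRing S]

lemma isEProjective_J (X : Mod.{uk, uS, uA, w} 𝒜) : IsEProjective (Einf 𝒜) ((J 𝒜).obj X) :=
  isEProjective_of_contractible (contractible_Jobj X)

lemma isEInjective_J (X : Mod.{uk, uS, uA, w} 𝒜) : IsEInjective (Einf 𝒜) ((J 𝒜).obj X) :=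
  isEInjective_of_contractible (contractible_Jobj X)

/-- Because $T$ is surjective on objects, $X=T(Y)$ for some $Y$, and $\beta_Y$ is a deflation from
$J(Y)$ onto $X$. -/
lemma exists_isDeflation_J (X : Mod.{uk, uS, uA, w} 𝒜) :
    ∃ (Y : Mod.{uk, uS, uA, w} 𝒜) (p : (J 𝒜).obj Y ⟶ X), IsDeflation (Einf 𝒜) p := by
  obtain ⟨Y, rfl⟩ := Tobj_bijective.2 X
  exact ⟨Y, (beta 𝒜).app Y, _, _, _, einf_alpha_beta Y⟩

lemma isInflation_alpha (X : Mod.{uk, uS, uA, w} 𝒜) : IsInflation (Einf 𝒜) ((alpha 𝒜).app X) :=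
  ⟨_, _, _, einf_alpha_beta X⟩

/-- A projective object splits off from a deflation $J(Y)\to X$, an injective one from the inflation
$X\to J(X)$. As the values of $J$ are both projective and injective, so are their retracts. -/
lemma isEProjective_iff_isEInjective (X : Mod.{uk, uS, uA, w} 𝒜) :
    IsEProjective (Einf 𝒜) X ↔ IsEInjective (Einf 𝒜) X := by
  constructor
  · intro h
    obtain ⟨Y, p, hp⟩ := exists_isDeflation_J X
    obtain ⟨i, hi⟩ := h p (𝟙 X) hp
    exact IsEInjective.of_retract (isEInjective_J Y) i p hi
  · intro h
    obtain ⟨r, hr⟩ := h ((alpha 𝒜).app X) (𝟙 X) (isInflation_alpha X)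
    exact IsEProjective.of_retract (isEProjective_J X) _ r hr

lemma exists_isEProjective_isDeflation (X : Mod.{uk, uS, uA, w} 𝒜) :
    ∃ (Q : Mod.{uk, uS, uA, w} 𝒜) (p : Q ⟶ X), IsEProjective (Einf 𝒜) Q ∧ IsDeflation (Einf 𝒜) p := by
  obtain ⟨Y, p, hp⟩ := exists_isDeflation_J X
  exact ⟨_, p, isEProjective_J Y, hp⟩

lemma exists_isEInjective_isInflation (X : Mod.{uk, uS, uA, w} 𝒜) :
    ∃ (I : Mod.{uk, uS, uA, w} 𝒜) (i : X ⟶ I), IsEInjective (Einf 𝒜) I ∧ IsInflation (Einf 𝒜) i :=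
  ⟨_, _, isEInjective_J X, isInflation_alpha X⟩

theorem isSpecialFrobenius_einf : IsSpecialFrobenius (Einf.{uk, uS, uA, w} 𝒜) where
  additive := inferInstance
  split := inferInstance
  exact := isExactStructure_einf
  enoughProjectives := exists_isEProjective_isDeflation
  enoughInjectives := exists_isEInjective_isInflation
  projective_iff_injective := isEProjective_iff_isEInjective
  special := ⟨T 𝒜, J 𝒜, inferInstance, inferInstance, alpha 𝒜, beta 𝒜, isExactAut_T,
    isEProjective_J, fun X => ⟨_, einf_alpha_beta X⟩⟩

end AInfAlg

end AInfinity

theorem mainTheorem9 {k : Type uk} {S : Type uS} [Field k] [Ring S] [Algebra k S]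
    [FiniteDimensional k S] [IsSemisimpleRing S] [IsSemisimpleRing (S ⊗[k] Sᵐᵒᵖ)]
    (A : AInfAlg.{uk, uS, uA} k S) :
    -- `Mod_∞-A` is additive with split idempotents
    (Limits.HasFiniteBiproducts (AInfAlg.Mod.{uk, uS, uA, w} A) ∧
      IsIdempotentComplete (AInfAlg.Mod.{uk, uS, uA, w} A)) ∧
    -- the exact structure `E_∞`
    IsExactStructure (AInfAlg.Einf.{uk, uS, uA, w} A) ∧
    (∀ P : ShortComplex (AInfAlg.Mod.{uk, uS, uA, w} A),
      AInfAlg.Einf A P ↔ Nonempty (P.map (AInfAlg.forgetOps A)).Splitting) ∧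
    (∀ {X Y : AInfAlg.Mod.{uk, uS, uA, w} A} (f : X ⟶ Y),
      IsInflation (AInfAlg.Einf A) f ↔ Function.Injective (AInfAlg.Mod.fst f)) ∧
    (∀ {X Y : AInfAlg.Mod.{uk, uS, uA, w} A} (g : X ⟶ Y),
      IsDeflation (AInfAlg.Einf A) g ↔ Function.Surjective (AInfAlg.Mod.fst g)) ∧
    -- the equivalence `𝔾` of exact categories
    (IsExactStructure (NormalBocs.E.{uk, uS, max uS uA, w} A.bar) ∧
      (AInfAlg.G.{uk, uS, uA, w} A).IsEquivalence ∧
      ∀ P : ShortComplex (AInfAlg.Mod.{uk, uS, uA, w} A),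
        AInfAlg.Einf A P ↔ NormalBocs.E A.bar (P.map (AInfAlg.G A))) ∧
    (∀ (d : ℤ) (X Y : AInfAlg.Mod.{uk, uS, uA, w} A), Function.Bijective (AInfAlg.Gd A d X Y)) ∧
    -- the shifting automorphism `T`
    ((∀ X : AInfAlg.Mod.{uk, uS, uA, w} A,
        AInfAlg.Td 0 X X (AInfAlg.TGHom.id X) = AInfAlg.TGHom.id (AInfAlg.Tobj X)) ∧
      (∀ (e d : ℤ) (X Y Z : AInfAlg.Mod.{uk, uS, uA, w} A) (g : AInfAlg.TGHom A e Y Z)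
        (f : AInfAlg.TGHom A d X Y), AInfAlg.Td (e + d) X Z (AInfAlg.TGHom.comp g f) =
          AInfAlg.TGHom.comp (AInfAlg.Td e Y Z g) (AInfAlg.Td d X Y f)) ∧
      (∀ (d : ℤ) (X Y : AInfAlg.Mod.{uk, uS, uA, w} A), Function.Bijective (AInfAlg.Td d X Y)) ∧
      IsExactAut (AInfAlg.Einf A) (AInfAlg.T.{uk, uS, uA, w} A)) ∧
    -- the endofunctor `J`
    ((∀ X : AInfAlg.Mod.{uk, uS, uA, w} A,
        AInfAlg.Jd 0 X X (AInfAlg.TGHom.id X) = AInfAlg.TGHom.id (AInfAlg.Jobj X)) ∧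
      (∀ (e d : ℤ) (X Y Z : AInfAlg.Mod.{uk, uS, uA, w} A) (g : AInfAlg.TGHom A e Y Z)
        (f : AInfAlg.TGHom A d X Y), AInfAlg.Jd (e + d) X Z (AInfAlg.TGHom.comp g f) =
          AInfAlg.TGHom.comp (AInfAlg.Jd e Y Z g) (AInfAlg.Jd d X Y f))) ∧
    -- `𝔾 T = T 𝔾` and `𝔾 J = J 𝔾`, on the morphisms of degree `0` and of any degree
    (AInfAlg.T A ⋙ AInfAlg.G.{uk, uS, uA, w} A = AInfAlg.G A ⋙ DGBocs.T A.bar.toDGBocs ∧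
      AInfAlg.J A ⋙ AInfAlg.G.{uk, uS, uA, w} A = AInfAlg.G A ⋙ DGBocs.J A.bar.toDGBocs ∧
      ∀ (d : ℤ) (X Y : AInfAlg.Mod.{uk, uS, uA, w} A) (f : AInfAlg.TGHom A d X Y),
        (AInfAlg.Gd A d (AInfAlg.Tobj X) (AInfAlg.Tobj Y) (AInfAlg.Td d X Y f)).1 =
          DGBocs.bshift (AInfAlg.Gd A d X Y f).1 ∧
        (AInfAlg.Gd A d (AInfAlg.Jobj X) (AInfAlg.Jobj Y) (AInfAlg.Jd d X Y f)).1 =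
          DGBocs.tJmor d (AInfAlg.Gd A d X Y f).1) ∧
    -- the natural transformations `α` and `β`
    (∃ (α : 𝟭 (AInfAlg.Mod.{uk, uS, uA, w} A) ⟶ AInfAlg.J A) (β : AInfAlg.J A ⟶ AInfAlg.T A),
      ∀ X : AInfAlg.Mod.{uk, uS, uA, w} A,
        (AInfAlg.IsStrict (α.app X) ∧ ∀ x : X.M, AInfAlg.Mod.fst (α.app X) x = (x, (0 : X.M))) ∧
        (AInfAlg.IsStrict (β.app X) ∧ ∀ z : X.M × X.M, AInfAlg.Mod.fst (β.app X) z = z.2) ∧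
        ∃ h : α.app X ≫ β.app X = 0,
          AInfAlg.Einf A (ShortComplex.mk (α.app X) (β.app X) h)) ∧
    -- the special Frobenius category `Mod_∞-A`
    (∀ X : AInfAlg.Mod.{uk, uS, uA, w} A,
      IsEProjective (AInfAlg.Einf A) ((AInfAlg.J A).obj X)) ∧
    (∀ X : AInfAlg.Mod.{uk, uS, uA, w} A,
      (∃ (Q : AInfAlg.Mod.{uk, uS, uA, w} A) (p : Q ⟶ X),
        IsEProjective (AInfAlg.Einf A) Q ∧ IsDeflation (AInfAlg.Einf A) p) ∧
      (∃ (I : AInfAlg.Mod.{uk, uS, uA, w} A) (i : X ⟶ I),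
        IsEInjective (AInfAlg.Einf A) I ∧ IsInflation (AInfAlg.Einf A) i) ∧
      (IsEProjective (AInfAlg.Einf A) X ↔ IsEInjective (AInfAlg.Einf A) X)) ∧
    IsSpecialFrobenius (AInfAlg.Einf.{uk, uS, uA, w} A) :=
  open AInfAlg in
  ⟨⟨inferInstance, inferInstance⟩, isExactStructure_einf, einf_iff_splitting, isInflation_iff,
    isDeflation_iff,
    ⟨isExactStructure_einf.of_equivalence (G A) Gobj_surjective einf_iff_map_G, inferInstance,
      einf_iff_map_G⟩,
    Gd_bijective,
    ⟨fun X => Subtype.ext (shiftF_fid X.M),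
      fun _ d _ _ _ g f => Subtype.ext (shiftF_fcomp d (TGHom.fam g).1 f.1),
      Td_bijective, isExactAut_T⟩,
    ⟨fun X => Subtype.ext (Jfam_fid X.M),
      fun e d _ _ _ g f => Subtype.ext (Jfam_fcomp e d (TGHom.fam g).1 f.1)⟩,
    ⟨T_comp_G, J_comp_G, fun _ _ _ f =>
      ⟨hat_shiftF (TGHom.fam f).1 _, hat_Jfam (TGHom.fam f).1 _⟩⟩,
    ⟨alpha A, beta A, fun X => ⟨⟨fun _ _ _ => rfl, fun _ => rfl⟩, ⟨fun _ _ _ => rfl, fun _ => rfl⟩,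
      _, einf_alpha_beta X⟩⟩,
    isEProjective_J,
    fun X => ⟨exists_isEProjective_isDeflation X, exists_isEInjective_isInflation X,
      isEProjective_iff_isEInjective X⟩,
    isSpecialFrobenius_einf⟩
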